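/- Let $\Sigma$ be a linearly ordered alphabet, let $\$\notin\Sigma$ and $\Sigma_\$=\Sigma\cup\{\$\}$. Let $d_H$ be the Hamming distance of strings of equal length, and let $\mathsf{LCP}_d(U,V)$ be the largest $p\le |U|,|V|$ such that $d_H(U[1..p],V[1..p])\le d$; write $\mathsf{LCP}=\mathsf{LCP}_0$. For $U,V\in\Sigma^*$ and $d\ge 0$, strings $U',V'\in\Sigma_\$^*$ form a $(U,V)_d$-pair if $|U'|=|U|$, $|V'|=|V|$, and for every position $i$: if $i>\mathsf{LCP}_d(U,V)$ or $U[i]=V[i]$, then $U'[i]=U[i]$ and $V'[i]=V[i]$ (wherever these letters exist); otherwise $U'[i]=V'[i]\in\{U[i],V[i],\$\}$. For a finite family $\mathcal F\subseteq\Sigma^*$, finite sets $N(F)\subseteq\Sigma_\$^*$, $F\in\mathcal F$, form a $k$-complete family if for all $U,V\in\mathcal F$ and $0\le d\le k$ there is a $(U,V)_d$-pair $U',V'$ with $U'\in N(U)$ and $V'\in N(V)$. Put $N_d(F)=\{F'\in N(F): |F'|=|F|,\ d_H(F,F')\le d\}$. Write $\log=\log_2$ and $\binom{x}{j}=x(x-1)\cdots(x-j+1)/j!$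 for real $x$. The compacted trie of a set of strings consists of the root, the terminal nodes and the branching nodes of its trie. **Proposition.** For every finite family $\mathcal F\subseteq\Sigma^*$ and every integer $k\ge 0$ there is a $k$-complete family $N$, with $|F'|=|F|$ for all $F'\in N(F)$, such that $$|N_d(F)|\le 2^d\binom{\log|\mathcal F|+d}{d}\qquad\text{for all } F\in\mathcal F,\ 0\le d\le k .$$ Moreover, if $\mathcal F\neq\emptyset$, the compacted trie of $\mathcal F'=\bigcup_{F\in\mathcal F}N(F)$ can be constructed in time $$\mathcal O\!\left(2^k\,|\mathcal F|\binom{\log|\mathcal F|+k+1}{k+1}\right),$$ provided that $\mathsf{LCP}$ queries for suffixes of the strings of $\mathcal F$ take constant time. Precisely, the second part means the following. There are one program and one constant $C>0$, independent of $\Sigma$, $\mathcal F$ and $k$, such that for every $\Sigma$, every finite $\mathcal F$, every $k$ and every listing $F_0,\dots,F_{m-1}$ of $\mathcal F$ without repetitions ($m=|\mathcal F|$), there is an $N$ as above (which may depend on the listing) with this property. Let $m\ge1$ and $T=2^k m\binom{\log m+k+1}{k+1}$. On a word RAM (unit-cost addition, truncated subtraction, multiplication, division, remainder, indirect memory access,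 comparisons and branching; initially only $m$ and $k$ are given) whose words range over $\{0,\dots,W-1\}$ for any $W\ge C\,(T+\max_{F\in\mathcal F}|F|)$, and which accesses the strings only by two kinds of unit-time queries, namely (i) the length of the longest common prefix of a suffix of $F_i$ and a suffix of $F_j$, and (ii) whether a given letter of $F_i$ is smaller than a given letter of $F_j$, the program halts within $C\,T$ steps with the compacted trie of $\mathcal F'$ in memory. In this representation the nodes of the trie are records at distinct addresses. Each node has a linked list of its children. Each edge is labeled in $\mathcal O(1)$ words by a factor of some $F_i$, perhaps prepended by $\$$. Each node stores the list of all $F_i$ for which its string $F'$ belongs to $N(F_i)$, together with the values $d_H(F_i,F')$. Each terminal node also stores the number of occurrences of $\$$ in its string. -/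

import Mathlib

noncomputable section

namespace KMismatch

/-! Strings over `α` are lists; letters are indexed from `0`.  The alphabet extended by the extra
symbol `$` is `Option α`, with `none` in the role of `$`. -/

/-- The symbol `$`. -/
abbrev dollar {α : Type*} : Option α := none

/-- A string over `α`, regarded as a string over the extended alphabet. -/
abbrev emb {α : Type*} (U : List α) : List (Option α) := U.map some

/-- Hamming distance of two strings of equal length. -/
def dH {β : Type*} [DecidableEq β] (U V : List β) : ℕ :=
  ((Finset.range U.length).filter (fun i => U[i]? ≠ V[i]?)).card

/-- `LCP_d(U,V)`: the largest `p ≤ |U|, |V|` such that the prefixes of length `p` are at Hamming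
distance at most `d`. -/
def LCP {β : Type*} [DecidableEq β] (d : ℕ) (U V : List β) : ℕ :=
  Nat.findGreatest (fun p => dH (U.take p) (V.take p) ≤ d) (min U.length V.length)

/-- `U', V'` form a `(U,V)_d`-pair. -/
structure IsPair {α : Type*} [DecidableEq α] (d : ℕ) (U V : List α)
    (U' V' : List (Option α)) : Prop where
  length_left : U'.length = U.length
  length_right : V'.length = V.length
  unchanged : ∀ i : ℕ, LCP d U V ≤ i ∨ U[i]? = V[i]? →
    U'[i]? = (emb U)[i]? ∧ V'[i]? = (emb V)[i]?
  changed : ∀ i : ℕ, ¬ (LCP d U V ≤ i ∨ U[i]? = V[i]?) →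
    U'[i]? = V'[i]? ∧
      (U'[i]? = (emb U)[i]? ∨ U'[i]? = (emb V)[i]? ∨ U'[i]? = some dollar)

/-- The sets `N F`, `F ∈ 𝓕`, form a `k`-complete family. -/
def IsComplete {α : Type*} [DecidableEq α] (𝓕 : Finset (List α)) (k : ℕ)
    (N : List α → Finset (List (Option α))) : Prop :=
  ∀ U ∈ 𝓕, ∀ V ∈ 𝓕, ∀ d ≤ k, ∃ U' ∈ N U, ∃ V' ∈ N V, IsPair d U V U' V'

/-- `N_d(F)`: the strings of `N F` at Hamming distance at most `d` from `F`. -/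
def nearSet {α : Type*} [DecidableEq α] (N : List α → Finset (List (Option α))) (d : ℕ)
    (F : List α) : Finset (List (Option α)) :=
  (N F).filter (fun F' => F'.length = F.length ∧ dH (emb F) F' ≤ d)

/-! ### Compacted tries -/

/-- The nodes of the trie of `S` are the prefixes of its strings (and the root `[]`).  Those kept in
the compacted trie are the root, the terminal nodes and the branching nodes. -/
def IsNode {β : Type*} (S : Set (List β)) (P : List β) : Prop :=
  P = [] ∨ P ∈ S ∨
    ∃ c d : β, c ≠ d ∧ (∃ U ∈ S, P ++ [c] <+: U) ∧ (∃ U ∈ S, P ++ [d] <+: U)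

/-- `Q` is a child of `P` in the compacted trie of `S`: it is a node properly below `P`, without any
node strictly in between. -/
def IsEdge {β : Type*} (S : Set (List β)) (P Q : List β) : Prop :=
  IsNode S P ∧ IsNode S Q ∧ P <+: Q ∧ P ≠ Q ∧
    ∀ R, IsNode S R → P <+: R → R <+: Q → R = P ∨ R = Q

/-! ### The machine model

A word RAM, programmed in a structured imperative language: finitely many registers are named by a
program, the memory is an array of words, and a word is a natural number below the bound `W`.  The
input strings are not stored in memory; they are accessed only by constant-time queries. -/

/-- Arithmetic operations on words. -/
inductive Op where
  | add | sub | mul | div | mod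

/-- The result of an operation (truncated subtraction; division and remainder of naturals). -/
def Op.eval : Op → ℕ → ℕ → ℕ
  | .add, a, b => a + b
  | .sub, a, b => a - b
  | .mul, a, b => a * b
  | .div, a, b => a / b
  | .mod, a, b => a % b

/-- Programs; `x`, `y`, `z`, … are names of registers. -/
inductive Prog where
  /-- `x := c` -/
  | const (x c : ℕ)
  /-- `x := y op z` -/
  | arith (o : Op) (x y z : ℕ)
  /-- `x := mem[y]` -/
  | load (x y : ℕ)
  /-- `mem[x] := y` -/
  | store (x y : ℕ)
  /-- `x :=` length of the longest common prefix of the suffixes `Fᵢ[a..]` and `Fⱼ[b..]`, where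
  `i, a, j, b` are the contents of the four other registers -/
  | lcp (x i a j b : ℕ)
  /-- `x := 1` if the letter `Fᵢ[a]` is smaller than the letter `Fⱼ[b]`, otherwise `x := 0` -/
  | less (x i a j b : ℕ)
  /-- `p; q` -/
  | seq (p q : Prog)
  /-- `if x ≤ y then p else q` -/
  | ite (x y : ℕ) (p q : Prog)
  /-- `while x ≠ 0 do p` -/
  | loop (x : ℕ) (p : Prog)

/-- Contents of the registers and of the memory. -/
structure State where
  reg : ℕ → ℕ
  mem : ℕ → ℕ

/-- Write the value `v` to the register `x`. -/
def State.setReg (s : State) (x v : ℕ) : State := { s with reg := Function.update s.reg x v }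

/-- Write the value `v` to the memory cell `a`. -/
def State.setMem (s : State) (a v : ℕ) : State := { s with mem := Function.update s.mem a v }

/-- The suffix of the `i`-th input string that starts at position `a`. -/
def suffixOf {α : Type*} (L : List (List α)) (i a : ℕ) : List α := (L.getD i []).drop a

open Classical in
/-- The answer to a letter comparison (`0` if one of the two positions does not exist). -/
def lessQuery {α : Type*} [LinearOrder α] (L : List (List α)) (i a j b : ℕ) : ℕ :=
  if ∃ c d : α, (suffixOf L i a)[0]? = some c ∧ (suffixOf L j b)[0]? = some d ∧ c < d
  then 1 else 0

/-- `Exec W L p s s' t`: on the list `L` of input strings, the program `p` started in the state `s`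
terminates in the state `s'` after exactly `t` steps, and all words that it computes are below `W`.
Every instruction, every query, and every evaluation of the condition of a branching or of a loop
takes one step. -/
inductive Exec {α : Type*} [LinearOrder α] (W : ℕ) (L : List (List α)) :
    Prog → State → State → ℕ → Prop where
  | const {s x c} : c < W → Exec W L (.const x c) s (s.setReg x c) 1
  | arith {s o x y z} : o.eval (s.reg y) (s.reg z) < W →
      Exec W L (.arith o x y z) s (s.setReg x (o.eval (s.reg y) (s.reg z))) 1
  | load {s x y} : Exec W L (.load x y) s (s.setReg x (s.mem (s.reg y))) 1
  | store {s x y} : Exec W L (.store x y) s (s.setMem (s.reg x) (s.reg y)) 1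
  | lcp {s x i a j b v} :
      v = LCP 0 (suffixOf L (s.reg i) (s.reg a)) (suffixOf L (s.reg j) (s.reg b)) → v < W →
      Exec W L (.lcp x i a j b) s (s.setReg x v) 1
  | less {s x i a j b v} : v = lessQuery L (s.reg i) (s.reg a) (s.reg j) (s.reg b) → v < W →
      Exec W L (.less x i a j b) s (s.setReg x v) 1
  | seq {p q s s' s'' t t'} : Exec W L p s s' t → Exec W L q s' s'' t' →
      Exec W L (.seq p q) s s'' (t + t')
  | iteTrue {x y p q s s' t} : s.reg x ≤ s.reg y → Exec W L p s s' t →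
      Exec W L (.ite x y p q) s s' (t + 1)
  | iteFalse {x y p q s s' t} : s.reg y < s.reg x → Exec W L q s s' t →
      Exec W L (.ite x y p q) s s' (t + 1)
  | loopDone {x p s} : s.reg x = 0 → Exec W L (.loop x p) s s 1
  | loopStep {x p s s' s'' t t'} : s.reg x ≠ 0 → Exec W L p s s' t →
      Exec W L (.loop x p) s' s'' t' → Exec W L (.loop x p) s s'' (t + t' + 1)

/-- The initial state: the number of strings in register `0`, the number `k` in register `1`, and
zeros everywhere else. -/
def initState (m k : ℕ) : State where
  reg := fun x => if x = 0 then m else if x = 1 then k else 0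
  mem := fun _ => 0

/-! ### Compacted tries in memory -/

/-- A linked list of words at the address `p`: a cell consists of an entry and the address of the
next cell, and the address `0` stands for the empty list. -/
def ListAt (M : ℕ → ℕ) : ℕ → List ℕ → Prop
  | p, [] => p = 0
  | p, x :: l => p ≠ 0 ∧ M p = x ∧ ListAt M (M (p + 1)) l

/-- A linked list of pairs of words. -/
def PairListAt (M : ℕ → ℕ) : ℕ → List (ℕ × ℕ) → Prop
  | p, [] => p = 0
  | p, x :: l => p ≠ 0 ∧ M p = x.1 ∧ M (p + 1) = x.2 ∧ PairListAt M (M (p + 2)) l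

/-- The string that the label of the edge into the node at address `q` stands for: the factor of
length `M (q + 3)` of the input string number `M (q + 1)` that starts at the position `M (q + 2)`,
with `$` in front unless `M q = 0`. -/
def labelAt {α : Type*} (L : List (List α)) (M : ℕ → ℕ) (q : ℕ) : List (Option α) :=
  (if M q = 0 then [] else [dollar]) ++
    emb ((suffixOf L (M (q + 1)) (M (q + 2))).take (M (q + 3)))

/-- The union of the sets `N F`, `F ∈ 𝓕`. -/
def unionFam {α : Type*} (𝓕 : Finset (List α)) (N : List α → Finset (List (Option α))) :
    Set (List (Option α)) :=
  {P | ∃ F ∈ 𝓕, P ∈ N F}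

/-- The memory `M` holds the compacted trie of the union of the sets `N F`, with its root at the
address `root`.  A node at address `p` is a record: the fields `p, …, p + 3` hold the label of the
edge from its parent; `p + 4` the number of occurrences of `$` in its string if it is terminal;
`p + 5` the list of its children; and `p + 6` the list of the (numbers of) strings `F` whose set
`N F` contains the string of the node, each with its Hamming distance to the latter. -/
def HoldsTrie {α : Type*} [DecidableEq α] (𝓕 : Finset (List α)) (L : List (List α))
    (N : List α → Finset (List (Option α))) (M : ℕ → ℕ) (root : ℕ) : Prop :=
  ∃ addr : List (Option α) → ℕ,
    addr [] = root ∧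
    Set.InjOn addr {P | IsNode (unionFam 𝓕 N) P} ∧
    ∀ P, IsNode (unionFam 𝓕 N) P →
      (∃ l : List ℕ, ListAt M (M (addr P + 5)) l ∧ l.Nodup ∧
        ∀ q, q ∈ l ↔ ∃ Q, IsEdge (unionFam 𝓕 N) P Q ∧ addr Q = q) ∧
      (∀ Q, IsEdge (unionFam 𝓕 N) P Q →
        M (addr Q + 1) < L.length ∧
        M (addr Q + 2) + M (addr Q + 3) ≤ (L.getD (M (addr Q + 1)) []).length ∧
        Q = P ++ labelAt L M (addr Q)) ∧
      (∃ l : List (ℕ × ℕ), PairListAt M (M (addr P + 6)) l ∧ l.Nodup ∧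
        ∀ j e, (j, e) ∈ l ↔ ∃ F, L[j]? = some F ∧ P ∈ N F ∧ e = dH (emb F) P) ∧
      (P ∈ unionFam 𝓕 N → M (addr P + 4) = P.count dollar)

/-- The quantity `2^k · m · C(log₂ m + k + 1, k + 1)`, with the generalized binomial coefficient
`C(x, j) = x (x - 1) ⋯ (x - j + 1) / j!`. -/
def timeBound (m k : ℕ) : ℝ :=
  2 ^ k * m * Ring.choose (Real.logb 2 m + k + 1) (k + 1)

end KMismatch

end

set_option linter.unusedSectionVars false

namespace KMismatch

open Nat (reduceEqDiff le_zero le_succ cast_nonneg)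
open Multiset (mem_add coe_add card cons_add add_cons cons_coe card_add coe_card card_cons mem_coe
  coe_nil card_pos map_le_map coe_eq_coe card_le_card coe_reverse card_map filter_le)
open List (mem_cons mem_map map_cons length_cons pairwise_cons map_append flatten_cons mem_append
  map_nil append_assoc sum_cons length_pos_of_ne_nil map_map mem_cons_of_mem prefix_append
  length_append not_mem_nil drop_drop length_nil append_nil length_map nil_append nodup_append
  sum_nil Forall₂ mem_map_of_mem mem_filter mem_flatten cons_append mem_singleton
  length_eq_zero_iff sum_append mem_reverse)
open Real (logb)
open Finset (mem_range)

/-- A linear arithmetic side condition. -/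
notation "ω" => (by omega)

/-- Proof of a side condition by simplification. -/
notation "✓" => (by simp)

/-- Proof by simplification and linear arithmetic. -/
notation "✦" => (by simp; omega)

/-- Lists of numbers of strings with distances. -/
notation "Λ" => List (ℕ × ℕ)

/-- Multisets of numbers of strings with distances. -/
notation "Φ" => Multiset (ℕ × ℕ)

/-! ### Common prefixes and the lexicographic order -/

section Strings

variable {α : Type*} [LinearOrder α]
variable {p i j r d : ℕ} {p' : ℕ} {U V : List α}

/-- The length of the longest common prefix, by recursion. -/
def cp : List α → List α → ℕ
  | a :: as, b :: bs => if a = b then cp as bs + 1 else 0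
  | _, _ => 0

@[simp] lemma cp_nil_left (V : List α) : cp [] V = 0 := by simp [cp]

@[simp] lemma cp_nil_right (U : List α) : cp U [] = 0 := by cases U <;> simp [cp]

lemma cp_cons (a b : α) (U V : List α) :
    cp (a :: U) (b :: V) = if a = b then cp U V + 1 else 0 := by simp [cp]

lemma cp_le_left : ∀ U V : List α, cp U V ≤ U.length
  | [], _ => ✓
  | _ :: _, [] => ✓
  | a :: U, b :: V => by
    rw [cp_cons]; split_ifs
    · simpa using cp_le_left U V
    · simp

lemma cp_comm : ∀ U V : List α, cp U V = cp V U
  | [], _ => ✓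
  | _ :: _, [] => ✓
  | a :: U, b :: V => by
    rw [cp_cons, cp_cons, cp_comm U V]; simp [eq_comm]

lemma cp_le_right (U V : List α) : cp U V ≤ V.length := cp_comm U V ▸ cp_le_left V U

lemma cp_self (U : List α) : cp U U = U.length := by
  induction U <;> simp_all [cp_cons]

lemma take_eq_take_iff : ∀ (U V : List α) (p : ℕ), p ≤ U.length → p ≤ V.length →
    (U.take p = V.take p ↔ p ≤ cp U V)
  | U, V, 0, _, _ => ✓
  | [], _, p + 1, h, _ => by simp at h
  | _ :: _, [], p + 1, _, h => by simp at h
  | a :: U, b :: V, p + 1, h, h' => by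
    have := take_eq_take_iff U V p (by simpa using h) (by simpa using h')
    rw [cp_cons]; split_ifs with hab
    · simp [hab, this]
    · simp [hab]

lemma take_eq_take_of_le (h : p ≤ cp U V) : U.take p = V.take p :=
  (take_eq_take_iff U V p (h.trans (cp_le_left U V)) (h.trans (cp_le_right U V))).2 h

lemma cp_drop : ∀ (U V : List α) (p : ℕ), p ≤ cp U V →
    cp (U.drop p) (V.drop p) = cp U V - p
  | U, V, 0, _ => ✓
  | [], _, p + 1, h => by simp at h
  | _ :: _, [], p + 1, h => by simp at h
  | a :: U, b :: V, p + 1, h => by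
    rw [cp_cons] at h ⊢; split_ifs at h ⊢ with hab
    · have := cp_drop U V p ω
      simp only [List.drop_succ_cons]; omega
    · omega

lemma dH_le_zero_iff (h : U.length = V.length) : dH U V ≤ 0 ↔ U = V := by
  rw [le_zero, dH, Finset.card_eq_zero, Finset.filter_eq_empty_iff]
  constructor
  · intro hh
    apply List.ext_getElem? ; intro i
    by_cases hi : i < U.length
    · simpa using hh (mem_range.2 hi)
    · rw [List.getElem?_eq_none ω, List.getElem?_eq_none ω]
  · rintro rfl; simp

lemma LCP_zero (U V : List α) : LCP 0 U V = cp U V := by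
  have key : ∀ p ≤ min U.length V.length, (dH (U.take p) (V.take p) ≤ 0 ↔ p ≤ cp U V) := fun p hp =>
    by rw [dH_le_zero_iff ✦, take_eq_take_iff U V p ω ω]
  have hle : cp U V ≤ min U.length V.length := le_min (cp_le_left U V) (cp_le_right U V)
  unfold LCP
  apply le_antisymm
  · refine (key _ (Nat.findGreatest_le _)).1 ?_
    exact Nat.findGreatest_spec (P := fun p => dH (U.take p) (V.take p) ≤ 0) (Nat.zero_le _)
      ((key 0 (Nat.zero_le _)).2 (Nat.zero_le _))
  · exact Nat.le_findGreatest hle ((key _ hle).2 le_rfl)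

lemma cons_lt_cons (a b : α) (U V : List α) : a :: U < b :: V ↔ a < b ∨ a = b ∧ U < V := by
  simp [List.cons_lt_cons_iff]

lemma drop_cp_lt : ∀ (U V : List α) (p : ℕ), p ≤ cp U V →
    (U.drop p < V.drop p ↔ U < V)
  | U, V, 0, _ => ✓
  | [], _, p + 1, h => by simp at h
  | _ :: _, [], p + 1, h => by simp at h
  | a :: U, b :: V, p + 1, h => by
    rw [cp_cons] at h; split_ifs at h with hab
    · rw [List.drop_succ_cons, List.drop_succ_cons, drop_cp_lt U V p ω, cons_lt_cons]
      simp [hab]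
    · omega

lemma drop_cp_le (U V : List α) (p : ℕ) (h : p ≤ cp U V) : U.drop p ≤ V.drop p ↔ U ≤ V := by
  rw [← not_lt, ← not_lt, drop_cp_lt V U p (cp_comm U V ▸ h)]

lemma lt_of_cp_lt : ∀ {X Y R : List α}, cp X R < cp Y R → X < R → X < Y
  | _, [], _, h, _ => by simp at h
  | _, _ :: _, [], h, _ => by simp at h
  | [], b :: Y, _, _, _ => ✓
  | a :: X, b :: Y, c :: R, h, hlt => by
    rw [cp_cons, cp_cons] at h
    rw [cons_lt_cons] at hlt ⊢
    split_ifs at h with h1 h2 h2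
    · subst h1 h2
      exact .inr ⟨rfl, lt_of_cp_lt (Nat.lt_of_succ_lt_succ h) (by simpa using hlt)⟩
    · omega
    · subst h2; exact .inl (hlt.resolve_right fun h => h1 h.1)
    · omega

lemma gt_of_cp_lt : ∀ {X Y R : List α}, cp X R < cp Y R → R < X → Y < X
  | _, [], _, h, _ => by simp at h
  | _, _ :: _, [], h, _ => by simp at h
  | [], b :: Y, _, _, h => by simp at h
  | a :: X, b :: Y, c :: R, h, hlt => by
    rw [cp_cons, cp_cons] at h
    rw [cons_lt_cons] at hlt ⊢
    split_ifs at h with h1 h2 h2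
    · subst h1 h2
      exact .inr ⟨rfl, gt_of_cp_lt (Nat.lt_of_succ_lt_succ h) (by simpa using hlt)⟩
    · omega
    · subst h2; exact .inl (hlt.resolve_right fun h => h1 h.1.symm)
    · omega

lemma le_cp_trans {X Y R : List α} (hX : p ≤ cp X R) (hY : p ≤ cp Y R) : p ≤ cp X Y := by
  rw [← take_eq_take_iff X Y p (hX.trans (cp_le_left _ _)) (hY.trans (cp_le_left _ _)),
    take_eq_take_of_le hX, take_eq_take_of_le hY]

variable (L : List (List α))

/-- The input string number `i`. -/
def str (i : ℕ) : List α := L.getD i []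

lemma suffixOf_eq (i a : ℕ) : suffixOf L i a = (str L i).drop a := rfl

/-- The answer to a longest-common-prefix query for suffixes starting at the same position. -/
def lc (p i j : ℕ) : ℕ := cp ((str L i).drop p) ((str L j).drop p)

lemma LCP_suffixOf (i j p : ℕ) : LCP 0 (suffixOf L i p) (suffixOf L j p) = lc L p i j :=
  LCP_zero _ _

lemma lc_self (p i : ℕ) : lc L p i i = (str L i).length - p := by
  rw [lc, cp_self, List.length_drop]

lemma lc_comm (p i j : ℕ) : lc L p i j = lc L p j i := cp_comm _ _

lemma lc_le_left (p i j : ℕ) : lc L p i j ≤ (str L i).length - p := by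
  simpa [lc] using cp_le_left ((str L i).drop p) ((str L j).drop p)

lemma lc_le_right (p i j : ℕ) : lc L p i j ≤ (str L j).length - p := by
  rw [lc_comm]; exact lc_le_left L p j i

lemma lc_add (p i j d : ℕ) (h : d ≤ lc L p i j) : lc L (p + d) i j = lc L p i j - d := by
  rw [lc, ← drop_drop, ← drop_drop, cp_drop _ _ _ h, lc]

lemma lc_trans (hi : d ≤ lc L p i r) (hj : d ≤ lc L p j r) : d ≤ lc L p i j :=
  le_cp_trans hi hj

lemma lessQuery_le_one (i a j b : ℕ) : lessQuery L i a j b ≤ 1 := by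
  unfold lessQuery; split_ifs <;> omega

lemma suffix_lt_iff (p i j : ℕ) (h : lc L p i j = 0) : (str L i).drop p < (str L j).drop p ↔ if lc L
    p i i = 0 then lc L p j j ≠ 0 else lessQuery L i p j p ≠ 0 := by
  unfold lc at h ⊢
  rw [cp_self, cp_self]
  unfold lessQuery
  rw [suffixOf_eq, suffixOf_eq]
  generalize (str L i).drop p = U at *
  generalize (str L j).drop p = V at *
  cases U with
  | nil => cases V <;> simp
  | cons a U =>
    cases V with
    | nil => simp
    | cons b V =>
      rw [cp_cons] at h
      split_ifs at h with hab
      rw [cons_lt_cons]; simp [hab]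

/-- The event order key of the string `i` with respect to the reference string `r`: the first
position at or after `p` where they differ, doubled, plus one unless `i` is smaller than `r`. -/
def key (r p i : ℕ) : ℕ :=
  2 * (p + lc L p i r) + if (str L i).drop p < (str L r).drop p then 0 else 1

lemma key_div (r p i : ℕ) : key L r p i / 2 = p + lc L p i r := by
  unfold key; split_ifs <;> omega

lemma key_mod (r p i : ℕ) :
    key L r p i % 2 = if (str L i).drop p < (str L r).drop p then 0 else 1 := by
  unfold key; split_ifs <;> omega

lemma drop_add_lt (h : d ≤ lc L p i j) :
    (str L i).drop (p + d) < (str L j).drop (p + d) ↔ (str L i).drop p < (str L j).drop p := by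
  rw [← drop_drop, ← drop_drop]; exact drop_cp_lt _ _ _ h

lemma drop_add_le (h : d ≤ lc L p i j) :
    (str L i).drop (p + d) ≤ (str L j).drop (p + d) ↔ (str L i).drop p ≤ (str L j).drop p := by
  rw [← drop_drop, ← drop_drop]; exact drop_cp_le _ _ _ h

lemma key_shift (hp : p ≤ p') (h : p' ≤ p + lc L p i r) : key L r p' i = key L r p i := by
  obtain ⟨d, rfl⟩ := Nat.exists_eq_add_of_le hp
  have hd : d ≤ lc L p i r := ω
  simp only [key, drop_add_lt L hd, lc_add L p i r d hd]
  congr 1; omega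

/-- The order in which strings leave the reference string `r`, as a relation on strings with given
keys; among strings leaving at the same place, the ones farther from `r` come first. -/
def Bef (r p i j : ℕ) : Prop :=
  key L r p i < key L r p j ∨ key L r p i = key L r p j ∧ if key L r p i % 2 = 0 then (str L i).drop
    (key L r p i / 2) ≤ (str L j).drop (key L r p i / 2) else (str L j).drop (key L r p i / 2) ≤
    (str L i).drop (key L r p i / 2)

lemma Bef.trans {l : ℕ} (h : Bef L r p i j) (h' : Bef L r p j l) : Bef L r p i l := by
  unfold Bef at *
  rcases h with h | ⟨h, h1⟩ <;> rcases h' with h' | ⟨h', h2⟩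
  · exact .inl (h.trans h')
  · exact .inl (h' ▸ h)
  · exact .inl (h ▸ h')
  · refine .inr ⟨h.trans h', ?_⟩
    rw [← h] at h2
    split_ifs at h1 h2 ⊢
    · exact h1.trans h2
    · exact h2.trans h1

lemma Bef.total (r p i j : ℕ) : Bef L r p i j ∨ Bef L r p j i := by
  unfold Bef
  rcases lt_trichotomy (key L r p i) (key L r p j) with h | h | h
  · exact .inl (.inl h)
  · simp only [h, lt_irrefl, false_or, true_and]
    split_ifs <;> exact le_total _ _
  · exact .inr (.inl h)

lemma Bef.refl (r p i : ℕ) : Bef L r p i i := (Bef.total L r p i i).elim id id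

lemma Bef.key_le (h : Bef L r p i j) : key L r p i ≤ key L r p j :=
  h.elim le_of_lt fun h => h.1.le

lemma Bef.shift (hp : p ≤ p') (hi : p' ≤ p + lc L p i r)
    (hj : p' ≤ p + lc L p j r) : Bef L r p' i j ↔ Bef L r p i j := by
  simp only [Bef, key_shift L hp hi, key_shift L hp hj]

lemma bef_iff_left (hi : (str L i).drop p < (str L r).drop p) (hj : (str L j).drop p < (str L
    r).drop p) : Bef L r p i j ↔ (str L i).drop p ≤ (str L j).drop p := by
  have fwd : ∀ {i j}, (str L i).drop p < (str L r).drop p → (str L j).drop p < (str L r).drop p →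
    key L r p i < key L r p j → (str L i).drop p < (str L j).drop p := fun {i j} hi hj h => by
    simp only [key, hi, hj, if_true] at h
    exact lt_of_cp_lt (show lc L p i r < lc L p j r by omega) hi
  unfold Bef
  rcases lt_trichotomy (key L r p i) (key L r p j) with h | h | h
  · simp [h, (fwd hi hj h).le]
  · have h2 : lc L p i r = lc L p j r := by
      have := congrArg (· / 2) h; simp only [key_div] at this; omega
    simp only [h, lt_irrefl, false_or, true_and, key_mod, hj, if_true]
    rw [key_div, drop_add_le L (lc_trans L h2.ge le_rfl)]
  · have := fwd hj hi h
    simp only [h.not_gt, h.ne', false_or, false_and, false_iff, not_le, this]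

lemma bef_iff_right (hi : (str L r).drop p ≤ (str L i).drop p) (hj : (str L r).drop p ≤ (str L
    j).drop p) : Bef L r p i j ↔ (str L j).drop p ≤ (str L i).drop p := by
  have fwd : ∀ {i j}, (str L r).drop p ≤ (str L i).drop p → (str L r).drop p ≤ (str L j).drop p →
    key L r p i < key L r p j → (str L j).drop p < (str L i).drop p := fun {i j} hi hj h => by
    simp only [key, hi.not_gt, hj.not_gt, if_false] at h
    have h' : lc L p i r < lc L p j r := ω
    refine gt_of_cp_lt h' (lt_of_le_of_ne hi ?_)
    intro he
    have h1 : lc L p i r = lc L p r r := by unfold lc; rw [he]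
    have h2 := lc_le_right L p j r
    rw [h1, lc_self] at h'; omega
  unfold Bef
  rcases lt_trichotomy (key L r p i) (key L r p j) with h | h | h
  · simp [h, (fwd hi hj h).le]
  · have h2 : lc L p i r = lc L p j r := by
      have := congrArg (· / 2) h; simp only [key_div] at this; omega
    simp only [h, lt_irrefl, false_or, true_and, key_mod, hj.not_gt, if_false, one_ne_zero]
    rw [key_div, drop_add_le L (lc_trans L le_rfl h2.ge)]
  · have := fwd hj hi h
    simp only [h.not_gt, h.ne', false_or, false_and, false_iff, not_le, this]

/-! ### The trie as a set of records -/

/-- A node of the trie: its string, its address, the terminal entries, and the children. -/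
structure Rec (α : Type*) where
  path : List (Option α)
  addr : ℕ
  terms : Λ
  kids : List (List (Option α) × ℕ)

/-- A subtree below a node, which starts with the symbol `sym` and is built for the members
`fam`. -/
structure Kid (α : Type*) where
  sym : Option α
  fam : Φ
  addr : ℕ
  path : List (Option α)
  recs : Set (Rec α)

/-- The members whose budget `k` is not exhausted, after one more modification. -/
def bump (k : ℕ) (S : Φ) : Φ :=
  (S.filter fun x => x.2 < k).map fun x => (x.1, x.2 + 1)

/-- The members of all light groups. -/
def lights (G : List (Option α × Φ)) : Φ := (G.map Prod.snd).sum

/-- The members `S` of a family at depth `q`: strings that end here, the heavy group `H` with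
letter `c`, and the light groups `G`. -/
structure Split (L : List (List α)) (q : ℕ) (S : Φ) (terms : Λ)
    (c : Option α) (H : Φ) (G : List (Option α × Φ)) : Prop where
  sum : S = (terms : Φ) + H + lights G
  terms_len : ∀ x ∈ terms, (str L x.1).length = q
  heavy_sym : ∀ x ∈ H, (str L x.1)[q]? = c
  light_sym : ∀ g ∈ G, ∀ x ∈ g.2, (str L x.1)[q]? = g.1
  heavy_ne : H ≠ 0 → c ≠ none
  light_ne : ∀ g ∈ G, g.1 ≠ none ∧ g.2 ≠ 0
  nodup : (G.map Prod.fst).Nodup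
  not_mem : c ∉ G.map Prod.fst
  card_le : ∀ g ∈ G, g.2.card ≤ H.card

/-- The families below a node. -/
def kidSpecs (k : ℕ) (c : Option α) (H : Φ)
    (G : List (Option α × Φ)) : List (Option α × Φ) :=
  G ++ ((if bump k (lights G) = 0 then [] else [(none, bump k (lights G))]) ++
    if H = 0 then [] else [(c, H + bump k (lights G))])

/-- The record at the address `a`. -/
structure RecAt (L : List (List α)) (M : ℕ → ℕ) (P0 Q : List (Option α)) (par a : ℕ)
    (terms : Λ) (kids : List ℕ) : Prop where
  parent : M (a + 7) = par
  index : M (a + 1) < L.length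
  label_le : M (a + 2) + M (a + 3) ≤ (str L (M (a + 1))).length
  label : Q = P0 ++ labelAt L M a
  dollars : M (a + 4) = Q.count dollar
  kidsAt : ListAt M (M (a + 5)) kids
  termsAt : PairListAt M (M (a + 6)) terms

/-- The records of a node and of the subtrees of its children. -/
notation "Nd!" P:max w:max a:max t:max ks:max =>
  (insert (Rec.mk (P ++ emb w) a t (List.map (fun K => (Kid.path K, Kid.addr K)) ks))
    (⋃ K ∈ ks, Kid.recs K))

/-- The memory `M` holds at the address `a` the trie `N` that the algorithm builds for the family
`S` with common prefix `P`; the parent has the string `P0` and the address `par`, and the string of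
the root is `Q`. -/
inductive Built (L : List (List α)) (k : ℕ) (M : ℕ → ℕ) :
    List (Option α) → List (Option α) → Φ → ℕ → ℕ → List (Option α) →
      Set (Rec α) → Prop where
  | node {P0 P : List (Option α)} {S : Φ} {par a : ℕ} (w : List α)
      (terms : Λ) (c : Option α) (H : Φ)
      (G : List (Option α × Φ)) (kids : List (Kid α))
      (ha : 16 < a)
      (hw : ∀ x ∈ S, w <+: (str L x.1).drop P.length)
      (split : Split L (P.length + w.length) S terms c H G)
      (hk : (kids.map fun K => (K.sym, K.fam)).Perm (kidSpecs k c H G))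
      (hbr : terms ≠ [] ∨ 2 ≤ kids.length)
      (hrec : RecAt L M P0 (P ++ emb w) par a terms (kids.map Kid.addr))
      (hkids : ∀ K ∈ kids, Built L k M (P ++ emb w) ((P ++ emb w) ++ [K.sym]) K.fam a K.addr
        K.path K.recs) :
      Built L k M P0 P S par a (P ++ emb w) (Nd! P w a terms kids)

/-- The strings of the terminal nodes. -/
def outS (N : Set (Rec α)) : Set (List (Option α)) := {Q | ∃ r ∈ N, r.path = Q ∧ r.terms ≠ []}

variable {L : List (List α)} {k : ℕ} {M : ℕ → ℕ}
variable {p i j r q d m n a : ℕ} {p' : ℕ} {U V w : List α} {s c : Option α} {G : List (Option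
  α × Φ)} {x : ℕ × ℕ} {H F : Φ} {terms : Λ} {par : ℕ} {N : Set (Rec α)} {P Q P0 : List (Option α)}
  {kids : List (Kid α)} {S : Φ} {K : Kid α}

lemma Split.kid_syms_nodup
    (h : Split L q S terms c H G) : ((kidSpecs k c H G).map Prod.fst).Nodup := by
  have hn : none ∉ G.map Prod.fst := fun hn => by
    obtain ⟨g, hg, h'⟩ := mem_map.1 hn
    exact (h.light_ne g hg).1 h'
  have h1 := h.nodup
  have h2 := h.not_mem
  have h3 := h.heavy_ne
  unfold kidSpecs
  split_ifs with hb hH hH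
  · simpa using h1
  · simp [nodup_append, h1]
    intro a x hx hc; exact h2 (mem_map.2 ⟨_, hx, hc⟩)
  · simp [nodup_append, h1]
    intro a x hx hc; exact hn (mem_map.2 ⟨_, hx, hc⟩)
  · simp [nodup_append, h1, (h3 hH).symm]
    intro a x hx
    exact ⟨fun hc => hn (mem_map.2 ⟨_, hx, hc⟩), fun hc => h2 (mem_map.2 ⟨_, hx, hc⟩)⟩

lemma kids_eq_of_sym (h : (kids.map Kid.sym).Nodup) {K' : Kid α}
    (hK : K ∈ kids) (hK' : K' ∈ kids) (he : K.sym = K'.sym) : K = K' :=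
  List.inj_on_of_nodup_map h hK hK' he

lemma sym_eq_of_prefix {β : Type*} {Q R : List β} {s t : β} (h : Q ++ [s] <+: R)
    (h' : Q ++ [t] <+: R) : s = t := by
  have := (List.prefix_of_prefix_length_le h h' ✓).eq_of_length ✓
  simpa using this

lemma Built.path_prefix (h : Built L k M P0 P S par a Q N) : P <+: Q ∧ ∀ r ∈ N, Q <+: r.path := by
  induction h with
  | node w terms c H G kids ha hw split hk hbr hrec hkids ih =>
    refine ⟨prefix_append _ _, ?_⟩
    intro r hr
    rcases hr with rfl | hr
    · exact List.prefix_rfl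
    · simp only [Set.mem_iUnion] at hr
      obtain ⟨K, hK, hr⟩ := hr
      exact (prefix_append _ [K.sym]).trans (((ih K hK).1).trans ((ih K hK).2 r hr))

lemma Built.root_mem (h : Built L k M P0 P S par a Q N) : ∃ r ∈ N, r.path = Q ∧ r.addr = a := by
  cases h with
  | node w terms c H G kids => exact ⟨_, Set.mem_insert _ _, rfl, rfl⟩

lemma Built.exists_term (h : Built L k M P0 P S par a Q N) : ∃ r ∈ N, r.terms ≠ [] := by
  induction h with
  | node w terms c H G kids ha hw split hk hbr hrec hkids ih =>
    rcases hbr with hbr | hbr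
    · exact ⟨_, Set.mem_insert _ _, hbr⟩
    · obtain ⟨K, hK⟩ := List.exists_mem_of_length_pos (show 0 < kids.length by omega)
      obtain ⟨r, hr, ht⟩ := ih K hK
      exact ⟨r, .inr (Set.mem_biUnion hK hr), ht⟩

lemma Split.kids_nodup (h : Split L q S terms c H G) (hk : (kids.map fun K => (K.sym, K.fam)).Perm
    (kidSpecs k c H G)) : (kids.map Kid.sym).Nodup := by
  have h1 := (hk.map Prod.fst).nodup_iff.2 h.kid_syms_nodup
  simpa [map_map, Function.comp_def] using h1

lemma Built.addr_gt (h : Built L k M P0 P S par a Q N) : ∀ r ∈ N, 16 < r.addr := by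
  induction h with
  | node w terms c H G kids ha hw split hk hbr hrec hkids ih =>
    intro r hr
    rcases hr with rfl | hr
    · exact ha
    · simp only [Set.mem_iUnion] at hr
      obtain ⟨K, hK, hr⟩ := hr
      exact ih K hK r hr

/-- All structural facts on the records that do not depend on the strings in `S`. -/
structure Flat (L : List (List α)) (M : ℕ → ℕ) (P0 Q : List (Option α)) (par a : ℕ)
    (N : Set (Rec α)) : Prop where
  uniq : ∀ r ∈ N, ∀ r' ∈ N, r.path = r'.path → r = r'
  recAt : ∀ r ∈ N, ∃ P' par', RecAt L M P' r.path par' r.addr r.terms (r.kids.map Prod.snd) ∧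
    ((r.path = Q ∧ r.addr = a ∧ P' = P0 ∧ par' = par) ∨ ∃ r' ∈ N, (r.path, r.addr) ∈ r'.kids ∧ P' =
    r'.path ∧ par' = r'.addr)
  kid : ∀ r ∈ N, ∀ κ ∈ r.kids, (∃ s, r.path ++ [s] <+: κ.1) ∧
    ∃ r' ∈ N, r'.path = κ.1 ∧ r'.addr = κ.2
  kid_eq : ∀ r ∈ N, ∀ κ ∈ r.kids, ∀ κ' ∈ r.kids, κ.1 <+: κ'.1 → κ = κ'
  kids_nodup : ∀ r ∈ N, (r.kids.map Prod.fst).Nodup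
  descend : ∀ r ∈ N, ∀ r' ∈ N, r.path <+: r'.path → r.path ≠ r'.path → ∃ κ ∈ r.kids, κ.1 <+: r'.path

/-- The nodes are the terminal strings and the branching ones. -/
def NodesOf (N : Set (Rec α)) (R : List (Option α)) : Prop :=
  (∃ r ∈ N, r.path = R) ↔ R ∈ outS N ∨
    ∃ c d, c ≠ d ∧ (∃ U ∈ outS N, R ++ [c] <+: U) ∧ ∃ U ∈ outS N, R ++ [d] <+: U

lemma Built.flat_and_nodesOf (h : Built L k M P0 P S par a Q N) :
    Flat L M P0 Q par a N ∧ ∀ R, NodesOf N R := by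
  induction h with
  | @node P0 P S par a w terms c H G kids ha hw split hk hbr hrec hkids ih =>
    have hnd := split.kids_nodup hk
    set Q := P ++ emb w with hQ
    set r0 : Rec α := ⟨Q, a, terms, kids.map fun K => (K.path, K.addr)⟩ with hr0
    have hsub : ∀ K ∈ kids, ∀ r ∈ K.recs, r ∈ insert r0 (⋃ K ∈ kids, K.recs) :=
      fun K hK r hr => .inr (Set.mem_biUnion hK hr)
    have hpre : ∀ K ∈ kids, ∀ r ∈ K.recs, Q ++ [K.sym] <+: r.path := fun K hK r hr =>
      ((hkids K hK).path_prefix.1).trans ((hkids K hK).path_prefix.2 r hr)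
    have hsame : ∀ K ∈ kids, ∀ r ∈ K.recs, ∀ K' ∈ kids, ∀ r' ∈ K'.recs, r.path <+: r'.path → K = K'
      := fun K hK r hr K' hK' r' hr' hp => kids_eq_of_sym hnd hK hK' (sym_eq_of_prefix ((hpre K hK r
      hr).trans hp) (hpre K' hK' r' hr'))
    have hlong : ∀ K ∈ kids, ∀ r ∈ K.recs, Q.length < r.path.length := fun K hK r hr => by
      simpa using (hpre K hK r hr).length_le
    have hmem : ∀ r ∈ insert r0 (⋃ K ∈ kids, K.recs), r = r0 ∨ ∃ K ∈ kids, r ∈ K.recs := by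
      intro r hr
      rcases hr with hr | hr
      · exact .inl hr
      · exact .inr (by simpa using hr)
    have hout : ∀ K ∈ kids, outS K.recs ⊆ outS (insert r0 (⋃ K ∈ kids, K.recs)) := by
      rintro K hK R ⟨r, hr, h1, h2⟩
      exact ⟨r, hsub K hK r hr, h1, h2⟩
    refine ⟨⟨?_, ?_, ?_, ?_, ?_, ?_⟩, ?_⟩
    · intro r hr r' hr' he
      rcases hmem r hr with rfl | ⟨K, hK, hrK⟩ <;> rcases hmem r' hr' with rfl | ⟨K', hK', hrK'⟩
      · rfl
      · have := hlong K' hK' r' hrK'; rw [← he] at this; exact absurd this (lt_irrefl _)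
      · have := hlong K hK r hrK; rw [he] at this; exact absurd this (lt_irrefl _)
      · obtain rfl := hsame K hK r hrK K' hK' r' hrK' (he ▸ List.prefix_rfl)
        exact (ih K hK).1.uniq r hrK r' hrK' he
    · intro r hr
      rcases hmem r hr with rfl | ⟨K, hK, hrK⟩
      · refine ⟨P0, par, ?_, .inl ⟨rfl, rfl, rfl, rfl⟩⟩
        simpa [hr0, map_map, Function.comp_def] using hrec
      · obtain ⟨P', par', h1, h2⟩ := (ih K hK).1.recAt r hrK
        refine ⟨P', par', h1, .inr ?_⟩
        rcases h2 with ⟨e1, e2, e3, e4⟩ | ⟨r', hr', h2⟩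
        · exact ⟨r0, Set.mem_insert _ _, mem_map.2 ⟨K, hK, by rw [e1, e2]⟩, e3, e4⟩
        · exact ⟨r', hsub K hK r' hr', h2⟩
    · intro r hr κ hκ
      rcases hmem r hr with rfl | ⟨K, hK, hrK⟩
      · obtain ⟨K, hK, rfl⟩ := mem_map.1 hκ
        obtain ⟨r', hr', h1, h2⟩ := (hkids K hK).root_mem
        exact ⟨⟨K.sym, (hkids K hK).path_prefix.1⟩, r', hsub K hK r' hr', h1, h2⟩
      · obtain ⟨h1, r', hr', h2⟩ := (ih K hK).1.kid r hrK κ hκ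
        exact ⟨h1, r', hsub K hK r' hr', h2⟩
    · intro r hr κ hκ κ' hκ' hp
      rcases hmem r hr with rfl | ⟨K, hK, hrK⟩
      · obtain ⟨K, hK, rfl⟩ := mem_map.1 hκ
        obtain ⟨K', hK', rfl⟩ := mem_map.1 hκ'
        obtain rfl := kids_eq_of_sym hnd hK hK' (sym_eq_of_prefix
          (((hkids K hK).path_prefix.1).trans hp) ((hkids K' hK').path_prefix.1))
        rfl
      · exact (ih K hK).1.kid_eq r hrK κ hκ κ' hκ' hp
    · intro r hr
      rcases hmem r hr with rfl | ⟨K, hK, hrK⟩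
      · rw [hr0]; dsimp only
        rw [map_map]
        refine List.Nodup.map_on ?_ hnd.of_map
        intro K hK K' hK' he
        have he' : K.path = K'.path := he
        exact kids_eq_of_sym hnd hK hK' (sym_eq_of_prefix
          (he' ▸ (hkids K hK).path_prefix.1) ((hkids K' hK').path_prefix.1))
      · exact (ih K hK).1.kids_nodup r hrK
    · intro r hr r' hr' hp hne
      rcases hmem r hr with rfl | ⟨K, hK, hrK⟩ <;> rcases hmem r' hr' with rfl | ⟨K', hK', hrK'⟩
      · exact absurd rfl hne
      · exact ⟨_, mem_map.2 ⟨K', hK', rfl⟩, (hkids K' hK').path_prefix.2 r' hrK'⟩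
      · exact absurd hp.length_le (hlong K hK r hrK).not_ge
      · obtain rfl := hsame K hK r hrK K' hK' r' hrK' hp
        exact (ih K hK).1.descend r hrK r' hrK' hp hne
    · intro R
      constructor
      · rintro ⟨r, hr, rfl⟩
        rcases hmem r hr with rfl | ⟨K, hK, hrK⟩
        · rcases hbr with hbr | hbr
          · exact .inl ⟨r0, hr, rfl, hbr⟩
          · right
            obtain ⟨K, K', rest, rfl⟩ : ∃ K K' rest, kids = K :: K' :: rest := by
              match kids, hbr with
              | K :: K' :: rest, _ => exact ⟨K, K', rest, rfl⟩
            have hK : K ∈ K :: K' :: rest := ✓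
            have hK' : K' ∈ K :: K' :: rest := ✓
            obtain ⟨t, ht, ht'⟩ := (hkids K hK).exists_term
            obtain ⟨u, hu, hu'⟩ := (hkids K' hK').exists_term
            refine ⟨K.sym, K'.sym, ?_, ⟨_, ⟨t, hsub K hK t ht, rfl, ht'⟩, hpre K hK t ht⟩,
              ⟨_, ⟨u, hsub K' hK' u hu, rfl, hu'⟩, hpre K' hK' u hu⟩⟩
            intro he
            simp [he] at hnd
        · rcases ((ih K hK).2 r.path).1 ⟨r, hrK, rfl⟩ with
            h1 | ⟨c, d, hcd, ⟨U, hU, hU'⟩, V, hV, hV'⟩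
          · exact .inl (hout K hK h1)
          · exact .inr ⟨c, d, hcd, ⟨U, hout K hK hU, hU'⟩, V, hout K hK hV, hV'⟩
      · rintro (⟨r, hr, h1, -⟩ | ⟨c, d, hcd, ⟨U, ⟨u, hu, rfl, hut⟩, hU'⟩, V, ⟨v, hv, rfl, hvt⟩, hV'⟩)
        · exact ⟨r, hr, h1⟩
        · have hpu : R <+: u.path := (prefix_append _ _).trans hU'
          have hpv : R <+: v.path := (prefix_append _ _).trans hV'
          rcases hmem u hu with rfl | ⟨K, hK, huK⟩ <;> rcases hmem v hv with rfl | ⟨K', hK', hvK⟩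
          · exact absurd (sym_eq_of_prefix hU' hV') hcd
          · exact absurd (sym_eq_of_prefix (hU'.trans ((prefix_append Q [K'.sym]).trans
              (hpre K' hK' v hvK))) hV') hcd
          · exact absurd (sym_eq_of_prefix hU' (hV'.trans ((prefix_append Q [K.sym]).trans
              (hpre K hK u huK)))) hcd
          · by_cases hKK : K = K'
            · subst hKK
              obtain ⟨r, hr, h1⟩ := ((ih K hK).2 R).2 (.inr ⟨c, d, hcd,
                ⟨_, ⟨u, huK, rfl, hut⟩, hU'⟩, _, ⟨v, hvK, rfl, hvt⟩, hV'⟩)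
              exact ⟨r, hsub K hK r hr, h1⟩
            · refine ⟨r0, Set.mem_insert _ _, ?_⟩
              have hs : K.sym ≠ K'.sym := fun he => hKK (kids_eq_of_sym hnd hK hK' he)
              have hQu := hpre K hK u huK
              have hQv := hpre K' hK' v hvK
              have e1 : Q <+: u.path := (prefix_append _ _).trans hQu
              have e2 : Q <+: v.path := (prefix_append _ _).trans hQv
              rcases lt_trichotomy Q.length R.length with hl | hl | hl
              · have f1 := List.prefix_of_prefix_length_le hQu hpu ✦
                have f2 := List.prefix_of_prefix_length_le hQv hpv ✦
                exact absurd (sym_eq_of_prefix f1 f2) hs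
              · exact (List.prefix_of_prefix_length_le e1 hpu hl.le).eq_of_length hl
              · have f1 := List.prefix_of_prefix_length_le hU' e1 ✦
                have f2 := List.prefix_of_prefix_length_le hV' e2 ✦
                exact absurd (sym_eq_of_prefix f1 f2) hcd

lemma Flat.eq_of_addr (h : Flat L M P0 Q par a N) (hpar : ∀ r ∈ N, par ≠ r.addr) : ∀ n, ∀ r ∈ N,
    ∀ r' ∈ N, r.path.length ≤ n → r.addr = r'.addr → r.path = r'.path := by
  have hshort : ∀ r' ∈ N, ∀ Q' b, (Q', b) ∈ r'.kids → r'.path.length < Q'.length := by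
    intro r' hr' Q' b hb
    obtain ⟨⟨s, hs⟩, -⟩ := h.kid r' hr' _ hb
    simpa using hs.length_le
  intro n
  induction n with
  | zero =>
    intro r hr r' hr' hn he
    obtain ⟨P', par', h1, h2⟩ := h.recAt r hr
    obtain ⟨P'', par'', h3, h4⟩ := h.recAt r' hr'
    rcases h2 with ⟨e1, -, -, e2⟩ | ⟨r2, hr2, hk, -⟩
    · rcases h4 with ⟨e3, -⟩ | ⟨r2, hr2, -, -, hk⟩
      · rw [e1, e3]
      · have := h1.parent; rw [he, h3.parent, hk, e2] at this
        exact absurd this.symm (hpar r2 hr2)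
    · have := hshort r2 hr2 _ _ hk; omega
  | succ n ih =>
    intro r hr r' hr' hn he
    obtain ⟨P', par', h1, h2⟩ := h.recAt r hr
    obtain ⟨P'', par'', h3, h4⟩ := h.recAt r' hr'
    rcases h2 with ⟨e1, -, -, e2⟩ | ⟨r2, hr2, hk, hP, hpp⟩
    · rcases h4 with ⟨e3, -⟩ | ⟨r2, hr2, -, -, hk⟩
      · rw [e1, e3]
      · have := h1.parent; rw [he, h3.parent, hk, e2] at this
        exact absurd this.symm (hpar r2 hr2)
    · rcases h4 with ⟨-, -, -, e4⟩ | ⟨r3, hr3, hk', hP', hpp'⟩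
      · have := h1.parent; rw [he, h3.parent, hpp, e4] at this
        exact absurd this (hpar r2 hr2)
      · have e : r2.addr = r3.addr := by
          have := h1.parent; rw [he, h3.parent, hpp, hpp'] at this; exact this.symm
        have := ih r2 hr2 r3 hr3 (by have := hshort r2 hr2 _ _ hk; omega) e
        rw [h1.label, h3.label, hP, hP', this, he]

theorem Flat.holdsTrie (h : Flat L M [] [] par a N) (hnodes : ∀ R ≠ [], NodesOf N R) (hpar : ∀ r ∈
    N, par ≠ r.addr) (hroot : ∃ r ∈ N, r.path = [] ∧ r.addr = a) {𝓕 : Finset (List α)} {N' : List α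
    → Finset (List (Option α))} (hun : unionFam 𝓕 N' = outS N) (hterm : ∀ r ∈ N, r.terms.Nodup ∧ ∀ j
    e, (j, e) ∈ r.terms ↔ ∃ F, L[j]? = some F ∧ r.path ∈ N' F ∧ e = dH (emb F) r.path) : HoldsTrie 𝓕
    L N' M a := by
  classical
  have hnode : ∀ P, IsNode (unionFam 𝓕 N') P ↔ ∃ r ∈ N, r.path = P := by
    intro P
    by_cases hP : P = []
    · subst hP
      obtain ⟨r, hr, h1, -⟩ := hroot
      exact iff_of_true (.inl rfl) ⟨r, hr, h1⟩
    · have := hnodes P hP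
      rw [NodesOf] at this
      rw [this, IsNode, hun]
      simp [hP]
  let addr : List (Option α) → ℕ := fun P => if hP : ∃ r ∈ N, r.path = P then hP.choose.addr else 0
  have haddr : ∀ r ∈ N, addr r.path = r.addr := by
    intro r hr
    have hP : ∃ r' ∈ N, r'.path = r.path := ⟨r, hr, rfl⟩
    have : hP.choose = r := h.uniq _ hP.choose_spec.1 _ hr hP.choose_spec.2
    simp only [addr, dif_pos hP, this]
  have hedge : ∀ r ∈ N, ∀ R, IsEdge (unionFam 𝓕 N') r.path R ↔ ∃ κ ∈ r.kids, κ.1 = R := by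
    intro r hr R
    constructor
    · rintro ⟨-, hR, hp, hne, hmin⟩
      obtain ⟨r', hr', rfl⟩ := (hnode R).1 hR
      obtain ⟨κ, hκ, hκp⟩ := h.descend r hr r' hr' hp hne
      obtain ⟨⟨s, hs⟩, r2, hr2, h2, -⟩ := h.kid r hr κ hκ
      refine ⟨κ, hκ, ?_⟩
      rcases hmin κ.1 ((hnode _).2 ⟨r2, hr2, h2⟩) ((prefix_append _ _).trans hs) hκp with e | e
      · have := hs.length_le; rw [e] at this; simp at this
      · exact e
    · rintro ⟨κ, hκ, rfl⟩
      obtain ⟨⟨s, hs⟩, r2, hr2, h2, -⟩ := h.kid r hr κ hκ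
      refine ⟨(hnode _).2 ⟨r, hr, rfl⟩, (hnode _).2 ⟨r2, hr2, h2⟩,
        (prefix_append _ _).trans hs, ?_, ?_⟩
      · intro e; have := hs.length_le; rw [← e] at this; simp at this
      · intro R hR h1 h3
        by_cases he : r.path = R
        · exact .inl he.symm
        · right
          obtain ⟨r', hr', rfl⟩ := (hnode R).1 hR
          obtain ⟨κ', hκ', hp'⟩ := h.descend r hr r' hr' h1 he
          have := h.kid_eq r hr κ' hκ' κ hκ (hp'.trans h3)
          subst this
          exact h3.eq_of_length (le_antisymm h3.length_le hp'.length_le)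
  refine ⟨addr, ?_, ?_, ?_⟩
  · obtain ⟨r, hr, h1, h2⟩ := hroot
    rw [← h1, haddr r hr, h2]
  · intro P hP P' hP' he
    obtain ⟨r, hr, rfl⟩ := (hnode P).1 hP
    obtain ⟨r', hr', rfl⟩ := (hnode P').1 hP'
    rw [haddr r hr, haddr r' hr'] at he
    exact h.eq_of_addr hpar _ r hr r' hr' le_rfl he
  · intro P hP
    obtain ⟨r, hr, rfl⟩ := (hnode P).1 hP
    obtain ⟨P', par', hrec, -⟩ := h.recAt r hr
    have hkaddr : ∀ κ ∈ r.kids, addr κ.1 = κ.2 := by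
      intro κ hκ
      obtain ⟨-, r2, hr2, h2, h3⟩ := h.kid r hr κ hκ
      rw [← h2, haddr r2 hr2, h3]
    refine ⟨⟨r.kids.map Prod.snd, ?_, ?_, ?_⟩, ?_, ?_, ?_⟩
    · rw [haddr r hr]; exact hrec.kidsAt
    · have hnd := h.kids_nodup r hr
      refine List.Nodup.map_on ?_ hnd.of_map
      intro κ hκ κ' hκ' he
      obtain ⟨-, r2, hr2, h2, h3⟩ := h.kid r hr κ hκ
      obtain ⟨-, r4, hr4, h4, h5⟩ := h.kid r hr κ' hκ'
      have := h.eq_of_addr hpar _ r2 hr2 r4 hr4 le_rfl (by rw [h3, h5, he])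
      rw [h2, h4] at this
      exact Prod.ext this he
    · intro q
      rw [mem_map]
      constructor
      · rintro ⟨κ, hκ, rfl⟩
        exact ⟨κ.1, (hedge r hr _).2 ⟨κ, hκ, rfl⟩, hkaddr κ hκ⟩
      · rintro ⟨R, hR, rfl⟩
        obtain ⟨κ, hκ, rfl⟩ := (hedge r hr _).1 hR
        exact ⟨κ, hκ, (hkaddr κ hκ).symm⟩
    · intro R hR
      obtain ⟨κ, hκ, rfl⟩ := (hedge r hr _).1 hR
      obtain ⟨⟨s, hs⟩, r2, hr2, h2, h3⟩ := h.kid r hr κ hκ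
      obtain ⟨P2, par2, hrec2, hcase⟩ := h.recAt r2 hr2
      have hP2 : P2 = r.path := by
        rcases hcase with ⟨e1, -⟩ | ⟨r3, hr3, hk3, e3, -⟩
        · have := hs.length_le; rw [← h2, e1] at this; simp at this
        · have e4 := (hedge r3 hr3 r2.path).2 ⟨_, hk3, rfl⟩
          have e5 := (hedge r hr r2.path).2 ⟨κ, hκ, h2.symm⟩
          rcases List.prefix_or_prefix_of_prefix e4.2.2.1 e5.2.2.1 with hh | hh
          · rcases e4.2.2.2.2 _ e5.1 hh e5.2.2.1 with e | e
            · rw [e3, e]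
            · exact absurd e e5.2.2.2.1
          · rcases e5.2.2.2.2 _ e4.1 hh e4.2.2.1 with e | e
            · rw [e3, e]
            · exact absurd e e4.2.2.2.1
      rw [hkaddr κ hκ, ← h3, ← h2]
      refine ⟨hrec2.index, hrec2.label_le, ?_⟩
      conv_lhs => rw [hrec2.label, hP2]
    · refine ⟨r.terms, ?_, hterm r hr⟩
      rw [haddr r hr]; exact hrec.termsAt
    · intro _
      rw [haddr r hr]; exact hrec.dollars

lemma Flat.wrap {r0 : ℕ} (h : Flat L M [] Q r0 a N) (hQ : Q ≠ []) (hpre : ∀ r ∈ N, Q <+: r.path)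
    (hroot : ∃ r ∈ N, r.path = Q ∧ r.addr = a) (hrec : RecAt L M [] [] par r0 [] [a]) : Flat L M []
    [] par r0 (insert ⟨[], r0, [], [(Q, a)]⟩ N) ∧ outS (insert ⟨[], r0, [], [(Q, a)]⟩ N) = outS
    N := by
  have hne : ∀ r ∈ N, r.path ≠ [] := fun r hr he => hQ (by
    have := hpre r hr; rw [he] at this; exact List.prefix_nil.1 this)
  have hout : outS (insert ⟨[], r0, [], [(Q, a)]⟩ N) = outS N := by
    ext R; constructor
    · rintro ⟨r, rfl | hr, h1, h2⟩
      · exact absurd rfl h2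
      · exact ⟨r, hr, h1, h2⟩
    · rintro ⟨r, hr, h1, h2⟩; exact ⟨r, .inr hr, h1, h2⟩
  obtain ⟨s, Q', hsQ⟩ : ∃ s Q', Q = s :: Q' := List.exists_cons_of_ne_nil hQ
  refine ⟨⟨?_, ?_, ?_, ?_, ?_, ?_⟩, hout⟩
  · rintro r (rfl | hr) r' (rfl | hr') he
    · rfl
    · exact absurd he.symm (hne r' hr')
    · exact absurd he (hne r hr)
    · exact h.uniq r hr r' hr' he
  · rintro r (rfl | hr)
    · exact ⟨[], par, by simpa using hrec, .inl ⟨rfl, rfl, rfl, rfl⟩⟩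
    · obtain ⟨P', par', h1, h2⟩ := h.recAt r hr
      refine ⟨P', par', h1, .inr ?_⟩
      rcases h2 with ⟨e1, e2, e3, e4⟩ | ⟨r', hr', h2⟩
      · exact ⟨_, .inl rfl, by simp [e1, e2], e3, e4⟩
      · exact ⟨r', .inr hr', h2⟩
  · rintro r (rfl | hr) κ hκ
    · obtain rfl : κ = (Q, a) := by simpa using hκ
      obtain ⟨r, hr, h1⟩ := hroot
      exact ⟨⟨s, by simp [hsQ]⟩, r, .inr hr, h1⟩
    · obtain ⟨h1, r', hr', h2⟩ := h.kid r hr κ hκ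
      exact ⟨h1, r', .inr hr', h2⟩
  · rintro r (rfl | hr) κ hκ κ' hκ' hp
    · have e1 : κ = (Q, a) := by simpa using hκ
      have e2 : κ' = (Q, a) := by simpa using hκ'
      rw [e1, e2]
    · exact h.kid_eq r hr κ hκ κ' hκ' hp
  · rintro r (rfl | hr)
    · simp
    · exact h.kids_nodup r hr
  · rintro r (rfl | hr) r' (rfl | hr') hp hne'
    · exact absurd rfl hne'
    · exact ⟨(Q, a), ✓, hpre r' hr'⟩
    · exact absurd (List.prefix_nil.1 hp) (hne r hr)
    · exact h.descend r hr r' hr' hp hne'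

/-! ### Generalized binomial coefficients -/

section Binomial

/-- The binomial coefficient `C(x + b, b)`. -/
noncomputable def bin (b : ℕ) (x : ℝ) : ℝ := Ring.choose (x + b) b

lemma bin_zero (x : ℝ) : bin 0 x = 1 := by simp [bin]

lemma bin_pascal (b : ℕ) (x : ℝ) : bin (b + 1) x = bin (b + 1) (x - 1) + bin b x := by
  have h := Ring.choose_succ_succ (x + b) b
  simp only [bin]
  rw [show x + ((b + 1 : ℕ) : ℝ) = x + b + 1 by push_cast; ring,
    show x - 1 + ((b + 1 : ℕ) : ℝ) = x + b by push_cast; ring, h, add_comm]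

lemma bin_succ (b : ℕ) (x : ℝ) : bin (b + 1) x = (x + b + 1) / (b + 1) * bin b x := by
  simp only [bin, Ring.choose_eq_smul, descPochhammer_succ_left, smul_eq_mul]
  rw [← Polynomial.aeval_eq_smeval, ← Polynomial.aeval_eq_smeval]
  simp only [map_mul, Polynomial.aeval_X, Polynomial.aeval_comp, map_sub, map_one]
  rw [show x + ((b + 1 : ℕ) : ℝ) - 1 = x + b by push_cast; ring, Nat.factorial_succ]
  have : ((b : ℝ) + 1) ≠ 0 := by positivity
  have h2 : ((b.factorial : ℕ) : ℝ) ≠ 0 := by positivity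
  push_cast
  field_simp
  ring

lemma one_le_bin (b : ℕ) {x : ℝ} (hx : 0 ≤ x) : 1 ≤ bin b x := by
  induction b with
  | zero => rw [bin_zero]
  | succ b ih =>
    rw [bin_succ]
    have : 1 ≤ (x + b + 1) / (b + 1) := by rw [le_div_iff₀ (by positivity)]; linarith
    nlinarith

lemma bin_mono (b : ℕ) {x y : ℝ} (hx : 0 ≤ x) (h : x ≤ y) : bin b x ≤ bin b y := by
  induction b with
  | zero => rw [bin_zero, bin_zero]
  | succ b ih =>
    rw [bin_succ, bin_succ]
    have h1 := one_le_bin b hx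
    have h2 : 0 ≤ (y + b + 1) / (b + 1) := by have := hx.trans h; positivity
    gcongr

lemma bin_one (x : ℝ) : bin 1 x = x + 1 := by
  have := bin_succ 0 x
  simpa [bin_zero] using this

end Binomial

/-! ### The Hamming distance -/

section Hamming

variable {β : Type*} [DecidableEq β]

lemma dH_eq_sum (U V : List β) :
    dH U V = ∑ i ∈ Finset.range U.length, if U[i]? ≠ V[i]? then 1 else 0 := by
  rw [dH, Finset.card_filter]

lemma dH_self (U : List β) : dH U U = 0 := by simp [dH]

lemma dH_append {U V : List β} (h : U.length = V.length) (U' V' : List β) :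
    dH (U ++ U') (V ++ V') = dH U V + dH U' V' := by
  simp only [dH_eq_sum]
  rw [length_append, Finset.sum_range_add]
  congr 1
  · refine Finset.sum_congr rfl fun i hi => ?_
    rw [mem_range] at hi
    rw [List.getElem?_append_left hi, List.getElem?_append_left (h ▸ hi)]
  · refine Finset.sum_congr rfl fun i _ => ?_
    rw [List.getElem?_append_right ω, List.getElem?_append_right ω]
    simp [h]

lemma dH_singleton (a b : β) : dH [a] [b] = if a = b then 0 else 1 := by
  simp [dH_eq_sum]

end Hamming

/-! ### The strings produced by the algorithm -/

/-- The string `Q` is produced for the input string number `i`, at distance `e`. -/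
def Out (N : Set (Rec α)) (i e : ℕ) (Q : List (Option α)) : Prop :=
  ∃ r ∈ N, r.path = Q ∧ (i, e) ∈ r.terms

/-- The member `x` of a family with common prefix `P` is consistent. -/
structure Val (L : List (List α)) (k : ℕ) (P : List (Option α)) (x : ℕ × ℕ) : Prop where
  lt : x.1 < L.length
  cost_le : x.2 ≤ k
  len : P.length ≤ (str L x.1).length
  dist : dH (emb ((str L x.1).take P.length)) P = x.2

lemma mem_bump   : x ∈ bump k S ↔ ∃ e, (x.1, e) ∈ S ∧ e < k ∧ x.2 = e + 1 := by
  simp only [bump, Multiset.mem_map, Multiset.mem_filter]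
  constructor
  · rintro ⟨y, ⟨h1, h2⟩, rfl⟩; exact ⟨y.2, h1, h2, rfl⟩
  · rintro ⟨e, h1, h2, h3⟩; exact ⟨(x.1, e), ⟨h1, h2⟩, by rw [← h3]⟩

lemma card_bump_le (S : Φ) : (bump k S).card ≤ S.card := by
  rw [bump, card_map]; exact card_le_card (filter_le _ _)

lemma mem_lights   : x ∈ lights G ↔ ∃ g ∈ G, x ∈ g.2 := by
  induction G with
  | nil => simp [lights]
  | cons g G ih => simp only [lights, map_cons, sum_cons, mem_add] at *; simp [ih]

lemma mem_kidSpecs : (s, F) ∈ kidSpecs k c H G ↔ (s, F) ∈ G ∨ (s = none ∧ F = bump k (lights G) ∧ F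
    ≠ 0) ∨ (s = c ∧ F = H + bump k (lights G) ∧ H ≠ 0) := by
  unfold kidSpecs
  split_ifs with h1 h2 h2 <;> simp only [mem_append, mem_singleton, Prod.mk.injEq,
    append_nil, nil_append] <;> grind

lemma Val.append (h : Val L k P x)
    (hw : w <+: (str L x.1).drop P.length) : Val L k (P ++ emb w) x := by
  obtain ⟨t, ht⟩ := hw
  have hlen : (str L x.1).length = P.length + (w.length + t.length) := by
    have := congrArg List.length ht; simp at this; have := h.len; omega
  refine ⟨h.lt, h.cost_le, by simp; omega, ?_⟩
  have : (str L x.1).take (P ++ emb w).length = (str L x.1).take P.length ++ w := by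
    rw [length_append, List.take_add, ← ht]; simp
  rw [this, emb, map_append, dH_append ✦, dH_self, add_zero]
  exact h.dist

lemma Val.snoc (h : Val L k P x) {a : α} (ha : (str L x.1)[P.length]? = some a) {e : ℕ} (he : e ≤ k)
    (hs : e = x.2 + if some a = s then 0 else 1) : Val L k (P ++ [s]) (x.1, e) := by
  have hlt := (List.getElem?_eq_some_iff.1 ha).1
  refine ⟨h.lt, he, by simpa using hlt, ?_⟩
  have : (str L x.1).take (P ++ [s]).length = (str L x.1).take P.length ++ [a] := by
    rw [length_append, List.length_singleton, List.take_add_one, ha]; rfl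
  dsimp only
  rw [this, emb, map_append, dH_append ✦, List.map_singleton, dH_singleton, hs]
  congr 1; exact h.dist

lemma Split.mem_iff (h : Split L q S terms c H G)  :
    x ∈ S ↔ x ∈ terms ∨ x ∈ H ∨ ∃ g ∈ G, x ∈ g.2 := by
  rw [h.sum, mem_add, mem_add, mem_lights, mem_coe, or_assoc]

lemma Split.kid_origin (h : Split L q S terms c H G) (hF : (s, F) ∈ kidSpecs k c H G) (hx : x ∈ F) :
    ∃ e0 a, (x.1, e0) ∈ S ∧ (str L x.1)[q]? = some a ∧ x.2 = e0 + (if some a = s then 0 else 1) ∧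
    (x.2 = e0 ∨ x.2 ≤ k) := by
  have hlight : ∀ g ∈ G, ∀ y ∈ g.2, y ∈ S ∧ ∃ a, (str L y.1)[q]? = some a ∧ g.1 = some a := by
    intro g hg y hy
    have h1 := h.light_sym g hg y hy
    obtain ⟨a, ha⟩ := Option.ne_none_iff_exists'.1 (h.light_ne g hg).1
    exact ⟨h.mem_iff.2 (.inr (.inr ⟨g, hg, hy⟩)), a, h1.trans ha, ha⟩
  have hbump : ∀ s, s ∉ G.map Prod.fst → x ∈ bump k (lights G) → ∃ e0 a, (x.1, e0) ∈ S ∧ (str L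
    x.1)[q]? = some a ∧ x.2 = e0 + (if some a = s then 0 else 1) ∧ (x.2 = e0 ∨ x.2 ≤ k) := by
    intro s hs hx
    obtain ⟨e, h1, h2, h3⟩ := mem_bump.1 hx
    obtain ⟨g, hg, hy⟩ := mem_lights.1 h1
    obtain ⟨h4, a, h5, h6⟩ := hlight g hg _ hy
    refine ⟨e, a, h4, h5, ?_, .inr ω⟩
    rw [if_neg, h3]
    rintro rfl
    exact hs (mem_map.2 ⟨g, hg, h6⟩)
  rcases mem_kidSpecs.1 hF with hG | ⟨rfl, rfl, -⟩ | ⟨rfl, rfl, hH⟩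
  · obtain ⟨h1, a, h2, h3⟩ := hlight _ hG x hx
    simp only at h3
    exact ⟨x.2, a, h1, h2, by simp [h3], .inl rfl⟩
  · refine hbump none ?_ hx
    intro hn
    obtain ⟨g, hg, h'⟩ := mem_map.1 hn
    exact (h.light_ne g hg).1 h'
  · rcases mem_add.1 hx with hx | hx
    · obtain ⟨a, ha⟩ := Option.ne_none_iff_exists'.1 (h.heavy_ne hH)
      exact ⟨x.2, a, h.mem_iff.2 (.inr (.inl hx)), (h.heavy_sym x hx).trans ha, by simp [ha],
        .inl rfl⟩
    · exact hbump _ h.not_mem hx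

lemma Split.kid_val (h : Split L P.length S terms c H G) (hv : ∀ x ∈ S, Val L k P x) (hF : (s, F) ∈
    kidSpecs k c H G) : ∀ x ∈ F, Val L k (P ++ [s]) x := by
  intro x hx
  obtain ⟨e0, a, h1, h2, h3, h4⟩ := h.kid_origin hF hx
  have hv' := hv _ h1
  exact hv'.snoc (e := x.2) h2 (h4.elim (fun h => h ▸ hv'.cost_le) id) h3

lemma kid_spec_mem
    (hk : (kids.map fun K => (K.sym, K.fam)).Perm (kidSpecs k c H G)) (hK : K ∈ kids) :
    (K.sym, K.fam) ∈ kidSpecs k c H G := hk.mem_iff.1 (mem_map.2 ⟨K, hK, rfl⟩)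

lemma exists_kid (hk : (kids.map fun K => (K.sym, K.fam)).Perm (kidSpecs k c H G)) (h : (s, F) ∈
    kidSpecs k c H G) : ∃ K ∈ kids, K.sym = s ∧ K.fam = F := by
  obtain ⟨K, hK, he⟩ := mem_map.1 (hk.mem_iff.2 h)
  exact ⟨K, hK, congrArg Prod.fst he, congrArg Prod.snd he⟩

lemma Built.out_spec (h : Built L k M P0 P S par a Q N) (hv : ∀ x ∈ S, Val L k P x) : ∀ {i e : ℕ} {R
    : List (Option α)}, Out N i e R → i < L.length ∧ e ≤ k ∧ R.length = (str L i).length ∧ dH (emb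
    (str L i)) R = e ∧ ∃ e0 ≤ e, (i, e0) ∈ S := by
  induction h with
  | node w terms c H G kids ha hw split hk hbr hrec hkids ih =>
    rename_i P0 P S par a
    have hv' : ∀ x ∈ S, Val L k (P ++ emb w) x := fun x hx => (hv x hx).append (hw x hx)
    have hlen : (P ++ emb w).length = P.length + w.length := ✓
    have split' := hlen ▸ split
    rintro i e R ⟨r, hr, rfl, ht⟩
    rcases hr with rfl | hr
    · have hmem := split.mem_iff.2 (.inl ht)
      have h1 := hv' _ hmem
      have h2 := split'.terms_len _ ht
      refine ⟨h1.lt, h1.cost_le, h2.symm, ?_, e, le_rfl, hmem⟩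
      have h3 := h1.dist
      rw [List.take_of_length_le (by simp only at h2 ⊢; omega)] at h3
      exact h3
    · simp only [Set.mem_iUnion] at hr
      obtain ⟨K, hK, hr⟩ := hr
      have hsp := kid_spec_mem hk hK
      obtain ⟨h1, h2, h3, h4, e0, h5, h6⟩ := ih K hK (split'.kid_val hv' hsp) ⟨r, hr, rfl, ht⟩
      obtain ⟨e1, b, h7, -, h8, -⟩ := split.kid_origin hsp h6
      exact ⟨h1, h2, h3, h4, e1, by simp only at h8; omega, h7⟩

lemma drop_prefix (hw : w <+: U.drop p) : U.drop p = w ++ U.drop (p + w.length) := by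
  obtain ⟨t, ht⟩ := hw
  rw [← drop_drop, ← ht]; simp

lemma drop_getElem? {a : α} (h : U[q]? = some a) : U.drop q = a :: U.drop (q + 1) := by
  obtain ⟨h1, rfl⟩ := List.getElem?_eq_some_iff.1 h
  exact List.drop_eq_getElem_cons h1

lemma Built.out_self (h : Built L k M P0 P S par a Q N) :
    ∀ x ∈ S, Out N x.1 x.2 (P ++ emb ((str L x.1).drop P.length)) := by
  induction h with
  | node w terms c H G kids ha hw split hk hbr hrec hkids ih =>
    rename_i P0 P S par a
    have hstep : ∀ x ∈ S, ∀ s F, (s, F) ∈ kidSpecs k c H G → x ∈ F → s ≠ none → (str L x.1)[P.length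
      + w.length]? = s → Out (Nd! P w a terms kids) x.1 x.2 (P ++ emb ((str L x.1).drop P.length)) := by
      intro x hx s F hF hxF hs hxs
      obtain ⟨K, hK, rfl, rfl⟩ := exists_kid hk hF
      obtain ⟨r, hr, h1, h2⟩ := ih K hK x hxF
      refine ⟨r, .inr (Set.mem_biUnion hK hr), ?_, h2⟩
      obtain ⟨b, hb⟩ := Option.ne_none_iff_exists'.1 hs
      rw [h1, drop_prefix (hw x hx), drop_getElem? (hxs.trans hb), hb]
      simp [Nat.add_assoc]
    intro x hx
    rcases split.mem_iff.1 hx with ht | hH | ⟨g, hg, hxg⟩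
    · refine ⟨_, Set.mem_insert _ _, ?_, ht⟩
      have := split.terms_len x ht
      dsimp only
      rw [drop_prefix (hw x hx), List.drop_of_length_le ω]; simp
    · have hne : H ≠ 0 := fun h => by simp [h] at hH
      exact hstep x hx c _ (mem_kidSpecs.2 (.inr (.inr ⟨rfl, rfl, hne⟩)))
        (mem_add.2 (.inl hH)) (split.heavy_ne hne) (split.heavy_sym x hH)
    · exact hstep x hx g.1 g.2 (mem_kidSpecs.2 (.inl hg)) hxg (split.light_ne g hg).1
        (split.light_sym g hg x hxg)

/-! ### Completeness -/

/-- The number of the first `p` positions at which `U` and `V` differ. -/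
def diffs (U V : List α) (p : ℕ) : ℕ := ((Finset.range p).filter fun t => U[t]? ≠ V[t]?).card

lemma diffs_mono (U V : List α) (h : p ≤ p') : diffs U V p ≤ diffs U V p' :=
  Finset.card_le_card (Finset.filter_subset_filter _ (Finset.range_mono h))

lemma diffs_succ (h : U[p]? ≠ V[p]?) : diffs U V (p + 1) = diffs U V p + 1 := by
  rw [diffs, Finset.range_add_one, Finset.filter_insert, if_pos h, Finset.card_insert_of_notMem]
  · rfl
  · simp

lemma LCP_le (d : ℕ) (U V : List α) : LCP d U V ≤ min U.length V.length := Nat.findGreatest_le _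

lemma diffs_LCP_le (d : ℕ) (U V : List α) : diffs U V (LCP d U V) ≤ d := by
  have h := Nat.findGreatest_spec (P := fun p => dH (U.take p) (V.take p) ≤ d)
    (Nat.zero_le (min U.length V.length)) (by simp [dH])
  change dH (U.take (LCP d U V)) (V.take (LCP d U V)) ≤ d at h
  refine le_trans (le_of_eq ?_) h
  have hl := LCP_le d U V
  rw [dH, diffs, List.length_take, min_eq_left ω]
  congr 1
  refine Finset.filter_congr fun t ht => ?_
  rw [mem_range] at ht
  rw [List.getElem?_take_of_lt ht, List.getElem?_take_of_lt ht]

/-- The common prefix `P` satisfies the conditions on a pair of strings modified from `U`, `V`. -/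
def PairPre (U V : List α) (P : List (Option α)) : Prop :=
  ∀ t < P.length, if U[t]? = V[t]? then P[t]? = (emb U)[t]?
    else P[t]? = (emb U)[t]? ∨ P[t]? = (emb V)[t]? ∨ P[t]? = some dollar

lemma PairPre.append (h : PairPre U V P)
    (hU : w <+: U.drop P.length) (hV : w <+: V.drop P.length) : PairPre U V (P ++ emb w) := by
  intro t ht
  by_cases htp : t < P.length
  · rw [List.getElem?_append_left htp]; exact h t htp
  · have hs : ∀ {X : List α}, w <+: X.drop P.length → X[t]? = w[t - P.length]? := by
      rintro X ⟨y, hy⟩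
      have := congrArg (fun l : List α => l[t - P.length]?) hy
      simp only [List.getElem?_drop] at this
      rw [List.getElem?_append_left (by simp at ht; omega)] at this
      rw [this]; congr 1; omega
    rw [if_pos (by rw [hs hU, hs hV]), List.getElem?_append_right ω]
    simp only [emb, List.getElem?_map]; rw [hs hU]

lemma PairPre.snoc (h : PairPre U V P) (hs : if U[P.length]? = V[P.length]? then some s = (emb
    U)[P.length]? else some s = (emb U)[P.length]? ∨ some s = (emb V)[P.length]? ∨ s = none) :
    PairPre U V (P ++ [s]) := by
  intro t ht
  rcases (show t < P.length ∨ t = P.length by simp at ht; omega) with ht | rfl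
  · rw [List.getElem?_append_left ht]; exact h t ht
  · simpa using hs

lemma PairPre.isPair (h : PairPre U V P) (hP : P.length ≤ LCP d U V) (hU : w <+: U.drop P.length)
    (hV : w <+: V.drop P.length) (hw : LCP d U V ≤ P.length + w.length) : IsPair d U V (P ++ emb
    (U.drop P.length)) (P ++ emb (V.drop P.length)) := by
  have hl := LCP_le d U V
  have hrest : ∀ X : List α, ∀ t, P.length ≤ t → (P ++ emb (X.drop P.length))[t]? = (emb X)[t]? :=
    by
    intro X t ht
    rw [List.getElem?_append_right ht]
    simp only [emb, List.getElem?_map, List.getElem?_drop]; congr 2; omega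
  refine ⟨by simp; omega, by simp; omega, ?_, ?_⟩
  · intro t ht
    by_cases htp : t < P.length
    · have he : U[t]? = V[t]? := ht.resolve_left ω
      have h1 := h t htp
      rw [if_pos he] at h1
      rw [List.getElem?_append_left htp, List.getElem?_append_left htp, h1]
      simp [emb, List.getElem?_map, he]
    · exact ⟨hrest U t ω, hrest V t ω⟩
  · intro t ht
    rw [not_or] at ht
    have htp : t < P.length := by
      by_contra hcon
      apply ht.2
      have hs : ∀ {X : List α}, w <+: X.drop P.length → X[t]? = w[t - P.length]? := by
        rintro X ⟨y, hy⟩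
        have := congrArg (fun l : List α => l[t - P.length]?) hy
        simp only [List.getElem?_drop] at this
        rw [List.getElem?_append_left ω] at this
        rw [this]; congr 1; omega
      rw [hs hU, hs hV]
    have h1 := h t htp
    rw [if_neg ht.2] at h1
    rw [List.getElem?_append_left htp, List.getElem?_append_left htp]
    exact ⟨rfl, h1⟩

lemma Built.pair (h : Built L k M P0 P S par a Q N) (hd : d ≤ k) : ∀ {e f : ℕ}, (i, e) ∈ S → (j, f)
    ∈ S → P.length ≤ LCP d (str L i) (str L j) → e ≤ diffs (str L i) (str L j) P.length → f ≤ diffs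
    (str L i) (str L j) P.length → PairPre (str L i) (str L j) P → ∃ U' V' e' f', Out N i e' U' ∧
    Out N j f' V' ∧ IsPair d (str L i) (str L j) U' V' := by
  induction h with
  | node w terms c H G kids ha hw split hk hbr hrec hkids ih =>
    rename_i P0 P S par a
    intro e f hi hj hP he hf hpp
    set U := str L i with hU
    set V := str L j with hV
    have hwU : w <+: U.drop P.length := hw _ hi
    have hwV : w <+: V.drop P.length := hw _ hj
    by_cases hq : LCP d U V ≤ P.length + w.length
    · have hb := Built.node w terms c H G kids ha hw split hk hbr hrec hkids
      exact ⟨_, _, _, _, hb.out_self _ hi, hb.out_self _ hj, hpp.isPair hP hwU hwV hq⟩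
    · rw [not_le] at hq
      set q := P.length + w.length with hqd
      have hl := LCP_le d U V
      have hqU : q < U.length := ω
      have hqV : q < V.length := ω
      have hmono := diffs_mono U V (show P.length ≤ q + 1 by omega)
      have hmono' := diffs_mono U V (show P.length ≤ q by omega)
      have hmono'' := diffs_mono U V (show q + 1 ≤ LCP d U V by omega)
      have hdl := diffs_LCP_le d U V
      have hpp' := hpp.append hwU hwV
      have hlen : (P ++ emb w).length = q := by simp [hqd]
      have hgo : ∀ s F, (s, F) ∈ kidSpecs k c H G → ∀ e f, (i, e) ∈ F → (j, f) ∈ F → e ≤ diffs U V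
        (q + 1) → f ≤ diffs U V (q + 1) → PairPre U V ((P ++ emb w) ++ [s]) → ∃ U' V' e' f', Out
        (Nd! P w a terms kids) i
        e' U' ∧ Out (Nd! P w a terms kids) j f' V' ∧ IsPair d U V U' V' := by
        intro s F hF e f hie hjf he hf hpre
        obtain ⟨K, hK, rfl, rfl⟩ := exists_kid hk hF
        have hl1 : (P ++ emb w ++ [K.sym]).length = q + 1 := by simp [hqd, Nat.add_assoc]
        obtain ⟨U', V', e', f', ⟨r, hr, h1⟩, ⟨r', hr', h2⟩, h3⟩ :=
          ih K hK hie hjf ω (by rw [hl1]; exact he) (by rw [hl1]; exact hf) hpre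
        exact ⟨U', V', e', f', ⟨r, .inr (Set.mem_biUnion hK hr), h1⟩,
          ⟨r', .inr (Set.mem_biUnion hK hr'), h2⟩, h3⟩
      have hcases : ∀ x ∈ S, q < (str L x.1).length → (x ∈ H ∧ (str L x.1)[q]? = c) ∨ ∃ g ∈ G, x ∈
        g.2 ∧ (str L x.1)[q]? = g.1 := by
        intro x hx hlt
        rcases split.mem_iff.1 hx with ht | hH | ⟨g, hg, hxg⟩
        · have := split.terms_len x ht; omega
        · exact .inl ⟨hH, split.heavy_sym x hH⟩
        · exact .inr ⟨g, hg, hxg, split.light_sym g hg x hxg⟩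
      have hsome : ∀ X : List α, q < X.length → ∃ b, X[q]? = some b := fun X hX =>
        ⟨X[q], List.getElem?_eq_getElem hX⟩
      obtain ⟨x, hx⟩ := hsome U hqU
      obtain ⟨y, hy⟩ := hsome V hqV
      have hnotG : ∀ g ∈ G, g.1 ≠ c := fun g hg hc => split.not_mem (mem_map.2 ⟨g, hg, hc⟩)
      have hlift : ∀ {i e : ℕ} {g : Option α × Φ}, g ∈ G → (i, e) ∈ g.2 → e < k → (i, e + 1) ∈ bump
        k (lights G) := fun hg hx he => mem_bump.2 ⟨_, mem_lights.2 ⟨_, hg, hx⟩, he, rfl⟩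
      have hembU : (emb U)[q]? = some (some x) := by simp [emb, hx]
      have hembV : (emb V)[q]? = some (some y) := by simp [emb, hy]
      by_cases hxy : x = y
      · subst hxy
        have hpre : PairPre U V ((P ++ emb w) ++ [some x]) := by
          refine hpp'.snoc ?_
          rw [hlen, if_pos (hx.trans hy.symm), hembU]
        rcases hcases _ hi hqU with ⟨h1, h2⟩ | ⟨g, hg, h1, h2⟩
        · have hc : c = some x := h2.symm.trans hx
          have hH : H ≠ 0 := fun h => by simp [h] at h1
          have hj' : (j, f) ∈ H := by
            rcases hcases _ hj hqV with ⟨h3, -⟩ | ⟨g', hg', -, h4⟩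
            · exact h3
            · exact absurd (h4.symm.trans (hy.trans hc.symm)) (hnotG g' hg')
          exact hgo (some x) _ (mem_kidSpecs.2 (.inr (.inr ⟨hc.symm, rfl, hH⟩))) e f (mem_add.2
            (.inl h1)) (mem_add.2 (.inl hj')) (he.trans hmono) (hf.trans hmono) hpre
        · have hgx : g.1 = some x := h2.symm.trans hx
          have hj' : (j, f) ∈ g.2 := by
            rcases hcases _ hj hqV with ⟨-, h4⟩ | ⟨g', hg', h3, h4⟩
            · exact absurd (hgx.trans (hy.symm.trans h4)) (hnotG g hg)
            · have := List.inj_on_of_nodup_map split.nodup hg hg' (hgx.trans (hy.symm.trans h4))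
              exact this ▸ h3
          exact hgo (some x) g.2 (mem_kidSpecs.2 (.inl (by rw [← hgx]; exact hg))) e f h1 hj'
            (he.trans hmono) (hf.trans hmono) hpre
      · have hne : U[q]? ≠ V[q]? := by rw [hx, hy]; simpa using hxy
        have hsucc := diffs_succ hne
        have hpre : ∀ s, s = some x ∨ s = some y ∨ s = none → PairPre U V ((P ++ emb w) ++ [s]) :=
          by
          intro s hs
          refine hpp'.snoc ?_
          rw [hlen, if_neg hne, hembU, hembV]
          simpa using hs
        rcases hcases _ hi hqU with ⟨h1, h2⟩ | ⟨g, hg, h1, h2⟩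
        · have hc : c = some x := h2.symm.trans hx
          have hH : H ≠ 0 := fun h => by simp [h] at h1
          obtain ⟨g, hg, h3⟩ : ∃ g ∈ G, (j, f) ∈ g.2 := by
            rcases hcases _ hj hqV with ⟨-, h4⟩ | ⟨g', hg', h3, -⟩
            · exact absurd (hx.trans (hc.symm.trans (h4.symm))) hne
            · exact ⟨g', hg', h3⟩
          exact hgo (some x) _ (mem_kidSpecs.2 (.inr (.inr ⟨hc.symm, rfl, hH⟩))) e (f + 1)
            (mem_add.2 (.inl h1)) (mem_add.2 (.inr (hlift hg h3 ω))) ω ω (hpre _ (.inl rfl))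
        · rcases hcases _ hj hqV with ⟨h3, h4⟩ | ⟨g', hg', h3, -⟩
          · have hc : c = some y := h4.symm.trans hy
            have hH : H ≠ 0 := fun h => by simp [h] at h3
            exact hgo (some y) _ (mem_kidSpecs.2 (.inr (.inr ⟨hc.symm, rfl, hH⟩))) (e + 1) f
              (mem_add.2 (.inr (hlift hg h1 ω))) (mem_add.2 (.inl h3)) ω ω (hpre _ (.inr (.inl
              rfl)))
          · have hb := hlift hg h1 ω
            exact hgo none _ (mem_kidSpecs.2 (.inr (.inl ⟨rfl, rfl, fun h => by
                simp [h] at hb⟩))) (e + 1) (f + 1) hb (hlift hg' h3 ω)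
              ω ω (hpre _ (.inr (.inr rfl)))

/-! ### Counting -/

lemma two_pow_bin_pascal (b : ℕ) (x : ℝ) : (2 : ℝ) ^ (b + 1) * bin (b + 1) x = 2 ^ (b + 1) * bin (b
    + 1) (x - 1) + 2 * (2 ^ b * bin b x) := by
  rw [bin_pascal]; ring

lemma logb_mono (hm : 0 < m) (h : m ≤ n) : logb 2 m ≤ logb 2 n :=
  Real.logb_le_logb_of_le (by norm_num) (by exact_mod_cast hm) (by exact_mod_cast h)

lemma logb_half (hm : 0 < m) (h : 2 * m ≤ n) : logb 2 m ≤ logb 2 n - 1 := by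
  have h1 : logb 2 ((2 * m : ℕ) : ℝ) ≤ logb 2 n := logb_mono ω h
  push_cast at h1
  rw [Real.logb_mul (by norm_num) (by positivity), Real.logb_self_eq_one (by norm_num)] at h1
  linarith

lemma logb_nonneg (m : ℕ) : 0 ≤ logb 2 m := by
  rcases Nat.eq_zero_or_pos m with rfl | h
  · simp
  · exact Real.logb_nonneg (by norm_num) (by exact_mod_cast h)

lemma Split.light_card (h : Split L q S terms c H G) : ∀ g ∈ G, 0 < g.2.card ∧ 2 * g.2.card ≤
    S.card := by
  intro g hg
  have h1 := h.card_le g hg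
  have h2 : g.2 ≤ lights G := by
    refine List.single_le_sum (fun x _ => zero_le) _ (mem_map.2 ⟨g, hg, rfl⟩)
  have h3 := card_le_card h2
  have h4 := congrArg card h.sum
  simp only [card_add] at h4
  exact ⟨card_pos.2 (h.light_ne g hg).2, ω⟩

lemma Split.kid_card (h : Split L q S terms c H G) (hF : (s, F) ∈ kidSpecs k c H G) : 0 < F.card ∧
    F.card ≤ S.card := by
  have h4 := congrArg card h.sum
  simp only [card_add] at h4
  have h5 := card_bump_le (k := k) (lights G)
  rcases mem_kidSpecs.1 hF with hG | ⟨-, rfl, hne⟩ | ⟨-, rfl, hH⟩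
  · have := h.light_card _ hG; simp only at this; omega
  · exact ⟨card_pos.2 hne, ω⟩
  · have := card_pos.2 hH
    rw [card_add]; omega

lemma fst_inj (hnd : (S.map Prod.fst).Nodup) {e e' : ℕ} (h : (i, e) ∈ S) (h' : (i, e') ∈ S) :
    e = e' := congrArg Prod.snd (Multiset.inj_on_of_nodup_map hnd _ h _ h' rfl)

lemma bump_fst_le (T : Φ) : (bump k T).map Prod.fst ≤ T.map Prod.fst := by
  rw [bump, Multiset.map_map]
  exact map_le_map (filter_le _ _)

lemma Split.kid_nodup (h : Split L q S terms c H G) (hnd : (S.map Prod.fst).Nodup) (hF : (s, F) ∈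
    kidSpecs k c H G) : (F.map Prod.fst).Nodup := by
  refine Multiset.nodup_of_le ?_ hnd
  have hb := bump_fst_le (k := k) (lights G)
  have hlS : H + lights G ≤ S := by rw [h.sum, add_assoc]; exact Multiset.le_add_left _ _
  have hl2 : lights G ≤ S := (Multiset.le_add_left _ _).trans hlS
  rcases mem_kidSpecs.1 hF with hG | ⟨-, rfl, hne⟩ | ⟨-, rfl, hH⟩
  · have h2 : F ≤ lights G := List.single_le_sum (fun x _ => zero_le) _ (mem_map.2 ⟨_, hG, rfl⟩)
    exact map_le_map (h2.trans hl2)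
  · exact hb.trans (map_le_map hl2)
  · rw [Multiset.map_add]
    exact (add_le_add le_rfl hb).trans (Multiset.map_add Prod.fst H (lights G) ▸ map_le_map hlS)

open Classical in
lemma Built.count (h : Built L k M P0 P S par a Q N) (hv : ∀ x ∈ S, Val L k P x) (hnd : (S.map
    Prod.fst).Nodup)  : ∀ {e : ℕ}, (i, e) ∈ S → ∀ b : ℕ, ∃ T : Finset (List (Option α)), (∀ e' R, e'
    ≤ e + b → Out N i e' R → R ∈ T) ∧ (T.card : ℝ) ≤ 2 ^ b * bin b (logb 2 S.card) := by
  induction h with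
  | node w terms c H G kids ha hw split hk hbr hrec hkids ih =>
    rename_i P0 P S par a
    intro e hi b
    have hv' : ∀ x ∈ S, Val L k (P ++ emb w) x := fun x hx => (hv x hx).append (hw x hx)
    have hlen : (P ++ emb w).length = P.length + w.length := ✓
    have split' := hlen ▸ split
    have hksyms := split.kids_nodup hk
    -- the strings that come from the subtree with a given symbol
    have hsub : ∀ (s : Option α) (e0 b : ℕ) (n : ℕ), (∀ F, (s, F) ∈ kidSpecs k c H G → (∀ e', (i,
      e') ∈ F → e' = e0) ∧ F.card ≤ n) → ∃ T : Finset (List (Option α)), (∀ K ∈ kids, K.sym = s → ∀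
      e' R, e' ≤ e0 + b → Out K.recs i e' R → R ∈ T) ∧ (T.card : ℝ) ≤ 2 ^ b * bin b (logb 2 n) := by
      intro s e0 b n hs
      by_cases hK : ∃ K ∈ kids, K.sym = s ∧ ∃ e', (i, e') ∈ K.fam
      · obtain ⟨K, hK, rfl, e', he'⟩ := hK
        have hsp := kid_spec_mem hk hK
        obtain ⟨h1, h2⟩ := hs _ hsp
        obtain rfl := h1 e' he'
        obtain ⟨T, hT, hc⟩ := ih K hK (split'.kid_val hv' hsp) (split.kid_nodup hnd hsp) he' b
        refine ⟨T, ?_, hc.trans ?_⟩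
        · intro K' hK' hs'
          rw [kids_eq_of_sym hksyms hK' hK hs']; exact hT
        · exact mul_le_mul_of_nonneg_left (bin_mono b (logb_nonneg _)
            (logb_mono (split.kid_card hsp).1 h2)) (by positivity)
      · refine ⟨∅, ?_, ?_⟩
        · intro K hK' hs' e' R _ hout
          obtain ⟨-, -, -, -, e1, -, h1⟩ := (hkids K hK').out_spec
            (split'.kid_val hv' (kid_spec_mem hk hK')) hout
          exact absurd ⟨K, hK', hs', e1, h1⟩ hK
        · simp only [Finset.card_empty, Nat.cast_zero]
          exact mul_nonneg (by positivity) (zero_le_one.trans (one_le_bin b (logb_nonneg _)))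
    have hfst : ∀ {e'}, (i, e') ∈ S → e' = e := fun h' => fst_inj hnd h' hi
    have hout : ∀ {e' R}, Out (Nd! P w a terms kids) i e' R → (R = P ++ emb w ∧ (i, e') ∈ terms) ∨ ∃ K ∈ kids, Out K.recs i e' R
      := by
      rintro e' R ⟨r, rfl | hr, h1, h2⟩
      · exact .inl ⟨h1.symm, h2⟩
      · simp only [Set.mem_iUnion] at hr
        obtain ⟨K, hK, hr⟩ := hr
        exact .inr ⟨K, hK, r, hr, h1, h2⟩
    have horig : ∀ {K : Kid α}, K ∈ kids → ∀ {e' R}, Out K.recs i e' R → ∃ x e1, (i, e1) ∈ K.fam ∧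
      (str L i)[P.length + w.length]? = some x ∧ e1 = e + (if some x = K.sym then 0 else 1) ∧ e1 ≤
      e' := by
      intro K hK e' R hR
      obtain ⟨-, -, -, -, e1, h2, h1⟩ := (hkids K hK).out_spec (split'.kid_val hv' (kid_spec_mem hk
        hK)) hR
      obtain ⟨e0, x, h3, h4, h5, -⟩ := split.kid_origin (kid_spec_mem hk hK) h1
      obtain rfl := hfst h3
      exact ⟨x, e1, h1, h4, h5, h2⟩
    have hnotG : ∀ g ∈ G, g.1 ≠ c := fun g hg hc => split.not_mem (mem_map.2 ⟨g, hg, hc⟩)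
    rcases split.mem_iff.1 hi with ht | hH | ⟨g, hg, hxg⟩
    · refine ⟨{P ++ emb w}, ?_, ?_⟩
      · intro e' R _ hR
        rcases hout hR with ⟨h1, -⟩ | ⟨K, hK, hR⟩
        · simp [h1]
        · obtain ⟨x, -, -, h1, -⟩ := horig hK hR
          have := split.terms_len _ ht
          simp only at this
          rw [List.getElem?_eq_none ω] at h1; cases h1
      · have h1 := one_le_bin b (logb_nonneg S.card)
        have h2 : (1 : ℝ) ≤ 2 ^ b := one_le_pow₀ (by norm_num)
        simp only [Finset.card_singleton, Nat.cast_one]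
        nlinarith
    · have hne : H ≠ 0 := fun h => by simp [h] at hH
      have hsym := split.heavy_sym _ hH
      obtain ⟨T, hT, hc⟩ := hsub c e b S.card (fun F hF => by
        refine ⟨fun e' he' => ?_, (split.kid_card hF).2⟩
        obtain ⟨e0, x, h1, h2, h3, -⟩ := split.kid_origin hF he'
        rw [if_pos (h2.symm.trans hsym), hfst h1] at h3
        exact h3)
      refine ⟨T, ?_, hc⟩
      intro e' R he hR
      rcases hout hR with ⟨-, h1⟩ | ⟨K, hK, hR⟩
      · have h2 := split.terms_len _ h1
        simp only at h2 hsym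
        rw [List.getElem?_eq_none ω] at hsym
        exact absurd hsym.symm (split.heavy_ne hne)
      · refine hT K hK ?_ e' R he hR
        rcases mem_kidSpecs.1 (kid_spec_mem hk hK) with hG | ⟨hs, hF, -⟩ | ⟨hs, -, -⟩
        · obtain ⟨x, e1, h1, h2, -⟩ := horig hK hR
          exact absurd ((split.light_sym _ hG _ h1).symm.trans hsym) (hnotG _ hG)
        · obtain ⟨x, e1, h1, -⟩ := horig hK hR
          rw [hF] at h1
          obtain ⟨e0, h3, -, -⟩ := mem_bump.1 h1
          obtain ⟨g, hg, hx⟩ := mem_lights.1 h3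
          exact absurd ((split.light_sym _ hg _ hx).symm.trans hsym) (hnotG _ hg)
        · exact hs
    · have hsym : (str L i)[P.length + w.length]? = g.1 := split.light_sym g hg _ hxg
      obtain ⟨x, hx⟩ := Option.ne_none_iff_exists'.1 (split.light_ne g hg).1
      have hhalf := split.light_card g hg
      have hlog := logb_half hhalf.1 hhalf.2
      have hgsym : ∀ {F}, (g.1, F) ∈ kidSpecs k c H G → F = g.2 := by
        intro F hF
        rcases mem_kidSpecs.1 hF with hG | ⟨hs, -, -⟩ | ⟨hs, -, -⟩
        · exact congrArg Prod.snd (List.inj_on_of_nodup_map split.nodup hG hg rfl)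
        · exact absurd hs (split.light_ne g hg).1
        · exact absurd hs (hnotG g hg)
      obtain ⟨T, hT, hcT⟩ := hsub g.1 e b g.2.card (fun F hF => by
        obtain rfl := hgsym hF
        exact ⟨fun e' he' => hfst (split.mem_iff.2 (.inr (.inr ⟨g, hg, he'⟩))), le_rfl⟩)
      have hTb : (T.card : ℝ) ≤ 2 ^ b * bin b (logb 2 S.card - 1) :=
        hcT.trans (mul_le_mul_of_nonneg_left (bin_mono b (logb_nonneg _) hlog) (by positivity))
      have hother : ∀ s, s = none ∨ s = c → ∀ F, (s, F) ∈ kidSpecs k c H G → (∀ e', (i, e') ∈ F → e'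
        = e + 1) ∧ F.card ≤ S.card := by
        intro s hs F hF
        refine ⟨fun e' he' => ?_, (split.kid_card hF).2⟩
        obtain ⟨e0, y, h1, h2, h3, -⟩ := split.kid_origin hF he'
        rw [if_neg, hfst h1] at h3
        · exact h3
        · intro hy
          have : g.1 = s := hsym.symm.trans (h2.trans hy)
          rcases hs with rfl | rfl
          · exact (split.light_ne g hg).1 this
          · exact hnotG g hg this
      have hroot : ∀ {e'}, (i, e') ∉ terms := by
        intro e' h1
        have h2 := split.terms_len _ h1
        simp only at h2
        rw [List.getElem?_eq_none ω] at hsym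
        exact (split.light_ne g hg).1 hsym.symm
      have hsyms : ∀ K ∈ kids, ∀ {e' R}, Out K.recs i e' R → K.sym = g.1 ∨ ((K.sym = none ∨ K.sym =
        c) ∧ e + 1 ≤ e') := by
        intro K hK e' R hR
        obtain ⟨y, e1, h1, h2, h3, h4⟩ := horig hK hR
        by_cases hy : K.sym = g.1
        · exact .inl hy
        · right
          rw [if_neg (fun h => hy (h.symm.trans (h2.symm.trans hsym)))] at h3
          refine ⟨?_, ω⟩
          rcases mem_kidSpecs.1 (kid_spec_mem hk hK) with hG | ⟨hs, -, -⟩ | ⟨hs, -, -⟩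
          · exact absurd ((split.light_sym _ hG _ h1).symm.trans hsym) hy
          · exact .inl hs
          · exact .inr hs
      cases b with
      | zero =>
        refine ⟨T, ?_, hTb.trans ?_⟩
        · intro e' R he hR
          rcases hout hR with ⟨-, h1⟩ | ⟨K, hK, hR⟩
          · exact absurd h1 hroot
          · rcases hsyms K hK hR with h1 | ⟨-, h1⟩
            · exact hT K hK h1 e' R he hR
            · omega
        · simp [bin_zero]
      | succ b =>
        obtain ⟨T1, hT1, hc1⟩ := hsub none (e + 1) b S.card (hother none (.inl rfl))
        obtain ⟨T2, hT2, hc2⟩ := hsub c (e + 1) b S.card (hother c (.inr rfl))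
        refine ⟨T ∪ (T1 ∪ T2), ?_, ?_⟩
        · intro e' R he hR
          rcases hout hR with ⟨-, h1⟩ | ⟨K, hK, hR⟩
          · exact absurd h1 hroot
          · rw [Finset.mem_union, Finset.mem_union]
            rcases hsyms K hK hR with h1 | ⟨h1 | h1, -⟩
            · exact .inl (hT K hK h1 e' R he hR)
            · exact .inr (.inl (hT1 K hK h1 e' R ω hR))
            · exact .inr (.inr (hT2 K hK h1 e' R ω hR))
        · rw [two_pow_bin_pascal]
          have h1 : (T ∪ (T1 ∪ T2)).card ≤ T.card + (T1.card + T2.card) :=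
            (Finset.card_union_le _ _).trans (add_le_add le_rfl (Finset.card_union_le _ _))
          have h2 : ((T ∪ (T1 ∪ T2)).card : ℝ) ≤ T.card + (T1.card + T2.card) := by
            exact_mod_cast h1
          linarith

lemma Built.terms_nodup (h : Built L k M P0 P S par a Q N) (hnd : (S.map Prod.fst).Nodup) : ∀ r ∈ N,
    r.terms.Nodup := by
  induction h with
  | node w terms c H G kids ha hw split hk hbr hrec hkids ih =>
    rintro r (rfl | hr)
    · have h1 : (terms : Φ).Nodup := by
        refine Multiset.nodup_of_le ?_ hnd.of_map
        rw [split.sum, add_assoc]; exact Multiset.le_add_right _ _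
      exact Multiset.coe_nodup.1 h1
    · simp only [Set.mem_iUnion] at hr
      obtain ⟨K, hK, hr⟩ := hr
      exact ih K hK (split.kid_nodup hnd (kid_spec_mem hk hK)) r hr

/-- The members of the family consisting of all unmodified input strings. -/
def initFam (m : ℕ) : Φ := (Multiset.range m).map fun i => (i, 0)

lemma mem_initFam   : x ∈ initFam m ↔ x.1 < m ∧ x.2 = 0 := by
  simp only [initFam, Multiset.mem_map, Multiset.mem_range]
  constructor
  · rintro ⟨i, hi, rfl⟩; exact ⟨hi, rfl⟩
  · rintro ⟨h1, h2⟩; exact ⟨x.1, h1, by rw [← h2]⟩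

lemma initFam_nodup (m : ℕ) : ((initFam m).map Prod.fst).Nodup := by
  rw [initFam, Multiset.map_map]
  simpa [Function.comp_def] using Multiset.nodup_range m

theorem Built.solution {root : ℕ} {𝓕 : Finset (List α)} (hL : L.Nodup) (hLF : L.toFinset = 𝓕) (h :
    Built L k M [] [] (initFam L.length) 16 a Q N) (hroot : (Q = [] ∧ root = a) ∨ (Q ≠ [] ∧ root =
    16 ∧ RecAt L M [] [] 0 16 [] [a])) : ∃ N' : List α → Finset (List (Option α)), IsComplete 𝓕 k N'
    ∧ (∀ F ∈ 𝓕, ∀ F' ∈ N' F, F'.length = F.length) ∧ (∀ F ∈ 𝓕, ∀ d ≤ k, ((nearSet N' d F).card : ℝ)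
    ≤ 2 ^ d * Ring.choose (logb 2 𝓕.card + d) d) ∧ HoldsTrie 𝓕 L N' M root := by
  classical
  have hv : ∀ x ∈ initFam L.length, Val L k [] x := by
    intro x hx
    obtain ⟨h1, h2⟩ := mem_initFam.1 hx
    exact ⟨h1, ω, ✓, by simp [h2, dH]⟩
  have hnd := initFam_nodup L.length
  have hout : ∀ {i e R}, Out N i e R → _ := fun {i e R} hR => h.out_spec hv hR
  have hcard : (initFam L.length).card = 𝓕.card := by
    rw [← hLF, List.toFinset_card_of_nodup hL, initFam, card_map, Multiset.card_range]
  have hidx : ∀ {i j : ℕ} {F : List α}, L[i]? = some F → L[j]? = some F → i = j := by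
    intro i j F hi hj
    obtain ⟨h1, h2⟩ := List.getElem?_eq_some_iff.1 hi
    obtain ⟨h3, h4⟩ := List.getElem?_eq_some_iff.1 hj
    exact (List.Nodup.getElem_inj_iff hL).1 (h2.trans h4.symm)
  have hstr : ∀ {i : ℕ} {F : List α}, L[i]? = some F → str L i = F ∧ i < L.length := by
    intro i F hi
    exact ⟨by rw [str, List.getD_eq_getElem?_getD, hi]; rfl, (List.getElem?_eq_some_iff.1 hi).1⟩
  have hmemF : ∀ {F}, F ∈ 𝓕 ↔ ∃ i : ℕ, L[i]? = some F := by
    intro F; rw [← hLF, List.mem_toFinset, List.mem_iff_getElem?]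
  let A : List α → Set (List (Option α)) := fun F => {R | ∃ (i e : ℕ), L[i]? = some F ∧ Out N i e R}
  have hcount : ∀ {i : ℕ} {F : List α}, L[i]? = some F → ∀ b, ∃ T : Finset (List (Option α)), (∀ e'
    R, e' ≤ b → Out N i e' R → R ∈ T) ∧ (T.card : ℝ) ≤ 2 ^ b * bin b (logb 2 𝓕.card) := by
    intro i F hi b
    have := h.count hv hnd (mem_initFam.2 ⟨(hstr hi).2, rfl⟩ : (i, 0) ∈ _) b
    simpa [hcard] using this
  have hfin : ∀ F, (A F).Finite := by
    intro F
    by_cases hF : ∃ i : ℕ, L[i]? = some F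
    · obtain ⟨i, hi⟩ := hF
      obtain ⟨T, hT, -⟩ := hcount hi k
      refine T.finite_toSet.subset ?_
      rintro R ⟨j, e, hj, hR⟩
      obtain rfl := hidx hi hj
      exact hT e R (hout hR).2.1 hR
    · refine Set.finite_empty.subset ?_
      rintro R ⟨j, e, hj, -⟩
      exact hF ⟨j, hj⟩
  let N' : List α → Finset (List (Option α)) := fun F => (hfin F).toFinset
  have hN' : ∀ {F R}, R ∈ N' F ↔ ∃ (i e : ℕ), L[i]? = some F ∧ Out N i e R := by
    intro F R; exact (hfin F).mem_toFinset
  obtain ⟨hflat, hnodes⟩ := h.flat_and_nodesOf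
  have hun : unionFam 𝓕 N' = outS N := by
    ext R
    constructor
    · rintro ⟨F, -, hR⟩
      obtain ⟨i, e, -, r, hr, h1, h2⟩ := hN'.1 hR
      exact ⟨r, hr, h1, List.ne_nil_of_mem h2⟩
    · rintro ⟨r, hr, h1, h2⟩
      obtain ⟨x, hx⟩ := List.exists_mem_of_ne_nil _ h2
      have hR : Out N x.1 x.2 R := ⟨r, hr, h1, hx⟩
      have hi := List.getElem?_eq_getElem (hout hR).1
      exact ⟨_, hmemF.2 ⟨_, hi⟩, hN'.2 ⟨_, _, hi, hR⟩⟩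
  have hterm : ∀ r ∈ N, r.terms.Nodup ∧ ∀ j e, (j, e) ∈ r.terms ↔ ∃ F, L[j]? = some F ∧ r.path ∈ N'
    F ∧ e = dH (emb F) r.path := by
    intro r hr
    refine ⟨h.terms_nodup hnd r hr, fun j e => ⟨fun hje => ?_, ?_⟩⟩
    · have hR : Out N j e r.path := ⟨r, hr, rfl, hje⟩
      obtain ⟨h1, -, -, h2, -⟩ := hout hR
      have hi := List.getElem?_eq_getElem h1
      refine ⟨_, hi, hN'.2 ⟨_, _, hi, hR⟩, ?_⟩
      rw [← h2, (hstr hi).1]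
    · rintro ⟨F, hF, hR, rfl⟩
      obtain ⟨i, e', hi, r', hr', h1, h2⟩ := hN'.1 hR
      obtain rfl := hidx hi hF
      obtain rfl := hflat.uniq r' hr' r hr h1
      have h3 := (hout ⟨r', hr', rfl, h2⟩).2.2.2.1
      rw [(hstr hi).1] at h3
      rw [h3]; exact h2
  refine ⟨N', ?_, ?_, ?_, ?_⟩
  · intro U hU V hV d hd
    obtain ⟨i, hi⟩ := hmemF.1 hU
    obtain ⟨j, hj⟩ := hmemF.1 hV
    obtain ⟨U', V', e, f, h1, h2, h3⟩ := h.pair (i := i) (j := j) hd (mem_initFam.2 ⟨(hstr hi).2,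
      rfl⟩) (mem_initFam.2 ⟨(hstr hj).2, rfl⟩) ✓ ✓ ✓ (fun t ht => by simp at ht)
    rw [(hstr hi).1, (hstr hj).1] at h3
    exact ⟨U', hN'.2 ⟨i, e, hi, h1⟩, V', hN'.2 ⟨j, f, hj, h2⟩, h3⟩
  · intro F hF F' hF'
    obtain ⟨i, e, hi, hR⟩ := hN'.1 hF'
    rw [(hout hR).2.2.1, (hstr hi).1]
  · intro F hF d hd
    obtain ⟨i, hi⟩ := hmemF.1 hF
    obtain ⟨T, hT, hc⟩ := hcount hi d
    refine le_trans ?_ hc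
    exact_mod_cast Finset.card_le_card fun R hR => by
      obtain ⟨h1, h2, h3⟩ := Finset.mem_filter.1 hR
      obtain ⟨j, e, hj, hR'⟩ := hN'.1 h1
      obtain rfl := hidx hi hj
      refine hT e R ?_ hR'
      rw [← (hout hR').2.2.2.1, (hstr hi).1]; exact h3
  · rcases hroot with ⟨rfl, rfl⟩ | ⟨hQ, rfl, hrec⟩
    · exact hflat.holdsTrie (fun R _ => hnodes R) (fun r hr => (h.addr_gt r hr).ne)
        h.root_mem hun hterm
    · obtain ⟨h1, h2⟩ := hflat.wrap hQ h.path_prefix.2 h.root_mem hrec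
      refine h1.holdsTrie ?_ ?_ ⟨_, .inl rfl, rfl, rfl⟩ (hun.trans h2.symm) ?_
      · intro R hR
        have := hnodes R
        unfold NodesOf at this ⊢
        rw [h2, ← this]
        constructor
        · rintro ⟨r, rfl | hr, h3⟩
          · exact absurd h3.symm hR
          · exact ⟨r, hr, h3⟩
        · rintro ⟨r, hr, h3⟩; exact ⟨r, .inr hr, h3⟩
      · rintro r (rfl | hr)
        · simp
        · exact ((by norm_num : 0 < 16).trans (h.addr_gt r hr)).ne
      · rintro r (rfl | hr)
        · refine ⟨List.nodup_nil, fun j e => ⟨fun h => by simp at h, ?_⟩⟩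
          rintro ⟨F, hF, hR, -⟩
          obtain ⟨i, e', hi, r', hr', h3, -⟩ := hN'.1 hR
          have := h.path_prefix.2 r' hr'
          rw [h3] at this
          exact absurd (List.prefix_nil.1 this) hQ
        · exact hterm r hr

end Strings

/-- A state is a function of the registers. -/
instance : CoeFun State fun _ => ℕ → ℕ := ⟨State.reg⟩

/-! ### Reasoning about programs -/

variable {α : Type*} [LinearOrder α] (W : ℕ) (L : List (List α))

/-- The program `p`, started in the state `s` at time `t`, terminates in a state and at a time
satisfying `Q`. -/
def wp (p : Prog) (s : State) (t : ℕ) (Q : State → ℕ → Prop) : Prop :=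
  ∃ s' t', Exec W L p s s' t' ∧ Q s' (t + t')

variable {x y a b v i j B : ℕ} {o l vs : List ℕ} {p q : Prog} {M : ℕ → ℕ}
variable {W L} {s : State} {t : ℕ} {Q : State → ℕ → Prop}

lemma wp_const {c : ℕ} : wp W L (.const x c) s t Q ↔ c < W ∧ Q (s.setReg x c) (t + 1) := by
  constructor
  · rintro ⟨s', t', h, hQ⟩; cases h with | const h => exact ⟨h, hQ⟩
  · rintro ⟨h, hQ⟩; exact ⟨_, _, .const h, hQ⟩

lemma wp_arith {o : Op} {z : ℕ} : wp W L (.arith o x y z) s t Q ↔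
    o.eval (s y) (s z) < W ∧ Q (s.setReg x (o.eval (s y) (s z))) (t + 1) := by
  constructor
  · rintro ⟨s', t', h, hQ⟩; cases h with | arith h => exact ⟨h, hQ⟩
  · rintro ⟨h, hQ⟩; exact ⟨_, _, .arith h, hQ⟩

lemma wp_load  : wp W L (.load x y) s t Q ↔ Q (s.setReg x (s.mem (s y))) (t + 1) := by
  constructor
  · rintro ⟨s', t', h, hQ⟩; cases h with | load => exact hQ
  · intro hQ; exact ⟨_, _, .load, hQ⟩

lemma wp_store  : wp W L (.store x y) s t Q ↔ Q (s.setMem (s x) (s y)) (t + 1) := by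
  constructor
  · rintro ⟨s', t', h, hQ⟩; cases h with | store => exact hQ
  · intro hQ; exact ⟨_, _, .store, hQ⟩

lemma wp_lcp  : wp W L (.lcp x i a j a) s t Q ↔ lc L (s a) (s i) (s j) < W ∧ Q (s.setReg x (lc L (s
    a) (s i) (s j))) (t + 1) := by
  constructor
  · rintro ⟨s', t', h, hQ⟩
    cases h with | lcp h h' => rw [LCP_suffixOf] at h; subst h; exact ⟨h', hQ⟩
  · rintro ⟨h, hQ⟩
    exact ⟨_, _, .lcp (LCP_suffixOf L _ _ _).symm h, hQ⟩

lemma wp_less  : wp W L (.less x i a j b) s t Q ↔ lessQuery L (s i) (s a) (s j) (s b) < W ∧ Q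
    (s.setReg x (lessQuery L (s i) (s a) (s j) (s b))) (t + 1) := by
  constructor
  · rintro ⟨s', t', h, hQ⟩
    cases h with | less h h' => subst h; exact ⟨h', hQ⟩
  · rintro ⟨h, hQ⟩
    exact ⟨_, _, .less rfl h, hQ⟩

lemma wp_seq  : wp W L (.seq p q) s t Q ↔ wp W L p s t fun s' t' => wp W L q s' t' Q := by
  constructor
  · rintro ⟨s', t', h, hQ⟩
    cases h with
    | seq h1 h2 => exact ⟨_, _, h1, _, _, h2, by rwa [Nat.add_assoc]⟩
  · rintro ⟨s1, t1, h1, s2, t2, h2, hQ⟩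
    exact ⟨_, _, .seq h1 h2, by rwa [← Nat.add_assoc]⟩

lemma wp_ite   : wp W L (.ite x y p q) s t Q ↔
    if s x ≤ s y then wp W L p s (t + 1) Q else wp W L q s (t + 1) Q := by
  constructor
  · rintro ⟨s', t', h, hQ⟩
    cases h with
    | iteTrue h h1 => rw [if_pos h]; exact ⟨_, _, h1, by convert hQ using 1; omega⟩
    | iteFalse h h1 => rw [if_neg ω]; exact ⟨_, _, h1, by convert hQ using 1; omega⟩
  · split_ifs with h
    · rintro ⟨s', t', h1, hQ⟩; exact ⟨_, _, .iteTrue h h1, by convert hQ using 1; omega⟩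
    · rintro ⟨s', t', h1, hQ⟩
      exact ⟨_, _, .iteFalse ω h1, by convert hQ using 1; omega⟩

lemma wp_loop   : wp W L (.loop x p) s t Q ↔ if s x = 0 then Q s (t + 1) else wp W L p s (t + 1)
    fun s' t' => wp W L (.loop x p) s' t' Q := by
  constructor
  · rintro ⟨s', t', h, hQ⟩
    cases h with
    | loopDone h => rwa [if_pos h]
    | loopStep h h1 h2 =>
      rw [if_neg h]
      exact ⟨_, _, h1, _, _, h2, by convert hQ using 1; omega⟩
  · split_ifs with h
    · intro hQ; exact ⟨_, _, .loopDone h, hQ⟩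
    · rintro ⟨s1, t1, h1, s2, t2, h2, hQ⟩
      exact ⟨_, _, .loopStep h h1 h2, by convert hQ using 1; omega⟩

lemma wp_mono {Q' : State → ℕ → Prop} (h : wp W L p s t Q)
    (hQ : ∀ s' t', Q s' t' → Q' s' t') : wp W L p s t Q' := by
  obtain ⟨s', t', h1, h2⟩ := h; exact ⟨s', t', h1, hQ _ _ h2⟩

lemma Exec.mono {W' : ℕ} (hW : W ≤ W') {s s' : State} {t : ℕ}
    (h : Exec W L p s s' t) : Exec W' L p s s' t := by
  induction h with
  | const h => exact .const (h.trans_le hW)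
  | arith h => exact .arith (h.trans_le hW)
  | load => exact .load
  | store => exact .store
  | lcp h h' => exact .lcp h (h'.trans_le hW)
  | less h h' => exact .less h (h'.trans_le hW)
  | seq _ _ h1 h2 => exact .seq h1 h2
  | iteTrue h _ h1 => exact .iteTrue h h1
  | iteFalse h _ h1 => exact .iteFalse h h1
  | loopDone h => exact .loopDone h
  | loopStep h _ _ h1 h2 => exact .loopStep h h1 h2

@[simp] lemma reg_setReg (s : State) (x v y : ℕ) :
    (s.setReg x v).reg y = if y = x then v else s y := by
  simp [State.setReg, Function.update_apply]

@[simp] lemma mem_setReg (s : State) (x v : ℕ) : (s.setReg x v).mem = s.mem := rfl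

lemma ifs : (∀ (s : State) (x v y : ℕ), (s.setReg x v).reg y = if y = x then v else s y) ∧
    (∀ (s : State) (x v : ℕ), (s.setReg x v).mem = s.mem) ∧
    (∀ {β : Type} {_ : Decidable True} (a b : β), (if True then a else b) = a) ∧
    ∀ {β : Type} {_ : Decidable False} (a b : β), (if False then a else b) = b :=
  ⟨reg_setReg, mem_setReg, fun _ _ => if_pos trivial, fun _ _ => if_neg id⟩

@[simp] lemma reg_setMem (s : State) (a v : ℕ) : (s.setMem a v).reg = s.reg := rfl

@[simp] lemma mem_setMem (s : State) (a v b : ℕ) :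
    (s.setMem a v).mem b = if b = a then v else s.mem b := by
  simp [State.setMem, Function.update_apply]

@[simp] lemma eval_add (a b : ℕ) : Op.add.eval a b = a + b := rfl
@[simp] lemma eval_sub (a b : ℕ) : Op.sub.eval a b = a - b := rfl
@[simp] lemma eval_div (a b : ℕ) : Op.div.eval a b = a / b := rfl
@[simp] lemma eval_mod (a b : ℕ) : Op.mod.eval a b = a % b := rfl

/-! ### Registers and basic programs

Register `1` holds `k`; registers `2`, `3`, `33`, `34` hold the constants `0`, `1`, `2`, `16`;
register `4` points to the free memory.  Registers from `67` on are temporary. -/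

/-- `p; q; …` -/
infixr:60 ";;" => Prog.seq

namespace Prog

/-- `x := y` -/
def copy (x y : ℕ) : Prog := arith .add x y 2

/-- No effect except on a temporary register. -/
def skip : Prog := const 67 0

/-- `x := mem[y + c]` -/
def get (x y c : ℕ) : Prog := const 67 c ;; arith .add 67 y 67 ;; load x 67

/-- Store the registers `vs` at the address in register `67` and behind it. -/
def stores : List ℕ → Prog
  | [] => skip
  | v :: vs => store 67 v ;; arith .add 67 67 3 ;; stores vs

/-- Let `x` point to a new cell in a fresh block, with the contents of the registers `vs`. -/
def alloc (x : ℕ) (vs : List ℕ) : Prog :=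
  const 67 8 ;; arith .add 67 4 67 ;; copy 68 67 ;; stores vs ;; copy x 68 ;; arith .add 4 4 34

end Prog

/-- The memory `M` with the values `l` stored from the address `a` on. -/
def putList (M : ℕ → ℕ) (a : ℕ) (l : List ℕ) : ℕ → ℕ :=
  fun b => if a ≤ b ∧ b < a + l.length then l.getD (b - a) 0 else M b

/-- The state after `Prog.alloc x vs`. -/
def State.alloc (s : State) (x : ℕ) (vs : List ℕ) : State where
  reg := fun y => if y = 4 then s 4 + 16 else if y = x then s 4 + 8
    else if y = 68 then s 4 + 8 else if y = 67 then 0 else s y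
  mem := putList s.mem (s 4 + 8) (vs.map s.reg)

/-- The registers with constants. -/
structure Consts (k : ℕ) (s : State) : Prop where
  c1 : s 1 = k
  c2 : s 2 = 0
  c3 : s 3 = 1
  c33 : s 33 = 2
  c34 : s 34 = 16

lemma putList_of_lt (h : b < a) : putList M a l b = M b := by
  rw [putList, if_neg ω]

lemma putList_zero    : putList M a (v :: l) a = v := by
  simp [putList]

lemma putList_add (h : i < l.length) : putList M a l (a + i) = l.getD i 0 := by
  rw [putList, if_pos ω]; congr 1; omega

@[simp] lemma reg_alloc (s : State) (x : ℕ) (vs : List ℕ) (y : ℕ) :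
    (s.alloc x vs).reg y = if y = 4 then s 4 + 16 else if y = x then s 4 + 8
    else if y = 68 then s 4 + 8 else if y = 67 then 0 else s y := rfl

@[simp] lemma mem_alloc (s : State) (x : ℕ) (vs : List ℕ) :
    (s.alloc x vs).mem = putList s.mem (s 4 + 8) (vs.map s.reg) := rfl

lemma wp_stores (vs : List ℕ) : ∀ {s : State} {t : ℕ}, s 3 = 1 → s 67 + vs.length < W → (∀ v ∈ vs, v
    < 67) → Q ⟨fun y => if y = 67 then 0 else s y, putList s.mem (s 67) (vs.map s.reg)⟩ (t + 2 *
    vs.length + 1) → wp W L (Prog.stores vs) s t Q := by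
  induction vs with
  | nil =>
    intro s t h3 hW hv hQ
    rw [Prog.stores, Prog.skip, wp_const]
    refine ⟨ω, ?_⟩
    convert hQ using 1
    · rw [State.setReg]
      congr 1
      · ext y; simp [Function.update_apply]
      · ext b; simp [putList]
    · simp
  | cons v vs ih =>
    intro s t h3 hW hv hQ
    simp only [length_cons] at hW
    simp only [Prog.stores, wp_seq, wp_store, wp_arith, reg_setMem, eval_add, h3]
    refine ⟨ω, ih (by simp [h3]) ✦ (fun u hu => hv u (mem_cons_of_mem _ hu)) ?_⟩
    convert hQ using 1
    · congr 1
      · ext y; simp; split_ifs <;> simp_all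
      · have hmap : vs.map (((s.setMem (s 67) (s v)).setReg 67 (s 67 + 1)).reg) = vs.map s.reg := by
          refine List.map_congr_left fun u hu => ?_
          have := hv u (mem_cons_of_mem _ hu)
          simp; omega
        rw [hmap]
        ext b
        simp only [putList, reg_setReg, if_true, mem_setReg, mem_setMem, length_map,
          map_cons, length_cons]
        rcases lt_trichotomy b (s 67) with hb | hb | hb
        · rw [if_neg ω, if_neg ω, if_neg ω]
        · subst hb; simp
        · by_cases hb2 : b < s 67 + (vs.length + 1)
          · rw [if_pos ω, if_pos ω,
              show b - s 67 = (b - (s 67 + 1)) + 1 by omega, List.getD_cons_succ]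
          · rw [if_neg ω, if_neg ω, if_neg ω]
    · simp; omega

lemma wp_alloc {k : ℕ} (hc : Consts k s) (hx : x < 67 ∧ 4 < x ∧ x ≠ 34)
    (hvs : ∀ v ∈ vs, v < 67) (hl : vs.length ≤ 8) (hW : s 4 + 17 ≤ W)
    (hQ : Q (s.alloc x vs) (t + 2 * vs.length + 6)) : wp W L (Prog.alloc x vs) s t Q := by
  obtain ⟨hx1, hx2, hx3⟩ := hx
  have h3 := hc.c3
  have h2 := hc.c2
  have h34 := hc.c34
  simp only [Prog.alloc, Prog.copy, wp_seq, wp_const, wp_arith, reg_setReg, eval_add]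
  simp only [if_true, reduceEqDiff, if_false, h2, Nat.add_zero]
  refine ⟨ω, ω, ω, ?_⟩
  refine wp_stores vs (by simpa using h3) ✦ hvs ?_
  simp only [reg_setReg, reduceEqDiff, if_true, if_false, h2, Nat.add_zero, if_neg hx3.symm,
    h34, if_neg (show 4 ≠ x by omega)]
  refine ⟨ω, ω, ?_⟩
  convert hQ using 1
  · simp only [State.alloc, State.setReg]
    congr 1
    · ext y
      simp only [Function.update_apply]
      by_cases h4 : y = 4
      · simp [h4]
      · by_cases hyx : y = x
        · simp [hyx]
        · by_cases h67 : y = 67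
          · subst h67; simp [hyx]
          · simp [h4, hyx, h67]
    · congr 1
      refine List.map_congr_left fun u hu => ?_
      have := hvs u hu
      simp [show u ≠ 67 by omega, show u ≠ 68 by omega]
  · omega

/-! ### Frames, and the comparison of events -/

variable {k T : ℕ} {s' s'' : State} {t' t'' : ℕ}
variable {x v i B : ℕ} {o vs : List ℕ}

/-- Words are large enough for the time `T`, for the input strings, and for the number `k`. -/
class Wide (W : ℕ) (L : List (List α)) (k T : outParam ℕ) : Prop where
  time : 16 * T + 128 ≤ W
  len : ∀ i, 2 * (str L i).length + 4 ≤ W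
  budget : k + 2 ≤ W

/-- The registers with constants are intact, and so is the pointer to the free memory. -/
structure Ok (k : ℕ) (s : State) (t : ℕ) : Prop extends Consts k s where
  fp_mod : s 4 % 16 = 0
  fp_pos : 32 ≤ s 4
  fp_le : s 4 ≤ 48 + 16 * t

/-- Up to the register `B`, only the registers `o` change, and the memory does not change. -/
structure Calm (B : ℕ) (o : List ℕ) (s : State) (t : ℕ) (s' : State) (t' : ℕ) : Prop where
  regs : ∀ r (_ : r < B := by omega) (_ : r ∉ o := by simp), s' r = s r
  mem : s'.mem = s.mem
  time : t ≤ t'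

/-- Up to the register `B`, only the registers `o` and the pointer to the free memory change, and
only free memory is written to. -/
structure Step (k B : ℕ) (o : List ℕ) (s : State) (t : ℕ) (s' : State) (t' : ℕ) : Prop where
  regs : ∀ r (_ : r < B := by omega) (_ : r ≠ 4 := by omega) (_ : r ∉ o := by simp), s' r = s r
  ok : Ok k s' t'
  mem : ∀ a < s 4, s'.mem a = s.mem a
  fp : s 4 ≤ s' 4
  time : t ≤ t'

lemma Calm.trans (h : Calm B o s t s' t') (h' : Calm B o s' t' s'' t'') : Calm B o s t s'' t'' :=
  ⟨fun r hr ho => (h'.regs r hr ho).trans (h.regs r hr ho), h'.mem.trans h.mem,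
    h.time.trans h'.time⟩

lemma Calm.refl (h : t ≤ t' := by omega) : Calm B o s t s t' := ⟨fun _ _ _ => rfl, rfl, h⟩

lemma Calm.mono {B' : ℕ} {o' : List ℕ} (h : Calm B o s t s' t') (hB : B' ≤ B := by omega)
    (ho : ∀ r ∈ o, r < B' → r ∈ o' := by simp) : Calm B' o' s t s' t' :=
  ⟨fun r hr hn => h.regs r (hr.trans_le hB) fun h' => hn (ho r h' hr), h.mem, h.time⟩

lemma Calm.setReg (h : Calm B o s t s' t') (hx : x < B → x ∈ o := by simp)
    (ht : t' ≤ t'' := by omega) : Calm B o s t (s'.setReg x v) t'' :=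
  ⟨fun r hr ho => by
    rw [reg_setReg, if_neg (by rintro rfl; exact ho (hx hr))]; exact h.regs r hr ho,
    h.mem, h.time.trans ht⟩

lemma Ok.calm (h : Ok k s t) (hc : Calm B o s t s' t')
    (hB : 34 < B := by omega) (ho : ∀ r ∈ o, 4 < r ∧ r ≠ 33 ∧ r ≠ 34 := by simp) : Ok k s' t' := by
  have e : ∀ r, r = 1 ∨ r = 2 ∨ r = 3 ∨ r = 4 ∨ r = 33 ∨ r = 34 → s' r = s r :=
    fun r hr => hc.regs r ω fun hr' => by have := ho r hr'; omega
  have ht := hc.time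
  have hf := h.fp_le
  refine ⟨⟨?_, ?_, ?_, ?_, ?_⟩, ?_, ?_, ?_⟩
  · rw [e 1 ω]; exact h.c1
  · rw [e 2 ω]; exact h.c2
  · rw [e 3 ω]; exact h.c3
  · rw [e 33 ω]; exact h.c33
  · rw [e 34 ω]; exact h.c34
  · rw [e 4 ω]; exact h.fp_mod
  · rw [e 4 ω]; exact h.fp_pos
  · rw [e 4 ω]; omega

lemma Calm.step (hc : Calm B o s t s' t') (h : Ok k s t)
    (hB : 34 < B := by omega) (ho : ∀ r ∈ o, 4 < r ∧ r ≠ 33 ∧ r ≠ 34 := by simp) : Step k B o s t s' t' :=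
  ⟨fun r hr _ ho => hc.regs r hr ho, h.calm hc hB ho, fun a _ => by rw [hc.mem],
    (hc.regs 4 ω fun h' => by have := ho 4 h'; omega).ge, hc.time⟩

lemma Step.refl (h : Ok k s t) : Step k B o s t s t :=
  ⟨fun _ _ _ _ => rfl, h, fun _ _ => rfl, le_rfl, le_rfl⟩

lemma Step.trans (h : Step k B o s t s' t') (h' : Step k B o s' t' s'' t'') :
    Step k B o s t s'' t'' :=
  ⟨fun r hr h4 ho => (h'.regs r hr h4 ho).trans (h.regs r hr h4 ho), h'.ok, fun a ha => (h'.mem a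
    (ha.trans_le h.fp)).trans (h.mem a ha), h.fp.trans h'.fp, h.time.trans h'.time⟩

lemma Step.mono {B' : ℕ} {o' : List ℕ} (h : Step k B o s t s' t') (hB : B' ≤ B := by omega)
    (ho : ∀ r ∈ o, r < B' → r ∈ o' := by simp) : Step k B' o' s t s' t' :=
  ⟨fun r hr h4 hn => h.regs r (hr.trans_le hB) h4 fun h' => hn (ho r h' hr), h.ok, h.mem, h.fp,
    h.time⟩

lemma Ok.later (h : Ok k s t) (ht : t ≤ t' := by omega) : Ok k s t' :=
  ⟨h.toConsts, h.fp_mod, h.fp_pos, by have := h.fp_le; omega⟩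

lemma Ok.next (h : Ok k s t) : Ok k s (t + 1) := h.later

lemma Step.later (h : Step k B o s t s' t') (ht : t' ≤ t'' := by omega) :
    Step k B o s t s' t'' :=
  ⟨@h.regs, h.ok.later ht, h.mem, h.fp, h.time.trans ht⟩

lemma Step.next (h : Step k B o s t s' t') : Step k B o s t s' (t' + 1) := h.later

lemma Ok.setReg (h : Ok k s t) (hx : x = 0 ∨ 4 < x ∧ x ≠ 33 ∧ x ≠ 34 := by omega)
    (ht : t ≤ t' := by omega) :
    Ok k (s.setReg x v) t' := by
  obtain ⟨⟨h1, h2, h3, h4, h5⟩, h6, h7, h8⟩ := h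
  refine ⟨⟨?_, ?_, ?_, ?_, ?_⟩, ?_, ?_, ?_⟩ <;> rw [reg_setReg, if_neg ω] <;>
    first | assumption | omega

lemma Step.setReg (h : Step k B o s t s' t')
    (hx : x < B → x ∈ o := by simp) (hx' : 4 < x ∧ x ≠ 33 ∧ x ≠ 34 := by omega)
    (ht : t' ≤ t'' := by omega) :
    Step k B o s t (s'.setReg x v) t'' :=
  ⟨fun r hr h4 ho => by
    rw [reg_setReg, if_neg (by rintro rfl; exact ho (hx hr))]; exact h.regs r hr h4 ho,
    h.ok.setReg (.inr hx') ht, h.mem, by rw [reg_setReg, if_neg ω]; exact h.fp,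
    h.time.trans ht⟩

lemma Ok.alloc (h : Ok k s t) (hx : x < 67 ∧ 4 < x ∧ x ≠ 33 ∧ x ≠ 34)
    (ht : t + 1 ≤ t') : Ok k (s.alloc x vs) t' := by
  obtain ⟨⟨h1, h2, h3, h4, h5⟩, h6, h7, h8⟩ := h
  have e : ∀ r < 67, r ≠ 4 → r ≠ x → (s.alloc x vs).reg r = s r := fun r h0 h1 h2 => by
    rw [reg_alloc, if_neg h1, if_neg h2, if_neg ω, if_neg ω]
  refine ⟨⟨?_, ?_, ?_, ?_, ?_⟩, ?_, ?_, ?_⟩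
  iterate 5 rw [e _ (by norm_num) (by norm_num) ω]; assumption
  all_goals (rw [reg_alloc, if_pos rfl]; omega)

lemma Step.alloc (h : Step k B o s t s' t')
    (hB : B ≤ 67 := by omega) (hx : x < B → x ∈ o := by simp)
    (hx' : x < 67 ∧ 4 < x ∧ x ≠ 33 ∧ x ≠ 34 := by omega) (ht : t' + 1 ≤ t'' := by omega) :
    Step k B o s t (s'.alloc x vs) t'' :=
  ⟨fun r hr h4 ho => by
    rw [reg_alloc, if_neg h4, if_neg (by rintro rfl; exact ho (hx hr)), if_neg ω,
      if_neg ω]; exact h.regs r hr h4 ho,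
    h.ok.alloc hx' ht, fun a ha => by
      rw [mem_alloc, putList_of_lt (by have := h.fp; omega)]; exact h.mem a ha, by
      rw [reg_alloc, if_pos rfl]; have := h.fp; omega, by have := h.time; omega⟩

lemma Wide.alloc_le (hw : Wide W L k T) (ok : Ok k s t) (ht : t ≤ T) : s 4 + 32 ≤ W := by
  have := hw.time; have := ok.fp_le; omega

lemma Wide.lc_lt (hw : Wide W L k T) (p i j : ℕ) : lc L p i j < W := by
  have := lc_le_left L p i j; have := hw.len i; omega

lemma Wide.less_lt (hw : Wide W L k T) (i a j b : ℕ) : lessQuery L i a j b < W := by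
  have := lessQuery_le_one L i a j b; have := hw.budget; omega

lemma setReg_setReg (s : State) (x v v' : ℕ) : (s.setReg x v).setReg x v' = s.setReg x v' := by
  simp [State.setReg]

namespace Prog

/-- `x ≠ 0` iff the string `F` is smaller than the string `G` at the position `pos` of a mismatch. -/
def cmpLess (x F G pos : ℕ) : Prog :=
  lcp x F pos F pos ;; ite x 2 (lcp x G pos G pos) (less x F pos G pos)

/-- Register `58` := the key of the string in register `57`. -/
def key : Prog :=
  lcp 58 57 9 14 9 ;; arith .add 58 58 9 ;; cmpLess 63 57 14 58 ;; arith .add 58 58 58 ;;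
    ite 63 2 (arith .add 58 58 3) skip

/-- Register `65` := `0` or `1`, according to which of the entries at the addresses in the
registers `55` and `56` comes first. -/
def better : Prog :=
  ite 55 2 (const 65 1) (ite 56 2 (const 65 0) (load 57 55 ;; key ;; copy 59 58 ;; load 57 56 ;; key
    ;; ite 59 58 (ite 58 59 (load 61 55 ;; load 62 56 ;; arith .div 60 59 33 ;; lcp 63 61 60 62 60
    ;; arith .add 60 60 63 ;; arith .mod 64 59 33 ;; ite 64 2 (cmpLess 63 62 61 60) (cmpLess 63 61
    62 60) ;; ite 63 2 (const 65 0) (const 65 1)) (const 65 0)) (const 65 1)))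

end Prog

lemma wp_cmpLess [hw : Wide W L k T] (h2 : s 2 = 0) {F G pos : ℕ} (hx : x ≠ F ∧ x ≠ G ∧ x ≠ pos ∧ x
    ≠ 2) (h0 : lc L (s pos) (s F) (s G) = 0) (hQ : ∀ v, (v ≠ 0 ↔ (str L (s F)).drop (s pos) < (str L
    (s G)).drop (s pos)) → Q (s.setReg x v) (t + 3)) : wp W L (Prog.cmpLess x F G pos) s t Q := by
  obtain ⟨h3, h4, h5, h6⟩ := hx
  simp only [Prog.cmpLess, wp_seq, wp_lcp, wp_ite, ifs, if_neg h3.symm, if_neg h4.symm, if_neg h5.symm, if_neg h6.symm, h2, le_zero, wp_less, setReg_setReg]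
  refine ⟨hw.lc_lt _ _ _, ?_⟩
  have := suffix_lt_iff L _ _ _ h0
  split_ifs with h7
  · exact ⟨hw.lc_lt _ _ _, hQ _ (by rw [this, if_pos h7])⟩
  · exact ⟨hw.less_lt _ _ _ _, hQ _ (by rw [this, if_neg h7])⟩

lemma Wide.key_lt (hw : Wide W L k T) {r p : ℕ} (hp : p ≤ (str L r).length) :
    key L r p i + 1 < W := by
  have := lc_le_right L p i r; have := hw.len r
  unfold key; split_ifs <;> omega

lemma wp_key [hw : Wide W L k T] (hc : Consts k s) (hp : s 9 ≤ (str L (s 14)).length) (hQ : ∀ s' t',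
    Calm 58 [] s t s' t' → t' ≤ t + 8 → (∀ r, r ≠ 58 → r ≠ 63 → r ≠ 67 → s' r = s r) → s' 58 =
    KMismatch.key L (s 14) (s 9) (s 57) → Q s' t') : wp W L Prog.key s t Q := by
  have hk := hw.key_lt (i := s 57) hp
  have hkd := key_div L (s 14) (s 9) (s 57)
  simp only [Prog.key, wp_seq, wp_lcp, wp_arith, ifs, eval_add, reduceEqDiff, setReg_setReg]
  refine ⟨hw.lc_lt _ _ _, ω, ?_⟩
  refine wp_cmpLess (by simpa using hc.c2) (by norm_num) ?_ ?_
  · simp only [ifs, reduceEqDiff]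
    rw [Nat.add_comm, lc_add _ _ _ _ _ le_rfl]; omega
  · intro v hv
    simp only [ifs, reduceEqDiff] at hv
    rw [Nat.add_comm, drop_add_lt L le_rfl] at hv
    simp only [ifs, reduceEqDiff, wp_ite, wp_arith, eval_add, hc.c2, hc.c3, le_zero, Prog.skip, wp_const]
    have hkey : KMismatch.key L (s 14) (s 9) (s 57) = 2 * (s 9 + lc L (s 9) (s 57) (s 14)) + if v =
      0 then 1 else 0 := by
      rw [KMismatch.key]; congr 1
      by_cases h : v = 0
      · rw [if_pos h, if_neg (by rw [← hv]; simpa using h)]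
      · rw [if_neg h, if_pos (by rw [← hv]; simpa using h)]
    refine ⟨by split_ifs at hkey <;> omega, ?_⟩
    split_ifs at hkey ⊢ with h
    · refine ⟨ω, hQ _ _ ⟨?_, rfl, ω⟩ ω ?_ ?_⟩
      · intro r hr _; simp [show r ≠ 58 by omega, show r ≠ 63 by omega]
      · intro r h1 h2 h3; simp [h1, h2]
      · simp; omega
    · refine ⟨ω, hQ _ _ ⟨?_, rfl, ω⟩ ω ?_ ?_⟩
      · intro r hr _; simp [show r ≠ 58 by omega, show r ≠ 63 by omega, show r ≠ 67 by omega]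
      · intro r h1 h2 h3; simp [h1, h2, h3]
      · simp; omega

lemma wp_better [hw : Wide W L k T] (hc : Consts k s) (hp : s 9 ≤ (str L (s 14)).length) (hQ : ∀ s'
    t', Calm 57 [] s t s' t' → t' ≤ t + 50 → (s' 65 = 0 ∧ s 55 ≠ 0 ∧ (s 56 ≠ 0 → Bef L (s 14) (s 9)
    (s.mem (s 55)) (s.mem (s 56))) ∨ s' 65 = 1 ∧ (s 55 ≠ 0 → s 56 ≠ 0 ∧ Bef L (s 14) (s 9) (s.mem (s
    56)) (s.mem (s 55)))) → Q s' t') : wp W L Prog.better s t Q := by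
  have h1W : 1 < W := by have := hw.budget; omega
  simp only [Prog.better, wp_ite, hc.c2, le_zero, wp_const, wp_seq, wp_load]
  split_ifs with ha hb
  · exact ⟨h1W, hQ _ _ ((Calm.refl (Nat.le_add_right t 1)).setReg) ω
      (.inr ⟨✓, fun h => absurd ha h⟩)⟩
  · exact ⟨ω, hQ _ _ ((Calm.refl (Nat.le_add_right t 1)).setReg)
      ω (.inl ⟨✓, ha, fun h => absurd hb h⟩)⟩
  refine wp_key ?_ (by simpa using hp) ?_
  · obtain ⟨h1, h2, h3, h4, h5⟩ := hc; exact ⟨by simpa, by simpa, by simpa, by simpa, by simpa⟩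
  intro s1 t1 c1 ht1 f1 k1
  simp only [ifs, reduceEqDiff] at k1
  have e1 : ∀ r < 57, s1 r = s r := fun r hr => by rw [c1.regs r, reg_setReg, if_neg ω]
  have m1 : s1.mem = s.mem := c1.mem
  have hk1 := hw.key_lt (i := s.mem (s 55)) hp
  simp only [Prog.copy, wp_arith, eval_add, e1 2 ω, hc.c2, Nat.add_zero, ifs, reduceEqDiff, m1, e1 56 ω, k1]
  refine ⟨ω, ?_⟩
  refine wp_key ?_ (by simpa [e1 9, e1 14] using hp) ?_
  · obtain ⟨h1, h2, h3, h4, h5⟩ := hc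
    exact ⟨by simpa [e1 1], by simpa [e1 2], by simpa [e1 3], by simpa [e1 33], by simpa [e1 34]⟩
  intro s2 t2 c2 ht2 f2 k2
  simp only [ifs, reduceEqDiff, e1 14 ω, e1 9 ω] at k2
  have e2 : ∀ r < 57, s2 r = s r := fun r hr => by
    rw [c2.regs r, reg_setReg, if_neg ω, reg_setReg, if_neg ω, e1 r hr]
  have m2 : s2.mem = s.mem := c2.mem.trans m1
  have k1' : s2 59 = KMismatch.key L (s 14) (s 9) (s.mem (s 55)) := by rw [f2 59 ω ω ω]; simp
  have hC : Calm 57 [] s t s2 t2 := ⟨fun r hr _ => e2 r hr, m2, by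
    have := c1.time; have := c2.time; omega⟩
  have d1 := key_div L (s 14) (s 9) (s.mem (s 55))
  have d2 := key_div L (s 14) (s 9) (s.mem (s 56))
  simp only [Bef] at hQ
  rw [k1', k2]
  generalize hka : KMismatch.key L (s 14) (s 9) (s.mem (s 55)) = ka at *
  generalize hkb : KMismatch.key L (s 14) (s 9) (s.mem (s 56)) = kb at *
  split_ifs with h1 h2
  · obtain rfl : ka = kb := ω
    have hlen := hw.len (s.mem (s 55))
    have l2 := lc_le_left L (ka / 2) (s.mem (s 55)) (s.mem (s 56))
    simp only [e2 55 ω, m2, wp_lcp, e2 56 ω, ifs, reduceEqDiff, eval_div, k1', e2 33 ω, hc.c33, eval_mod, e2 2 ω, hc.c2, le_zero]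
    have hlen' := hw.len (s 14)
    refine ⟨ω, hw.lc_lt _ _ _, ω, ω, ?_⟩
    generalize hs3 : State.setReg _ 64 (ka % 2) = s3
    have r55 : s3 61 = s.mem (s 55) := by rw [← hs3]; simp
    have r56 : s3 62 = s.mem (s 56) := by rw [← hs3]; simp
    have r60 : s3 60 = ka / 2 + lc L (ka / 2) (s.mem (s 55)) (s.mem (s 56)) := by rw [← hs3]; simp
    have r2 : s3 2 = 0 := by rw [← hs3]; simp [e2 2, hc.c2]
    have c3 : Calm 57 [] s t s3 t2 := by
      refine ⟨fun r hr _ => ?_, ?_, hC.time⟩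
      · rw [← hs3]
        simp [e2 r hr, show r ≠ 60 by omega, show r ≠ 61 by omega, show r ≠ 62 by omega,
          show r ≠ 63 by omega, show r ≠ 64 by omega]
      · rw [← hs3]; exact m2
    have z : lc L (ka / 2 + lc L (ka / 2) (s.mem (s 55)) (s.mem (s 56))) (s.mem (s 55)) (s.mem (s
      56)) = 0 := by rw [lc_add _ _ _ _ _ le_rfl]; omega
    split_ifs with h3
    · refine wp_cmpLess r2 (by norm_num) ?_ ?_
      · rw [r55, r56, r60, lc_comm]; exact z
      intro v hv
      rw [r55, r56, r60, drop_add_lt L (by rw [lc_comm])] at hv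
      simp only [ifs, reduceEqDiff, r2, le_zero]
      split_ifs with h4
      · refine ⟨ω, hQ _ _ ((c3.setReg ω le_rfl).setReg)
          ω (.inl ⟨✓, ha, fun _ => .inr ⟨by trivial, ?_⟩⟩)⟩
        rw [if_pos h3, ← not_lt, ← hv]; simpa using h4
      · refine ⟨ω, hQ _ _ ((c3.setReg ω le_rfl).setReg)
          ω (.inr ⟨✓, fun _ => ⟨hb, .inr ⟨by trivial, ?_⟩⟩⟩)⟩
        rw [if_pos h3]; exact (hv.1 h4).le
    · refine wp_cmpLess r2 (by norm_num) ?_ ?_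
      · rw [r55, r56, r60]; exact z
      intro v hv
      rw [r55, r56, r60, drop_add_lt L le_rfl] at hv
      simp only [ifs, reduceEqDiff, r2, le_zero]
      split_ifs with h4
      · refine ⟨ω, hQ _ _ ((c3.setReg ω le_rfl).setReg)
          ω (.inl ⟨✓, ha, fun _ => .inr ⟨by trivial, ?_⟩⟩)⟩
        rw [if_neg h3, ← not_lt, ← hv]; simpa using h4
      · refine ⟨ω, hQ _ _ ((c3.setReg ω le_rfl).setReg)
          ω (.inr ⟨✓, fun _ => ⟨hb, .inr ⟨by trivial, ?_⟩⟩⟩)⟩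
        rw [if_neg h3]; exact (hv.1 h4).le
  · exact ⟨ω, hQ _ _ (hC.setReg) ω (.inl ⟨✓, ha, fun _ => .inl ω⟩)⟩
  · exact ⟨ω, hQ _ _ (hC.setReg) ω (.inr ⟨✓, fun _ => ⟨hb, .inl ω⟩⟩)⟩

/-! ### Linked lists and heaps in memory -/

/-- The cells below `f` are the same in both memories. -/
def Keep (f : ℕ) (M M' : ℕ → ℕ) : Prop := ∀ a < f, 8 ≤ a % 16 → M' a = M a

lemma Step.keep {k B : ℕ} {o : List ℕ} {s s' : State} {t t' : ℕ} (h : Step k B o s t s' t') :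
    Keep (s 4) s.mem s'.mem := fun a ha _ => h.mem a ha

/-- `p` is the address of a cell of a block below `f`. -/
def IsCell (f p : ℕ) : Prop := p % 16 = 8 ∧ p < f

lemma IsCell.mono {f f' p : ℕ} (h : IsCell f p) (hf : f ≤ f') : IsCell f' p :=
  ⟨h.1, h.2.trans_le hf⟩

lemma IsCell.ne_zero {f p : ℕ} (h : IsCell f p) : p ≠ 0 := by have := h.1; omega

lemma IsCell.keep {f p i : ℕ} {M M' : ℕ → ℕ} (h : IsCell f p) (hf : f % 16 = 0)
    (hk : Keep f M M') (hi : i < 8) : M' (p + i) = M (p + i) := by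
  have := h.1; have := h.2
  exact hk _ ω ω

/-- A linked list of pairs in cells below `f`. -/
def PL (M : ℕ → ℕ) (f : ℕ) : ℕ → Λ → Prop
  | p, [] => p = 0
  | p, x :: l => IsCell f p ∧ M p = x.1 ∧ M (p + 1) = x.2 ∧ PL M f (M (p + 2)) l

/-- In the memory of a state. -/
notation:max "PL!" s:max => PL (State.mem s) (State.reg s 4)

lemma PL.keep {M M' : ℕ → ℕ} {f f' : ℕ} (hf : f % 16 = 0) (hff : f ≤ f') (hk : Keep f M M') :
    ∀ {l : Λ} {p : ℕ}, PL M f p l → PL M' f' p l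
  | [], _, h => h
  | x :: l, p, ⟨h1, h2, h3, h4⟩ => by
    refine ⟨h1.mono hff, ?_, ?_, ?_⟩
    · rw [← h2]; exact h1.keep (i := 0) hf hk ω
    · rw [← h3]; exact h1.keep hf hk ω
    · rw [h1.keep hf hk ω]; exact h4.keep hf hff hk

lemma PL.pairListAt {M : ℕ → ℕ} {f : ℕ} : ∀ {l : Λ} {p : ℕ}, PL M f p l →
    PairListAt M p l
  | [], _, h => h
  | _ :: _, _, ⟨h1, h2, h3, h4⟩ => ⟨h1.ne_zero, h2, h3, h4.pairListAt⟩

lemma PL.eq_zero_iff {M : ℕ → ℕ} {f p : ℕ} {l : Λ} (h : PL M f p l) : p = 0 ↔ l = [] := by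
  cases l with
  | nil => exact ⟨fun _ => rfl, fun _ => h⟩
  | cons x l => exact ⟨fun hp => absurd hp h.1.ne_zero, fun h => by simp at h⟩

/-- Heap-ordered binary trees. -/
inductive Hp where
  | nil
  | node (x : ℕ × ℕ) (l r : Hp)

namespace Hp

/-- The entries. -/
def els : Hp → Φ
  | nil => 0
  | node x l r => x ::ₘ (els l + els r)

/-- The rank, the length of the right spine. -/
def rk : Hp → ℕ
  | nil => 0
  | node _ _ r => rk r + 1

/-- A leftist heap for the order `B`. -/
def Good (B : ℕ → ℕ → Prop) : Hp → Prop
  | nil => True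
  | node x l r => (∀ y ∈ els l + els r, B x.1 y.1) ∧ rk r ≤ rk l ∧ Good B l ∧ Good B r

/-- The node with entry `x` and the two given subtrees, in leftist order. -/
def mk (x : ℕ × ℕ) (l r : Hp) : Hp := if rk r ≤ rk l then node x l r else node x r l

variable {B : ℕ → ℕ → Prop}

lemma two_pow_rk_le : ∀ {h : Hp}, h.Good B → 2 ^ h.rk ≤ h.els.card + 1
  | nil, _ => by simp [rk]
  | node x l r, ⟨_, h2, h3, h4⟩ => by
    have h5 := two_pow_rk_le h3
    have h6 := two_pow_rk_le h4
    have h7 : 2 ^ rk r ≤ 2 ^ rk l := Nat.pow_le_pow_right ω h2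
    simp only [rk, els, card_cons, card_add, pow_succ]
    omega

lemma els_mk (x : ℕ × ℕ) (l r : Hp) : (mk x l r).els = x ::ₘ (l.els + r.els) := by
  unfold mk; split_ifs
  · rfl
  · rw [els, add_comm]

lemma Good.mk {x : ℕ × ℕ} {l r : Hp} (hl : l.Good B) (hr : r.Good B)
    (h : ∀ y ∈ l.els + r.els, B x.1 y.1) : (Hp.mk x l r).Good B := by
  unfold Hp.mk; split_ifs with h1
  · exact ⟨h, h1, hl, hr⟩
  · exact ⟨by rwa [add_comm], ω, hr, hl⟩

lemma Good.imp {B' : ℕ → ℕ → Prop} : ∀ {h : Hp}, h.Good B →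
    (∀ x ∈ h.els, ∀ y ∈ h.els, B x.1 y.1 → B' x.1 y.1) → h.Good B'
  | nil, _, _ => trivial
  | node x l r, ⟨h1, h2, h3, h4⟩, hh => by
    simp only [els, Multiset.mem_cons, mem_add] at hh h1
    refine ⟨fun y hy => hh x (.inl rfl) y (.inr (by simpa using hy)) (h1 y (by simpa using hy)),
      h2, h3.imp fun x hx y hy => hh x (.inr (.inl hx)) y (.inr (.inl hy)),
      h4.imp fun x hx y hy => hh x (.inr (.inr hx)) y (.inr (.inr hy))⟩

/-- The conditions on a path in the heap to a subtree with entries `S`. -/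
def GoodPath (B : ℕ → ℕ → Prop) : List ((ℕ × ℕ) × Hp) → Φ → Prop
  | [], _ => True
  | (x, l) :: π, S => (∀ y ∈ l.els + S, B x.1 y.1) ∧ l.Good B ∧ GoodPath B π (x ::ₘ (l.els + S))

/-- The entries on a path. -/
def pathEls (π : List ((ℕ × ℕ) × Hp)) : Φ :=
  (π.map fun e => e.1 ::ₘ e.2.els).sum

end Hp

/-- The heap `h` in memory: the cell of a node holds its entry, the addresses of its subtrees, and
its rank. -/
def HAt (M : ℕ → ℕ) (f : ℕ) : ℕ → Hp → Prop
  | p, .nil => p = 0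
  | p, .node x l r => IsCell f p ∧ M p = x.1 ∧ M (p + 1) = x.2 ∧ HAt M f (M (p + 2)) l ∧
      HAt M f (M (p + 3)) r ∧ M (p + 4) = r.rk + 1

/-- In the memory of a state. -/
notation:max "HAt!" s:max => HAt (State.mem s) (State.reg s 4)

lemma HAt.keep {M M' : ℕ → ℕ} {f f' : ℕ} (hf : f % 16 = 0) (hff : f ≤ f') (hk : Keep f M M') :
    ∀ {h : Hp} {p : ℕ}, HAt M f p h → HAt M' f' p h
  | .nil, _, h => h
  | .node x l r, p, ⟨h1, h2, h3, h4, h5, h6⟩ => by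
    refine ⟨h1.mono hff, ?_, ?_, ?_, ?_, ?_⟩
    · rw [← h2]; exact h1.keep (i := 0) hf hk ω
    · rw [← h3]; exact h1.keep hf hk ω
    · rw [h1.keep hf hk ω]; exact h4.keep hf hff hk
    · rw [h1.keep hf hk ω]; exact h5.keep hf hff hk
    · rw [← h6]; exact h1.keep hf hk ω

lemma HAt.cases {M : ℕ → ℕ} {f p : ℕ} {h : Hp} (hh : HAt M f p h) : p = 0 ∧ h = .nil ∨ IsCell f p ∧
    ∃ l r, h = .node (M p, M (p + 1)) l r ∧ HAt M f (M (p + 2)) l ∧ HAt M f (M (p + 3)) r ∧ M (p +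
    4) = h.rk := by
  cases h with
  | nil => exact .inl ⟨hh, rfl⟩
  | node x l r =>
    obtain ⟨h1, h2, h3, h4, h5, h6⟩ := hh
    exact .inr ⟨h1, l, r, by rw [h2, h3], h4, h5, h6⟩

/-- A path in the heap, in memory. -/
def PathAt (M : ℕ → ℕ) (f : ℕ) : ℕ → List ((ℕ × ℕ) × Hp) → Prop
  | p, [] => p = 0
  | p, (x, l) :: π => IsCell f p ∧ M p = x.1 ∧ M (p + 1) = x.2 ∧ HAt M f (M (p + 2)) l ∧
      PathAt M f (M (p + 3)) π

lemma PathAt.keep {M M' : ℕ → ℕ} {f f' : ℕ} (hf : f % 16 = 0) (hff : f ≤ f')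
    (hk : Keep f M M') : ∀ {π : List ((ℕ × ℕ) × Hp)} {p : ℕ}, PathAt M f p π → PathAt M' f' p π
  | [], _, h => h
  | (x, l) :: π, p, ⟨h1, h2, h3, h4, h5⟩ => by
    refine ⟨h1.mono hff, ?_, ?_, ?_, ?_⟩
    · rw [← h2]; exact h1.keep (i := 0) hf hk ω
    · rw [← h3]; exact h1.keep hf hk ω
    · rw [h1.keep hf hk ω]; exact h4.keep hf hff hk
    · rw [h1.keep hf hk ω]; exact h5.keep hf hff hk

variable [hw : Wide W L k T]
variable {f p q i x h j r a y f' n B : ℕ} {M M' : ℕ → ℕ} {H : Hp} {ev l X g : Λ} {o : List ℕ}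
  {S : Φ} {gs : List Λ} {ds : List Desc}

lemma wp_get {c : ℕ} (hy : y ≠ 67) : wp W L (Prog.get x y c) s t Q ↔ c < W ∧ s y + c < W ∧ Q
    ((s.setReg 67 (s y + c)).setReg x (s.mem (s y + c))) (t + 3) := by
  simp [Prog.get, wp_seq, wp_const, wp_arith, wp_load, hy, setReg_setReg, Nat.add_assoc]

lemma wp_copy (h2 : s 2 = 0) : wp W L (Prog.copy x y) s t Q ↔
    s y < W ∧ Q (s.setReg x (s y)) (t + 1) := by
  simp [Prog.copy, wp_arith, h2]

namespace Prog

/-- Descend along the right spines of the heaps in `45` and `46` while both are nonempty, and keep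
the path in `47`. -/
def mergeDown : Prog :=
  loop 54 (ite 45 2 (const 54 0) (ite 46 2 (const 54 0) (copy 55 45 ;; copy 56 46 ;; better ;; ite
    65 2 skip (copy 48 45 ;; copy 45 46 ;; copy 46 48) ;; load 48 45 ;; get 49 45 1 ;; get 50 45 2
    ;; get 51 45 3 ;; alloc 47 [48, 49, 50, 47] ;; copy 45 51)))

/-- Rebuild the heap from the path in `47` and the subtree in `45`. -/
def mergeUp : Prog :=
  loop 47 (load 48 47 ;; get 49 47 1 ;; get 50 47 2 ;; get 47 47 3 ;; ite 50 2 (const 51 0) (get 51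
    50 4) ;; ite 45 2 (const 52 0) (get 52 45 4) ;; ite 52 51 skip (copy 53 50 ;; copy 50 45 ;; copy
    45 53 ;; copy 52 51) ;; arith .add 52 52 3 ;; alloc 45 [48, 49, 50, 45, 52])

/-- Merge the heaps in the registers `45` and `46` into `45`. -/
def merge : Prog :=
  const 47 0 ;; const 54 1 ;; mergeDown ;; ite 45 2 (copy 45 46) skip ;; mergeUp

end Prog

/-- The event order on entries, for the reference string and position in the registers. -/
def evOrd (L : List (List α)) (s : State) (i j : ℕ) : Prop := Bef L (s 14) (s 9) i j

lemma evOrd_congr (h9 : s' 9 = s 9) (h14 : s' 14 = s 14) : evOrd L s' = evOrd L s := by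
  funext i j; rw [evOrd, evOrd, h9, h14]

lemma isCell_new (h : f % 16 = 0) : IsCell (f + 16) (f + 8) := ⟨ω, ω⟩

/-- The state of the descent. -/
structure DownInv (L : List (List α)) (k : ℕ) (S : Φ) (s : State) (t : ℕ)
    (A B : Hp) (π : List ((ℕ × ℕ) × Hp)) : Prop where
  ok : Ok k s t
  pos : s 9 ≤ (str L (s 14)).length
  hA : HAt! s (s 45) A
  hB : HAt! s (s 46) B
  hπ : PathAt s.mem (s 4) (s 47) π
  gA : A.Good (evOrd L s)
  gB : B.Good (evOrd L s)
  gπ : Hp.GoodPath (evOrd L s) π (A.els + B.els)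
  sum : Hp.pathEls π + (A.els + B.els) = S

lemma wp_skip {k' T' : ℕ} [hw : Wide W L k' T'] : wp W L Prog.skip s t Q ↔ Q (s.setReg 67 0) (t + 1) := by
  have := hw.budget
  simp [Prog.skip, wp_const]; omega

lemma wp_bind {p q : Prog} {R : State → ℕ → Prop} (h : wp W L p s t R)
    (hq : ∀ s' t', R s' t' → wp W L q s' t' Q) : wp W L (.seq p q) s t Q :=
  wp_seq.2 (wp_mono h hq)

lemma DownInv.calm {A B : Hp} {π : List ((ℕ × ℕ) × Hp)}
    (h : DownInv L k S s t A B π) (hc : Calm 45 [] s t s' t') (h45 : s' 45 = s 45)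
    (h46 : s' 46 = s 46) (h47 : s' 47 = s 47) : DownInv L k S s' t' A B π := by
  obtain ⟨h1, h2, h3, h4, h5, h6, h7, h8, h9⟩ := h
  have e := @hc.regs
  refine ⟨h1.calm hc, ?_, ?_, ?_, ?_, ?_, ?_, ?_, h9⟩
  · rwa [e 9, e 14]
  · rwa [hc.mem, e 4, h45]
  · rwa [hc.mem, e 4, h46]
  · rwa [hc.mem, e 4, h47]
  all_goals rwa [evOrd_congr (e 9) (e 14)]

lemma DownInv.swap {A B : Hp} {π : List ((ℕ × ℕ) × Hp)}
    (h : DownInv L k S s t A B π) (hc : Calm 45 [] s t s' t') (h45 : s' 45 = s 46)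
    (h46 : s' 46 = s 45) (h47 : s' 47 = s 47) : DownInv L k S s' t' B A π := by
  obtain ⟨h1, h2, h3, h4, h5, h6, h7, h8, h9⟩ := h
  have e := @hc.regs
  refine ⟨h1.calm hc, ?_, ?_, ?_, ?_, ?_, ?_, ?_, by rwa [add_comm B.els]⟩
  · rwa [e 9, e 14]
  · rwa [hc.mem, e 4, h45]
  · rwa [hc.mem, e 4, h46]
  · rwa [hc.mem, e 4, h47]
  all_goals rw [evOrd_congr (e 9) (e 14)]
  exacts [h7, h6, by rwa [add_comm]]

set_option maxHeartbeats 1000000 in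
lemma wp_mergeDown_body {A B : Hp} {π : List ((ℕ × ℕ) × Hp)} (h54 : s 54 = 1) (inv : DownInv L k S s
    t A B π) (hT : t + 99 ≤ T) : wp W L (.ite 45 2 (.const 54 0) (.ite 46 2 (.const 54 0) (.copy 55
    45 ;; .copy 56 46 ;; .better ;; .ite 65 2 .skip (.copy 48 45 ;; .copy 45 46 ;; .copy 46 48) ;;
    .load 48 45 ;; .get 49 45 1 ;; .get 50 45 2 ;; .get 51 45 3 ;; .alloc 47 [48, 49, 50, 47] ;;
    .copy 45 51))) s t fun s' t' => Step k 45 [] s t s' t' ∧ t' ≤ t + 99 ∧ (s' 54 = 0 ∧ DownInv L k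
    S s' t' A B π ∧ (A = .nil ∨ B = .nil) ∨ s' 54 = 1 ∧ ∃ A' B' e, DownInv L k S s' t' A' B' (e ::
    π) ∧ A'.rk + B'.rk + 1 ≤ A.rk + B.rk) := by
  have ok := inv.ok
  have h2 := ok.c2
  have hal := hw.alloc_le ok ω
  have h0W : 0 < W := ω
  simp only [wp_ite, h2, le_zero, wp_const]
  have hout : ∀ t', t ≤ t' → Calm 45 [] s t (s.setReg 54 0) t' := fun t' ht =>
    (Calm.refl (Nat.le_refl t)).setReg ω ht
  split_ifs with hA hB
  · refine ⟨h0W, (hout _ ω).step ok, ω, .inl ⟨✓, inv.calm (hout _ ω) ✓ ✓ ✓, .inl ?_⟩⟩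
    rcases inv.hA.cases with h | h
    · exact h.2
    · exact absurd hA h.1.ne_zero
  · refine ⟨h0W, (hout _ ω).step ok, ω, .inl ⟨✓, inv.calm (hout _ ω) ✓ ✓ ✓, .inr ?_⟩⟩
    rcases inv.hB.cases with h | h
    · exact h.2
    · exact absurd hB h.1.ne_zero
  obtain ⟨hcA, -⟩ := inv.hA.cases.resolve_left fun h => hA h.1
  obtain ⟨hcB, -⟩ := inv.hB.cases.resolve_left fun h => hB h.1
  have hpA := hcA.2
  have hpB := hcB.2
  rw [wp_seq, wp_copy h2]
  refine ⟨ω, ?_⟩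
  rw [wp_seq, wp_copy (by simpa using h2)]
  refine ⟨by simp; omega, ?_⟩
  have c0 : Calm 45 [] s t ((s.setReg 55 (s 45)).setReg 56 (s 46)) (t + 4) :=
    ((Calm.refl (Nat.le_refl t)).setReg ω (Nat.le_refl t)).setReg
  have inv0 := inv.calm c0 ✓ ✓ ✓
  refine wp_seq.2 (wp_better inv0.ok.toConsts inv0.pos ?_)
  intro s1 t1 c1 ht1 h1
  simp only [ifs, reduceEqDiff] at h1
  have e1 : ∀ r < 55, s1 r = s r := fun r hr => by
    rw [c1.regs r, reg_setReg, if_neg ω, reg_setReg, if_neg ω]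
  have c1' : Calm 45 [] s t s1 t1 := ⟨fun r hr _ => e1 r ω, c1.mem, by have := c1.time; omega⟩
  -- the winner is now in register `45`
  refine wp_bind (R := fun s2 t2 => Calm 45 [] s t s2 t2 ∧ t2 ≤ t1 + 10 ∧ s2 54 = 1 ∧ ∃ C D, DownInv
    L k S s2 t2 C D π ∧ C.rk + D.rk = A.rk + B.rk ∧ s2 45 ≠ 0 ∧ s2 46 ≠ 0 ∧ evOrd L s (s.mem (s2
    45)) (s.mem (s2 46))) ?_ ?_
  · simp only [wp_ite, e1 2 (by omega : 2 < 55), h2, le_zero]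
    rcases h1 with ⟨h65, -, h1⟩ | ⟨h65, h1⟩
    · rw [if_pos h65, wp_skip]
      have cc : Calm 45 [] s t (s1.setReg 67 0) (t1 + 1 + 1) := c1'.setReg
      refine ⟨cc, ω, by simp [e1, h54], A, B, ?_, rfl, ?_, ?_, ?_⟩
      · exact inv.calm cc (by simp [e1]) (by simp [e1]) (by simp [e1])
      · simpa [e1] using hA
      · simpa [e1] using hB
      · simpa [e1, evOrd] using h1 hB
    · have h20 : s1 2 = 0 := by rw [e1 2 ω, h2]
      rw [if_neg ω, wp_seq, wp_copy h20, wp_seq, wp_copy (by simpa using h20),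
        wp_copy (by simpa using h20)]
      simp only [ifs, reduceEqDiff, e1 45 ω, e1 46 ω]
      have cc : Calm 45 [] s t (((s1.setReg 48 (s 45)).setReg 45 (s 46)).setReg 46 (s 45)) (t1 + 1 +
        1 + 1 + 1) := ((c1'.setReg ω le_rfl).setReg ω le_rfl).setReg
      refine ⟨ω, ω, ω, cc, ω, by simp [e1, h54], B, A, ?_, Nat.add_comm _ _, ?_, ?_, ?_⟩
      · exact inv.swap cc ✓ ✓ (by simp [e1])
      · simpa using hB
      · simpa using hA
      · simpa [evOrd] using (h1 hA).2
  rintro s2 t2 ⟨c2, ht2, h254, C, D, inv2, hrk, h45, h46, hord⟩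
  obtain ⟨hcC, lC, rC, eC, hlC, hrC, hrkC⟩ := inv2.hA.cases.resolve_left fun h => h45 h.1
  obtain ⟨hcD, lD, rD, eD, hlD, hrD, hrkD⟩ := inv2.hB.cases.resolve_left fun h => h46 h.1
  have hpC := hcC.2
  have e2 := @c2.regs
  have e24 := e2 4
  have h22 := inv2.ok.c2
  have tt := c2.time
  simp only [wp_seq, wp_load, wp_get (show (45 : ℕ) ≠ 67 by omega), reg_setReg, reduceEqDiff,
    if_false, mem_setReg]
  refine ⟨ω, ω, ω, ω, ω, ω, ?_⟩
  generalize hs3 : State.setReg _ 51 (s2.mem (s2 45 + 3)) = s3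
  have c3 : Calm 45 [] s t s3 (t2 + 1 + 3 + 3 + 3) := by
    rw [← hs3]
    refine Calm.setReg (Calm.setReg (Calm.setReg (Calm.setReg (Calm.setReg (Calm.setReg (Calm.setReg
      c2 ω le_rfl) ω le_rfl) ω le_rfl) ω le_rfl) ω le_rfl) ω le_rfl) ω ω
  have ok3 := ok.calm c3
  have m3 : s3.mem = s.mem := c3.mem
  have m2 : s2.mem = s.mem := c2.mem
  have f4 : s3 4 = s 4 := c3.regs 4
  have r45 : s3 45 = s2 45 := by rw [← hs3]; simp
  have r46 : s3 46 = s2 46 := by rw [← hs3]; simp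
  have r47 : s3 47 = s2 47 := by rw [← hs3]; simp
  have r48 : s3 48 = s.mem (s2 45) := by rw [← hs3]; simp [m2]
  have r49 : s3 49 = s.mem (s2 45 + 1) := by rw [← hs3]; simp [m2]
  have r50 : s3 50 = s.mem (s2 45 + 2) := by rw [← hs3]; simp [m2]
  have r51 : s3 51 = s.mem (s2 45 + 3) := by rw [← hs3]; simp [m2]
  have r54 : s3 54 = 1 := by rw [← hs3]; simpa using h254
  refine wp_alloc ok3.toConsts ω ✓ ✓ (by rw [f4]; omega) ?_
  have st4 : Step k 45 [] s t (s3.alloc 47 [48, 49, 50, 47]) (t2 + 1 + 3 + 3 + 3 + 2 * [48, 49, 50,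
    47].length + 6) := (c3.step ok).alloc ω ω ω ω
  rw [wp_copy st4.ok.c2]
  have hfm := ok.fp_mod
  rw [m2, e24] at hlC hrC
  rw [e24] at hcC
  have hr51W : s.mem (s2 45 + 3) < W := by
    rcases hrC.cases with h | h
    · omega
    · have := h.1.2; omega
  simp only [reg_alloc, reduceEqDiff, if_false, r51]
  set s5 := (s3.alloc 47 [48, 49, 50, 47]).setReg 45 (s.mem (s2 45 + 3)) with hs5
  have st5 : Step k 45 [] s t s5 (t2 + 1 + 3 + 3 + 3 + 2 * [48, 49, 50, 47].length + 6 + 1) :=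
    st4.setReg
  have hk5 := st5.keep
  have f5 : s5 4 = s 4 + 16 := by rw [hs5]; simp [f4]
  have hp := st5.fp
  have e59 : s5 9 = s 9 := st5.regs 9
  have e514 : s5 14 = s 14 := st5.regs 14
  have eo : evOrd L s5 = evOrd L s := evOrd_congr e59 e514
  have eo2 : evOrd L s2 = evOrd L s := evOrd_congr (e2 9) (e2 14)
  have em : s5.mem = putList s.mem (s 4 + 8) [s3 48, s3 49, s3 50, s3 47] := by
    rw [hs5]; simp [m3, f4]
  have inv2B := inv2.hB
  have inv2π := inv2.hπ
  have gA := inv2.gA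
  have gB := inv2.gB
  have gπ := inv2.gπ
  have sum := inv2.sum
  rw [m2, e24] at inv2B inv2π
  rw [eo2] at gA gB gπ
  rw [m2] at eC eD
  have eCels : C.els = (s.mem (s2 45), s.mem (s2 45 + 1)) ::ₘ (lC.els + rC.els) := by rw [eC]; rfl
  have gA' := gA
  rw [eC] at gA'
  have gB' := gB
  rw [eD] at gB'
  refine ⟨ω, st5, by simp; omega, .inr ⟨by simp [hs5, r54], rC, D, ((s.mem (s2 45), s.mem (s2 45 +
    1)), lC), ⟨st5.ok, ?_, ?_, ?_, ?_, ?_, ?_, ?_, ?_⟩, ?_⟩⟩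
  · rw [e59, e514]; exact inv.pos
  · rw [show s5 45 = s.mem (s2 45 + 3) by simp [hs5]]
    exact hrC.keep hfm hp hk5
  · rw [show s5 46 = s2 46 by simp [hs5, r46]]
    exact inv2B.keep hfm hp hk5
  · rw [show s5 47 = s 4 + 8 by simp [hs5, f4], f5]
    refine ⟨isCell_new hfm, ?_, ?_, ?_, ?_⟩
    · rw [em, putList_zero, r48]
    · rw [em, putList_add ✓]; simp [r49]
    · rw [show s5.mem (s 4 + 8 + 2) = s3 50 by rw [em, putList_add ✓]; rfl, r50, ← f5]
      exact hlC.keep hfm hp hk5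
    · rw [show s5.mem (s 4 + 8 + 3) = s3 47 by rw [em, putList_add ✓]; rfl, r47, ← f5]
      exact inv2π.keep hfm hp hk5
  · rw [eo]; exact gA'.2.2.2
  · rw [eo]; exact gB
  · rw [eo]
    refine ⟨?_, gA'.2.2.1, ?_⟩
    · intro y hy
      simp only [mem_add] at hy
      rcases hy with hy | hy | hy
      · exact gA'.1 y (by simp [hy])
      · exact gA'.1 y (by simp [hy])
      · rw [eD, Hp.els, Multiset.mem_cons] at hy
        rcases hy with rfl | hy
        · exact hord
        · exact Bef.trans L hord (gB'.1 y hy)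
    · rw [eCels] at gπ
      rw [← add_assoc, ← cons_add]; exact gπ
  · rw [← sum, eCels]
    simp only [Hp.pathEls, map_cons, sum_cons, cons_add, add_cons]
    congr 1; abel
  · rw [← hrk, eC]; simp only [Hp.rk]; omega

lemma wp_mergeDown  : ∀ (n : ℕ) {s : State} {t : ℕ} {A B : Hp} {π : List ((ℕ × ℕ) × Hp)}, A.rk +
    B.rk ≤ n → s 54 = 1 → DownInv L k S s t A B π → t + 101 * (n + 1) ≤ T → wp W L Prog.mergeDown s
    t fun s' t' => Step k 45 [] s t s' t' ∧ t' ≤ t + 101 * (n + 1) ∧ ∃ A' B' π', DownInv L k S s' t'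
    A' B' π' ∧ (A' = .nil ∨ B' = .nil) ∧ π'.length ≤ π.length + n := by
  intro n
  induction n with
  | zero =>
    intro s t A B π hr h54 inv hT
    have st := Step.refl (B := 45) (o := []) inv.ok
    rw [Prog.mergeDown, wp_loop, if_neg ω]
    refine wp_mono (wp_mergeDown_body h54 (inv.calm (Calm.refl (le_succ t)) rfl rfl rfl) ω) ?_
    rintro s' t' ⟨h1, h2, ⟨h3, h4, h5⟩ | ⟨h3, A', B', e, h4, h5⟩⟩
    · rw [wp_loop, if_pos h3]
      exact ⟨((st.later (le_succ t)).trans h1).later, ω, A, B, π,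
        h4.calm (Calm.refl (le_succ t')) rfl rfl rfl, h5, ω⟩
    · omega
  | succ n ih =>
    intro s t A B π hr h54 inv hT
    have st := Step.refl (B := 45) (o := []) inv.ok
    rw [Prog.mergeDown, wp_loop, if_neg ω]
    refine wp_mono (wp_mergeDown_body h54 (inv.calm (Calm.refl (le_succ t)) rfl rfl rfl) ω) ?_
    rintro s' t' ⟨h1, h2, ⟨h3, h4, h5⟩ | ⟨h3, A', B', e, h4, h5⟩⟩
    · rw [wp_loop, if_pos h3]
      exact ⟨((st.later (le_succ t)).trans h1).later, ω, A, B, π,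
        h4.calm (Calm.refl (le_succ t')) rfl rfl rfl, h5, ω⟩
    · refine wp_mono (ih ω h3 h4 ω) ?_
      rintro s2 t2 ⟨g1, g2, A2, B2, π2, g3, g4, g5⟩
      exact ⟨((st.later (le_succ t)).trans h1).trans g1, ω, A2, B2, π2, g3, g4, by
        simp at g5; omega⟩

/-- The state of the ascent. -/
structure UpInv (L : List (List α)) (k : ℕ) (S : Φ) (s : State) (t : ℕ)
    (A : Hp) (π : List ((ℕ × ℕ) × Hp)) : Prop where
  ok : Ok k s t
  hA : HAt! s (s 45) A
  hπ : PathAt s.mem (s 4) (s 47) π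
  gA : A.Good (evOrd L s)
  gπ : Hp.GoodPath (evOrd L s) π A.els
  sum : Hp.pathEls π + A.els = S

lemma UpInv.calm {A : Hp} {π : List ((ℕ × ℕ) × Hp)} (h : UpInv L k S s t A π) (hc : Calm 45 [] s t
    s' t') (h45 : s' 45 = s 45) (h47 : s' 47 = s 47) : UpInv L k S s' t' A π := by
  obtain ⟨h1, h3, h5, h6, h8, h9⟩ := h
  have e := @hc.regs
  refine ⟨h1.calm hc, ?_, ?_, ?_, ?_, h9⟩
  · rwa [hc.mem, e 4, h45]
  · rwa [hc.mem, e 4, h47]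
  all_goals rwa [evOrd_congr (e 9) (e 14)]

lemma HAt.lt {h : Hp} (hh : HAt M f p h) (hf : 0 < f) : p < f := by
  rcases hh.cases with h | h
  · omega
  · exact h.1.2

lemma wp_rank {h : Hp} (ok : Ok k s t) (ht : t ≤ T) (hy : y ≠ 67) (hh : HAt! s (s y) h) (hQ : ∀ s'
    t', Calm 67 [x] s t s' t' → t' ≤ t + 4 → s' x = h.rk → Q s' t') : wp W L (.ite y 2 (.const x 0)
    (.get x y 4)) s t Q := by
  have hal := hw.alloc_le ok ht
  simp only [wp_ite, ok.c2, le_zero, wp_const, wp_get hy]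
  rcases hh.cases with ⟨h1, h2⟩ | ⟨h1, l, r, h2, h3, h4, h5⟩
  · rw [if_pos h1]
    exact ⟨ω, hQ _ _ ((Calm.refl (Nat.le_refl t)).setReg ✓ ω) ω (by simp [h2, Hp.rk])⟩
  · rw [if_neg h1.ne_zero]
    have := h1.2
    exact ⟨ω, ω, hQ _ _ (((Calm.refl (Nat.le_refl t)).setReg ✓ le_rfl).setReg ✓ ω) ω (by simp [h5])⟩

set_option maxHeartbeats 1000000 in
lemma wp_mergeUp  : ∀ (π : List ((ℕ × ℕ) × Hp)) {s : State} {t : ℕ} {A : Hp}, UpInv L k S s t A π →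
    S.card + 2 ≤ W → t + 100 * π.length + 1 ≤ T → wp W L Prog.mergeUp s t fun s' t' => Step k 45 []
    s t s' t' ∧ t' ≤ t + 100 * π.length + 1 ∧ ∃ A', UpInv L k S s' t' A' [] := by
  intro π
  induction π with
  | nil =>
    intro s t A inv _ hT
    have h47 : s 47 = 0 := inv.hπ
    rw [Prog.mergeUp, wp_loop, if_pos h47]
    exact ⟨(Step.refl inv.ok).later, ✓, A, inv.calm (Calm.refl) rfl rfl⟩
  | cons e π ih =>
    intro s t A inv hS hT
    obtain ⟨x, l⟩ := e
    obtain ⟨hcell, hx1, hx2, hl, hπ⟩ := inv.hπ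
    have ok := inv.ok
    simp only [length_cons] at hT ⊢
    have hal := hw.alloc_le ok ω
    have hlt := hcell.2
    rw [Prog.mergeUp, wp_loop, if_neg hcell.ne_zero]
    simp only [wp_seq, wp_load, wp_get (show (47 : ℕ) ≠ 67 by omega), reg_setReg,
      reduceEqDiff, if_false, mem_setReg, hx1, hx2]
    refine ⟨ω, ω, ω, ω, ω, ω, ?_⟩
    generalize hs1 : State.setReg _ 47 (s.mem (s 47 + 3)) = s1
    have c1 : Calm 45 [] s t s1 (t + 1 + 1 + 3 + 3 + 3) := by
      rw [← hs1]
      refine Calm.setReg (Calm.setReg (Calm.setReg (Calm.setReg (Calm.setReg (Calm.setReg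
        (Calm.setReg (Calm.refl (Nat.le_refl t)) ω le_rfl) ω le_rfl) ω
        le_rfl) ω le_rfl) ω le_rfl) ω le_rfl) ω ω
    have r45 : s1 45 = s 45 := by rw [← hs1]; simp
    have r47 : s1 47 = s.mem (s 47 + 3) := by rw [← hs1]; simp
    have r48 : s1 48 = x.1 := by rw [← hs1]; simp
    have r49 : s1 49 = x.2 := by rw [← hs1]; simp
    have r50 : s1 50 = s.mem (s 47 + 2) := by rw [← hs1]; simp
    have ok1 := ok.calm c1
    have f4 : s1 4 = s 4 := c1.regs 4
    have m1 : s1.mem = s.mem := c1.mem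
    have hfp := ok.fp_pos
    have hlW := hl.lt ω
    have hAW := inv.hA.lt ω
    have hcard : A.els.card + l.els.card + 1 ≤ S.card := by rw [← inv.sum]; simp [Hp.pathEls]; omega
    have gl := inv.gπ.2.1
    have hrl : l.rk ≤ l.els.card := by
      have := Hp.two_pow_rk_le gl; have := Nat.lt_two_pow_self (n := l.rk); omega
    have hrA : A.rk ≤ A.els.card := by
      have := Hp.two_pow_rk_le inv.gA; have := Nat.lt_two_pow_self (n := A.rk); omega
    refine wp_rank ok1 ω ω (h := l) (by rwa [m1, f4, r50]) ?_
    intro s2 t2 c2 ht2 r51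
    have c12 : Calm 45 [] s t s2 t2 := c1.trans (c2.mono)
    have e2 : ∀ r < 67, r ≠ 51 → s2 r = s1 r := fun r h h' => c2.regs r h (by simpa)
    have m2 : s2.mem = s.mem := c12.mem
    have f24 : s2 4 = s 4 := c12.regs 4
    refine wp_rank (ok.calm c12) ω ω (h := A) ?_ ?_
    · rw [m2, f24, e2 45 ω ω, r45]; exact inv.hA
    intro s3 t3 c3 ht3 r52
    have c13 : Calm 45 [] s t s3 t3 := c12.trans (c3.mono)
    have e3 : ∀ r < 67, r ≠ 51 → r ≠ 52 → s3 r = s1 r := fun r h h' h'' => by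
      rw [c3.regs r h (by simpa), e2 r h h']
    have r51' : s3 51 = l.rk := by rw [c3.regs 51, r51]
    have h23 : s3 2 = 0 := (ok.calm c13).c2
    -- order the subtrees
    refine wp_mono (Q := fun s4 t4 => Calm 45 [] s t s4 t4 ∧ t4 ≤ t3 + 5 ∧ ∃ l' A' : Hp, HAt! s (s4
      50) l' ∧ HAt! s (s4 45) A' ∧ s4 52 = A'.rk ∧ Hp.mk x l A = .node x l' A' ∧ s4 47 = s.mem (s 47
      + 3) ∧ s4 48 = x.1 ∧ s4 49 = x.2 ∧ A'.rk ≤ S.card) ?_ ?_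
    · simp only [wp_ite, r51', r52]
      split_ifs with hrk
      · rw [wp_skip]
        refine ⟨c13.setReg, ω, l, A, ?_, ?_, ?_, ?_, ?_, ?_, ?_, ω⟩
        · simpa [e3, r50] using hl
        · simpa [e3, r45] using inv.hA
        · simpa using r52
        · rw [Hp.mk, if_pos hrk]
        · simp [e3, r47]
        · simp [e3, r48]
        · simp [e3, r49]
      · rw [wp_seq, wp_copy h23, wp_seq, wp_copy (by simpa using h23), wp_seq,
          wp_copy (by simpa using h23), wp_copy (by simpa using h23)]
        simp only [ifs, reduceEqDiff, e3 50 ω ω ω, e3 45 ω ω ω, r50, r45, r51']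
        refine ⟨ω, ω, ω, ω, ?_⟩
        refine ⟨Calm.setReg (Calm.setReg (Calm.setReg (Calm.setReg c13 ω le_rfl) ω le_rfl) ω le_rfl)
          ω ω, ω, A, l, ?_, ?_, ?_, ?_, ?_, ?_, ?_, ω⟩
        · simpa using inv.hA
        · simpa using hl
        · simp
        · rw [Hp.mk, if_neg hrk]
        · simp [e3, r47]
        · simp [e3, r48]
        · simp [e3, r49]
    rintro s4 t4 ⟨c4, ht4, l', A', hl', hA', r52', hmk, r47', r48', r49', hrk'⟩
    have ok4 := ok.calm c4
    have f44 : s4 4 = s 4 := c4.regs 4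
    simp only [wp_arith, eval_add, r52', ok4.c3]
    refine ⟨ω, ?_⟩
    set s5 := s4.setReg 52 (A'.rk + 1) with hs5
    have c5 : Calm 45 [] s t s5 (t4 + 1) := c4.setReg
    have ok5 := ok.calm c5
    have f54 : s5 4 = s 4 := c5.regs 4
    refine wp_alloc ok5.toConsts ω ✓ ✓ ω ?_
    have st6 : Step k 45 [] s t (s5.alloc 45 [48, 49, 50, 45, 52]) (t4 + 1 + 2 * [48, 49, 50, 45,
      52].length + 6) := (c5.step ok).alloc ω ω ω ω
    set s6 := s5.alloc 45 [48, 49, 50, 45, 52] with hs6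
    have hk6 := st6.keep
    have hp6 := st6.fp
    have hfm := ok.fp_mod
    have f6 : s6 4 = s 4 + 16 := by rw [hs6]; simp [f54]
    have em : s6.mem = putList s.mem (s 4 + 8) [s5 48, s5 49, s5 50, s5 45, s5 52] :=
      by rw [hs6]; simp [c5.mem, f54]
    have eo := evOrd_congr (L := L) (st6.regs 9) (st6.regs 14)
    refine wp_mono (ih (A := Hp.mk x l A) ⟨st6.ok, ?_, ?_, ?_, ?_, ?_⟩ hS
      (by simp; have := c4.time; omega)) ?_
    · rw [show s6 45 = s 4 + 8 by rw [hs6]; simp [f54], f6, hmk]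
      refine ⟨isCell_new hfm, ?_, ?_, ?_, ?_, ?_⟩
      · rw [em, putList_zero]; simp [hs5, r48']
      · rw [em, putList_add ✓]; simp [hs5, r49']
      · rw [show s6.mem (s 4 + 8 + 2) = s5 50 by rw [em, putList_add ✓]; rfl, ← f6,
          show s5 50 = s4 50 by simp [hs5]]
        exact hl'.keep hfm hp6 hk6
      · rw [show s6.mem (s 4 + 8 + 3) = s5 45 by rw [em, putList_add ✓]; rfl, ← f6,
          show s5 45 = s4 45 by simp [hs5]]
        exact hA'.keep hfm hp6 hk6
      · rw [em, putList_add ✓]; simp [hs5]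
    · rw [show s6 47 = s4 47 by rw [hs6]; simp [hs5], r47']
      exact hπ.keep hfm hp6 hk6
    · rw [eo]
      exact gl.mk inv.gA inv.gπ.1
    · rw [eo, Hp.els_mk]; exact inv.gπ.2.2
    · rw [Hp.els_mk, ← inv.sum]
      simp only [Hp.pathEls, map_cons, sum_cons, cons_add, add_cons]
      congr 1; abel
    · rintro s7 t7 ⟨h1, h2, A'', h3⟩
      refine ⟨st6.trans h1, ?_, A'', h3⟩
      simp at h2; omega

lemma wp_merge {A B : Hp} (ok : Ok k s t) (hpos : s 9 ≤ (str L (s 14)).length) (hA : HAt! s (s 45)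
    A) (hB : HAt! s (s 46) B) (gA : A.Good (evOrd L s)) (gB : B.Good (evOrd L s)) (hS : (A.els +
    B.els).card + 2 ≤ W) (hT : t + 250 * (A.rk + B.rk + 1) ≤ T) : wp W L Prog.merge s t fun s' t' =>
    Step k 45 [] s t s' t' ∧ t' ≤ t + 250 * (A.rk + B.rk + 1) ∧ ∃ H, HAt! s' (s' 45) H ∧ H.Good
    (evOrd L s) ∧ H.els = A.els + B.els := by
  simp only [Prog.merge, wp_seq, wp_const]
  refine ⟨ω, ω, ?_⟩
  have c0 : Calm 45 [] s t ((s.setReg 47 0).setReg 54 1) (t + 1 + 1) :=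
    ((Calm.refl (Nat.le_refl t)).setReg ω (Nat.le_refl t)).setReg
  set s0 := (s.setReg 47 0).setReg 54 1 with hs0
  have eo0 : evOrd L s0 = evOrd L s := evOrd_congr (by simp [hs0]) (by simp [hs0])
  refine wp_mono (wp_mergeDown (S := A.els + B.els) (A.rk + B.rk) (A := A) (B := B) (π := []) le_rfl
    (by simp [hs0]) ⟨ok.calm c0, ?_, ?_, ?_, ?_, ?_, ?_, ?_, ?_⟩ ω) ?_
  · simpa [hs0] using hpos
  · simpa [hs0] using hA
  · simpa [hs0] using hB
  · simp [PathAt, hs0]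
  · rwa [eo0]
  · rwa [eo0]
  · trivial
  · simp [Hp.pathEls]
  rintro s1 t1 ⟨st1, ht1, A', B', π', inv, hnil, hlen⟩
  simp only [length_nil, Nat.zero_add] at hlen
  have ok1 := st1.ok
  have st1' : Step k 45 [] s t s1 t1 := (c0.step ok).trans st1
  have hBW := inv.hB.lt (by have := ok1.fp_pos; omega)
  have hal := hw.alloc_le ok1 ω
  refine wp_mono (Q := fun s2 t2 => Step k 45 [] s t s2 t2 ∧ t2 ≤ t1 + 2 ∧
    ∃ C, UpInv L k (A.els + B.els) s2 t2 C π') ?_ ?_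
  · simp only [wp_ite, ok1.c2, le_zero, wp_copy, wp_skip]
    have h1 := inv.hA.cases
    split_ifs with h45
    · have hAn : A' = .nil := by
        rcases h1 with h | h
        · exact h.2
        · exact absurd h45 h.1.ne_zero
      subst hAn
      refine ⟨ω, st1'.setReg, ω, B', ?_⟩
      have eo : evOrd L (s1.setReg 45 (s1 46)) = evOrd L s1 := evOrd_congr ✓ ✓
      refine ⟨ok1.setReg, by simpa using inv.hB, by simpa using inv.hπ, ?_,
        ?_, by simpa [Hp.els] using inv.sum⟩
      · rw [eo]; exact inv.gB
      · rw [eo]; simpa [Hp.els] using inv.gπ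
    · have hBn : B' = .nil := by
        rcases hnil with rfl | h
        · exact absurd inv.hA h45
        · exact h
      subst hBn
      refine ⟨st1'.setReg, ω, A', ?_⟩
      have eo : evOrd L (s1.setReg 67 0) = evOrd L s1 := evOrd_congr ✓ ✓
      refine ⟨ok1.setReg, by simpa using inv.hA, by simpa using inv.hπ, ?_,
        ?_, by simpa [Hp.els] using inv.sum⟩
      · rw [eo]; exact inv.gA
      · rw [eo]; simpa [Hp.els] using inv.gπ
  rintro s2 t2 ⟨st2, ht2, C, inv2⟩
  refine wp_mono (wp_mergeUp π' inv2 hS ω) ?_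
  rintro s3 t3 ⟨st3, ht3, H, inv3⟩
  have st := st2.trans st3
  refine ⟨st, ω, H, inv3.hA, ?_, by simpa [Hp.pathEls] using inv3.sum⟩
  have := inv3.gA
  rwa [evOrd_congr (st.regs 9) (st.regs 14)] at this

lemma Hp.rk_le {B : ℕ → ℕ → Prop} {H : Hp} (hg : H.Good B)
    (hh : H.els.card + 1 < 2 ^ (h + 1)) : H.rk ≤ h := by
  have := Hp.two_pow_rk_le hg
  exact Nat.lt_succ_iff.1 ((Nat.pow_lt_pow_iff_right ω).1 (this.trans_lt hh))

/-- Insert the members of the list in `8` into the heap in `17`, counting them in `18`. -/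
def Prog.insert : Prog :=
  .loop 8 (.load 35 8 ;; .get 36 8 1 ;; .get 8 8 2 ;; .alloc 46 [35, 36, 2, 2, 3] ;;
    .copy 45 17 ;; .merge ;; .copy 17 45 ;; .arith .add 18 18 3)

set_option maxHeartbeats 1000000 in
lemma wp_insert  : ∀ (X : Λ) {s : State} {t : ℕ} {H : Hp}, Ok k s t → s 9 ≤ (str L (s 14)).length →
    PL! s (s 8) X → HAt! s (s 17) H → H.Good (evOrd L s) → H.els.card + X.length + 1 < 2 ^ (h + 1) →
    H.els.card + X.length + 2 ≤ W → s 18 + X.length < W → t + 250 * (h + 3) * X.length + 1 ≤ T → wp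
    W L Prog.insert s t fun s' t' => Step k 35 [8, 17, 18] s t s' t' ∧ t' ≤ t + 250 * (h + 3) *
    X.length + 1 ∧ s' 18 = s 18 + X.length ∧ ∃ H', HAt! s' (s' 17) H' ∧ H'.Good (evOrd L s) ∧ H'.els
    = H.els + (X : Φ) := by
  intro X
  obtain ⟨c, hc⟩ : ∃ c, c = 250 * (h + 3) := ⟨_, rfl⟩
  rw [← hc]
  induction X with
  | nil =>
    intro s t H ok hpos hX hH gH _ _ _ hT
    have h8 : s 8 = 0 := hX
    rw [Prog.insert, wp_loop, if_pos h8]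
    exact ⟨(Step.refl ok).later, ✓, ✓, H, hH, gH, ✓⟩
  | cons x X ih =>
    intro s t H ok hpos hX hH gH hh hW h18 hT
    obtain ⟨hcell, hx1, hx2, hX'⟩ := hX
    simp only [length_cons, Nat.mul_add, Nat.mul_one] at hh hW h18 hT ⊢
    have hal := hw.alloc_le ok ω
    have hlt := hcell.2
    have hfm := ok.fp_mod
    have hfp := ok.fp_pos
    rw [Prog.insert, wp_loop, if_neg hcell.ne_zero]
    simp only [wp_seq, wp_load, wp_get (show (8 : ℕ) ≠ 67 by omega), reg_setReg,
      reduceEqDiff, if_false, mem_setReg, hx1, hx2]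
    refine ⟨ω, ω, ω, ω, ?_⟩
    generalize hs1 : State.setReg _ 8 (s.mem (s 8 + 2)) = s1
    have c1 : Calm 35 [8, 17, 18] s t s1 (t + 1 + 1 + 3 + 3) := by
      rw [← hs1]
      refine Calm.setReg (Calm.setReg (Calm.setReg (Calm.setReg (Calm.setReg (Calm.refl (Nat.le_refl
        t)) ω le_rfl) ω le_rfl) ω le_rfl) ω le_rfl) ✓ ω
    have r8 : s1 8 = s.mem (s 8 + 2) := by rw [← hs1]; simp
    have r17 : s1 17 = s 17 := by rw [← hs1]; simp
    have r18 : s1 18 = s 18 := by rw [← hs1]; simp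
    have r35 : s1 35 = x.1 := by rw [← hs1]; simp
    have r36 : s1 36 = x.2 := by rw [← hs1]; simp
    have f1 : s1 4 = s 4 := by rw [← hs1]; simp
    have ok1 : Ok k s1 (t + 1 + 1 + 3 + 3) := ⟨⟨by rw [← hs1]; simpa using ok.c1,
      by rw [← hs1]; simpa using ok.c2, by rw [← hs1]; simpa using ok.c3,
      by rw [← hs1]; simpa using ok.c33, by rw [← hs1]; simpa using ok.c34⟩,
      by rw [f1]; exact hfm, by rw [f1]; exact hfp, by rw [f1]; have := ok.fp_le; omega⟩
    have st1 : Step k 35 [8, 17, 18] s t s1 (t + 1 + 1 + 3 + 3) := c1.step ok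
    refine wp_alloc ok1.toConsts ω ✓ ✓ ω ?_
    have st2 := st1.alloc (x := 46) (vs := [35, 36, 2, 2, 3]) ω ω ω
      (t'' := t + 1 + 1 + 3 + 3 + 2 * [35, 36, 2, 2, 3].length + 6) ω
    rw [wp_copy st2.ok.c2]
    have h17 := hH.lt ω
    refine ⟨by simp [r17]; omega, ?_⟩
    have st3 := st2.setReg (x := 45) (v := (s1.alloc 46 [35, 36, 2, 2, 3]).reg 17)
      ω ω (Nat.le_add_right _ 1)
    set s3 := (s1.alloc 46 [35, 36, 2, 2, 3]).setReg 45
      ((s1.alloc 46 [35, 36, 2, 2, 3]).reg 17) with hs3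
    have f3 : s3 4 = s 4 + 16 := by rw [hs3]; simp [f1]
    have em : s3.mem = putList s.mem (s 4 + 8) [x.1, x.2, 0, 0, 1] := by
      rw [hs3]; simp [c1.mem, f1, r35, r36, ok1.c2, ok1.c3]
    have hk3 := st3.keep
    have hp3 := st3.fp
    have e39 := st3.regs 9
    have e314 := st3.regs 14
    have eo3 := evOrd_congr (L := L) e39 e314
    have hrk := Hp.rk_le gH (h := h) ω
    have hr1 : Hp.rk (.node x .nil .nil) = 1 := rfl
    refine wp_mono (wp_merge (A := H) (B := .node x .nil .nil) st3.ok (by rwa [e39, e314])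
      ?_ ?_ (by rwa [eo3]) ?_ ?_ ?_) ?_
    · rw [show s3 45 = s 17 by rw [hs3]; simp [r17]]; exact hH.keep hfm hp3 hk3
    · rw [show s3 46 = s 4 + 8 by rw [hs3]; simp [f1], f3]
      refine ⟨isCell_new hfm, ?_, ?_, ?_, ?_, ?_⟩
      · rw [em, putList_zero]
      all_goals rw [em, putList_add ✓]; simp [HAt, Hp.rk]
    · exact ⟨by simp [Hp.els], le_rfl, trivial, trivial⟩
    · simp [Hp.els]; omega
    · rw [hr1]; simp only [length_cons, length_nil]
      linarith [Nat.zero_le (c * X.length)]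
    rintro s4 t4 ⟨st4, ht4, H4, hH4, gH4, eH4⟩
    rw [hr1] at ht4
    simp only [length_cons, length_nil] at ht4
    have e4 : ∀ r < 45, r ≠ 4 → s4 r = s3 r := fun r h h' => st4.regs r h h' ✓
    have h45 := hH4.lt (by have := st4.ok.fp_pos; omega)
    have hal4 := hw.alloc_le st4.ok ω
    rw [wp_copy st4.ok.c2]
    have r418 : s4 18 = s 18 := by rw [e4 18 ω ω, hs3]; simp [r18]
    simp only [wp_arith, eval_add, ifs, reduceEqDiff, r418, st4.ok.c3]
    refine ⟨ω, ω, ?_⟩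
    set s5 := (s4.setReg 17 (s4 45)).setReg 18 (s 18 + 1) with hs5
    have st5 : Step k 35 [8, 17, 18] s t s5 (t4 + 1 + 1) := ((st3.trans (st4.mono)).setReg ✓ ω
      le_rfl).setReg ✓ ω ω
    have hk5 := st5.keep
    have hp5 := st5.fp
    have f5 : s5 4 = s4 4 := by simp [hs5]
    have e59 := st5.regs 9
    have e514 := st5.regs 14
    have eo5 := evOrd_congr (L := L) e59 e514
    have hels : H4.els.card = H.els.card + 1 := by rw [eH4]; simp [Hp.els]
    refine wp_mono (ih (H := H4) st5.ok (by rwa [e59, e514]) ?_ ?_ ?_ ω ω ?_ ω) ?_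
    · rw [show s5 8 = s.mem (s 8 + 2) by
        simp only [hs5, ifs, reduceEqDiff]
        rw [e4 8 ω ω, hs3]; simp [r8]]
      exact hX'.keep hfm hp5 hk5
    · rw [f5, show s5 17 = s4 45 by simp [hs5]]; exact hH4
    · rw [eo5]; rwa [eo3] at gH4
    · simp [hs5]; omega
    rintro s6 t6 ⟨st6, ht6, r6, H6, hH6, gH6, eH6⟩
    refine ⟨st5.trans st6, ω, ?_, H6, hH6, ?_, ?_⟩
    · rw [r6, show s5 18 = s 18 + 1 by simp [hs5]]; omega
    · rwa [eo5] at gH6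
    · rw [eH6, eH4, ← cons_coe]
      simp only [Hp.els, add_zero, add_cons, cons_add]

namespace Prog

/-- Register `39` := the address of the first entry of the list in `16` and the heap in `17`. -/
def top : Prog :=
  copy 55 16 ;; copy 56 17 ;; better ;; ite 65 2 (copy 39 16) (copy 39 17)

/-- Remove the entry in `39` from the list in `16` or the heap in `17`. -/
def popOne : Prog :=
  load 41 39 ;; get 42 39 1 ;; arith .mod 43 58 33 ;;
    ite 43 2 (alloc 20 [41, 42, 20]) (alloc 21 [41, 42, 21]) ;; arith .sub 18 18 3 ;;
    ite 65 2 (get 16 16 2) (get 45 17 2 ;; get 46 17 3 ;; merge ;; copy 17 45)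

/-- Move the entries that leave the reference string up to the position in `38` from the list in
`16` and the heap in `17` to the stacks in `20` and `21`, counting down in `18`. -/
def pop : Prog :=
  const 37 1 ;; loop 37 (top ;; ite 39 2 (const 37 0)
    (load 57 39 ;; key ;; arith .div 40 58 33 ;; ite 40 38 popOne (const 37 0)))

end Prog

/-- The entries of the list `ev` and the heap `H` are in memory. -/
structure EvAt (L : List (List α)) (s : State) (ev : Λ) (H : Hp) : Prop where
  evp : PL! s (s 16) ev
  hpp : HAt! s (s 17) H
  sorted : ev.Pairwise fun x y => evOrd L s x.1 y.1
  good : H.Good (evOrd L s)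

lemma EvAt.calm (h : EvAt L s ev H)
    (hc : Calm B o s t s' t') (hB : 18 ≤ B := by omega)
    (ho : ∀ r ∈ o, r ∉ [4, 9, 14, 16, 17] := by simp) :
    EvAt L s' ev H := by
  have e : ∀ r ∈ [4, 9, 14, 16, 17], s' r = s r := fun r hr =>
    hc.regs r (by simp at hr; omega) fun h => ho r h hr
  have eo := evOrd_congr (L := L) (e 9 ✓) (e 14 ✓)
  obtain ⟨h1, h2, h3, h4⟩ := h
  refine ⟨?_, ?_, by rwa [eo], by rwa [eo]⟩
  · rwa [hc.mem, e 4 ✓, e 16 ✓]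
  · rwa [hc.mem, e 4 ✓, e 17 ✓]

lemma EvAt.step (h : EvAt L s ev H) (ok : Ok k s t)
    (hc : Step k B o s t s' t') (hB : 18 ≤ B := by omega)
    (ho : ∀ r ∈ o, r ∉ [9, 14, 16, 17] := by simp) : EvAt L s' ev H := by
  have e : ∀ r ∈ [9, 14, 16, 17], s' r = s r := fun r hr =>
    hc.regs r (by simp at hr; omega) (by simp at hr; omega) fun h => ho r h hr
  have eo := evOrd_congr (L := L) (e 9 ✓) (e 14 ✓)
  obtain ⟨h1, h2, h3, h4⟩ := h
  refine ⟨?_, ?_, by rwa [eo], by rwa [eo]⟩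
  · rw [e 16 ✓]; exact h1.keep ok.fp_mod hc.fp hc.keep
  · rw [e 17 ✓]; exact h2.keep ok.fp_mod hc.fp hc.keep

lemma PL.cases (h : PL M f p l) :
    p = 0 ∧ l = [] ∨ IsCell f p ∧ ∃ l', l = (M p, M (p + 1)) :: l' ∧ PL M f (M (p + 2)) l' := by
  cases l with
  | nil => exact .inl ⟨h, rfl⟩
  | cons x l =>
    obtain ⟨h1, h2, h3, h4⟩ := h
    exact .inr ⟨h1, l, by rw [h2, h3], h4⟩

lemma PL.lt (h : PL M f p l) (hf : 0 < f) : p < f := by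
  rcases h.cases with h | h
  · omega
  · exact h.1.2

lemma wp_top (ok : Ok k s t) (ht : t ≤ T) (hpos : s 9 ≤ (str L (s 14)).length) (h : EvAt L s ev H)
    (hQ : ∀ s' t', Calm 39 [] s t s' t' → t' ≤ t + 55 → (s' 39 = 0 ∧ ev = [] ∧ H = .nil ∨ IsCell (s
    4) (s' 39) ∧ (∀ y ∈ (ev : Φ) + H.els, evOrd L s (s.mem (s' 39)) y.1) ∧ (s' 65 = 0 ∧ s' 39 = s 16
    ∨ s' 65 = 1 ∧ s' 39 = s 17)) → Q s' t') : wp W L Prog.top s t Q := by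
  have hal := hw.alloc_le ok ht
  have hfp := ok.fp_pos
  have h2 := ok.c2
  have h16 := h.evp.lt ω
  have h17 := h.hpp.lt ω
  rw [Prog.top, wp_seq, wp_copy h2]
  refine ⟨ω, ?_⟩
  rw [wp_seq, wp_copy (by simpa using h2)]
  refine ⟨by simp; omega, ?_⟩
  have c0 : Calm 39 [] s t ((s.setReg 55 (s 16)).setReg 56 (s 17)) (t + 2) := by
    iterate 2 refine Calm.setReg ?_ ω le_rfl
    exact Calm.refl
  refine wp_seq.2 (wp_better (ok.calm c0).toConsts (by simpa using hpos) ?_)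
  intro s1 t1 c1 ht1 h1
  simp only [ifs, reduceEqDiff] at h1
  have c1' : Calm 39 [] s t s1 t1 := c0.trans (c1.mono)
  have e1 := @c1'.regs
  simp only [wp_ite, e1 2, h2, le_zero, wp_copy (show s1 2 = 0 by rw [e1 2, h2]), e1 16, e1 17]
  -- facts on the first entries
  have hev : s 16 ≠ 0 → IsCell (s 4) (s 16) ∧ ∀ y ∈ ev, evOrd L s (s.mem (s 16)) y.1 := fun h16 =>
    by
    obtain ⟨g1, l, rfl, g2⟩ := h.evp.cases.resolve_left fun h => h16 h.1
    refine ⟨g1, fun y hy => ?_⟩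
    rcases mem_cons.1 hy with rfl | hy
    · exact Bef.refl _ _ _ _
    · exact (pairwise_cons.1 h.sorted).1 y hy
  have hev0 : s 16 = 0 → ev = [] := fun h16 => h.evp.eq_zero_iff.1 h16
  have hhp : s 17 ≠ 0 → IsCell (s 4) (s 17) ∧ ∀ y ∈ H.els, evOrd L s (s.mem (s 17)) y.1 := fun h17
    => by
    obtain ⟨g1, l, r, e, g2⟩ := h.hpp.cases.resolve_left fun h => h17 h.1
    refine ⟨g1, fun y hy => ?_⟩
    have := h.good
    rw [e] at this hy
    rcases Multiset.mem_cons.1 hy with rfl | hy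
    · exact Bef.refl _ _ _ _
    · exact this.1 y hy
  have hhp0 : s 17 = 0 → H = .nil := fun h17 => by
    rcases h.hpp.cases with h | h
    · exact h.2
    · exact absurd h17 h.1.ne_zero
  rcases h1 with ⟨h65, hne, h1⟩ | ⟨h65, h1⟩
  · rw [if_pos h65]
    refine ⟨ω, hQ _ _ (c1'.setReg) ω (.inr ?_)⟩
    simp only [ifs]
    refine ⟨(hev hne).1, fun y hy => ?_, .inl ⟨by simpa using h65, trivial⟩⟩
    rcases mem_add.1 hy with hy | hy
    · exact (hev hne).2 y hy
    · by_cases h17 : s 17 = 0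
      · rw [hhp0 h17] at hy; simp [Hp.els] at hy
      · exact Bef.trans L (h1 h17) ((hhp h17).2 y hy)
  · rw [if_neg ω]
    refine ⟨ω, hQ _ _ (c1'.setReg) ω ?_⟩
    simp only [ifs]
    by_cases h17 : s 17 = 0
    · left
      exact ⟨h17, hev0 (by by_contra h; exact (h1 h).1 h17), hhp0 h17⟩
    · right
      refine ⟨(hhp h17).1, fun y hy => ?_, .inr ⟨by simpa using h65, trivial⟩⟩
      rcases mem_add.1 hy with hy | hy
      · by_cases h16 : s 16 = 0
        · rw [hev0 h16] at hy; simp at hy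
        · exact Bef.trans L (h1 h16).2 ((hev h16).2 y hy)
      · exact (hhp h17).2 y hy

/-- The strings smaller than the reference string. -/
def isLeft (L : List (List α)) (s : State) (x : ℕ × ℕ) : Bool :=
  key L (s 14) (s 9) x.1 % 2 = 0

lemma isLeft_congr (h9 : s' 9 = s 9) (h14 : s' 14 = s 14) : isLeft L s' = isLeft L s := by
  funext x; rw [isLeft, isLeft, h9, h14]

lemma PL.alloc {r1 r2 r3 : ℕ} (hl : PL! s p l) (ok : Ok k s t) (hr : s r3 = p) : PL (s.alloc x [r1,
    r2, r3]).mem (s 4 + 16) (s 4 + 8) ((s r1, s r2) :: l) := by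
  have hfm := ok.fp_mod
  have h2 : (s.alloc x [r1, r2, r3]).mem (s 4 + 8 + 2) = p := by
    rw [mem_alloc, putList_add ✓]; simpa using hr
  refine ⟨isCell_new hfm, ?_, ?_, ?_⟩
  · rw [mem_alloc, map_cons, putList_zero]
  · rw [mem_alloc, putList_add ✓]; simp
  · rw [h2]
    exact hl.keep hfm ω fun a ha _ => by rw [mem_alloc, putList_of_lt ω]

lemma PL.step (hl : PL! s p l) (ok : Ok k s t) (h : Step k B o s t s' t') : PL! s' p l :=
  hl.keep ok.fp_mod h.fp h.keep

/-- One entry is removed. -/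
structure OnePopped (L : List (List α)) (h : ℕ) (s : State) (t : ℕ) (ev : Λ) (H : Hp)
    (ls rs : Λ) (s' : State) (t' : ℕ) (x : ℕ × ℕ) (ev' : Λ) (H' : Hp) :
    Prop where
  evAt : EvAt L s' ev' H'
  cases : ev = x :: ev' ∧ H' = H ∧ t' ≤ t + 60 ∨
    ev = ev' ∧ H.els = x ::ₘ H'.els ∧ t' ≤ t + 60 + 250 * (2 * h + 1)
  left : PL! s' (s' 20) (if isLeft L s x then x :: ls else ls)
  right : PL! s' (s' 21) (if isLeft L s x then rs else x :: rs)
  count : s' 18 = s 18 - 1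

set_option maxHeartbeats 1000000 in
lemma wp_popOne (ok : Ok k s t) (hpos : s 9 ≤ (str L (s 14)).length) {ls rs : Λ} (he : EvAt L s ev
    H) (hc : IsCell (s 4) (s 39)) (h65 : s 65 = 0 ∧ s 39 = s 16 ∨ s 65 = 1 ∧ s 39 = s 17) (h58 : s
    58 = key L (s 14) (s 9) (s.mem (s 39))) (hls : PL! s (s 20) ls) (hrs : PL! s (s 21) rs) (hh :
    H.els.card + 1 < 2 ^ (h + 1)) (hHW : H.els.card + 2 ≤ W) (h18 : s 18 < W) (hT : t + 60 + 250 *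
    (2 * h + 1) ≤ T) : wp W L Prog.popOne s t fun s' t' => Step k 39 [16, 17, 18, 20, 21] s t s' t'
    ∧ ∃ ev' H', OnePopped L h s t ev H ls rs s' t' (s.mem (s 39), s.mem (s 39 + 1)) ev' H' := by
  have hal := hw.alloc_le ok ω
  have hlt := hc.2
  have hfm := ok.fp_mod
  have hfp := ok.fp_pos
  simp only [Prog.popOne, wp_seq, wp_load, wp_get (show (39 : ℕ) ≠ 67 by omega), reg_setReg,
    reduceEqDiff, if_false, mem_setReg, wp_arith, eval_mod, h58, ok.c33]
  refine ⟨ω, ω, ω, ?_⟩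
  set x : ℕ × ℕ := (s.mem (s 39), s.mem (s 39 + 1)) with hx
  generalize hs1 : State.setReg _ 43 _ = s1
  have c1 : Calm 39 [] s t s1 (t + 1 + 3 + 1) := by
    rw [← hs1]
    iterate 4 refine Calm.setReg ?_ ω le_rfl
    exact Calm.refl
  have ok1 := ok.calm c1
  have e1 := @c1.regs
  have r41 : s1 41 = x.1 := by rw [← hs1]; simp [hx]
  have r42 : s1 42 = x.2 := by rw [← hs1]; simp [hx]
  have r43 : s1 43 = if isLeft L s x then 0 else 1 := by
    rw [← hs1]
    simp only [ifs, isLeft, hx, decide_eq_true_eq]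
    rw [key_mod]; split_ifs <;> simp_all
  have r65 : s1 65 = s 65 := by rw [← hs1]; simp
  have m1 : s1.mem = s.mem := c1.mem
  have pls1 : PL! s1 (s1 20) ls := by rwa [m1, e1 4, e1 20]
  have prs1 : PL! s1 (s1 21) rs := by rwa [m1, e1 4, e1 21]
  -- push to one of the stacks
  refine wp_mono (Q := fun s2 t2 => Step k 39 [20, 21] s t s2 t2 ∧ t2 ≤ t + 20 ∧ s2 65 = s 65 ∧ PL!
    s2 (s2 20) (if isLeft L s x then x :: ls else ls) ∧ PL! s2 (s2 21) (if isLeft L s x then rs else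
    x :: rs)) ?_ ?_
  · have st1' : Step k 39 [20, 21] s t s1 (t + 1 + 3 + 1) := (c1.step ok).mono
    simp only [wp_ite, r43, ok1.c2]
    have e4 := e1 4
    cases hL : isLeft L s x with
    | true =>
      simp only [if_true, le_refl]
      refine wp_alloc ok1.toConsts ω ✓ ✓ ω ?_
      refine ⟨st1'.alloc, ✓, by simp [r65], ?_, ?_⟩
      · have := pls1.alloc ok1 (x := 20) (r1 := 41) (r2 := 42) rfl
        rw [r41, r42] at this
        simpa using this
      · have := prs1.step ok1 ((Step.refl (B := 39) (o := [20]) ok1).alloc (x := 20)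
          (vs := [41, 42, 20]) ω ✓ ω le_rfl)
        simpa using this
    | false =>
      simp only [Bool.false_eq_true, if_false, show ¬ (1 : ℕ) ≤ 0 by omega]
      refine wp_alloc ok1.toConsts ω ✓ ✓ ω ?_
      refine ⟨st1'.alloc, ✓, by simp [r65], ?_, ?_⟩
      · have := pls1.step ok1 ((Step.refl (B := 39) (o := [21]) ok1).alloc (x := 21)
          (vs := [41, 42, 21]) ω ✓ ω le_rfl)
        simpa using this
      · have := prs1.alloc ok1 (x := 21) (r1 := 41) (r2 := 42) rfl
        rw [r41, r42] at this
        simpa using this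
  rintro s2 t2 ⟨st2, ht2, r265, pls2, prs2⟩
  have ok2 := st2.ok
  have htt := st2.time
  have r218 : s2 18 = s 18 := st2.regs 18
  have st2' : Step k 39 [16, 17, 18, 20, 21] s t s2 t2 := st2.mono
  simp only [eval_sub, r218, ok2.c3, wp_ite, reg_setReg, reduceEqDiff, if_false, r265, ok2.c2,
    wp_seq, wp_get (show (16 : ℕ) ≠ 67 by omega), wp_get (show (17 : ℕ) ≠ 67 by omega), mem_setReg]
  refine ⟨ω, ?_⟩
  have r216 : s2 16 = s 16 := st2.regs 16
  have r217 : s2 17 = s 17 := st2.regs 17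
  have em2 : ∀ i < 8, s2.mem (s 39 + i) = s.mem (s 39 + i) := fun i hi => hc.keep hfm st2.keep hi
  rcases h65 with ⟨h65, h39⟩ | ⟨h65, h39⟩
  · rw [if_pos ω, r216, ← h39]
    refine ⟨ω, ω, ?_⟩
    generalize hs3 : State.setReg _ 16 _ = s3
    have st3 : Step k 39 [16, 17, 18, 20, 21] s t s3 (t2 + 1 + 1 + 3) := by
      rw [← hs3]
      iterate 3 refine Step.setReg ?_ ✓ ω le_rfl
      exact st2'.later
    have c3 : Calm 39 [16, 17, 18, 67] s2 t2 s3 (t2 + 1 + 1 + 3) := by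
      rw [← hs3]
      iterate 3 refine Calm.setReg ?_ ✓ le_rfl
      exact Calm.refl
    obtain ⟨-, l, el, hl⟩ := he.evp.cases.resolve_left fun h => by have := hc.ne_zero; omega
    rw [← h39] at el hl
    have f3 := c3.regs 4
    refine ⟨st3, l, H, ⟨?_, .inl ⟨el, rfl, ω⟩, ?_, ?_, ?_⟩⟩
    · have eo := evOrd_congr (L := L) (st3.regs 9) (st3.regs 14)
      refine ⟨?_, ?_, ?_, ?_⟩
      · rw [show s3 16 = s.mem (s 39 + 2) by rw [← hs3]; simp [em2]]
        exact hl.step ok st3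
      · rw [show s3 17 = s 17 by rw [← hs3]; simp [r217]]
        exact he.hpp.keep hfm st3.fp st3.keep
      · rw [eo]; have := he.sorted; rw [el] at this; exact (pairwise_cons.1 this).2
      · rw [eo]; exact he.good
    · rw [c3.mem, f3, c3.regs 20]; exact pls2
    · rw [c3.mem, f3, c3.regs 21]; exact prs2
    · rw [← hs3]; simp
  · rw [if_neg ω, r217, ← h39]
    refine ⟨ω, ω, ω, ω, ?_⟩
    generalize hs3 : State.setReg _ 46 _ = s3
    have c3 : Calm 39 [18] s2 t2 s3 (t2 + 1 + 1 + 3 + 3) := by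
      rw [← hs3]
      iterate 5 refine Calm.setReg ?_ ✓ le_rfl
      exact Calm.refl
    have st3 : Step k 39 [18, 20, 21] s t s3 (t2 + 1 + 1 + 3 + 3) :=
      (st2.mono).trans ((c3.step ok2).mono)
    obtain ⟨-, l, r, el, hl, hr, -⟩ := he.hpp.cases.resolve_left fun h => by
      have := hc.ne_zero; omega
    rw [← h39] at el hl hr
    have eo3 := evOrd_congr (L := L) (st3.regs 9) (st3.regs 14)
    have gH := he.good
    have eH : H.els = x ::ₘ (l.els + r.els) := by rw [el]; rfl
    have hcard : H.els.card = l.els.card + r.els.card + 1 := by rw [eH]; simp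
    rw [el] at gH
    have hrl := Hp.rk_le gH.2.2.1 (h := h) ω
    have hrr := Hp.rk_le gH.2.2.2 (h := h) ω
    have hcost : 250 * (l.rk + r.rk + 1) ≤ 250 * (2 * h + 1) := Nat.mul_le_mul_left _ ω
    refine wp_mono (wp_merge (A := l) (B := r) st3.ok ?_ ?_ ?_ (by rw [eo3]; exact gH.2.2.1)
      (by rw [eo3]; exact gH.2.2.2) ✦ (by linarith)) ?_
    · rw [st3.regs 9, st3.regs 14]
      exact hpos
    · rw [show s3 45 = s.mem (s 39 + 2) by rw [← hs3]; simp [em2]]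
      exact hl.keep hfm st3.fp st3.keep
    · rw [show s3 46 = s.mem (s 39 + 3) by rw [← hs3]; simp [em2]]
      exact hr.keep hfm st3.fp st3.keep
    rintro s4 t4 ⟨st4, ht4, H', hH', gH', eH'⟩
    rw [wp_copy st4.ok.c2]
    have hfp4 := st4.ok.fp_pos
    have h45 := hH'.lt ω
    have hal4 := hw.alloc_le st4.ok ω
    refine ⟨ω, ?_⟩
    set s5 := s4.setReg 17 (s4 45) with hs5
    have st35 : Step k 39 [17] s3 (t2 + 1 + 1 + 3 + 3) s5 (t4 + 1) := (st4.mono).setReg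
    have st5 : Step k 39 [16, 17, 18, 20, 21] s t s5 (t4 + 1) := (st3.mono).trans (st35.mono)
    have eo5 := evOrd_congr (L := L) (st5.regs 9) (st5.regs 14)
    refine ⟨st5, ev, H', ⟨⟨?_, ?_, by rw [eo5]; exact he.sorted, ?_⟩,
      .inr ⟨rfl, by rw [eH', eH], ω⟩, ?_, ?_, ?_⟩⟩
    · rw [st35.regs 16, st3.regs 16]
      exact he.evp.step ok st5
    · simpa [hs5] using hH'
    · rw [eo5, ← eo3]; exact gH'
    · rw [st35.regs 20]
      refine PL.step ?_ st3.ok st35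
      rw [c3.mem, c3.regs 4, c3.regs 20]; exact pls2
    · rw [st35.regs 21]
      refine PL.step ?_ st3.ok st35
      rw [c3.mem, c3.regs 4, c3.regs 21]; exact prs2
    · rw [hs5]; simp [st4.regs 18]; rw [← hs3]; simp

/-- The entries `pp` are removed, in this order. -/
structure Popped (L : List (List α)) (s : State) (ev : Λ) (H : Hp)
    (ls rs : Λ) (s' : State) (pp ev1 ev2 : Λ) (Pm : Φ)
    (H' : Hp) : Prop where
  evAt : EvAt L s' ev2 H'
  ev_eq : ev = ev1 ++ ev2
  hp_eq : H.els = Pm + H'.els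
  pp_eq : (pp : Φ) = ev1 + Pm
  sorted : pp.Pairwise fun x y => evOrd L s x.1 y.1
  key_le : ∀ x ∈ pp, key L (s 14) (s 9) x.1 / 2 ≤ s 38
  lt_key : ∀ x ∈ (ev2 : Φ) + H'.els, s 38 < key L (s 14) (s 9) x.1 / 2
  left : PL! s' (s' 20) ((pp.filter (isLeft L s)).reverse ++ ls)
  right : PL! s' (s' 21) ((pp.filter fun x => !isLeft L s x).reverse ++ rs)
  count : s' 18 = s 18 - pp.length

set_option maxHeartbeats 1000000 in
lemma wp_pop_loop (n : ℕ) : ∀ {s : State} {t : ℕ} {ev ls rs : Λ} {H : Hp}, ev.length + H.els.card ≤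
    n → s 37 = 1 → Ok k s t → s 9 ≤ (str L (s 14)).length → EvAt L s ev H → PL! s (s 20) ls → PL! s
    (s 21) rs → H.els.card + 1 < 2 ^ (h + 1) → H.els.card + 2 ≤ W → s 18 < W → t + 150 * ev.length +
    500 * (h + 1) * H.els.card + 500 * (h + 1) ≤ T → wp W L (.loop 37 (.top ;; .ite 39 2 (.const 37
    0) (.load 57 39 ;; .key ;; .arith .div 40 58 33 ;; .ite 40 38 .popOne (.const 37 0)))) s t
    fun s' t' => Step k 37 [16, 17, 18, 20, 21] s t s' t' ∧ ∃ pp ev1 ev2 Pm H', Popped L s ev H ls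
    rs s' pp ev1 ev2 Pm H' ∧ t' + 150 * ev2.length + 500 * (h + 1) * H'.els.card ≤ t + 150 *
    ev.length + 500 * (h + 1) * H.els.card + 100 := by
  obtain ⟨c, hc⟩ : ∃ c, c = 500 * (h + 1) := ⟨_, rfl⟩
  rw [← hc]
  induction n using Nat.strong_induction_on with | _ n ih =>
  intro s t ev ls rs H hn h37 ok hpos he hls hrs hh hHW h18 hT
  have hbW := hw.budget
  have hc500 : 500 ≤ c := ω
  have hfp := ok.fp_pos
  rw [wp_loop, if_neg ω, wp_seq]
  refine wp_top (ok.later (Nat.le_add_right t 1)) ω hpos he ?_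
  intro s1 t1 c1 ht1 htop
  have hdone : ∀ s' t', Calm 37 [] s t s' t' → t' + 1 ≤ t + 100 → s' 37 = 0 → (∀ x ∈ (ev : Φ) +
    H.els, s 38 < key L (s 14) (s 9) x.1 / 2) → Step k 37 [16, 17, 18, 20, 21] s t s' (t' + 1) ∧ ∃
    pp ev1 ev2 Pm H', Popped L s ev H ls rs s' pp ev1 ev2 Pm H' ∧ t' + 1 + 150 * ev2.length + c *
    H'.els.card ≤ t + 150 * ev.length + c * H.els.card + 100 := by
    intro s' t' hc' ht' _ hall
    have e := @hc'.regs
    refine ⟨((hc'.step ok).mono).later, [], [], ev, 0, H, ⟨he.calm hc', rfl, ✓, ✓, ✓, ✓, hall, ?_,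
      ?_, by simp [e]⟩, ω⟩
    · simpa [e, hc'.mem] using hls
    · simpa [e, hc'.mem] using hrs
  have e1 := @c1.regs
  have tt1 := c1.time
  have c1' : Calm 39 [] s t s1 t1 := ⟨@c1.regs, c1.mem, ω⟩
  have ok1 := ok.calm c1'
  simp only [wp_ite, e1 2, ok.c2, le_zero, wp_const, wp_seq, wp_load, c1.mem]
  split_ifs with h39
  · refine ⟨ω, ?_⟩
    have hnil : ev = [] ∧ H = .nil := by
      rcases htop with h | h
      · exact h.2
      · exact absurd h39 h.1.ne_zero
    rw [wp_loop, if_pos ✓]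
    refine hdone _ _ ((c1'.mono).setReg) ω ✓ ?_
    rw [hnil.1, hnil.2]; simp [Hp.els]
  obtain ⟨hcell, hmin, hwh⟩ := htop.resolve_left fun h => h39 h.1
  refine wp_key (ok1.setReg (t' := t1) ω le_rfl).toConsts (by simpa [e1] using hpos) ?_
  intro s2 t2 c2 ht2 f2 k2
  simp only [ifs, reduceEqDiff, e1 14, e1 9] at k2
  set i := s.mem (s1 39) with hi
  have c2' : Calm 57 [] s1 t1 s2 t2 := by
    have := c2.time
    refine ⟨fun r hr _ => ?_, c2.mem, ω⟩
    rw [c2.regs r, reg_setReg, if_neg ω]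
  have c12 : Calm 39 [] s t s2 t2 := c1'.trans ((c2'.mono))
  have e2 := @c12.regs
  have hk := hw.key_lt (i := i) hpos
  simp only [wp_arith, eval_div, k2, e2 33, ok.c33, ifs, reduceEqDiff, e2 38]
  refine ⟨ω, ?_⟩
  set s3 := s2.setReg 40 (key L (s 14) (s 9) i / 2) with hs3
  have c3 : Calm 39 [] s t s3 (t2 + 1 + 1) := c12.setReg
  have e3 := @c3.regs
  have r339 : s3 39 = s1 39 := by rw [hs3, reg_setReg, if_neg ω, c2'.regs 39]
  have r365 : s3 65 = s1 65 := by rw [hs3, reg_setReg, if_neg ω, f2 65 ω ω ω, reg_setReg, if_neg ω]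
  have m3 : s3.mem = s.mem := c3.mem
  have ok3 := ok.calm c3
  have he3 := he.calm c3
  have il := isLeft_congr (L := L) (e3 9) (e3 14)
  have eo3 := evOrd_congr (L := L) (e3 9) (e3 14)
  split_ifs with hle
  · -- one entry is removed, and the loop continues
    by_cases hne : ev.length + H.els.card = 0
    · exfalso
      have hev : ev = [] := List.eq_nil_of_length_eq_zero ω
      have hH : H.els = 0 := Multiset.card_eq_zero.1 ω
      rcases hwh with ⟨-, h⟩ | ⟨-, h⟩
      · exact h39 (h.trans (he.evp.eq_zero_iff.2 hev))
      · rcases he.hpp.cases with ⟨h0, -⟩ | ⟨-, l, r, h0, -⟩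
        · exact h39 (h.trans h0)
        · rw [h0] at hH; simp [Hp.els] at hH
    have hcH : 0 < H.els.card → c ≤ c * H.els.card := fun h => Nat.le_mul_of_pos_right _ h
    refine wp_mono (wp_popOne (h := h) ok3 (by rwa [e3 9, e3 14]) he3
      ?_ ?_ ?_ (ls := ls) (rs := rs) ?_ ?_ hh hHW ?_ ?_) ?_
    · rw [e3 4, r339]; exact hcell
    · rw [r365, r339, e3 16, e3 17]; exact hwh
    · rw [r339, m3, e3 9, e3 14, hs3, reg_setReg, if_neg ω, k2]
    · rwa [m3, e3 4, e3 20]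
    · rwa [m3, e3 4, e3 21]
    · rwa [e3 18]
    · have := Nat.zero_le (c * H.els.card)
      rw [hc] at hT this
      linarith
    rintro s4 t4 ⟨st4, ev', H', pop⟩
    rw [r339, m3] at pop
    set x : ℕ × ℕ := (s.mem (s1 39), s.mem (s1 39 + 1)) with hx
    have st04 : Step k 37 [16, 17, 18, 20, 21] s t s4 t4 := ((c3.step ok).mono).trans (st4.mono)
    have e49 : s4 9 = s 9 := st04.regs 9
    have e414 : s4 14 = s 14 := st04.regs 14
    have e438 : s4 38 = s 38 := by rw [st4.regs 38, e3 38]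
    have e437 : s4 37 = 1 := by rw [st4.regs 37, e3 37, h37]
    have eo4 := evOrd_congr (L := L) e49 e414
    have il4 := isLeft_congr (L := L) e49 e414
    have hcnt := pop.count
    rw [e3 18] at hcnt
    have hpl := pop.left
    have hpr := pop.right
    rw [il] at hpl hpr
    -- bookkeeping for the rest
    have hsub : (ev : Φ) + H.els = x ::ₘ ((ev' : Φ) + H'.els) := by
      rcases pop.cases with ⟨h1, h2, -⟩ | ⟨h1, h2, -⟩
      · rw [h1, h2, ← cons_coe, cons_add]
      · rw [h1, h2, add_cons]
    have hlen : ev'.length + H'.els.card + 1 = ev.length + H.els.card := by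
      have := congrArg card hsub; simp at this; omega
    have htime : t4 + 150 * ev'.length + c * H'.els.card ≤ t + 150 * ev.length + c * H.els.card :=
      by
      rcases pop.cases with ⟨h1, h2, h3⟩ | ⟨h1, h2, h3⟩
      · rw [h1, h2, length_cons]; omega
      · rw [h1, h2, card_cons, Nat.mul_succ]
        have : 250 * (2 * h + 1) + 250 = c := by rw [hc]; ring
        omega
    have hHle : H'.els.card ≤ H.els.card := by
      rcases pop.cases with ⟨h1, h2, h3⟩ | ⟨h1, h2, h3⟩
      · rw [h2]
      · rw [h2]; simp
    refine wp_mono (ih (n - 1) ω ω e437 st04.ok (by rwa [e49, e414]) pop.evAt hpl hpr ω ω ω ω) ?_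
    rintro s5 t5 ⟨st5, pp, ev1, ev2, Pm, H'', P, ht5⟩
    have hev1 := P.ev_eq
    have hh1 := P.hp_eq
    have hp1 := P.pp_eq
    have hl := P.left
    have hr := P.right
    rw [il4] at hl hr
    have hmem : ∀ y ∈ pp, y ∈ (ev : Φ) + H.els := fun y hy => by
      rw [hsub, hev1, hh1, ← coe_add]
      have : y ∈ (pp : Φ) := hy
      rw [hp1] at this
      simp only [Multiset.mem_cons, mem_add] at this ⊢
      tauto
    have hsorted := P.sorted
    have hkl := P.key_le
    have hlk := P.lt_key
    rw [eo4] at hsorted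
    rw [e49, e414, e438] at hkl hlk
    refine ⟨st04.trans st5, ?_⟩
    have main : ∀ ev1' Pm', ev = ev1' ++ ev2 → H.els = Pm' + H''.els → (x ::ₘ (pp : Φ)) = ev1' + Pm'
      → Popped L s ev H ls rs s5 (x :: pp) ev1' ev2 Pm' H'' := fun ev1' Pm' g1 g2 g3 => by
      refine ⟨P.evAt, g1, g2, by rw [← g3]; rfl, ?_, ?_, hlk, ?_, ?_, ?_⟩
      · exact pairwise_cons.2 ⟨fun y hy => hmin y (hmem y hy), hsorted⟩
      · intro y hy
        rcases mem_cons.1 hy with rfl | hy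
        · exact hle
        · exact hkl y hy
      · cases hb : isLeft L s x <;> simp [hb] at hl ⊢ <;> exact hl
      · cases hb : isLeft L s x <;> simp [hb] at hr ⊢ <;> exact hr
      · rw [P.count, hcnt, length_cons]; omega
    rcases pop.cases with ⟨h1, h2, h3⟩ | ⟨h1, h2, h3⟩
    · refine ⟨x :: pp, x :: ev1, ev2, Pm, H'', main _ _ ?_ ?_ ?_, ω⟩
      · rw [h1, hev1]; rfl
      · rw [← h2, hh1]
      · rw [hp1, ← cons_coe, cons_add]
    · refine ⟨x :: pp, ev1, ev2, x ::ₘ Pm, H'', main _ _ ?_ ?_ ?_, ω⟩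
      · rw [h1, hev1]
      · rw [h2, hh1, cons_add]
      · rw [hp1, add_cons]
  · refine ⟨ω, ?_⟩
    rw [wp_loop, if_pos ✓]
    refine hdone _ _ ((c3.mono).setReg) ω ✓ ?_
    intro y hy
    have h1 := Bef.key_le L (hmin y hy)
    have : key L (s 14) (s 9) i / 2 ≤ key L (s 14) (s 9) y.1 / 2 := Nat.div_le_div_right h1
    omega

lemma wp_pop (ok : Ok k s t) (hpos : s 9 ≤ (str L (s 14)).length) (he : EvAt L s ev H) (hls : s 20 =
    0) (hrs : s 21 = 0) (hh : H.els.card + 1 < 2 ^ (h + 1)) (hHW : H.els.card + 2 ≤ W) (h18 : s 18 <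
    W) (hT : t + 150 * ev.length + 500 * (h + 1) * H.els.card + 500 * (h + 1) + 1 ≤ T) : wp W L .pop
    s t fun s' t' => Step k 37 [16, 17, 18, 20, 21] s t s' t' ∧ ∃ pp ev1 ev2 Pm H', Popped L s ev H
    [] [] s' pp ev1 ev2 Pm H' ∧ t' + 150 * ev2.length + 500 * (h + 1) * H'.els.card ≤ t + 150 *
    ev.length + 500 * (h + 1) * H.els.card + 101 := by
  rw [Prog.pop, wp_seq, wp_const]
  refine ⟨ω, ?_⟩
  have c1 : Calm 37 [] s t (s.setReg 37 1) (t + 1) := (Calm.refl (Nat.le_refl t)).setReg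
  refine wp_mono (wp_pop_loop (h := h) _ le_rfl ✓ (ok.calm c1) (by simpa using hpos) (he.calm c1)
    (ls := []) (rs := []) (by simpa [PL] using hls) (by simpa [PL] using hrs) hh hHW
    (by simpa using h18) (by linarith)) ?_
  rintro s' t' ⟨st, pp, ev1, ev2, Pm, H', P, ht⟩
  refine ⟨((c1.step ok).mono).trans st, pp, ev1, ev2, Pm, H', ?_, by linarith⟩
  obtain ⟨h1, h2, h3, h4, h5, h6, h7, h8, h9, h10⟩ := P
  have eo := evOrd_congr (L := L) (s' := s.setReg 37 1) (s := s) ✓ ✓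
  have il := isLeft_congr (L := L) (s' := s.setReg 37 1) (s := s) ✓ ✓
  rw [il] at h8 h9
  rw [eo] at h5
  exact ⟨h1, h2, h3, h4, h5, by simpa using h6, by simpa using h7, h8, h9, by simpa using h10⟩

namespace Prog

/-- Move the first entry of the list in `x` to the front of the list in `y`. -/
def shift (x y : ℕ) : Prog := load 41 x ;; get 42 x 1 ;; get x x 2 ;; alloc y [41, 42, y]

/-- Move all entries of the list in `x` to the list in `y`, in reverse order. -/
def move (x y : ℕ) : Prog := loop x (shift x y)

end Prog

lemma wp_shift (ok : Ok k s t) (ht : t + 20 ≤ T) (hx : 4 < x ∧ x < 33) (hy : 4 < y ∧ y < 33) (hxy :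
    x ≠ y) {e : ℕ × ℕ} {m : Λ} (hl : PL! s (s x) (e :: l)) (hm : PL! s (s y) m) : wp W L (.shift x
    y) s t fun s' t' => Step k 41 [x, y] s t s' t' ∧ t' ≤ t + 20 ∧ PL! s' (s' x) l ∧ PL! s' (s' y)
    (e :: m) := by
  have hal := hw.alloc_le ok ω
  obtain ⟨hc, h1, h2, h3⟩ := hl
  have hlt := hc.2
  simp only [Prog.shift, wp_seq, wp_load, wp_get (show x ≠ 67 by omega), reg_setReg,
    if_neg (show x ≠ 41 by omega), if_neg (show x ≠ 67 by omega), if_neg (show x ≠ 42 by omega),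
    mem_setReg, h1, h2]
  refine ⟨ω, ω, ω, ω, ?_⟩
  generalize hs1 : State.setReg _ x (s.mem (s x + 2)) = s1
  have c1 : Calm 41 [x] s t s1 (t + 1 + 3 + 3) := by
    rw [← hs1]
    iterate 5 refine Calm.setReg ?_ ✓ le_rfl
    exact Calm.refl
  have ok1 := ok.calm c1 ω ✦
  have f4 := c1.regs 4 ω ✦
  have fy := c1.regs y ω ✦
  have st1 := c1.step ok ω ✦
  refine wp_alloc ok1.toConsts ω ✦ ✓ ω ?_
  have st2 : Step k 41 [x, y] s t (s1.alloc y [41, 42, y]) (t + 1 + 3 + 3 + 2 * [41, 42, y].length +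
    6) := (st1.mono).alloc
  refine ⟨st2, ✓, ?_, ?_⟩
  · rw [show (s1.alloc y [41, 42, y]).reg x = s.mem (s x + 2) by
      rw [reg_alloc, if_neg ω, if_neg ω, if_neg ω, if_neg ω, ← hs1]; simp]
    exact h3.step ok st2
  · have hm1 : PL! s1 (s1 y) m := by rwa [c1.mem, f4, fy]
    have := hm1.alloc ok1 (x := y) (r1 := 41) (r2 := 42) rfl
    rw [show s1 41 = e.1 by
        rw [← hs1]; simp [show (41 : ℕ) ≠ x by omega],
      show s1 42 = e.2 by rw [← hs1]; simp [show (42 : ℕ) ≠ x by omega]] at this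
    simpa [show y ≠ 4 by omega] using this

lemma wp_move (hx : 4 < x ∧ x < 33) (hy : 4 < y ∧ y < 33)
    (hxy : x ≠ y) : ∀ (l : Λ) {m : Λ} {s : State} {t : ℕ}, Ok k s t →
    PL! s (s x) l → PL! s (s y) m →
    t + 21 * l.length + 1 ≤ T →
    wp W L (.move x y) s t fun s' t' => Step k 41 [x, y] s t s' t' ∧ t' ≤ t + 21 * l.length + 1 ∧
      s' x = 0 ∧ PL! s' (s' y) (l.reverse ++ m)
  | [], m, s, t, ok, hl, hm, hT => by
    have h0 : s x = 0 := hl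
    rw [Prog.move, wp_loop, if_pos h0]
    exact ⟨(Step.refl ok).later, ✓, h0, by simpa using hm⟩
  | e :: l, m, s, t, ok, hl, hm, hT => by
    rw [length_cons] at hT
    rw [Prog.move, wp_loop, if_neg (hl.1.ne_zero)]
    refine wp_mono (wp_shift (ok.later (Nat.le_add_right t 1)) ω hx hy hxy hl hm) ?_
    rintro s1 t1 ⟨st1, ht1, hl1, hm1⟩
    refine wp_mono (wp_move hx hy hxy l st1.ok hl1 hm1 ω) ?_
    rintro s2 t2 ⟨st2, ht2, h2, hm2⟩
    refine ⟨(((Step.refl ok).later (Nat.le_add_right t 1)).trans st1).trans st2, ?_, h2, ?_⟩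
    · rw [length_cons]; omega
    · simpa using hm2

/-! ### Grouping by letter -/

/-- A linked list of lists with their lengths. -/
def GrpL (M : ℕ → ℕ) (f : ℕ) : ℕ → List Λ → Prop
  | p, [] => p = 0
  | p, g :: gs => IsCell f p ∧ PL M f (M p) g ∧ GrpL M f (M (p + 1)) gs ∧ M (p + 2) = g.length

/-- In the memory of a state. -/
notation:max "GrpL!" s:max => GrpL (State.mem s) (State.reg s 4)

lemma GrpL.keep (hf : f % 16 = 0) (hff : f ≤ f') (hk : Keep f M M') :
    ∀ {l : List Λ} {p : ℕ}, GrpL M f p l → GrpL M' f' p l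
  | [], _, h => h
  | x :: l, p, ⟨h1, h2, h3, h4⟩ => by
    refine ⟨h1.mono hff, ?_, ?_, ?_⟩
    · rw [show M' p = M p from h1.keep (i := 0) hf hk ω]; exact h2.keep hf hff hk
    · rw [h1.keep hf hk ω]; exact h3.keep hf hff hk
    · rw [← h4]; exact h1.keep hf hk ω

lemma GrpL.step {l : List Λ} (hl : GrpL! s p l)
    (ok : Ok k s t) (h : Step k B o s t s' t') : GrpL! s' p l :=
  hl.keep ok.fp_mod h.fp h.keep

/-- The letters of the strings `i` and `j` at position `q` exist and are the same. -/
def Same (L : List (List α)) (q i j : ℕ) : Prop := lc L q i j ≠ 0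

lemma same_iff  : Same L q i j ↔ (str L i)[q]? ≠ none ∧ (str L i)[q]? = (str L j)[q]? := by
  unfold Same lc
  rw [← Nat.add_zero q, ← List.getElem?_drop, ← List.getElem?_drop, Nat.add_zero]
  generalize (str L i).drop q = U
  generalize (str L j).drop q = V
  cases U with
  | nil => simp
  | cons a U =>
    cases V with
    | nil => simp
    | cons b V => rw [cp_cons]; split_ifs with h <;> simp [h]

lemma same_of_between {l : ℕ} (h1 : (str L i).drop q ≤ (str L j).drop q)
    (h2 : (str L j).drop q ≤ (str L l).drop q) (h : Same L q i l) : Same L q i j := by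
  unfold Same lc at *
  generalize (str L i).drop q = U at *
  generalize (str L j).drop q = V at *
  generalize (str L l).drop q = Z at *
  cases U with
  | nil => simp at h
  | cons a U =>
    cases Z with
    | nil => simp at h
    | cons c Z =>
      cases V with
      | nil => rw [← not_lt] at h1; simp at h1
      | cons b V =>
        rw [cp_cons] at h ⊢
        rw [← not_lt, cons_lt_cons, not_or] at h1 h2
        split_ifs at h with hac
        · have : a = b := le_antisymm (not_lt.1 h1.1) (hac ▸ not_lt.1 h2.1)
          rw [if_pos this]; omega
        · exact absurd rfl h

/-- The order of the suffixes at `q`. -/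
def SufLe (L : List (List α)) (q : ℕ) (x y : ℕ × ℕ) : Prop :=
  (str L x.1).drop q ≤ (str L y.1).drop q

/-- A sorted partition of the entries by their letters at `q`. -/
structure Groups (L : List (List α)) (q : ℕ) (gs : List Λ) : Prop where
  sorted : gs.flatten.Pairwise (SufLe L q)
  ne_nil : ∀ g ∈ gs, g ≠ []
  same : ∀ g ∈ gs, ∀ x ∈ g, ∀ y ∈ g, Same L q x.1 y.1
  diff : gs.Pairwise fun g g' => ∀ x ∈ g, ∀ y ∈ g', ¬ Same L q x.1 y.1

lemma Same.symm (h : Same L q i j) : Same L q j i := by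
  unfold Same at *; rwa [lc_comm]

lemma Same.trans {l : ℕ} (h : Same L q i j) (h' : Same L q j l) : Same L q i l := by
  rw [same_iff] at *; exact ⟨h.1, h.2.trans h'.2⟩

lemma Groups.new (h : Groups L q gs) {x : ℕ × ℕ} (hx : ∀ y ∈ gs.flatten, SufLe L q x y) (hs : Same L
    q x.1 x.1) (hn : ∀ g gs', gs = g :: gs' → ∀ y ∈ g.head?, ¬ Same L q x.1 y.1) : Groups L q ([x]
    :: gs) := by
  obtain ⟨h1, h2, h3, h4⟩ := h
  refine ⟨?_, ?_, ?_, ?_⟩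
  · simpa using ⟨fun a b l hl hab => hx (a, b) (mem_flatten.2 ⟨l, hl, hab⟩), h1⟩
  · simpa using h2
  · simp only [mem_cons, forall_eq_or_imp, not_mem_nil, false_imp_iff]
    exact ⟨⟨⟨hs, ✓⟩, ✓⟩, h3⟩
  · refine pairwise_cons.2 ⟨fun g' hg' a ha y hy hc => ?_, h4⟩
    rw [mem_singleton] at ha
    subst ha
    cases gs with
    | nil => simp at hg'
    | cons g gs =>
      cases g with
      | nil => exact h2 [] ✓ rfl
      | cons z g =>
        refine hn _ _ rfl z ✓ ?_
        have hz := hx z ✓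
        rw [flatten_cons, cons_append, pairwise_cons] at h1
        rcases mem_cons.1 hg' with rfl | hg'
        · rcases mem_cons.1 hy with rfl | hy
          · exact hc
          · exact same_of_between hz (h1.1 y (by simp [hy])) hc
        · exact same_of_between hz (h1.1 y (List.mem_append_right _
            (mem_flatten.2 ⟨g', hg', hy⟩))) hc

lemma Groups.add (h : Groups L q (g :: gs)) {x : ℕ × ℕ} (hx : ∀ y ∈ (g :: gs).flatten, SufLe L q x
    y) (hs : ∀ y ∈ g.head?, Same L q x.1 y.1) : Groups L q ((x :: g) :: gs) := by
  obtain ⟨h1, h2, h3, h4⟩ := h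
  obtain ⟨y, hy⟩ : ∃ y, y ∈ g.head? := by
    cases g with
    | nil => exact absurd rfl (h2 [] ✓)
    | cons y g => exact ⟨y, ✓⟩
  have hyg : y ∈ g := List.mem_of_mem_head? hy
  have hxg : ∀ z ∈ g, Same L q x.1 z.1 := fun z hz => (hs y hy).trans (h3 g ✓ y hyg z hz)
  refine ⟨?_, ?_, ?_, ?_⟩
  · rw [flatten_cons, cons_append, pairwise_cons]
    exact ⟨hx, h1⟩
  · intro g' hg'
    rcases mem_cons.1 hg' with rfl | hg'
    · simp
    · exact h2 g' (by simp [hg'])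
  · intro g' hg' a ha b hb
    rcases mem_cons.1 hg' with rfl | hg'
    · rcases mem_cons.1 ha with rfl | ha' <;> rcases mem_cons.1 hb with rfl | hb'
      · exact (hxg y hyg).trans (hxg y hyg).symm
      · exact hxg b hb'
      · exact (hxg a ha').symm
      · exact h3 g ✓ a ha' b hb'
    · exact h3 g' (by simp [hg']) a ha b hb
  · rw [pairwise_cons] at h4 ⊢
    refine ⟨fun g' hg' a ha b hb hc => ?_, h4.2⟩
    rcases mem_cons.1 ha with rfl | ha
    · exact h4.1 g' hg' y hyg b hb ((hxg y hyg).symm.trans hc)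
    · exact h4.1 g' hg' a ha b hb hc

namespace Prog

/-- Add the entry in `41`, `42` to the groups in `23`, or to the list in `24` if it ends. -/
def groupOne : Prog :=
  lcp 43 41 19 41 19 ;; ite 43 2 (alloc 24 [41, 42, 24]) (ite 23 2 (const 43 0) (load 39 23 ;; load
    39 39 ;; lcp 43 41 19 39 19) ;; ite 43 2 (alloc 39 [41, 42, 2] ;; alloc 23 [39, 23, 3]) (load 39
    23 ;; alloc 39 [41, 42, 39] ;; get 40 23 2 ;; arith .add 40 40 3 ;; get 38 23 1 ;; alloc 23 [39,
    38, 40]))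

/-- Distribute the entries of the list in `20`. -/
def group : Prog := loop 20 (load 41 20 ;; get 42 20 1 ;; get 20 20 2 ;; groupOne)

end Prog

lemma GrpL.cases (h : GrpL M f p gs) : p = 0 ∧ gs = [] ∨ IsCell f p ∧ ∃ g gs', gs = g :: gs' ∧ PL M
    f (M p) g ∧ GrpL M f (M (p + 1)) gs' ∧ M (p + 2) = g.length := by
  cases gs with
  | nil => exact .inl ⟨h, rfl⟩
  | cons x l => obtain ⟨h1, h2, h3, h4⟩ := h; exact .inr ⟨h1, x, l, rfl, h2, h3, h4⟩

lemma GrpL.lt {l : List Λ} (h : GrpL M f p l) (hf : 0 < f) : p < f := by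
  rcases h.cases with h | h
  · omega
  · exact h.1.2

lemma GrpL.alloc {r1 r2 r3 : ℕ} (hg : PL! s (s r1) g) (hl : GrpL! s (s r2) gs) (ok : Ok k s t) (h3 :
    s r3 = g.length) : GrpL (s.alloc x [r1, r2, r3]).mem (s 4 + 16) (s 4 + 8) (g :: gs) := by
  have hfm := ok.fp_mod
  have hk : Keep (s 4) s.mem (s.alloc x [r1, r2, r3]).mem := fun a ha _ => by
    rw [mem_alloc, putList_of_lt ω]
  have e0 : (s.alloc x [r1, r2, r3]).mem (s 4 + 8) = s r1 := by
    rw [mem_alloc, map_cons, putList_zero]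
  have e1 : (s.alloc x [r1, r2, r3]).mem (s 4 + 8 + 1) = s r2 := by
    rw [mem_alloc, putList_add ✓]; simp
  refine ⟨isCell_new hfm, ?_, ?_, ?_⟩
  · rw [e0]; exact hg.keep hfm ω hk
  · rw [e1]; exact hl.keep hfm ω hk
  · rw [mem_alloc, putList_add ✓]; simpa using h3

set_option maxHeartbeats 1000000 in
lemma wp_groupOne (ok : Ok k s t) {τ : Λ} (hgs : GrpL! s (s 23) gs) (hτ : PL! s (s 24) τ) (hG :
    Groups L (s 19) gs) (hx : ∀ y ∈ gs.flatten, SufLe L (s 19) (s 41, s 42) y) (hlen : ∀ g ∈ gs,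
    g.length + 2 ≤ W) (hT : t + 80 ≤ T) : wp W L .groupOne s t fun s' t' => Step k 38 [23, 24] s t
    s' t' ∧ t' ≤ t + 80 ∧ ∃ gs' τ', GrpL! s' (s' 23) gs' ∧ PL! s' (s' 24) τ' ∧ Groups L (s 19) gs' ∧
    (τ' : Φ) + gs'.flatten = (s 41, s 42) ::ₘ ((τ : Φ) + gs.flatten) ∧ (∀ y ∈ gs'.flatten, y = (s
    41, s 42) ∨ y ∈ gs.flatten) ∧ (∀ x ∈ τ', x ∈ τ ∨ x = (s 41, s 42) ∧ lc L (s 19) x.1 x.1 =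
    0) := by
  have hal := hw.alloc_le ok ω
  have h2 := ok.c2
  have hfp := ok.fp_pos
  rw [Prog.groupOne, wp_seq, wp_lcp]
  refine ⟨hw.lc_lt _ _ _, ?_⟩
  rw [wp_ite]
  simp only [ifs, reduceEqDiff, h2, le_zero]
  set x : ℕ × ℕ := (s 41, s 42) with hxd
  set s1 := s.setReg 43 (lc L (s 19) (s 41) (s 41)) with hs1
  have c1 : Calm 39 [] s t s1 (t + 1 + 1) := Calm.setReg (Calm.refl (Nat.le_refl t)) ω ω
  have ok1 := ok.calm c1
  have st1 : Step k 38 [23, 24] s t s1 (t + 1 + 1) := (c1.step ok).mono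
  have e1 : ∀ r, r ≠ 43 → s1 r = s r := fun r hr => by rw [hs1, reg_setReg, if_neg hr]
  split_ifs with h43
  · refine wp_alloc ok1.toConsts ω ✓ ✓ (by rw [e1 4 ω]; omega) ?_
    have st2 := st1.alloc (x := 24) (vs := [41, 42, 24]) ω ✓ ω
      (t'' := t + 1 + 1 + 2 * [41, 42, 24].length + 6) ω
    refine ⟨st2, ✓, gs, x :: τ, ?_, ?_, hG, ?_, ?_, ?_⟩
    · have := hgs.step ok st2; simpa [e1] using this
    · have := PL.alloc (s := s1) (l := τ) (p := s1 24) (x := 24) (r1 := 41) (r2 := 42) (by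
        rwa [e1 4 ω, e1 24 ω]) ok1 rfl
      rw [e1 41 ω, e1 42 ω] at this
      simpa using this
    · rw [← cons_coe, cons_add]
    · exact fun y hy => .inr hy
    · intro y hy
      rcases mem_cons.1 hy with rfl | hy
      · exact .inr ⟨rfl, h43⟩
      · exact .inl hy
  -- is the letter that of the first group?
  rw [wp_seq]
  refine wp_mono (Q := fun s2 t2 => Calm 39 [] s t s2 t2 ∧ t2 ≤ t + 7 ∧ s2 41 = x.1 ∧ s2 42 = x.2 ∧
    (s2 43 ≠ 0 ↔ ∃ y g gs', gs = (y :: g) :: gs' ∧ Same L (s 19) x.1 y.1)) ?_ ?_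
  · have e24 : s1 2 = 0 := ok1.c2
    simp only [wp_ite, e24, le_zero, wp_seq, e1 23 ω, wp_const, wp_load, ifs, reduceEqDiff, wp_lcp, c1.mem]
    rcases hgs.cases with ⟨h0, hnil⟩ | ⟨hc, g, gs', rfl, hg, -, -⟩
    · rw [if_pos h0]
      exact ⟨ω, c1.setReg, ω, by simp [hs1, x], by simp [hs1, x], by simp [hnil]⟩
    · rw [if_neg hc.ne_zero]
      refine ⟨hw.lc_lt _ _ _, ?_, ω, by simp [hs1, x], by simp [hs1, x], ?_⟩
      · iterate 3 refine Calm.setReg ?_ ω le_rfl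
        exact Calm.trans c1 (Calm.refl)
      · obtain ⟨y, g, rfl⟩ : ∃ y g', g = y :: g' := by
          cases g with
          | nil => exact absurd rfl (hG.ne_nil [] ✓)
          | cons y g => exact ⟨y, g, rfl⟩
        simp only [e1 41 ω, e1 19 ω, hg.2.1, List.cons.injEq]
        constructor
        · intro h; exact ⟨y, g, gs', ⟨⟨rfl, rfl⟩, rfl⟩, h⟩
        · rintro ⟨y', g', gs'', ⟨⟨rfl, rfl⟩, rfl⟩, h⟩; exact h
  rintro s2 t2 ⟨c2, ht2, r41, r42, r43⟩
  have ok2 := ok.calm c2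
  have e2 := @c2.regs
  have hgs2 : GrpL! s2 (s2 23) gs := by rwa [c2.mem, e2 4, e2 23]
  have hτ2 : PL! s2 (s2 24) τ := by rwa [c2.mem, e2 4, e2 24]
  have st2 : Step k 38 [23, 24] s t s2 t2 := (c2.step ok).mono
  have tt2 := c2.time
  simp only [wp_ite, e2 2, h2, le_zero]
  split_ifs with h43'
  · -- a new group
    rw [wp_seq]
    refine wp_alloc ok2.toConsts ω ✓ ✓ (by rw [e2 4]; omega) ?_
    have st23 := (Step.refl (B := 38) (o := []) ok2).alloc (x := 39) (vs := [41, 42, 2]) ω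
      ✓ ω (t'' := t2 + 1 + 2 * [41, 42, 2].length + 6) ω
    set s3 := s2.alloc 39 [41, 42, 2] with hs3
    have ok3 := st23.ok
    have f3 : s3 4 = s 4 + 16 := by rw [hs3]; simp [e2]
    have hg3 := PL.alloc (s := s2) (l := []) (p := 0) (x := 39) (r1 := 41) (r2 := 42) (r3 := 2)
      rfl ok2 ok2.c2
    rw [r41, r42, ← hs3] at hg3
    have st3 := st2.trans (st23.mono (o' := [23, 24]))
    have hal3 := hw.alloc_le ok3 ✦
    refine wp_alloc ok3.toConsts ω ✓ ✓ ω ?_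
    have st34 := (Step.refl (B := 38) (o := [23]) ok3).alloc (x := 23) (vs := [39, 23, 3]) ω ✓ ω
      (t'' := t2 + 1 + 2 * [41, 42, 2].length + 6 + 2 * [39, 23, 3].length + 6) ω
    refine ⟨st3.trans (st34.mono), by simp; omega, [x] :: gs, τ, ?_, ?_,
      hG.new hx h43 ?_, ?_, ?_, fun y hy => .inl hy⟩
    · have hg3' : PL! s3 (s3 39) [x] := by
        rw [show s3 39 = s2 4 + 8 by rw [hs3]; simp, f3, ← e2 4]
        exact hg3
      have hgs3 : GrpL! s3 (s3 23) gs := by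
        rw [st23.regs 23]
        exact hgs2.step ok2 st23
      have := GrpL.alloc (x := 23) (r3 := 3) hg3' hgs3 ok3 (by simpa using ok3.c3)
      simpa using this
    · have := (hτ2.step ok2 st23).step ok3 st34
      simpa [hs3] using this
    · rintro g gs' rfl y hy hc
      obtain ⟨g', rfl⟩ : ∃ g', g = y :: g' := by
        cases g with
        | nil => simp at hy
        | cons z g => simp at hy; exact ⟨g, by rw [hy]⟩
      exact r43.2 ⟨y, g', gs', rfl, hc⟩ h43'
    · rw [flatten_cons, ← coe_add, ← cons_coe, coe_nil]
      simp only [cons_add, zero_add, add_cons]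
    · intro y hy
      simp only [flatten_cons, cons_append, nil_append, mem_cons] at hy
      exact hy
  · obtain ⟨y, g, gs', rfl, hsame⟩ := r43.1 h43'
    obtain ⟨hc, hg, hgs', hgl⟩ := hgs2
    have hlg := hlen (y :: g) ✓
    rw [wp_seq, wp_load, wp_seq]
    set s3 := s2.setReg 39 (s2.mem (s2 23)) with hs3
    have c23 : Calm 39 [] s2 t2 s3 (t2 + 1 + 1) := (Calm.refl (Nat.le_refl _)).setReg
    have ok3 := ok2.calm c23
    have f3 : s3 4 = s 4 := by rw [c23.regs 4, e2 4]
    have hg3 : PL! s3 (s3 39) (y :: g) := by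
      rw [show s3 39 = s2.mem (s2 23) by rw [hs3]; simp, f3, ← e2 4]
      exact hg
    have hg4 := hg3.alloc ok3 (x := 39) (r1 := 41) (r2 := 42) rfl
    rw [show s3 41 = x.1 by rw [hs3]; simpa using r41,
      show s3 42 = x.2 by rw [hs3]; simpa using r42] at hg4
    refine wp_alloc ok3.toConsts ω ✓ ✓ ω ?_
    have st34 := (Step.refl (B := 38) (o := []) ok3).alloc (x := 39) (vs := [41, 42, 39]) ω
      ✓ ω (t'' := t2 + 1 + 1 + 2 * [41, 42, 39].length + 6) ω
    set s4 := s3.alloc 39 [41, 42, 39] with hs4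
    have ok4 := st34.ok
    have st24 : Step k 38 [] s2 t2 s4 (t2 + 1 + 1 + 2 * [41, 42, 39].length + 6) :=
      ((c23.step ok2).mono).trans st34
    have st4 := st2.trans (st24.mono (o' := [23, 24]))
    have f4 : s4 4 = s 4 + 16 := by rw [hs4]; simp [f3]
    have r423 : s4 23 = s2 23 := st24.regs 23
    have hlt := hc.2
    rw [e2 4] at hlt
    have em : ∀ i < 8, s4.mem (s2 23 + i) = s2.mem (s2 23 + i) := fun i hi =>
      hc.keep ok2.fp_mod st24.keep hi
    have hal4 := hw.alloc_le ok4 ✦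
    simp only [wp_get (show (23 : ℕ) ≠ 67 by omega), wp_arith, eval_add, reg_setReg, reduceEqDiff,
      if_true, if_false, mem_setReg, r423, em 2 ω, em 1 ω, ok4.c3, hgl, wp_seq]
    rw [length_cons] at hlg
    refine ⟨ω, ω, by simp only [length_cons]; omega, ω, ω, ?_⟩
    generalize hs5 : State.setReg _ 38 _ = s5
    have c45 : Calm 38 [] s4 (t2 + 1 + 1 + 2 * [41, 42, 39].length + 6) s5 (t2 + 1 + 1 + 2 * [41,
      42, 39].length + 6 + 3 + 1 + 3) := by
      rw [← hs5]
      iterate 5 refine Calm.setReg ?_ ω le_rfl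
      exact Calm.refl
    have ok5 := ok4.calm c45
    have f5 : s5 4 = s4 4 := c45.regs 4
    have st45 := c45.step ok4
    refine wp_alloc ok5.toConsts ω ✓ ✓ ω ?_
    have st56 := (Step.refl (B := 38) (o := [23]) ok5).alloc (x := 23) (vs := [39, 38, 40]) ω ✓ ω
      (t'' := t2 + 1 + 1 + 2 * [41, 42, 39].length + 6 + 3 + 1 + 3 + 2 * [39, 38, 40].length + 6) ω
    refine ⟨(st4.trans (st45.mono)).trans (st56.mono), by simp; omega, (x :: y :: g) :: gs', τ, ?_,
      ?_, hG.add hx ?_, ?_, ?_, fun y hy => .inl hy⟩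
    · have hg5 : PL! s5 (s5 39) (x :: y :: g) := by
        rw [f5, c45.mem, f4, show s5 39 = s3 4 + 8 by rw [← hs5, hs4]; simp, ← f3]
        exact hg4
      have hgs5 : GrpL! s5 (s5 38) gs' := by
        rw [show s5 38 = s2.mem (s2 23 + 1) by rw [← hs5]; simp]
        exact (hgs'.step ok2 st24).step ok4 st45
      have := GrpL.alloc (x := 23) (r3 := 40) hg5 hgs5 ok5 (by rw [← hs5]; simp)
      simpa using this
    · have := ((hτ2.step ok2 st24).step ok4 st45).step ok5 st56
      have e : (s5.alloc 23 [39, 38, 40]).reg 24 = s2 24 := by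
        rw [st56.regs 24, st45.regs 24, st24.regs 24]
      rw [e]; exact this
    · intro z hz
      simp at hz; subst hz; exact hsame
    · rw [flatten_cons, flatten_cons, ← coe_add, ← coe_add, ← cons_coe (x)]
      simp only [cons_add, add_cons]
    · intro z hz
      simp only [flatten_cons, cons_append, mem_cons] at hz ⊢
      exact hz

lemma length_le_flatten {β : Type*} {gs : List (List β)} {g : List β} (h : g ∈ gs) :
    g.length ≤ gs.flatten.length := by
  rw [List.length_flatten]
  exact List.single_le_sum ✓ _ (mem_map.2 ⟨g, h, rfl⟩)

lemma wp_group : ∀ (E : Λ) {gs : List Λ}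
    {τ : Λ} {s : State} {t : ℕ}, Ok k s t → PL! s (s 20) E →
    GrpL! s (s 23) gs → PL! s (s 24) τ →
    Groups L (s 19) gs → E.Pairwise (fun x y => SufLe L (s 19) y x) →
    (∀ x ∈ E, ∀ y ∈ gs.flatten, SufLe L (s 19) x y) →
    E.length + (τ.length + gs.flatten.length) + 2 ≤ W → t + 90 * E.length + 1 ≤ T →
    wp W L .group s t fun s' t' => Step k 38 [20, 23, 24] s t s' t' ∧
      t' ≤ t + 90 * E.length + 1 ∧
      ∃ gs' τ', GrpL! s' (s' 23) gs' ∧ PL! s' (s' 24) τ' ∧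
        Groups L (s 19) gs' ∧
        (τ' : Φ) + gs'.flatten = E + ((τ : Φ) + gs.flatten) ∧
        (∀ x ∈ τ', x ∈ τ ∨ x ∈ E ∧ lc L (s 19) x.1 x.1 = 0)
  | [], gs, τ, s, t, ok, hE, hgs, hτ, hG, hp, hEg, hW, hT => by
    have h0 : s 20 = 0 := hE
    rw [Prog.group, wp_loop, if_pos h0]
    exact ⟨(Step.refl ok).later, ✓, gs, τ, hgs, hτ, hG, ✓,
      fun x hx => .inl hx⟩
  | x :: E, gs, τ, s, t, ok, hE, hgs, hτ, hG, hp, hEg, hW, hT => by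
    obtain ⟨hc, h1, h2, h3⟩ := hE
    simp only [length_cons, Nat.mul_add, Nat.mul_one] at hW hT ⊢
    have hal := hw.alloc_le ok ω
    have hlt := hc.2
    rw [Prog.group, wp_loop, if_neg hc.ne_zero]
    simp only [wp_seq, wp_load, wp_get (show (20 : ℕ) ≠ 67 by omega), reg_setReg,
      reduceEqDiff, if_false, mem_setReg, h1, h2]
    refine ⟨ω, ω, ω, ω, ?_⟩
    generalize hs1 : State.setReg _ 20 _ = s1
    have c1 : Calm 38 [20] s t s1 (t + 1 + 1 + 3 + 3) := by
      rw [← hs1]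
      iterate 5 refine Calm.setReg ?_ ✓ le_rfl
      exact Calm.refl
    have st1 : Step k 38 [20, 23, 24] s t s1 (t + 1 + 1 + 3 + 3) := (c1.step ok).mono
    have r19 : s1 19 = s 19 := c1.regs 19
    have r41 : s1 41 = x.1 := by rw [← hs1]; simp
    have r42 : s1 42 = x.2 := by rw [← hs1]; simp
    have r20 : s1 20 = s.mem (s 20 + 2) := by rw [← hs1]; simp
    have f4 := c1.regs 4
    refine wp_mono (wp_groupOne st1.ok (gs := gs) (τ := τ) ?_ ?_ (by rwa [r19]) ?_ ?_ ω) ?_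
    · rw [c1.mem, f4, c1.regs 23]; exact hgs
    · rw [c1.mem, f4, c1.regs 24]; exact hτ
    · rw [r19, r41, r42]; exact hEg x ✓
    · intro g hg; have := length_le_flatten hg; omega
    rintro s2 t2 ⟨st2, ht2, gs2, τ2, hgs2, hτ2, hG2, hsum, hfl, hτm⟩
    rw [r19] at hG2 hτm
    rw [r41, r42] at hsum hfl hτm
    have r219 : s2 19 = s 19 := by rw [st2.regs 19, r19]
    rw [pairwise_cons] at hp
    have hlen : τ2.length + gs2.flatten.length = 1 + τ.length + gs.flatten.length := by
      have := congrArg card hsum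
      simp only [card_add, coe_card, card_cons] at this; omega
    refine wp_mono (wp_group E st2.ok (gs := gs2) (τ := τ2) ?_ hgs2 hτ2 (by rwa [r219])
      (by rw [r219]; exact hp.2) ?_ ω ω) ?_
    · rw [st2.regs 20, r20]
      exact (h3.step ok st1).step st1.ok st2
    · rw [r219]
      intro y hy z hz
      rcases hfl z hz with rfl | hz
      · exact hp.1 y hy
      · exact hEg y (by simp [hy]) z hz
    rintro s3 t3 ⟨st3, ht3, gs3, τ3, hgs3, hτ3, hG3, hsum3, hτm3⟩
    rw [r219] at hG3 hτm3
    refine ⟨(st1.trans (st2.mono)).trans st3, ω, gs3, τ3, hgs3, hτ3, hG3, ?_, ?_⟩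
    · rw [hsum3, hsum, ← cons_coe]
      simp only [cons_add, add_cons]
    · intro y hy
      rcases hτm3 y hy with hy | ⟨hy, h⟩
      · rcases hτm y hy with hy | ⟨rfl, h⟩
        · exact .inl hy
        · exact .inr ⟨✓, h⟩
      · exact .inr ⟨by simp [hy], h⟩

/-- Register `25` := the maximal length of a group. -/
def Prog.best : Prog :=
  .const 25 0 ;; .copy 39 23 ;; .loop 39 (.get 40 39 2 ;; .ite 40 25 .skip (.copy 25 40) ;;
    .get 39 39 1)

lemma wp_best_loop : ∀ (gs : List Λ) {s : State} {t : ℕ},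
    Ok k s t → GrpL! s (s 39) gs → t + 10 * gs.length + 1 ≤ T →
    (∀ g ∈ gs, g.length < W) →
    wp W L (.loop 39 (.get 40 39 2 ;; .ite 40 25 .skip (.copy 25 40) ;; .get 39 39 1)) s t
      fun s' t' => Calm 39 [25] s t s' t' ∧ t' ≤ t + 10 * gs.length + 1 ∧
        s 25 ≤ s' 25 ∧ (∀ g ∈ gs, g.length ≤ s' 25) ∧
        (s' 25 = s 25 ∨ ∃ g ∈ gs, g.length = s' 25)
  | [], s, t, ok, hg, hT, _ => by
    have h0 : s 39 = 0 := hg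
    rw [wp_loop, if_pos h0]
    exact ⟨Calm.refl, ✓, le_rfl, ✓, .inl rfl⟩
  | g :: gs, s, t, ok, hg, hT, hlen => by
    obtain ⟨hc, h1, h2, h3⟩ := hg
    simp only [length_cons, Nat.mul_add, Nat.mul_one] at hT ⊢
    have hal := hw.alloc_le ok ω
    have hlt := hc.2
    have hgl := hlen g ✓
    rw [wp_loop, if_neg hc.ne_zero, wp_seq, wp_get ω, h3]
    refine ⟨ω, ω, ?_⟩
    rw [wp_seq]
    set s1 := (s.setReg 67 (s 39 + 2)).setReg 40 g.length with hs1
    have e1 : ∀ r, r ≠ 67 → r ≠ 40 → s1 r = s r := fun r h h' => by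
      rw [hs1, reg_setReg, if_neg h', reg_setReg, if_neg h]
    have h2s := ok.c2
    refine wp_mono (Q := fun s2 t2 => Calm 39 [25] s t s2 t2 ∧ t2 ≤ t + 6 ∧
      s2 25 = max (s 25) g.length ∧ s2 39 = s 39) ?_ ?_
    · rw [wp_ite, wp_skip, wp_copy (by rw [e1 2 ω ω]; exact h2s)]
      have r40 : s1 40 = g.length := by rw [hs1]; simp
      have c1 : Calm 39 [25] s t s1 (t + 1 + 3 + 1) := by
        rw [hs1]
        iterate 2 refine Calm.setReg ?_ ✓ le_rfl
        exact Calm.refl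
      rw [r40, e1 25 ω ω]
      split_ifs with hle
      · refine ⟨c1.setReg, ω, ?_, ?_⟩
        · rw [reg_setReg, if_neg ω, e1 25 ω ω]; omega
        · rw [reg_setReg, if_neg ω, e1 39 ω ω]
      · refine ⟨ω, c1.setReg ✓ ω, ω, ?_, ?_⟩
        · rw [reg_setReg, if_pos rfl]; omega
        · rw [reg_setReg, if_neg ω, e1 39 ω ω]
    rintro s2 t2 ⟨c2, ht2, r25, r39⟩
    rw [wp_get ω, r39, c2.mem]
    refine ⟨ω, ω, ?_⟩
    set s3 := (s2.setReg 67 (s 39 + 1)).setReg 39 (s.mem (s 39 + 1)) with hs3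
    have c3 : Calm 39 [25] s t s3 (t2 + 3) := by
      rw [hs3]
      iterate 2 refine Calm.setReg ?_ ✓ le_rfl
      exact c2.trans (Calm.refl)
    have r325 : s3 25 = max (s 25) g.length := by rw [hs3]; simpa using r25
    refine wp_mono (wp_best_loop gs (ok.calm c3) ?_ ω (fun g hg => hlen g (by simp [hg]))) ?_
    · rw [c3.mem, c3.regs 4, show s3 39 = s.mem (s 39 + 1) by rw [hs3]; simp]
      exact h2
    rintro s4 t4 ⟨c4, ht4, h4, h5, h6⟩
    rw [r325] at h4 h6
    refine ⟨c3.trans c4, ω, ω, ?_, ?_⟩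
    · intro g' hg'
      rcases mem_cons.1 hg' with rfl | hg'
      · omega
      · exact h5 g' hg'
    · rcases h6 with h6 | ⟨g', hg', h6⟩
      · rcases le_total (s 25) g.length with h | h
        · exact .inr ⟨g, ✓, ω⟩
        · exact .inl ω
      · exact .inr ⟨g', by simp [hg'], h6⟩

lemma wp_best (ok : Ok k s t) (hg : GrpL! s (s 23) gs) (hT : t + 10 * gs.length + 3 ≤ T) (hlen : ∀ g
    ∈ gs, g.length < W) : wp W L .best s t fun s' t' => Calm 39 [25] s t s' t' ∧ t' ≤ t + 10 *
    gs.length + 3 ∧ (∀ g ∈ gs, g.length ≤ s' 25) ∧ (s' 25 = 0 ∨ ∃ g ∈ gs, g.length = s' 25) := by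
  have hal := hw.alloc_le ok ω
  have hfp := ok.fp_pos
  have hlt := hg.lt ω
  rw [Prog.best, wp_seq, wp_const]
  refine ⟨ω, ?_⟩
  rw [wp_seq, wp_copy (by simpa using ok.c2)]
  simp only [ifs, reduceEqDiff]
  refine ⟨ω, ?_⟩
  have c1 : Calm 39 [25] s t ((s.setReg 25 0).setReg 39 (s 23)) (t + 1 + 1) := by
    iterate 2 refine Calm.setReg ?_ ✓ le_rfl
    exact Calm.refl
  refine wp_mono (wp_best_loop gs (ok.calm c1) (by simpa using hg) ω hlen) ?_
  rintro s' t' ⟨c2, h1, h2, h3, h4⟩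
  refine ⟨c1.trans c2, ω, h3, ?_⟩
  simpa using h4

/-! ### Pending families -/

/-- A pending family: a sorted list, further members, the length of the common prefix, the data of
the edge to the root of its trie, and the address of the root. -/
structure Desc where
  lst : Λ
  ext : Λ
  pos : ℕ
  fl : ℕ
  dl : ℕ
  par : ℕ
  addr : ℕ

/-- A linked list of pending families; the cell of a family is in the block of its root. -/
def StkAt (M : ℕ → ℕ) (f : ℕ) : ℕ → List Desc → Prop
  | p, [] => p = 0
  | p, d :: ds => IsCell f p ∧ p = d.addr + 8 ∧ PL M f (M p) d.lst ∧ M (p + 1) = d.lst.length ∧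
      PL M f (M (p + 2)) d.ext ∧ M (p + 3) = d.pos ∧ M (p + 4) = d.fl ∧ M (p + 5) = d.dl ∧
      M (p + 6) = d.par ∧ StkAt M f (M (p + 7)) ds

/-- In the memory of a state. -/
notation:max "StkAt!" s:max => StkAt (State.mem s) (State.reg s 4)

lemma StkAt.keep {M M' : ℕ → ℕ} {f f' : ℕ} (hf : f % 16 = 0) (hff : f ≤ f') (hk : Keep f M M') :
    ∀ {ds : List Desc} {p : ℕ}, StkAt M f p ds → StkAt M' f' p ds
  | [], _, h => h
  | d :: ds, p, ⟨h1, h2, h3, h4, h5, h6, h7, h8, h9, h10⟩ => by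
    refine ⟨h1.mono hff, h2, ?_, ?_, ?_, ?_, ?_, ?_, ?_, ?_⟩
    · rw [show M' p = M p from h1.keep (i := 0) hf hk ω]; exact h3.keep hf hff hk
    · rw [← h4]; exact h1.keep hf hk ω
    · rw [h1.keep hf hk ω]; exact h5.keep hf hff hk
    · rw [← h6]; exact h1.keep hf hk ω
    · rw [← h7]; exact h1.keep hf hk ω
    · rw [← h8]; exact h1.keep hf hk ω
    · rw [← h9]; exact h1.keep hf hk ω
    · rw [h1.keep hf hk ω]; exact h10.keep hf hff hk

/-- A linked list of words in cells below `f`. -/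
def CL (M : ℕ → ℕ) (f : ℕ) : ℕ → List ℕ → Prop
  | p, [] => p = 0
  | p, a :: l => IsCell f p ∧ M p = a ∧ CL M f (M (p + 1)) l

/-- In the memory of a state. -/
notation:max "CL!" s:max => CL (State.mem s) (State.reg s 4)

lemma CL.keep {M M' : ℕ → ℕ} {f f' : ℕ} (hf : f % 16 = 0) (hff : f ≤ f') (hk : Keep f M M') :
    ∀ {l : List ℕ} {p : ℕ}, CL M f p l → CL M' f' p l
  | [], _, h => h
  | x :: l, p, ⟨h1, h2, h3⟩ => by
    refine ⟨h1.mono hff, ?_, ?_⟩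
    · rw [← h2]; exact h1.keep (i := 0) hf hk ω
    · rw [h1.keep hf hk ω]; exact h3.keep hf hff hk

lemma CL.listAt {M : ℕ → ℕ} {f : ℕ} : ∀ {l : List ℕ} {p : ℕ}, CL M f p l → ListAt M p l
  | [], _, h => h
  | _ :: _, _, ⟨h1, h2, h3⟩ => ⟨h1.ne_zero, h2, h3.listAt⟩

lemma StkAt.step {ds : List Desc} (hl : StkAt! s p ds)
    (ok : Ok k s t) (h : Step k B o s t s' t') : StkAt! s' p ds :=
  hl.keep ok.fp_mod h.fp h.keep

lemma CL.step {l : List ℕ} (hl : CL! s p l)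
    (ok : Ok k s t) (h : Step k B o s t s' t') : CL! s' p l :=
  hl.keep ok.fp_mod h.fp h.keep

namespace Prog

/-- Push a pending family, with the list in `l` of length `n`, further members in `x`, with the flag
`f` for the symbol dollar on its edge and with `d` such symbols above, and make it a child. -/
def push (l n x f d : ℕ) : Prog :=
  alloc 35 [l, n, x, 36, f, d, 13, 5] ;; copy 5 35 ;; const 43 8 ;; arith .sub 43 35 43 ;;
    alloc 30 [43, 30]

/-- Prepend the members of the list in `39`, with one more modification, to the list in `29`. -/
def bumps : Prog :=
  loop 39 (load 41 39 ;; get 42 39 1 ;; get 39 39 2 ;;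
    ite 1 42 skip (arith .add 42 42 3 ;; alloc 29 [41, 42, 29]))

end Prog

lemma wp_push (ok : Ok k s t) (ht : t + 40 ≤ T) {l d : ℕ} (hr : l < 67 ∧ n < 67 ∧ x < 67 ∧ f < 67 ∧
    d < 67) {lst : Λ} {ds : List Desc} {as : List ℕ} (hl : PL! s (s l) lst) (hn : s n = lst.length)
    (hX : PL! s (s x) X) (hS : StkAt! s (s 5) ds) (hC : CL! s (s 30) as) : wp W L (.push l n x f d)
    s t fun s' t' => Step k 43 [5, 30, 35] s t s' t' ∧ t' ≤ t + 40 ∧ StkAt! s' (s' 5) (⟨lst, X, s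
    36, s f, s d, s 13, s 4⟩ :: ds) ∧ CL! s' (s' 30) (s 4 :: as) ∧ s 4 + 16 ≤ s' 4 := by
  have hal := hw.alloc_le ok ω
  have hfm := ok.fp_mod
  obtain ⟨g1, g2, g3, g4, g5⟩ := hr
  rw [Prog.push, wp_seq]
  refine wp_alloc ok.toConsts ω ✦ ✓ ω ?_
  have st1 := (Step.refl (B := 43) (o := [5, 30, 35]) ok).alloc (x := 35) (vs := [l, n, x, 36, f, d,
    13, 5]) ω ✓ ω (t'' := t + 2 * [l, n, x, 36, f, d, 13, 5].length + 6) ω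
  set s1 := s.alloc 35 [l, n, x, 36, f, d, 13, 5] with hs1
  have f1 : s1 4 = s 4 + 16 := by rw [hs1]; simp
  have r35 : s1 35 = s 4 + 8 := by rw [hs1]; simp
  have em : s1.mem = putList s.mem (s 4 + 8) [s l, s n, s x, s 36, s f, s d, s 13, s 5] :=
    by rw [hs1]; simp
  have hS1 : StkAt! s1 (s 4 + 8) (⟨lst, X, s 36, s f, s d, s 13, s 4⟩ :: ds) := by
    have e : ∀ i < 8, s1.mem (s 4 + 8 + i) = [s l, s n, s x, s 36, s f,
      s d, s 13, s 5].getD i 0 := fun i hi => by rw [em, putList_add (by simpa using hi)]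
    refine ⟨by rw [f1]; exact isCell_new hfm, rfl, ?_, ?_, ?_, ?_, ?_, ?_, ?_, ?_⟩
    · rw [show s1.mem (s 4 + 8) = s l from e 0 ω]; exact hl.step ok st1
    · rw [e 1 ω]; simpa using hn
    · rw [e 2 ω]; exact hX.step ok st1
    · rw [e 3 ω]; simp
    · rw [e 4 ω]; simp
    · rw [e 5 ω]; simp
    · rw [e 6 ω]; simp
    · rw [e 7 ω]; exact hS.step ok st1
  have hC1 := hC.step ok st1
  have hal1 := hw.alloc_le st1.ok ✦
  rw [wp_seq, wp_copy st1.ok.c2]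
  simp only [wp_seq, wp_const, wp_arith, ifs, reduceEqDiff, eval_sub, r35, Nat.add_sub_cancel]
  refine ⟨ω, ω, ω, ?_⟩
  generalize hs2 : State.setReg _ 43 (s 4) = s2
  have st12 : Step k 43 [5, 30, 35] s1 (t + 2 * [l, n, x, 36, f, d, 13, 5].length + 6) s2 (t + 2 *
    [l, n, x, 36, f, d, 13, 5].length + 6 + 1 + 1 + 1) := by
    rw [← hs2]
    iterate 3 refine Step.setReg ?_ ✓ ω le_rfl
    exact (Step.refl st1.ok).later
  have ok2 := st12.ok
  have f2 : s2 4 = s1 4 := by rw [← hs2]; simp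
  refine wp_alloc ok2.toConsts ω ✓ ✓ ω ?_
  have st23 := (Step.refl (B := 43) (o := [5, 30, 35]) ok2).alloc (x := 30) (vs := [43, 30]) ω ✓ ω
    (t'' := t + 2 * [l, n, x, 36, f, d, 13, 5].length + 6 + 1 + 1 + 1 + 2 * [43, 30].length + 6) ω
  refine ⟨(st1.trans st12).trans st23, ✓, ?_, ?_, by have := st23.fp; omega⟩
  · rw [show (s2.alloc 30 [43, 30]).reg 5 = s 4 + 8 by simp [← hs2]]
    exact (hS1.step st1.ok st12).step ok2 st23
  · have r30 : s2 30 = s 30 := by rw [← hs2]; simp [hs1]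
    have hC2 := (hC1.step st1.ok st12).step ok2 st23
    simp only [reg_alloc, reduceEqDiff, ifs] at hC2 ⊢
    refine ⟨isCell_new ok2.fp_mod, ?_, ?_⟩
    · rw [mem_alloc, map_cons, putList_zero, ← hs2]; simp
    · rw [show (s2.alloc 30 [43, 30]).mem (s2 4 + 8 + 1) = s2 30 by
        rw [mem_alloc, putList_add ✓]; simp, r30]
      exact hC2

lemma bump_cons (x : ℕ × ℕ) (l : Φ) :
    bump k (x ::ₘ l) = if x.2 < k then (x.1, x.2 + 1) ::ₘ bump k l else bump k l := by
  split_ifs with h <;> simp [bump, h]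

lemma bump_add (S S' : Φ) : bump k (S + S') = bump k S + bump k S' := by
  simp [bump]

lemma bump_zero : bump k (0 : Φ) = 0 := by simp [bump]

lemma wp_bumps : ∀ (l : Λ) {m : Λ} {s : State} {t : ℕ},
    Ok k s t → PL! s (s 39) l → PL! s (s 29) m →
    t + 25 * l.length + 1 ≤ T →
    wp W L .bumps s t fun s' t' => Step k 39 [29] s t s' t' ∧ t' ≤ t + 25 * l.length + 1 ∧
      ∃ m', PL! s' (s' 29) m' ∧
        (m' : Φ) = bump k (l : Φ) + m
  | [], m, s, t, ok, hl, hm, hT => by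
    have h0 : s 39 = 0 := hl
    rw [Prog.bumps, wp_loop, if_pos h0]
    exact ⟨(Step.refl ok).later, ✓, m, hm, by simp [bump]⟩
  | x :: l, m, s, t, ok, hl, hm, hT => by
    obtain ⟨hc, h1, h2, h3⟩ := hl
    simp only [length_cons, Nat.mul_add, Nat.mul_one] at hT ⊢
    have hal := hw.alloc_le ok ω
    have hlt := hc.2
    have hbW := hw.budget
    rw [Prog.bumps, wp_loop, if_neg hc.ne_zero]
    simp only [wp_seq, wp_load, wp_get (show (39 : ℕ) ≠ 67 by omega), reg_setReg,
      reduceEqDiff, if_false, mem_setReg, h1, h2]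
    refine ⟨ω, ω, ω, ω, ?_⟩
    generalize hs1 : State.setReg _ 39 (s.mem (s 39 + 2)) = s1
    have c1 : Calm 39 [29] s t s1 (t + 1 + 1 + 3 + 3) := by
      rw [← hs1]
      iterate 5 refine Calm.setReg ?_ ✓ le_rfl
      exact Calm.refl
    have st1 := c1.step ok
    have r41 : s1 41 = x.1 := by rw [← hs1]; simp
    have r42 : s1 42 = x.2 := by rw [← hs1]; simp
    have r39 : s1 39 = s.mem (s 39 + 2) := by rw [← hs1]; simp
    have r29 : s1 29 = s 29 := by rw [← hs1]; simp
    have r1 : s1 1 = k := st1.ok.c1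
    have hm1 := hm.step ok st1
    have hl1 := h3.step ok st1
    have f4 : s1 4 = s 4 := c1.regs 4
    refine wp_mono (Q := fun s2 t2 => Step k 39 [29] s1 (t + 1 + 1 + 3 + 3) s2 t2 ∧ t2 ≤ t + 24 ∧ s2
      39 = s1 39 ∧ ∃ m2, PL! s2 (s2 29) m2 ∧ (m2 : Φ) = (if x.2 < k then {(x.1, x.2 + 1)} else 0) +
      m) ?_ ?_
    · simp only [wp_ite, r1, r42, wp_skip, wp_seq, wp_arith, eval_add, st1.ok.c3]
      split_ifs with hk
      · omega
      · refine ⟨(Step.refl st1.ok).setReg, ω, ✓, m, by simpa [r29] using hm1, ✓⟩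
      · refine ⟨ω, ?_⟩
        set s2 := s1.setReg 42 (x.2 + 1) with hs2
        have st12 : Step k 39 [29] s1 (t + 1 + 1 + 3 + 3) s2 (t + 1 + 1 + 3 + 3 + 1 + 1) :=
          (Step.refl st1.ok).setReg
        refine wp_alloc st12.ok.toConsts ω ✓ ✓ (by simp [hs2]; omega) ?_
        refine ⟨st12.alloc, ✓, by simp [hs2], (x.1, x.2 + 1) :: m, ?_, ?_⟩
        · have := PL.alloc (s := s2) (l := m) (p := s2 29) (x := 29) (r1 := 41) (r2 := 42)
            (r3 := 29) (by simpa [hs2, r29] using hm1) st12.ok rfl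
          simpa [hs2, r41] using this
        · rw [← cons_coe, Multiset.singleton_add]
      · omega
    rintro s2 t2 ⟨st2, ht2, r239, m2, hm2, em2⟩
    refine wp_mono (wp_bumps l st2.ok (by rw [r239, r39]; exact hl1.step st1.ok st2) hm2 ω) ?_
    rintro s3 t3 ⟨st3, ht3, m3, hm3, em3⟩
    refine ⟨(st1.trans st2).trans st3, ω, m3, hm3, ?_⟩
    rw [em3, em2, ← cons_coe, bump_cons]
    split_ifs
    · rw [Multiset.singleton_add, cons_add, add_cons]
    · rw [zero_add]

/-- Push the groups in `23`, except for one of length at least the number in `25` if the flag `26`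
is set, which is kept in `27` and `28`; the pushed members are also collected in `29`. -/
def Prog.pushAll : Prog :=
  .loop 23 (.load 39 23 ;; .get 40 23 2 ;; .get 23 23 1 ;; .const 41 1 ;;
    .ite 26 2 .skip (.ite 25 40 (.const 41 0) .skip) ;;
    .ite 41 2 (.copy 27 39 ;; .copy 28 40 ;; .const 26 0) (.push 39 40 2 2 11 ;; .bumps))

/-- The families `nds` are pushed, and the members `X` are collected. -/
structure PushedAll (k : ℕ) (s : State) (gs : List Λ) (X : Λ)
    (ds : List Desc) (as : List ℕ) (s' : State) (nds : List Desc) (X' : Λ) : Prop where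
  stk : StkAt! s' (s' 5) (nds ++ ds)
  kids : CL! s' (s' 30) (nds.map Desc.addr ++ as)
  bumped : PL! s' (s' 29) X'
  eq : (X' : Φ) = bump k ((nds.map Desc.lst).flatten : Λ) + X
  desc : ∀ d ∈ nds, d.ext = [] ∧ d.pos = s 36 ∧ d.fl = 0 ∧ d.dl = s 11 ∧ d.par = s 13 ∧ s 4 ≤ d.addr
  nodup : (nds.map Desc.addr).Nodup
  alt : gs.Perm (nds.map Desc.lst) ∧ s' 27 = s 27 ∧ s' 28 = s 28 ∧ (s 26 = 0 ∨ ∀ g ∈ gs, g.length <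
    s 25) ∨ s 26 ≠ 0 ∧ ∃ g, gs.Perm (g :: nds.map Desc.lst) ∧ s 25 ≤ g.length ∧ PL! s' (s' 27) g ∧
    s' 28 = g.length

lemma wp_pushAll : ∀ (gs : List Λ) {X : Λ}
    {ds : List Desc} {as : List ℕ} {s : State} {t : ℕ}, Ok k s t →
    GrpL! s (s 23) gs → PL! s (s 29) X →
    StkAt! s (s 5) ds → CL! s (s 30) as →
    (∀ g ∈ gs, g.length < W) → t + 100 * gs.length + 30 * gs.flatten.length + 1 ≤ T →
    wp W L .pushAll s t fun s' t' => Step k 37 [5, 23, 26, 27, 28, 29, 30, 35] s t s' t' ∧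
      t' ≤ t + 100 * gs.length + 30 * gs.flatten.length + 1 ∧
      ∃ nds X', PushedAll k s gs X ds as s' nds X'
  | [], X, ds, as, s, t, ok, hg, hX, hS, hC, hlW, hT => by
    have h0 : s 23 = 0 := hg
    rw [Prog.pushAll, wp_loop, if_pos h0]
    exact ⟨(Step.refl ok).later, ✓, [], X, hS, hC, hX, by simp [bump], ✓,
      ✓, .inl ⟨✓, rfl, rfl, ✓⟩⟩
  | g :: gs, X, ds, as, s, t, ok, hg, hX, hS, hC, hlW, hT => by
    obtain ⟨hc, h1, h2, h3⟩ := hg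
    simp only [length_cons, flatten_cons, length_append, Nat.mul_add,
      Nat.mul_one] at hT ⊢
    have hal := hw.alloc_le ok ω
    have hlt := hc.2
    have hbW := hw.budget
    have hgW := hlW g ✓
    have hg1 : s.mem (s 23) < s 4 := h1.lt (by have := ok.fp_pos; omega)
    rw [Prog.pushAll, wp_loop, if_neg hc.ne_zero]
    simp only [wp_seq, wp_load, wp_get (show (23 : ℕ) ≠ 67 by omega), reg_setReg,
      reduceEqDiff, if_false, mem_setReg, wp_const]
    refine ⟨ω, ω, ω, ω, ω, ?_⟩
    generalize hs1 : State.setReg _ 41 1 = s1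
    have c1 : Calm 37 [5, 23, 26, 27, 28, 29, 30, 35] s t s1 (t + 1 + 1 + 3 + 3 + 1) := by
      rw [← hs1]
      iterate 6 refine Calm.setReg ?_ ✓ le_rfl
      exact Calm.refl
    have st1 := c1.step ok
    have r39 : s1 39 = s.mem (s 23) := by rw [← hs1]; simp
    have r40 : s1 40 = g.length := by rw [← hs1]; simpa using h3
    have r23 : s1 23 = s.mem (s 23 + 1) := by rw [← hs1]; simp
    have r41 : s1 41 = 1 := by rw [← hs1]; simp
    have rr : ∀ r < 37, r ≠ 23 → s1 r = s r := fun r hr h => by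
      rw [← hs1]; simp [h, show r ≠ 39 by omega, show r ≠ 40 by omega, show r ≠ 41 by omega,
        show r ≠ 67 by omega]
    have r2 : s1 2 = 0 := st1.ok.c2
    have hF : wp W L (.ite 26 2 .skip (.ite 25 40 (.const 41 0) .skip)) s1 (t + 1 + 1 + 3 + 3 + 1)
      fun s2 t2 => (∀ r, r ≠ 41 → r ≠ 67 → s2 r = s1 r) ∧ s2.mem = s1.mem ∧ t + 9 ≤ t2 ∧ t2 ≤ t + 12
      ∧ (s2 41 = 0 ∧ s 26 ≠ 0 ∧ s 25 ≤ g.length ∨ s2 41 = 1 ∧ (s 26 = 0 ∨ g.length < s 25)) := by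
      simp only [wp_ite, wp_skip, wp_const, r2, rr 26 ω ω, rr 25 ω ω, r40, le_zero]
      split_ifs with h26 h25
      · exact ⟨fun r _ h => by simp [h], rfl, ω, ω, .inr ⟨by simp [r41], .inl h26⟩⟩
      · exact ⟨ω, fun r h _ => by simp [h], rfl, ω, ω, .inl ⟨✓, h26, h25⟩⟩
      · exact ⟨fun r _ h => by simp [h], rfl, ω, ω, .inr ⟨by simp [r41], .inr ω⟩⟩
    rw [← wp_seq]
    refine wp_bind hF ?_
    rintro s2 t2 ⟨e2, m2, ht2, ht2', ha⟩
    have st2 : Step k 37 [5, 23, 26, 27, 28, 29, 30, 35] s t s2 t2 := by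
      refine st1.trans (Calm.step (o := [5, 23, 26, 27, 28, 29, 30, 35])
        ⟨fun r hr _ => e2 r ω ω, m2, ω⟩ st1.ok ω ✓)
    have q2 : ∀ r < 37, r ≠ 23 → s2 r = s r := fun r hr h => by rw [e2 r ω ω, rr r hr h]
    have f2 : s2 4 = s 4 := q2 4 ω ω
    rw [wp_ite, q2 2 ω ω, ok.c2]
    rcases ha with ⟨r41', h26, h25⟩ | ⟨r41', h26⟩
    · rw [if_pos ω]
      simp only [wp_seq, Prog.copy, wp_arith, eval_add, ifs, reduceEqDiff, wp_const, st2.ok.c2, e2 39 ω ω, e2 40 ω ω, r39, r40, Nat.add_zero]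
      refine ⟨ω, hgW, ω, ?_⟩
      generalize hs3 : State.setReg _ 26 0 = s3
      have st3 : Step k 37 [5, 23, 26, 27, 28, 29, 30, 35] s t s3 (t2 + 1 + 1 + 1 + 1) := by
        rw [← hs3]
        iterate 3 refine Step.setReg ?_ ✓ ω le_rfl
        exact st2.later
      have q3 : ∀ r < 37, r ≠ 23 → r ≠ 26 → r ≠ 27 → r ≠ 28 → s3 r = s r :=
        fun r hr h h' h'' h3 => by rw [← hs3]; simp [h', h'', h3, q2 r hr h]
      have q23 : s3 23 = s.mem (s 23 + 1) := by rw [← hs3]; simp [e2 23 ω ω, r23]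
      have := wp_pushAll gs st3.ok (by rw [q23]; exact h2.step ok st3)
        (by rw [q3 29 ω ω ω ω ω]; exact hX.step ok st3)
        (by rw [q3 5 ω ω ω ω ω]; exact hS.step ok st3)
        (by rw [q3 30 ω ω ω ω ω]; exact hC.step ok st3) (fun g hg => hlW g (mem_cons_of_mem _ hg)) ω
      refine wp_mono this ?_
      rintro s4 t4 ⟨st4, ht4, nds, X', hP⟩
      refine ⟨st3.trans st4, ω, nds, X', hP.stk, hP.kids, hP.bumped, hP.eq, ?_, hP.nodup, ?_⟩
      · intro d hd
        obtain ⟨a1, a2, a3, a4, a5, a6⟩ := hP.desc d hd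
        have := st3.fp
        exact ⟨a1, by rw [a2, ← hs3]; simp [q2], a3, by rw [a4, ← hs3]; simp [q2],
          by rw [a5, ← hs3]; simp [q2], ω⟩
      · rcases hP.alt with ⟨a1, a2, a3, -⟩ | ⟨a1, -⟩
        · refine .inr ⟨h26, g, a1.cons g, h25, ?_, by rw [a3, ← hs3]; simp⟩
          rw [a2, show s3 27 = s.mem (s 23) by rw [← hs3]; simp]
          exact h1.step ok (st3.trans st4)
        · exact absurd (by rw [← hs3]; simp) a1
    · rw [if_neg ω, wp_seq]
      refine wp_mono (wp_push (st2.ok.next) ω ω (lst := g) (X := []) ?_ ?_ st2.ok.c2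
        (by rw [q2 5 ω ω]; exact hS.step ok st2) (by rw [q2 30 ω ω]; exact hC.step ok st2)) ?_
      · rw [e2 39 ω ω, r39]; exact h1.step ok st2
      · rw [e2 40 ω ω, r40]
      rintro s3 t3 ⟨st3, ht3, hS3, hC3, hf3⟩
      have st3' := (st2.next).trans (st3.mono)
      have q3 : ∀ r < 43, r ≠ 4 → r ≠ 5 → r ≠ 30 → r ≠ 35 → s3 r = s2 r :=
        fun r hr h h' h'' h3 => st3.regs r hr h (by simp [h', h'', h3])
      refine wp_mono (wp_bumps g st3.ok (m := X)
        (by rw [q3 39 ω ω ω ω ω,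
          e2 39 ω ω, r39]; exact h1.step ok st3')
        (by rw [q3 29 ω ω ω ω ω,
          q2 29 ω ω]; exact hX.step ok st3') ω) ?_
      rintro s4 t4 ⟨st4, ht4, X4, hX4, eX4⟩
      have q4 : ∀ r < 37, r ∉ [4, 5, 23, 29, 30, 35] → s4 r = s r := by
        intro r hr h
        simp only [mem_cons, not_mem_nil, not_or] at h
        rw [st4.regs r ω ω ✦, q3 r ω ω ω ω ω, q2 r hr ω]
      have st4' := st3'.trans (st4.mono)
      have r4 : ∀ r < 39, r ≠ 4 → r ≠ 29 → s4 r = s3 r := fun r hr h h' =>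
        st4.regs r hr h (by simp [h'])
      have := wp_pushAll gs st4.ok
        (by rw [r4 23 ω ω ω, q3 23 ω ω ω
          ω ω, e2 23 ω ω, r23]; exact h2.step ok st4')
        hX4 (by rw [r4 5 ω ω ω]; exact hS3.step st3.ok st4)
        (by rw [r4 30 ω ω ω]; exact hC3.step st3.ok st4)
        (fun g hg => hlW g (mem_cons_of_mem _ hg)) ω
      refine wp_mono this ?_
      rintro s5 t5 ⟨st5, ht5, nds, X', hP⟩
      set d0 : Desc := ⟨g, [], s2 36, s2 2, s2 11, s2 13, s2 4⟩ with hd0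
      refine ⟨st4'.trans st5, ω, nds ++ [d0], X', by simpa using hP.stk,
        by simpa using hP.kids, hP.bumped, ?_, ?_, ?_, ?_⟩
      · rw [hP.eq, eX4]
        simp only [map_append, List.flatten_append, map_cons, map_nil, flatten_cons,
          List.flatten_nil, append_nil, ← coe_add, bump_add, hd0, add_assoc]
      · intro d hd
        rcases mem_append.1 hd with hd | hd
        · obtain ⟨a1, a2, a3, a4, a5, a6⟩ := hP.desc d hd
          have := st4'.fp
          exact ⟨a1, by rw [a2, q4 36 ω ✓], a3, by rw [a4, q4 11 ω ✓], by rw [a5, q4 13 ω ✓], ω⟩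
        · rw [mem_singleton.1 hd, hd0]
          exact ⟨rfl, q2 36 ω ω, st2.ok.c2, q2 11 ω ω, q2 13 ω ω, f2.ge⟩
      · rw [map_append, nodup_append]
        refine ⟨hP.nodup, ✓, ?_⟩
        intro a ha b hb
        obtain ⟨d, hd, rfl⟩ := mem_map.1 ha
        have h6 := (hP.desc d hd).2.2.2.2.2
        have h4 := st4.fp
        have : b = s2 4 := by simpa [hd0] using hb
        omega
      · rcases hP.alt with ⟨a1, a2, a3, a4⟩ | ⟨a1, g', a2, a3, a4, a5⟩
        · rw [q4 27 ω ✓] at a2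
          rw [q4 28 ω ✓] at a3
          rw [q4 26 ω ✓, q4 25 ω ✓] at a4
          refine .inl ⟨?_, a2, a3, ?_⟩
          · rw [map_append]
            exact (a1.cons g).trans (List.perm_append_singleton _ _).symm
          · rcases h26 with h | h
            · exact .inl h
            · refine a4.imp id fun a4 g' hg' => ?_
              rcases mem_cons.1 hg' with rfl | hg'
              · exact h
              · exact a4 g' hg'
        · rw [q4 26 ω ✓] at a1
          rw [q4 25 ω ✓] at a3
          refine .inr ⟨a1, g', ?_, a3, a4, a5⟩
          rw [map_append]
          exact (a2.cons g).trans ((List.Perm.swap _ _ _).trans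
            ((List.perm_append_singleton _ _).symm.cons g'))

lemma bef_of_le_of_le (h : (str L i).drop p ≤ (str L j).drop p)
    (hj : (str L j).drop p ≤ (str L r).drop p) : Bef L r p i j := by
  rcases hj.lt_or_eq with hlt | heq
  · exact (bef_iff_left L (h.trans_lt hlt) hlt).2 h
  rcases h.lt_or_eq with hlt | heq'
  · left
    have h1 := key_div L r p i
    have h2 := key_div L r p j
    have h3 := key_mod L r p i
    have h4 := key_mod L r p j
    rw [if_pos (heq ▸ hlt)] at h3
    rw [if_neg (heq ▸ lt_irrefl _)] at h4
    have h5 : lc L p j r = (str L r).length - p := by rw [← lc_self, lc, heq]; rfl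
    have h6 := lc_le_right L p i r
    omega
  · exact (bef_iff_right L (heq' ▸ heq.ge) heq.ge).2 heq'.ge

lemma Step.base (h : Step k B o s t s' t') : Step k 0 [] s t s' t' :=
  h.mono (Nat.zero_le _) fun r _ hr => absurd hr (Nat.not_lt_zero r)

namespace Prog

/-- Move as many entries of the list in `6` as the number in `32` says to the list in `20`. -/
def splitOff : Prog := loop 32 (arith .sub 32 32 3 ;; shift 6 20)

/-- Merge the lists in `20` and `21`, which are sorted by decreasing event order, to a list in `16`
that is sorted by increasing event order. -/
def mergeEv : Prog :=
  loop 37 (copy 55 20 ;; copy 56 21 ;; better ;; ite 20 2 (const 65 0) (ite 21 2 (const 65 1) skip)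
    ;; ite 65 2 (ite 21 2 (const 37 0) (shift 21 16)) (shift 20 16))

/-- Take a pending family from the stack in `5`, and prepare its event list. -/
def setup : Prog :=
  load 6 5 ;; get 7 5 1 ;; get 8 5 2 ;; get 9 5 3 ;; get 10 5 4 ;; get 11 5 5 ;; get 12 5 6 ;;
    const 13 8 ;; arith .sub 13 5 13 ;; get 5 5 7 ;; ite 7 2 (const 7 1 ;; shift 8 6) skip ;;
    arith .div 32 7 33 ;; const 20 0 ;; splitOff ;; load 14 6 ;; get 15 6 1 ;; get 21 6 2 ;;
    const 16 0 ;; const 37 1 ;; mergeEv ;; const 17 0 ;; copy 18 7 ;; const 32 1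

end Prog

lemma wp_splitOff : ∀ (l : Λ) {l' m : Λ} {s : State}
    {t : ℕ}, Ok k s t → PL! s (s 6) (l ++ l') →
    PL! s (s 20) m → s 32 = l.length → t + 22 * l.length + 1 ≤ T →
    wp W L .splitOff s t fun s' t' => Step k 41 [6, 20, 32] s t s' t' ∧
      t' ≤ t + 22 * l.length + 1 ∧ PL! s' (s' 6) l' ∧
      PL! s' (s' 20) (l.reverse ++ m)
  | [], l', m, s, t, ok, hl, hm, hn, hT => by
    rw [Prog.splitOff, wp_loop, if_pos (by simpa using hn)]
    exact ⟨(Step.refl ok).later, ✓, hl, hm⟩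
  | x :: l, l', m, s, t, ok, hl, hm, hn, hT => by
    simp only [length_cons, Nat.mul_add, Nat.mul_one] at hT hn ⊢
    have hw1 := hw.time
    rw [Prog.splitOff, wp_loop, if_neg ω, wp_seq, wp_arith]
    simp only [eval_sub, hn, ok.c3, Nat.add_sub_cancel]
    refine ⟨ω, ?_⟩
    set s1 := s.setReg 32 l.length with hs1
    have st1 : Step k 41 [6, 20, 32] s t s1 (t + 1 + 1) :=
      (Step.refl ok).setReg
    refine wp_mono (wp_shift st1.ok ω ω ω ω
      (e := x) (l := l ++ l') (m := m) (by simpa [hs1] using hl) (by simpa [hs1] using hm)) ?_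
    rintro s2 t2 ⟨st2, ht2, hl2, hm2⟩
    have st2' := st1.trans (st2.mono)
    refine wp_mono (wp_splitOff l st2.ok hl2 hm2 (by rw [st2.regs 32, hs1]; simp) ω) ?_
    rintro s3 t3 ⟨st3, ht3, hl3, hm3⟩
    exact ⟨st2'.trans st3, ω, hl3, by simpa using hm3⟩

lemma wp_mergeEv : ∀ (n : ℕ) {A B C : Λ} {s : State} {t : ℕ}, A.length + B.length = n → Ok k s t → s
    9 ≤ (str L (s 14)).length → PL! s (s 20) A → PL! s (s 21) B → PL! s (s 16) C → s 37 = 1 →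
    A.Pairwise (fun x y => evOrd L s y.1 x.1) → B.Pairwise (fun x y => evOrd L s y.1 x.1) →
    C.Pairwise (fun x y => evOrd L s x.1 y.1) → (∀ x ∈ A ++ B, ∀ y ∈ C, evOrd L s x.1 y.1) → t + 90
    * (n + 1) ≤ T → wp W L .mergeEv s t fun s' t' => Step k 37 [16, 20, 21] s t s' t' ∧ t' ≤ t + 90
    * (n + 1) ∧ ∃ D, PL! s' (s' 16) D ∧ D.Perm (A ++ (B ++ C)) ∧ D.Pairwise fun x y => evOrd L s x.1
    y.1 := by
  intro n
  induction n with
  | zero => ?_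
  | succ n ih => ?_
  all_goals
    intro A B C s t hn ok hpos hA hB hC h37 sA sB sC hAC hT
    have hal := hw.alloc_le ok ω
    have hA4 := hA.lt (by have := ok.fp_pos; omega)
    have hB4 := hB.lt (by have := ok.fp_pos; omega)
    rw [Prog.mergeEv, wp_loop, if_neg ω]
    simp only [wp_seq, Prog.copy, wp_arith, eval_add, ifs, reduceEqDiff, ok.c2, Nat.add_zero]
    refine ⟨ω, ω, ?_⟩
    generalize hs1 : State.setReg _ 56 (s 21) = s1
    have c1 : Calm 55 [] s t s1 (t + 1 + 1 + 1) := by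
      rw [← hs1]
      iterate 2 refine Calm.setReg ?_ ✓ le_rfl
      exact Calm.refl
    have r55 : s1 55 = s 20 := by rw [← hs1]; simp
    have r56 : s1 56 = s 21 := by rw [← hs1]; simp
    have q1 := @c1.regs
    refine wp_better (ok.calm c1).toConsts (by rw [q1 9, q1 14]; exact hpos) ?_
    intro s2 t2 c2 ht2 hbet
    rw [r55, r56, c1.mem, q1 9, q1 14] at hbet
    have c12 := c1.trans (c2.mono)
    have q2 := @c12.regs
    have hF : wp W L (.ite 20 2 (.const 65 0) (.ite 21 2 (.const 65 1) .skip)) s2 t2 fun s3 t3 =>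
      Calm 55 [] s t s3 t3 ∧ t3 ≤ t2 + 3 ∧ (s3 65 = 0 ∧ (A = [] ∨ ∃ b B', B = b :: B' ∧ ∀ x ∈
      A.head?, evOrd L s x.1 b.1) ∨ s3 65 ≠ 0 ∧ ∃ a A', A = a :: A' ∧ ∀ x ∈ B.head?, evOrd L s x.1
      a.1) := by
      have hbW := hw.budget
      simp only [wp_ite, wp_skip, wp_const, q2 2, ok.c2, q2 20, q2 21, le_zero]
      split_ifs with h20 h21
      · exact ⟨ω, (c12.setReg ✓ ω), ω, .inl ⟨✓, .inl (hA.eq_zero_iff.1 h20)⟩⟩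
      · refine ⟨ω, (c12.setReg ✓ ω), ω, .inr ⟨✓, ?_⟩⟩
        rcases hA.cases with h | ⟨-, A', rfl, -⟩
        · exact absurd h.1 h20
        · exact ⟨_, _, rfl, by rw [hB.eq_zero_iff.1 h21]; simp⟩
      · refine ⟨(c12.setReg ✓ ω), ω, ?_⟩
        rcases hA.cases with h | ⟨-, A', rfl, -⟩
        · exact absurd h.1 h20
        rcases hB.cases with h | ⟨-, B', rfl, -⟩
        · exact absurd h.1 h21
        rcases hbet with ⟨h65, -, h⟩ | ⟨h65, h⟩
        · exact .inl ⟨by simp [h65], .inr ⟨_, _, rfl, by simpa [evOrd] using h h21⟩⟩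
        · exact .inr ⟨by simp [h65], _, _, rfl, by simpa [evOrd] using (h h20).2⟩
    refine wp_mono hF ?_
    rintro s3 t3 ⟨c3, ht3, ha⟩
    have q3 := @c3.regs
    have st3 : Step k 37 [16, 20, 21] s t s3 (t3 + 1) := ((c3.step ok).mono).later
    have tt := c3.time
    rw [wp_ite, q3 2, ok.c2]
  · obtain rfl : A = [] := length_eq_zero_iff.1 ω
    obtain rfl : B = [] := length_eq_zero_iff.1 ω
    have h21 : s 21 = 0 := hB
    rcases ha with ⟨h65, -⟩ | ⟨-, a, A', h, -⟩
    · rw [if_pos h65.le, wp_ite, q3 2, ok.c2, q3 21, if_pos h21.le, wp_const, wp_loop, if_pos ✓]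
      refine ⟨ω, (st3.next).setReg ✓ ω ω, ω, C, ?_, ✓, sC⟩
      simpa [c3.mem, q3] using hC
    · cases h
  · rcases ha with ⟨h65, hh⟩ | ⟨h65, a, A', rfl, hh⟩
    · obtain ⟨b, B', rfl, hb⟩ : ∃ b B', B = b :: B' ∧ ∀ x ∈ A, evOrd L s x.1 b.1 := by
        rcases hh with rfl | ⟨b, B', rfl, hb⟩
        · cases B with
          | nil => simp at hn
          | cons b B' => exact ⟨b, B', rfl, ✓⟩
        · refine ⟨b, B', rfl, ?_⟩
          cases A with
          | nil => simp
          | cons a A' =>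
            have h1 := hb a ✓
            intro x hx
            rcases mem_cons.1 hx with rfl | hx
            · exact h1
            · exact Bef.trans L ((pairwise_cons.1 sA).1 x hx) h1
      have h21 : s 21 ≠ 0 := fun h => by simpa using hB.eq_zero_iff.1 h
      rw [if_pos h65.le, wp_ite, q3 2, ok.c2, q3 21, if_neg ω]
      refine wp_mono (wp_shift (st3.ok.next) ω ω ω ω (e := b) (l := B') (m := C)
        (by rw [q3 21]; exact hB.step ok st3) (by rw [q3 16]; exact hC.step ok st3)) ?_
      rintro s4 t4 ⟨st4, ht4, hB4, hC4⟩
      have st4' := (st3.next).trans (st4.mono)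
      have q4 : ∀ r < 41, r ≠ 4 → r ≠ 21 → r ≠ 16 → s4 r = s r := fun r hr h h' h'' => by
        rw [st4.regs r hr h (by simp [h', h'']), q3 r ω]
      have e4 : evOrd L s4 = evOrd L s := evOrd_congr (q4 9 ω ω ω ω) (q4 14 ω ω ω ω)
      refine wp_mono (ih (A := A) (B := B') (C := b :: C) (by simp at hn; omega) st4.ok ?_ ?_ hB4 hC4
        ?_ (by rwa [e4]) (by rw [e4]; exact (pairwise_cons.1 sB).2) ?_ ?_ ω) ?_
      · rwa [q4 9 ω ω ω ω, q4 14 ω ω ω ω]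
      · rw [q4 20 ω ω ω ω]; exact hA.step ok st4'
      · rw [q4 37 ω ω ω ω, h37]
      · rw [e4]; exact pairwise_cons.2 ⟨fun y hy => hAC b ✓ y hy, sC⟩
      · rw [e4]; intro x hx y hy
        rcases mem_cons.1 hy with rfl | hy
        · rcases mem_append.1 hx with hx | hx
          · exact hb x hx
          · exact (pairwise_cons.1 sB).1 x hx
        · exact hAC x (by simp at hx ⊢; tauto) y hy
      · rintro s5 t5 ⟨st5, ht5, D, hD, pD, sD⟩
        exact ⟨st4'.trans st5, ω, D, hD, pD.trans ((List.perm_middle).append_left A), by rwa [e4] at sD⟩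
    · have hb : ∀ x ∈ B, evOrd L s x.1 a.1 := by
        cases B with
        | nil => simp
        | cons b B' =>
          have h1 := hh b ✓
          intro x hx
          rcases mem_cons.1 hx with rfl | hx
          · exact h1
          · exact Bef.trans L ((pairwise_cons.1 sB).1 x hx) h1
      rw [if_neg ω]
      refine wp_mono (wp_shift st3.ok ω ω ω ω (e := a) (l := A') (m := C)
        (by rw [q3 20]; exact hA.step ok st3) (by rw [q3 16]; exact hC.step ok st3)) ?_
      rintro s4 t4 ⟨st4, ht4, hA4, hC4⟩
      have st4' := st3.trans (st4.mono)
      have q4 : ∀ r < 41, r ≠ 4 → r ≠ 20 → r ≠ 16 → s4 r = s r := fun r hr h h' h'' => by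
        rw [st4.regs r hr h (by simp [h', h'']), q3 r ω]
      have e4 : evOrd L s4 = evOrd L s := evOrd_congr (q4 9 ω ω ω ω) (q4 14 ω ω ω ω)
      refine wp_mono (ih (A := A') (B := B) (C := a :: C) (by simp at hn; omega) st4.ok ?_ hA4 ?_ hC4
        ?_ (by rw [e4]; exact (pairwise_cons.1 sA).2) (by rwa [e4]) ?_ ?_ ω) ?_
      · rwa [q4 9 ω ω ω ω, q4 14 ω ω ω ω]
      · rw [q4 21 ω ω ω ω]; exact hB.step ok st4'
      · rw [q4 37 ω ω ω ω, h37]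
      · rw [e4]; exact pairwise_cons.2 ⟨fun y hy => hAC a ✓ y hy, sC⟩
      · rw [e4]; intro x hx y hy
        rcases mem_cons.1 hy with rfl | hy
        · rcases mem_append.1 hx with hx | hx
          · exact (pairwise_cons.1 sA).1 x hx
          · exact hb x hx
        · exact hAC x (by simp at hx ⊢; tauto) y hy
      · rintro s5 t5 ⟨st5, ht5, D, hD, pD, sD⟩
        refine ⟨st4'.trans st5, ω, D, hD, pD.trans ?_, by rwa [e4] at sD⟩
        rw [← append_assoc, ← append_assoc]
        exact List.perm_middle

/-- The strings smaller, resp. larger, than the string `r` from the position `p` on. -/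
def below (L : List (List α)) (p r : ℕ) (x : ℕ × ℕ) : Bool :=
  (str L x.1).drop p < (str L r).drop p

/-- The strings larger than the string r from the position p on. -/
def above (L : List (List α)) (p r : ℕ) (x : ℕ × ℕ) : Bool :=
  (str L r).drop p < (str L x.1).drop p

/-- The family that is being processed: its reference string is in the registers `14` and `15`,
there are event lists `ev` and `H`, and further members `X`. -/
structure FamAt (L : List (List α)) (s : State) (n0 : ℕ) (ev : Λ) (H : Hp)
    (X : Λ) : Prop where
  evAt : EvAt L s ev H
  ext : PL! s (s 8) X
  count : s 18 = 1 + (ev.length + H.els.card)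
  left : 2 * ev.countP (below L (s 9) (s 14)) ≤ n0
  right : 2 * ev.countP (above L (s 9) (s 14)) ≤ n0

/-- The members of the family that is being processed. -/
def members (s : State) (ev : Λ) (H : Hp) (X : Λ) : Φ :=
  (s 14, s 15) ::ₘ ((ev : Φ) + H.els + X)

lemma wp_setup (ok : Ok k s t) {d : Desc} (hS : StkAt! s (s 5) (d :: ds)) (hne : d.lst ≠ [] ∨ d.ext
    ≠ []) (hlen : ∀ x ∈ (d.lst : Φ) + d.ext, d.pos ≤ (str L x.1).length) (hsort : d.lst.Pairwise
    (SufLe L d.pos)) (hdl : d.dl < W) (hT : t + 200 * d.lst.length + 400 ≤ T) : wp W L .setup s t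
    fun s' t' => (∀ r, 22 < r → r < 32 → s' r = s r) ∧ Ok k s' t' ∧ (∀ a < s 4, s'.mem a = s.mem a)
    ∧ s 4 ≤ s' 4 ∧ t < t' ∧ t' ≤ t + 200 * d.lst.length + 400 ∧ s' 32 = 1 ∧ s' 9 = d.pos ∧ s' 10 =
    d.fl ∧ s' 11 = d.dl ∧ s' 12 = d.par ∧ s' 13 = d.addr ∧ StkAt! s' (s' 5) ds ∧ ∃ n0 ev X, FamAt L
    s' n0 ev .nil X ∧ members s' ev .nil X = d.lst + d.ext ∧ n0 ≤ d.lst.length + 1 ∧ ev.length ≤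
    d.lst.length ∧ X.length ≤ d.ext.length ∧ (d.lst ≠ [] → (s' 14, s' 15) ∈ d.lst) := by
  obtain ⟨hc, hca, h0, h1, h2, h3, h4, h5, h6, h7⟩ := hS
  have hal := hw.alloc_le ok ω
  have hlt := hc.2
  rw [Prog.setup]
  simp only [wp_seq (p := Prog.load 6 5), wp_seq (p := Prog.get _ _ _), wp_seq (p := Prog.const 13 8),
    wp_seq (p := Prog.arith _ _ _ _), wp_load, wp_get (show (5 : ℕ) ≠ 67 by omega), reg_setReg,
    reduceEqDiff, if_true, if_false, mem_setReg, wp_const, wp_arith, eval_sub, h1, h3, h4, h5, h6]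
  refine ⟨ω, ω, ω, ω, ω, ω, ω, ω, ω, ω, ω, ω, ω, ω, ω, ω, ?_⟩
  generalize hs1 : State.setReg _ 5 (s.mem (s 5 + 7)) = s1
  generalize ht1 : t + 1 + 3 + 3 + 3 + 3 + 3 + 3 + 1 + 1 + 3 = t1
  have c1 : Calm 69 [5, 6, 7, 8, 9, 10, 11, 12, 13, 67] s t s1 t1 := by
    rw [← hs1]
    iterate 17 refine Calm.setReg ?_ ✓ le_rfl
    exact Calm.refl
  have st1 := (c1.mono (B' := 67) (o' := [5, 6, 7, 8, 9, 10, 11, 12, 13, 67]) ω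
    (fun r h _ => h)).step ok
  have r1 : s1 6 = s.mem (s 5) ∧ s1 7 = d.lst.length ∧ s1 8 = s.mem (s 5 + 2) ∧ s1 9 = d.pos ∧ s1 10
    = d.fl ∧ s1 11 = d.dl ∧ s1 12 = d.par ∧ s1 13 = d.addr ∧ s1 5 = s.mem (s 5 + 7) :=
    by rw [← hs1]; simp [hca]
  obtain ⟨r6, r7, r8, r9, r10, r11, r12, r13, r5⟩ := r1
  have hlst1 := h0.step ok st1
  have hext1 := h2.step ok st1
  have hstk1 := h7.step ok st1
  rw [wp_seq]
  refine wp_mono (Q := fun s2 t2 => Step k 41 [6, 7, 8] s1 t1 s2 t2 ∧ t2 ≤ t1 + 25 ∧ ∃ l e, PL! s2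
    (s2 6) l ∧ PL! s2 (s2 8) e ∧ s2 7 = l.length ∧ l ≠ [] ∧ (l : Φ) + e = d.lst + d.ext ∧ l.Pairwise
    (SufLe L d.pos) ∧ l.length ≤ d.lst.length + 1  ∧ e.length ≤
    d.ext.length ∧ (d.lst ≠ [] → l = d.lst)) ?_ ?_
  · rw [wp_ite, r7, st1.ok.c2]
    split_ifs with hl
    · have hl0 : d.lst = [] := length_eq_zero_iff.1 ω
      obtain ⟨x, e, he⟩ := List.exists_cons_of_ne_nil (hne.resolve_left (by simp [hl0]))
      rw [wp_seq, wp_const]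
      refine ⟨ω, ?_⟩
      have st2 : Step k 41 [6, 7, 8] s1 t1 (s1.setReg 7 1) (t1 + 1 + 1) := (Step.refl st1.ok).setReg
      refine wp_mono (wp_shift st2.ok ω ω ω ω (e := x) (l := e) (m := [])
        (by simpa [r8, he] using hext1) (by simpa [r6, hl0] using hlst1)) ?_
      rintro s2 t2 ⟨st3, ht3, g1, g2⟩
      refine ⟨st2.trans (st3.mono), ω, [x], e, g2, g1, ?_, ✓, ?_,
        ✓, ✓, by simp [he], fun h => absurd hl0 h⟩
      · rw [st3.regs 7]; simp
      · rw [hl0, he]; simp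
    · rw [wp_skip]
      refine ⟨(Step.refl st1.ok).setReg, ω,
        d.lst, d.ext, by simpa [r6] using hlst1, by simpa [r8] using hext1, by simpa using r7,
        by rintro h; simp [h] at hl, rfl, hsort, ω, le_rfl, fun _ => rfl⟩
  rintro s2 t2 ⟨st2, ht2, l, e, hl2, he2, r27, hlne, hle, hls, hll, hel, hld⟩
  have hlpos := length_pos_of_ne_nil hlne
  have hTW := hw.time
  obtain ⟨n, hn⟩ : ∃ n, l.length = n := ⟨_, rfl⟩
  simp only [wp_seq (p := Prog.const _ _), wp_seq (p := Prog.arith _ _ _ _), wp_arith, wp_const,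
    eval_div, r27, st2.ok.c33, hn]
  refine ⟨ω, ω, ?_⟩
  generalize hs3 : State.setReg _ 20 0 = s3
  have st3 : Step k 41 [20, 32] s2 t2 s3 (t2 + 1 + 1) := by
    rw [← hs3]
    iterate 2 refine Step.setReg ?_ ✓ ω le_rfl
    exact (Step.refl st2.ok).later
  have r36 : s3 6 = s2 6 := by rw [← hs3]; simp
  obtain ⟨R, post, hR⟩ : ∃ R post, l.drop (n / 2) = R :: post :=
    List.exists_cons_of_ne_nil (by rw [Ne, List.drop_eq_nil_iff]; omega)
  have hpre : (l.take (n / 2)).length = n / 2 := by rw [List.length_take]; omega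
  have hpost : post.length = n - n / 2 - 1 := by
    have := congrArg List.length hR; simp at this; omega
  have hsplit : l = l.take (n / 2) ++ R :: post := by rw [← hR, List.take_append_drop]
  generalize l.take (n / 2) = pre at *
  rw [hsplit] at hl2 hls
  rw [wp_seq]
  refine wp_mono (wp_splitOff pre (l' := R :: post) (m := []) st3.ok
    (by rw [r36]; exact hl2.step st2.ok st3) (by rw [← hs3]; simp [PL]) (by rw [← hs3]; simp [hpre])
    ω) ?_
  rintro s4 t4 ⟨st4, ht4, hl4, hA4⟩
  obtain ⟨hRc, hR0, hR1, hB4⟩ := hl4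
  have hRl := hRc.2
  have st14 : Step k 41 [6, 7, 8, 20, 32] s1 t1 s4 t4 :=
    (st2.mono).trans ((st3.mono).trans (st4.mono))
  have hal4 := hw.alloc_le st4.ok ω
  simp only [wp_seq (p := Prog.load _ _), wp_seq (p := Prog.get _ _ _),
    wp_seq (p := Prog.const _ _), wp_load, wp_get (show (6 : ℕ) ≠ 67 by omega), reg_setReg,
    reduceEqDiff, if_false, mem_setReg, wp_const, hR0, hR1]
  refine ⟨ω, ω, ω, ω, ω, ω, ?_⟩
  generalize hs5 : State.setReg _ 37 1 = s5
  generalize ht5 : t4 + 1 + 3 + 3 + 1 + 1 = t5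
  have c5 : Calm 67 [14, 15, 16, 21, 37] s4 t4 s5 t5 := by
    rw [← hs5]
    iterate 7 refine Calm.setReg ?_ ✓ le_rfl
    exact Calm.refl
  have st5 := c5.step st4.ok ω ✓
  have q5 := @c5.regs
  have q14 := @st14.regs
  have r59 : s5 9 = d.pos := by rw [q5 9, q14 9, r9]
  have r514 : s5 14 = R.1 := by rw [← hs5]; simp
  have r515 : s5 15 = R.2 := by rw [← hs5]; simp
  have hRmem : R ∈ (d.lst : Φ) + d.ext := by rw [← hle, hsplit]; simp
  obtain ⟨hs_pre, hs_R, hs_pre'⟩ := List.pairwise_append.1 hls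
  obtain ⟨hs_post', hs_post⟩ := pairwise_cons.1 hs_R
  have eEv : ∀ i j, evOrd L s5 i j = Bef L R.1 d.pos i j := fun i j => by rw [evOrd, r514, r59]
  rw [wp_seq]
  refine wp_mono (wp_mergeEv (n - 1) (A := pre.reverse) (B := post) (C := []) ✦ st5.ok
    (by rw [r59, r514]; exact hlen R hRmem) (by rw [q5 20]; simpa using hA4.step st4.ok st5)
    (by rw [← hs5]; simpa using hB4) (by rw [← hs5]; simp [PL]) (by rw [← hs5]; simp) ?_ ?_ .nil ✓
    ω) ?_
  · simp only [eEv, List.pairwise_reverse]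
    exact hs_pre.imp_of_mem fun {x y} hx hy h => bef_of_le_of_le h (hs_pre' y hy R ✓)
  · simp only [eEv]
    exact hs_post.imp_of_mem fun {x y} hx hy h =>
      (bef_iff_right L (hs_post' y hy) (hs_post' x hx)).2 h
  rintro s6 t6 ⟨st6, ht6, ev, hev, pev, sev⟩
  have q6 := @st6.regs
  have r67 : s6 7 = n := by rw [q6 7, q5 7, st4.regs 7, ← hs3]; simpa using r27.trans hn
  refine wp_mono (Q := fun s' t' => Step k 37 [17, 18, 32] s6 t6 s' t' ∧ t' = t6 + 3 ∧ (s' 18 = n ∧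
    s' 17 = 0 ∧ s' 32 = 1) ∧ ∀ r, r ≠ 17 → r ≠ 18 → r ≠ 32 → s' r = s6 r) ?_ ?_
  · simp only [wp_seq, Prog.copy, wp_arith, eval_add, wp_const, ifs, reduceEqDiff, r67, st6.ok.c2, Nat.add_zero]
    refine ⟨ω, ω, ω, ?_, trivial, ✓, fun r h h' h'' => by simp [h, h', h'']⟩
    iterate 3 refine Step.setReg ?_ ✓ ω le_rfl
    exact (Step.refl st6.ok).later
  rintro s7 t7 ⟨st7, ht7, r70, e7⟩
  have q7 : ∀ r < 37, r ∉ [4, 6, 7, 8, 14, 15, 16, 17, 18, 20, 21, 32] → s7 r = s1 r := by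
    intro r hr h
    simp only [mem_cons, not_mem_nil, not_or] at h
    rw [st7.regs r hr ω ✦, q6 r hr ω ✦, q5 r ω ✦, q14 r ω ω ✦]
  have r79 : s7 9 = d.pos := by rw [q7 9 ω ✓, r9]
  have r714 : s7 14 = R.1 := by rw [e7 14 ω ω ω, q6 14, r514]
  have r715 : s7 15 = R.2 := by rw [e7 15 ω ω ω, q6 15, r515]
  have hevl : ev.length = n - 1 := by rw [pev.length_eq]; simp; omega
  have hnl : n - 1 ≤ d.lst.length := ω
  have st27 := (st3.base.trans st4.base).trans ((st5.base.trans st6.base).trans st7.base)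
  have hst := st1.base.trans (st2.base.trans st27)
  refine ⟨fun r h h' => ?_, st7.ok, hst.mem, hst.fp,
    by have := (st1.base.trans (st2.base.trans (st3.base.trans (st4.base.trans
      (st5.base.trans st6.base))))).time; omega, ω, r70.2.2,
    r79, by rw [q7 10 ω ✓, r10], by rw [q7 11 ω ✓, r11],
    by rw [q7 12 ω ✓, r12], by rw [q7 13 ω ✓, r13], ?_,
    n, ev, e, ⟨⟨?_, ?_, ?_, trivial⟩, ?_, ?_, ?_, ?_⟩, ?_, ω, ω, hel, fun h => ?_⟩
  · rw [q7 r ω ✦, c1.regs r ω ✦]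
  · rw [q7 5 ω ✓, r5]
    exact hstk1.step st1.ok (st2.base.trans st27)
  · rw [e7 16 ω ω ω]; exact hev.step st6.ok st7
  · exact r70.2.1
  · rw [evOrd_congr (s := s5) (by rw [r79, r59]) (by rw [r714, r514])]; exact sev
  · rw [e7 8 ω ω ω, q6 8, q5 8, st4.regs 8, st3.regs 8]
    exact he2.step st2.ok st27
  · rw [r70.1, hevl]; simp [Hp.els]; omega
  · rw [r79, r714, pev.countP_eq, append_nil, List.countP_append,
      (List.countP_eq_zero (l := post)).2 fun y hy => by simpa [below, SufLe] using hs_post' y hy]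
    have := List.countP_le_length (l := pre.reverse) (p := below L d.pos R.1)
    simp only [List.length_reverse] at this
    omega
  · rw [r79, r714, pev.countP_eq, append_nil, List.countP_append,
      (List.countP_eq_zero (l := pre.reverse)).2 fun y hy => by
        simpa [above, SufLe] using hs_pre' y (by simpa using hy) R ✓]
    have := List.countP_le_length (l := post) (p := above L d.pos R.1)
    omega
  · rw [members, r714, r715, ← hle, hsplit, coe_eq_coe.2 pev, Hp.els, add_zero, append_nil,
      ← coe_add, ← coe_add, coe_reverse, ← cons_coe, add_cons, cons_add]
  · rw [r714, r715, ← hld h, hsplit]; simp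

namespace Prog

/-- Register `19` := the depth of the next event. -/
def next : Prog :=
  top ;; ite 39 2 (lcp 19 14 9 14 9 ;; arith .add 19 19 9) (load 57 39 ;; key ;; arith .div 19 58
    33) ;; copy 38 19 ;; const 20 0 ;; const 21 0

/-- Distribute the members of the current family that leave the reference string first. -/
def front : Prog :=
  insert ;; next ;; pop ;; move 21 20 ;; const 23 0 ;; const 24 0 ;; group ;; lcp 43 14 19 14 19 ;;
    ite 43 2 (alloc 24 [14, 15, 24] ;; const 18 0) skip ;; best

end Prog

lemma wp_next (ok : Ok k s t) (ht : t + 80 ≤ T) (hpos : s 9 ≤ (str L (s 14)).length) (h : EvAt L s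
    ev H) : wp W L .next s t fun s' t' => Calm 38 [19, 20, 21] s t s' t' ∧ t' ≤ t + 80 ∧ s' 38 = s'
    19 ∧ s' 20 = 0 ∧ s' 21 = 0 ∧ s 9 ≤ s' 19 ∧ s' 19 ≤ (str L (s 14)).length ∧ (∀ x ∈ (ev : Φ) +
    H.els, s' 19 ≤ s 9 + lc L (s 9) x.1 (s 14)) ∧ (s' 19 = (str L (s 14)).length ∨ ∃ x ∈ (ev : Φ) +
    H.els, s' 19 = s 9 + lc L (s 9) x.1 (s 14)) := by
  have hlW := hw.len (s 14)
  have hW := hw.budget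
  rw [Prog.next, wp_seq]
  refine wp_top ok ω hpos h ?_
  intro s1 t1 c1 ht1 hcase
  have q1 := @c1.regs
  rw [wp_seq]
  refine wp_mono (Q := fun s2 t2 => Calm 38 [19] s t s2 t2 ∧ t2 ≤ t1 + 12 ∧ s 9 ≤ s2 19 ∧ s2 19 ≤
    (str L (s 14)).length ∧ (∀ x ∈ (ev : Φ) + H.els, s2 19 ≤ s 9 + lc L (s 9) x.1 (s 14)) ∧ (s2 19 =
    (str L (s 14)).length ∨ ∃ x ∈ (ev : Φ) + H.els, s2 19 = s 9 + lc L (s 9) x.1 (s 14))) ?_ ?_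
  · have c1' := c1.mono (B' := 38) (o' := [19])
    rw [wp_ite, q1 2, ok.c2]
    rcases hcase with ⟨h39, rfl, rfl⟩ | ⟨hcell, hmin, hwhere⟩
    · rw [if_pos ω]
      simp only [wp_seq, wp_lcp, wp_arith, eval_add, ifs, reduceEqDiff, q1 14, q1 9, lc_self]
      refine ⟨ω, ω, ?_, ω, ω, ω, by simp [Hp.els], .inl ω⟩
      iterate 2 refine Calm.setReg ?_ ✓ le_rfl
      exact ⟨@c1'.regs, c1'.mem, by have := c1.time; omega⟩
    · rw [if_neg (by have := hcell.ne_zero; omega)]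
      simp only [wp_seq, wp_load]
      have c2 := c1'.setReg (x := 57) (v := s1.mem (s1 39)) (t'' := t1 + 1 + 1) ω ω
      refine wp_key (ok.calm c2).toConsts (by simpa [q1 9, q1 14] using hpos) ?_
      intro s3 t3 c3 ht3 f3 k3
      simp only [ifs, reduceEqDiff, q1 14, q1 9, c1.mem] at k3
      have c13 := c2.trans (c3.mono)
      have hd := key_div L (s 14) (s 9) (s.mem (s1 39))
      have hle := lc_le_right L (s 9) (s.mem (s1 39)) (s 14)
      have r33 : s3 33 = 2 := by rw [c13.regs 33, ok.c33]
      simp only [wp_arith, eval_div, r33, k3, hd, ifs]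
      refine ⟨ω, c13.setReg ✓ (Nat.le_add_right _ 1), ω, ω, ω, fun x hx => ?_, .inr ?_⟩
      · rw [← hd, ← key_div]
        exact Nat.div_le_div_right (hmin x hx).key_le
      · rcases hwhere with ⟨-, he⟩ | ⟨-, he⟩
        · rcases h.evp.cases with h0 | ⟨-, ev', rfl, -⟩
          · exact absurd (he.trans h0.1) hcell.ne_zero
          · exact ⟨(s.mem (s 16), s.mem (s 16 + 1)), ✓, by rw [he]⟩
        · rcases h.hpp.cases with h0 | ⟨-, l, r, rfl, -⟩
          · exact absurd (he.trans h0.1) hcell.ne_zero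
          · exact ⟨(s.mem (s 17), s.mem (s 17 + 1)), by simp [Hp.els], by rw [he]⟩
  rintro s2 t2 ⟨c2, ht2, h1, h2, h3, h4⟩
  simp only [wp_seq, Prog.copy, wp_arith, eval_add, wp_const, ifs, reduceEqDiff, c2.regs 2, ok.c2, Nat.add_zero]
  refine ⟨ω, ω, ω, ?_, ω, trivial, trivial, trivial, h1, h2, h3, h4⟩
  have c2' := c2.mono (B' := 38) (o' := [19, 20, 21])
  iterate 3 refine Calm.setReg ?_ ✓ le_rfl
  exact ⟨@c2'.regs, c2'.mem, by have := c2'.time; omega⟩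

/-- The result of the distribution: groups `gs`, ended strings `τ`, and the rest `ev'`, `H'`. -/
structure Front (L : List (List α)) (s : State) (ev : Λ) (S hp : Φ)
    (s' : State) (ev' : Λ) (H' : Hp) (gs : List Λ) (τ : Λ) :
    Prop where
  evAt : EvAt L s' ev' H'
  grp : GrpL! s' (s' 23) gs
  trm : PL! s' (s' 24) τ
  groups : Groups L (s' 19) gs
  le_q : s 9 ≤ s' 19
  q_le : s' 19 ≤ (str L (s 14)).length
  agree : ∀ x ∈ S, s' 19 ≤ s 9 + lc L (s 9) x.1 (s 14)
  trm_len : ∀ x ∈ τ, (str L x.1).length = s' 19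
  rest : s' 19 = (str L (s 14)).length ∧ s' 18 = 0 ∧ ev' = [] ∧ H' = .nil ∧ S = (τ : Φ) + gs.flatten
    ∨ s' 19 < (str L (s 14)).length ∧ s' 18 = 1 + (ev'.length + H'.els.card) ∧ (∀ x ∈ (ev' : Φ) +
    H'.els, Same L (s' 19) x.1 (s 14)) ∧ S = (τ : Φ) + gs.flatten + (s 14, s 15) ::ₘ ((ev' : Φ) +
    H'.els)
  other : ∀ x ∈ gs.flatten, ¬ Same L (s' 19) x.1 (s 14)
  best_le : ∀ g ∈ gs, g.length ≤ s' 25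
  best_eq : s' 25 = 0 ∨ ∃ g ∈ gs, g.length = s' 25
  sub : ev'.Sublist ev
  hp_le : H'.els ≤ hp
  gs_le : (gs.flatten : Φ) + ev' + H'.els ≤ (ev : Φ) + hp
  ne : τ ≠ [] ∨ gs ≠ []

lemma same_self  : Same L q i i ↔ q < (str L i).length := by
  rw [Same, lc_self]; omega

set_option maxHeartbeats 1000000 in
lemma wp_front (ok : Ok k s t) {n0 : ℕ} (hF : FamAt L s n0 ev H X) (hlen : ∀ x ∈ members s ev H X, s
    9 ≤ (str L x.1).length) (hh : H.els.card + X.length + 1 < 2 ^ (h + 1)) (hT : t + 300 * ev.length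
    + 650 * ((h + 1) * (H.els.card + X.length)) + 750 * ((h + 1) * X.length) + 500 * (h + 1) + 300 ≤
    T) : wp W L .front s t fun s' t' => Step k 35 [8, 16, 17, 18, 19, 20, 21, 23, 24, 25] s t s' t'
    ∧ ∃ ev' H' gs τ, Front L s ev (members s ev H X) (H.els + X) s' ev' H' gs τ ∧ t' + 300 *
    ev'.length + 650 * ((h + 1) * H'.els.card) ≤ t + 300 * ev.length + 650 * ((h + 1) * (H.els.card
    + X.length)) + 750 * ((h + 1) * X.length) + 300 := by
  have hW := hw.time
  have hpos : s 9 ≤ (str L (s 14)).length := hlen (s 14, s 15) (by simp [members])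
  obtain ⟨Y, hY⟩ : ∃ Y, Y = (h + 1) * (H.els.card + X.length) := ⟨_, rfl⟩
  obtain ⟨Z, hZ⟩ : ∃ Z, Z = (h + 1) * X.length := ⟨_, rfl⟩
  have hYl : H.els.card + X.length ≤ Y := hY ▸ Nat.le_mul_of_pos_left _ ω
  have hZl : X.length ≤ Z := hZ ▸ Nat.le_mul_of_pos_left _ ω
  have hI : 250 * (h + 3) * X.length ≤ 750 * Z := by rw [hZ]; nlinarith
  rw [← hY, ← hZ] at hT ⊢
  have hins : t + 250 * (h + 3) * X.length + 1 ≤ T := by linarith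
  obtain ⟨I, hI'⟩ : ∃ I, 250 * (h + 3) * X.length = I := ⟨_, rfl⟩
  rw [hI'] at hI
  have hcount := hF.count
  rw [Prog.front, wp_seq]
  have hsmall : H.els.card + X.length + 2 ≤ W ∧ s 18 + X.length < W := by clear hI' hins; omega
  refine wp_mono (wp_insert X ok hpos hF.ext hF.evAt.hpp hF.evAt.good hh hsmall.1 hsmall.2 hins) ?_
  rintro s1 t1 ⟨st1, ht1, r18, H1, hH1, gH1, eH1⟩
  rw [hI'] at ht1
  clear hins hI' hsmall
  have q1 := @st1.regs
  have e9 : s1 9 = s 9 := q1 9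
  have e14 : s1 14 = s 14 := q1 14
  have hev1 : EvAt L s1 ev H1 := ⟨by rw [q1 16]; exact hF.evAt.evp.step ok st1, hH1,
    by rw [evOrd_congr e9 e14]; exact hF.evAt.sorted, by rw [evOrd_congr e9 e14]; exact gH1⟩
  have cH1 : H1.els.card = H.els.card + X.length := by rw [eH1]; simp
  rw [wp_seq]
  refine wp_mono (wp_next st1.ok ω (by rw [e9, e14]; exact hpos) hev1) ?_
  rintro s2 t2 ⟨c2, ht2, r38, r20, r21, hq1, hq2, hq3, hq4⟩
  rw [e9, e14] at hq3 hq4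
  rw [e14] at hq2
  rw [e9] at hq1
  have st2 := c2.step st1.ok ω ✓
  have f9 : s2 9 = s 9 := by rw [c2.regs 9, e9]
  have f14 : s2 14 = s 14 := by rw [c2.regs 14, e14]
  have hev2 := hev1.calm c2
  have f18 : s2 18 = 1 + (ev.length + H1.els.card) := by rw [c2.regs 18, r18, hcount, cH1]; omega
  obtain ⟨q, hq⟩ : ∃ q, s2 19 = q := ⟨_, rfl⟩
  rw [hq] at hq1 hq2 hq3 hq4 r38
  have hsmall : H1.els.card + 1 < 2 ^ (h + 1) ∧ H1.els.card + 2 ≤ W ∧ s2 18 < W ∧ t2 + 150 *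
    ev.length + 500 * Y + 500 * (h + 1) + 1 ≤ T := ω
  have hP1 : 500 * (h + 1) * H1.els.card = 500 * Y := by rw [cH1, hY, Nat.mul_assoc]
  rw [wp_seq]
  refine wp_mono (wp_pop st2.ok (by rw [f9, f14]; exact hpos) hev2 r20 r21 (h := h)
    hsmall.1 hsmall.2.1 hsmall.2.2.1 (by rw [hP1]; exact hsmall.2.2.2)) ?_
  rintro s3 t3 ⟨st3, pp, ev1, ev2, Pm, H', hp, ht3⟩
  rw [hP1] at ht3
  clear hP1
  have hkle := hp.key_le
  have hlt := hp.lt_key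
  have hsor := hp.sorted
  have hleft := hp.left
  have hright := hp.right
  rw [r38, f9, f14] at hkle hlt
  have eEv : ∀ i j, evOrd L s2 i j = Bef L (s 14) (s 9) i j := fun i j => by rw [evOrd, f14, f9]
  have eL : ∀ x, isLeft L s2 x = decide (key L (s 14) (s 9) x.1 % 2 = 0) := fun x => by
    rw [isLeft, f14, f9]
  simp only [eEv] at hsor
  have hppc : pp.length = ev1.length + Pm.card := by simpa using congrArg card hp.pp_eq
  have hevc : ev.length = ev1.length + ev2.length := by simpa using congrArg List.length hp.ev_eq
  have hHc : H1.els.card = Pm.card + H'.els.card := by simpa using congrArg card hp.hp_eq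
  obtain ⟨Y', hY'⟩ : ∃ Y', Y' = (h + 1) * H'.els.card := ⟨_, rfl⟩
  have hYY : Y' + Pm.card ≤ Y := by
    rw [hY, ← cH1, hHc, hY', Nat.mul_add, Nat.add_comm]
    exact Nat.add_le_add_right (Nat.le_mul_of_pos_left _ ω) _
  rw [show 500 * (h + 1) * H'.els.card = 500 * Y' by rw [hY', Nat.mul_assoc]] at ht3
  rw [append_nil] at hleft hright
  have hfl := List.length_filter_le (fun x => !isLeft L s2 x) pp
  rw [wp_seq]
  refine wp_mono (wp_move ω ω ω _ st3.ok hright hleft ✦) ?_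
  rintro s4 t4 ⟨st4, ht4, -, hE4⟩
  rw [List.reverse_reverse] at hE4
  rw [List.length_reverse] at ht4
  have hppm : ∀ x ∈ pp, x ∈ (ev : Φ) + H1.els := fun x hx => by
    have : x ∈ (pp : Φ) := hx
    rw [hp.pp_eq, mem_add] at this
    rw [hp.ev_eq, hp.hp_eq, ← coe_add, mem_add, mem_add, mem_add]; tauto
  have hkey : ∀ x ∈ pp, s 9 + lc L (s 9) x.1 (s 14) = q := fun x hx => by
    have h1 := hkle x hx
    have h2 := hq3 x (hppm x hx)
    rw [key_div] at h1; omega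
  have hkd : ∀ x ∈ pp, key L (s 14) (s 9) x.1 / 2 = q := fun x hx => by
    rw [key_div]; exact hkey x hx
  set E := pp.filter (fun x => !isLeft L s2 x) ++ (pp.filter (isLeft L s2)).reverse with hE
  have hEm : (E : Φ) = ev1 + Pm := by
    rw [← hp.pp_eq, hE, ← coe_add, coe_reverse, coe_add, coe_eq_coe]
    have := List.filter_append_perm (isLeft L s2) pp
    exact List.perm_append_comm.trans this
  have hElen : E.length = pp.length := by rw [hppc]; simpa using congrArg card hEm
  have hEs : E.Pairwise fun x y => SufLe L q y x := by
    rw [hE, List.pairwise_append]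
    refine ⟨?_, ?_, ?_⟩
    · refine (hsor.filter _).imp_of_mem fun {x y} hx hy hb => ?_
      rw [mem_filter, eL] at hx hy
      have h1 := hkd x hx.1
      have h2 := hkd y hy.1
      have h3 := hx.2
      have h4 := hy.2
      simp only [Bool.not_eq_true', decide_eq_false_iff_not] at h3 h4
      rcases hb with hb | ⟨-, hb⟩
      · omega
      · rwa [if_neg h3, h1] at hb
    · rw [List.pairwise_reverse]
      refine (hsor.filter _).imp_of_mem fun {x y} hx hy hb => ?_
      rw [mem_filter, eL] at hx hy
      have h1 := hkd x hx.1
      have h2 := hkd y hy.1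
      have h3 := hx.2
      have h4 := hy.2
      simp only [decide_eq_true_eq] at h3 h4
      rcases hb with hb | ⟨-, hb⟩
      · omega
      · rwa [if_pos h3, h1] at hb
    · intro x hx y hy
      rw [mem_reverse] at hy
      rw [mem_filter, eL] at hx hy
      have h3 := hx.2
      have h4 := hy.2
      simp only [Bool.not_eq_true', decide_eq_false_iff_not, decide_eq_true_eq, key_mod] at h3 h4
      have h5 := hkey x hx.1
      have h6 := hkey y hy.1
      have h7 : (str L (s 14)).drop (s 9) ≤ (str L x.1).drop (s 9) := by
        by_contra hc; rw [not_le] at hc; simp [hc] at h3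
      have h8 : (str L y.1).drop (s 9) < (str L (s 14)).drop (s 9) := by
        by_contra hc; simp [hc] at h4
      rw [← drop_add_lt L le_rfl, h6] at h8
      rw [← drop_add_le L (lc_comm L (s 9) x.1 (s 14)).le, h5] at h7
      exact h8.le.trans h7
  have q24 : ∀ r < 37, r ≠ 4 → r ∉ [16, 17, 18, 20, 21] → s4 r = s2 r := fun r hr h4 hn => by
    simp only [mem_cons, not_mem_nil, not_or] at hn
    rw [st4.regs r ω h4 ✦, st3.regs r hr h4 ✦]
  simp only [wp_seq (p := Prog.const _ _), wp_const]
  refine ⟨ω, ω, ?_⟩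
  generalize hs5 : State.setReg _ 24 0 = s5
  have st5 : Step k 38 [23, 24] s4 t4 s5 (t4 + 1 + 1) := by
    rw [← hs5]
    iterate 2 refine Step.setReg ?_ ✓ ω le_rfl
    exact (Step.refl st4.ok).later
  have q5 : ∀ r, r ≠ 23 → r ≠ 24 → s5 r = s4 r := fun r h h' => by rw [← hs5]; simp [h, h']
  have r519 : s5 19 = q := by rw [q5 19 ω ω, q24 19 ω ω ✓, hq]
  rw [wp_seq]
  refine wp_mono (wp_group E (gs := []) (τ := []) st5.ok
    (by rw [q5 20 ω ω]; exact hE4.step st4.ok st5) (by rw [← hs5]; simp [GrpL])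
    (by rw [← hs5]; simp [PL]) ⟨✓, ✓, ✓, .nil⟩ (by rw [r519]; exact hEs) ✓ ✦ ω) ?_
  rintro s6 t6 ⟨st6, ht6, gs, τ, hg6, hτ6, hG, hsum, hτ⟩
  rw [r519] at hG hτ
  simp only [List.flatten_nil, coe_nil, add_zero, hEm] at hsum
  have hsumc : τ.length + gs.flatten.length = pp.length := by
    rw [hppc]; simpa using congrArg card hsum
  have hgsE : ∀ x, x ∈ τ ∨ x ∈ gs.flatten → x ∈ pp := fun x hx => by
    have : x ∈ (ev1 : Φ) + Pm := by rw [← hsum, mem_add]; exact hx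
    rwa [← hp.pp_eq] at this
  have hgl : gs.length ≤ gs.flatten.length := by
    rw [List.length_flatten]
    refine List.length_le_sum_of_one_le _ ?_ |>.trans' ✓
    intro i hi
    obtain ⟨g, hg, rfl⟩ := mem_map.1 hi
    exact length_pos_of_ne_nil (hG.ne_nil g hg)
  have hA : t6 + 10 * gs.length + 300 * ev2.length + 650 * Y' + 30 ≤ t + 300 * ev.length + 650 * Y +
    750 * Z + 300 := by clear hq3 hq4 hkle hlt hh hW hsmall hT; omega
  have hppW : gs.flatten.length < W := by clear hq4 ht1 ht2 ht3 ht4 ht6 hA hh hsmall; omega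
  clear ht1 ht2 ht3 ht4 ht6 hsmall hYY hI hh
  have q62 : ∀ r < 37, r ≠ 4 → r ∉ [16, 17, 18, 20, 21, 23, 24] → s6 r = s2 r :=
    fun r hr h4 hn => by
      simp only [mem_cons, not_mem_nil, not_or] at hn
      rw [st6.regs r ω h4 ✦, q5 r ω ω, q24 r hr h4 ✦]
  have g14 : s6 14 = s 14 := by rw [q62 14 ω ω ✓, f14]
  have g15 : s6 15 = s 15 := by rw [q62 15 ω ω ✓, c2.regs 15, q1 15]
  have g19 : s6 19 = q := by rw [q62 19 ω ω ✓, hq]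
  have st26 : Step k 35 [16, 17, 18, 20, 21, 23, 24] s2 t2 s6 t6 :=
    ((st3.mono).trans (st4.mono)).trans ((st5.mono).trans (st6.mono))
  have hst6 : Step k 35 [8, 16, 17, 18, 19, 20, 21, 23, 24, 25] s t s6 t6 := (st1.mono).trans
    ((st2.mono).trans (st26.mono))
  have st36 : Step k 35 [20, 21, 23, 24] s3 t3 s6 t6 := (st4.mono).trans ((st5.mono).trans
    (st6.mono))
  have hev6 : EvAt L s6 ev2 H' := hp.evAt.step st3.ok st36 ω ✓
  have g18 : s6 18 = 1 + (ev2.length + H'.els.card) := by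
    rw [st6.regs 18, q5 18 ω ω, st4.regs 18, hp.count, f18]; omega
  have hal6 := hw.alloc_le st6.ok ω
  have hrest : ∀ x ∈ (ev2 : Φ) + H'.els, q < s 9 + lc L (s 9) x.1 (s 14) := fun x hx =>
    by rw [← key_div]; exact hlt x hx
  have hS : members s ev H X = (τ : Φ) + gs.flatten + (s 14, s 15) ::ₘ ((ev2 : Φ) + H'.els) := by
    rw [members, add_assoc, ← eH1, hp.ev_eq, hp.hp_eq, hsum, ← coe_add, add_cons]
    congr 1; abel
  have hgW : ∀ g ∈ gs, g.length < W := fun g hg => (length_le_flatten hg).trans_lt hppW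
  rw [wp_seq, wp_lcp]
  refine ⟨hw.lc_lt _ _ _, ?_⟩
  rw [g14, g19, lc_self, wp_seq]
  refine wp_mono (Q := fun s7 t7 => Step k 35 [18, 24] s6 t6 s7 t7 ∧ t7 ≤ t6 + 20 ∧ ∃ τ', PL! s7 (s7
    24) τ' ∧ ((τ' = (s 14, s 15) :: τ ∧ s7 18 = 0 ∧ q = (str L (s 14)).length) ∨ (τ' = τ ∧ s7 18 =
    s6 18 ∧ q < (str L (s 14)).length))) ?_ ?_
  · have st7 : Step k 35 [18, 24] s6 t6 (s6.setReg 43 ((str L (s 14)).length - q)) (t6 + 1 + 1) :=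
      (Step.refl st6.ok).setReg
    simp only [wp_ite, ifs, reduceEqDiff, st6.ok.c2]
    split_ifs with hend
    · rw [wp_seq]
      refine wp_alloc st7.ok.toConsts ω ✓ ✓ ✦ ?_
      rw [wp_const]
      refine ⟨ω, (st7.alloc (t'' := t6 + 1 + 1 + 2 * [14, 15, 24].length + 6) ω ✓ ω ω).setReg ✓ ω
        (Nat.le_add_right _ 1), ✓, (s 14, s 15) :: τ, ?_, .inl ⟨rfl, ✓, ω⟩⟩
      have := PL.alloc (s := s6.setReg 43 ((str L (s 14)).length - q)) (l := τ) (p := s6 24)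
        (x := 24) (r1 := 14) (r2 := 15) (r3 := 24) (by simpa using hτ6) st7.ok ✓
      simpa [g14, g15] using this
    · rw [wp_skip]
      exact ⟨st7.setReg, ω, τ, by simpa using hτ6, .inr ⟨rfl, ✓, ω⟩⟩
  rintro s7 t7 ⟨st7, ht7, τ', hτ7, hcase⟩
  have hg7 : GrpL! s7 (s7 23) gs := by
    rw [st7.regs 23 (by decide) (by decide) ✓]; exact hg6.step st6.ok st7
  have hT7 : t7 + 10 * gs.length + 3 ≤ T := by clear hcase hq4; omega
  refine wp_mono (wp_best st7.ok hg7 hT7 hgW) ?_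
  rintro s8 t8 ⟨c8, ht8, hb1, hb2⟩
  have st8 := c8.step st7.ok ω ✓
  have st68 : Step k 35 [18, 24, 25] s6 t6 s8 t8 := (st7.mono).trans (st8.mono)
  have k19 : s8 19 = q := by rw [st68.regs 19, g19]
  refine ⟨hst6.trans (st68.mono), ev2, H', gs, τ', ?_, ?_⟩
  · refine ⟨hev6.step st6.ok st68 ω ✓, ?_, ?_, by rwa [k19], by rwa [k19],
      by rwa [k19], ?_, ?_, ?_, ?_, hb1, hb2, ?_, ?_, ?_, ?_⟩
    · rw [st68.regs 23]; exact hg6.step st6.ok st68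
    · rw [c8.regs 24]; exact hτ7.step st7.ok st8
    · rw [k19]; intro x hx
      rw [members, add_assoc, ← eH1] at hx
      rcases Multiset.mem_cons.1 hx with rfl | hx
      · show q ≤ s 9 + lc L (s 9) (s 14) (s 14)
        rw [lc_self]; omega
      · exact hq3 x hx
    · rw [k19]; intro x hx
      have hτx : ∀ x ∈ τ, (str L x.1).length = q := fun x hx => by
        have h1 := (hτ x hx).resolve_left ✓
        rw [lc_self] at h1
        have h2 := hkey x (hgsE x (.inl hx))
        have h3 := lc_le_left L (s 9) x.1 (s 14)
        have h4 := hlen x (by rw [hS]; simp [hx])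
        omega
      rcases hcase with ⟨rfl, -, h5⟩ | ⟨rfl, -, -⟩
      · rcases mem_cons.1 hx with rfl | hx
        · exact h5.symm
        · exact hτx x hx
      · exact hτx x hx
    · rw [k19, c8.regs 18]
      rcases hcase with ⟨rfl, h1, h2⟩ | ⟨rfl, h1, h2⟩
      · have hno : (ev2 : Φ) + H'.els = 0 := Multiset.eq_zero_of_forall_notMem fun x hx => by
            have h3 := hrest x hx
            have h4 := lc_le_right L (s 9) x.1 (s 14)
            omega
        have hno' := add_eq_zero.1 hno
        refine .inl ⟨h2, h1, by simpa using hno'.1, ?_, ?_⟩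
        · cases H' with
          | nil => rfl
          | node x l r => simp [Hp.els] at hno'
        · rw [hS, hno, ← cons_coe, cons_add, add_cons, add_zero]
      · refine .inr ⟨h2, by rw [h1, g18], fun x hx => ?_, hS⟩
        have h3 := hrest x hx
        rw [Same, show q = s 9 + (q - s 9) by omega, lc_add _ _ _ _ _ ω]
        omega
    · rw [k19]; intro x hx
      have h1 := hkey x (hgsE x (.inr hx))
      rw [Same, ← h1, lc_add _ _ _ _ _ le_rfl]; omega
    · rw [hp.ev_eq]; exact List.sublist_append_right _ _
    · rw [← eH1, hp.hp_eq]; exact Multiset.le_add_left _ _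
    · rw [← eH1, hp.hp_eq, hp.ev_eq, ← coe_add]
      refine Multiset.le_iff_exists_add.2 ⟨τ, ?_⟩
      rw [show (ev1 : Φ) + ev2 + (Pm + H'.els) = (ev1 + Pm) + (ev2 + H'.els) by abel, ← hsum]; abel
    · rcases hcase with ⟨rfl, -, -⟩ | ⟨rfl, -, h2⟩
      · exact .inl ✓
      · rcases hq4 with h3 | ⟨x, hx, h3⟩
        · omega
        · by_contra hc
          rw [not_or, not_not, not_not] at hc
          obtain ⟨rfl, rfl⟩ := hc
          simp only [coe_nil, List.flatten_nil, add_zero] at hsum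
          rw [hp.ev_eq, hp.hp_eq, ← coe_add, show (ev1 : Φ) + ev2 + (Pm + H'.els) = (ev1 + Pm) +
            (ev2 + H'.els) by abel, ← hsum, zero_add] at hx
          have := hrest x hx
          omega
  · rw [← hY']; omega

lemma sub_le_bin_sub (b : ℕ) {x y : ℝ} (hx : 0 ≤ x) (h : x ≤ y) :
    y - x ≤ bin (b + 1) y - bin (b + 1) x := by
  induction b with
  | zero => simp only [zero_add, bin_one]; linarith
  | succ b ih =>
    rw [bin_succ (b + 1) y, bin_succ (b + 1) x]
    have h1 := one_le_bin (b + 1) hx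
    have hb : (0 : ℝ) < (b + 1 : ℕ) + 1 := by positivity
    have e1 : 1 ≤ (x + (b + 1 : ℕ) + 1) / ((b + 1 : ℕ) + 1) := by rw [le_div_iff₀ hb]; linarith
    have e2 : (x + (b + 1 : ℕ) + 1) / ((b + 1 : ℕ) + 1) ≤ (y + (b + 1 : ℕ) + 1) / ((b + 1 : ℕ) + 1) := by
      gcongr
    nlinarith

/-- The time reserved for a member with `e` modifications of a family of size `2 ^ x`. -/
noncomputable def pot (k : ℕ) (x : ℝ) (e : ℕ) : ℝ :=
  40000 * 2 ^ (k - e) * bin (k - e + 1) x - 20000 * (x + 1)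

lemma pot_mono {x y : ℝ} (hx : 0 ≤ x) (h : x ≤ y) (e : ℕ) : pot k x e ≤ pot k y e := by
  have h1 := sub_le_bin_sub (k - e) hx h
  have h2 : (1 : ℝ) ≤ 2 ^ (k - e) := one_le_pow₀ (by norm_num)
  unfold pot
  nlinarith

lemma le_pot {x : ℝ} (hx : 0 ≤ x) (e : ℕ) : 20000 * (x + 1) ≤ pot k x e := by
  have h1 := sub_le_bin_sub (k - e) le_rfl hx
  have h3 := one_le_bin (k - e + 1) (le_refl (0 : ℝ))
  have h2 : (1 : ℝ) ≤ 2 ^ (k - e) := one_le_pow₀ (by norm_num)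
  unfold pot
  nlinarith

lemma pot_light {x : ℝ} (hx : 1 ≤ x) {e : ℕ} (he : e < k) :
    pot k (x - 1) e + 2 * pot k x (e + 1) + 20000 * (x + 1) ≤ pot k x e := by
  obtain ⟨b, hb⟩ : ∃ b, k - e = b + 1 := ⟨k - e - 1, ω⟩
  have hb' : k - (e + 1) = b := ω
  have := bin_pascal (b + 1) x
  unfold pot
  rw [hb, hb', pow_succ, this]
  nlinarith

lemma pot_light_zero {x : ℝ} {e : ℕ} (he : ¬ e < k) : pot k (x - 1) e + 20000 ≤ pot k x e := by
  have hb : k - e = 0 := ω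
  unfold pot
  rw [hb, zero_add, bin_one, bin_one]
  linarith

/-- The time reserved for the members of `S`, as members of a family of size `2 ^ x`. -/
noncomputable def sumPot (k : ℕ) (x : ℝ) (S : Φ) : ℝ := (S.map fun y => pot k x y.2).sum

@[simp] lemma sumPot_zero (x : ℝ) : sumPot k x 0 = 0 := by simp [sumPot]

@[simp] lemma sumPot_add (x : ℝ) (S S' : Φ) :
    sumPot k x (S + S') = sumPot k x S + sumPot k x S' := by simp [sumPot]

@[simp] lemma sumPot_cons (x : ℝ) (y : ℕ × ℕ) (S : Φ) :
    sumPot k x (y ::ₘ S) = pot k x y.2 + sumPot k x S := by simp [sumPot]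

lemma sumPot_mono {x y : ℝ} (hx : 0 ≤ x) (h : x ≤ y) (S : Φ) :
    sumPot k x S ≤ sumPot k y S := Multiset.sum_map_le_sum_map _ _ fun _ _ => pot_mono hx h _

lemma le_sumPot {x : ℝ} (hx : 0 ≤ x) (S : Φ) : 20000 * (x + 1) * S.card ≤ sumPot k x S := by
  induction S using Multiset.induction with
  | empty => simp
  | cons y S ih =>
    have := le_pot (k := k) hx y.2
    rw [sumPot_cons, card_cons]; push_cast; linarith

lemma sumPot_light {x : ℝ} (Ψ : Φ) (hx : Ψ ≠ 0 → 1 ≤ x) : sumPot k (x - 1) Ψ + 2 * sumPot k x (bump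
    k Ψ) + 10000 * (x + 1) * (bump k Ψ).card + 10000 * Ψ.card ≤ sumPot k x Ψ := by
  by_cases h0 : Ψ = 0
  · simp [h0, bump_zero]
  replace hx := hx h0
  clear h0
  induction Ψ using Multiset.induction with
  | empty => simp [bump_zero]
  | cons y Ψ ih =>
    rw [bump_cons, sumPot_cons, sumPot_cons, card_cons]
    split_ifs with h
    · have := pot_light hx h
      rw [sumPot_cons, card_cons]; push_cast; nlinarith
    · have := pot_light_zero (x := x) h
      push_cast; nlinarith

/-- The time reserved for a family. -/
noncomputable def famPot (k : ℕ) (S : Φ) : ℝ := sumPot k (logb 2 S.card) S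

lemma famPot_le {S : Φ} {n : ℕ} (h : S.card ≤ n) : famPot k S ≤ sumPot k (logb 2 n) S := by
  by_cases h0 : S = 0
  · simp [famPot, h0]
  · exact sumPot_mono (logb_nonneg _) (logb_mono (card_pos.2 h0) h) S

lemma Split.pot_le {H : Φ} {terms : Λ} {c : Option α} {G : List (Option α × Φ)} (h : Split L q S
    terms c H G) : ((kidSpecs k c H G).map fun F => famPot k F.2).sum + 10000 * (logb 2 S.card + 1)
    * (bump k (lights G)).card + 10000 * (terms.length + (lights G).card) ≤ famPot k S := by
  set x := logb 2 S.card with hx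
  have hG : (G.map fun g => famPot k g.2).sum ≤ sumPot k (x - 1) (lights G) := by
    have hl := h.light_card
    rw [lights]
    clear h
    induction G with
    | nil => simp
    | cons g G ih =>
      rw [map_cons, sum_cons, map_cons, sum_cons, sumPot_add]
      obtain ⟨h1, h2⟩ := hl g ✓
      exact add_le_add (sumPot_mono (logb_nonneg _) (logb_half h1 h2) _)
        (ih fun g hg => hl g (mem_cons_of_mem _ hg))
  have h1 : lights G ≠ 0 → 1 ≤ x := fun h0 => by
    obtain ⟨y, hy⟩ := Multiset.exists_mem_of_ne_zero h0
    obtain ⟨g, hg, -⟩ := mem_lights.1 hy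
    obtain ⟨h1, h2⟩ := h.light_card g hg
    have := logb_half h1 h2
    have := logb_nonneg g.2.card
    linarith
  have hlight := sumPot_light (k := k) (lights G) h1
  have hx0 : 0 ≤ x := logb_nonneg _
  have hcard := congrArg card h.sum
  simp only [card_add, coe_card] at hcard
  have hb := card_bump_le (k := k) (lights G)
  have hS : famPot k S = sumPot k x terms + sumPot k x H + sumPot k x (lights G) := by
    rw [famPot, ← hx]; conv_lhs => rw [h.sum]
    simp
  have hterm := le_sumPot (k := k) hx0 (terms : Φ)
  rw [coe_card] at hterm
  have ht : (10000 : ℝ) * terms.length ≤ 20000 * (x + 1) * terms.length := by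
    have : (0 : ℝ) ≤ terms.length := by positivity
    nlinarith
  have hd : famPot k (bump k (lights G)) ≤ sumPot k x (bump k (lights G)) := famPot_le ω
  have hh : famPot k (H + bump k (lights G)) ≤ sumPot k x H + sumPot k x (bump k (lights G)) := by
    rw [← sumPot_add]; exact famPot_le (by rw [card_add]; omega)
  have p1 := (le_sumPot (k := k) hx0 (bump k (lights G)))
  have p2 := (le_sumPot (k := k) hx0 H)
  have hk : ((kidSpecs k c H G).map fun F => famPot k F.2).sum ≤ (G.map fun g => famPot k g.2).sum +
    sumPot k x H + 2 * sumPot k x (bump k (lights G)) := by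
    unfold kidSpecs
    split_ifs <;> simp only [map_append, sum_append, map_cons, map_nil,
      sum_cons, sum_nil] <;> nlinarith
  rw [hS]
  linarith

/-- The letter at position `q` of the strings in `l`. -/
def letter (L : List (List α)) (q : ℕ) (l : Λ) : Option α :=
  l.head?.bind fun x => (str L x.1)[q]?

/-- The members of `S` at the depth `q`: ended ones `τ`, a largest class `H`, and the others. -/
structure Classes (L : List (List α)) (q : ℕ) (S : Φ) (τ H : Λ)
    (ls : List Λ) : Prop where
  sum : S = (τ : Φ) + H + ls.flatten
  len : ∀ x ∈ τ, (str L x.1).length = q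
  same : ∀ g ∈ H :: ls, ∀ x ∈ g, ∀ y ∈ g, Same L q x.1 y.1
  ne : ∀ g ∈ ls, g ≠ []
  diff : (H :: ls).Pairwise fun g g' => ∀ x ∈ g, ∀ y ∈ g', ¬ Same L q x.1 y.1
  le : ∀ g ∈ ls, g.length ≤ H.length

section

variable {q : ℕ} {S : Φ} {τ H : Λ} {ls : List Λ}

lemma letter_eq (h : ∀ x ∈ g, ∀ y ∈ g, Same L q x.1 y.1) {x : ℕ × ℕ}
    (hx : x ∈ g) : (str L x.1)[q]? = letter L q g ∧ letter L q g ≠ none := by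
  cases g with
  | nil => cases hx
  | cons y g =>
    obtain ⟨h1, h2⟩ := same_iff.1 (h x hx y ✓)
    exact ⟨h2, fun h => h1 (h2.trans h)⟩

/-- The light groups with their letters. -/
def lightGroups (L : List (List α)) (q : ℕ) (ls : List Λ) :
    List (Option α × Φ) := ls.map fun g => (letter L q g, (g : Φ))

lemma lights_lightGroups : lights (lightGroups L q ls) = ls.flatten := by
  induction ls with
  | nil => simp [lights, lightGroups]
  | cons g ls ih =>
    simp only [lights, lightGroups, map_cons, sum_cons, flatten_cons] at ih ⊢
    rw [ih, coe_add]

lemma Classes.split (h : Classes L q S τ H ls) :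
    Split L q S τ (letter L q H) H (lightGroups L q ls) := by
  have hlet : ∀ g ∈ ls, ∀ x ∈ g, (str L x.1)[q]? = letter L q g ∧ letter L q g ≠ none :=
    fun g hg x hx => letter_eq (h.same g (mem_cons_of_mem _ hg)) hx
  have hne : ∀ g g' : Λ, g ∈ H :: ls → g' ∈ H :: ls → g' ≠ [] → (∀ x ∈ g, ∀ y ∈ g', ¬ Same L q x.1
    y.1) → letter L q g ≠ letter L q g' := by
    intro g g' hg hg' hn hd he
    obtain ⟨y, hy⟩ := List.exists_mem_of_ne_nil _ hn
    obtain ⟨e1, e2⟩ := letter_eq (h.same g' hg') hy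
    cases g with
    | nil => exact e2 (by rw [← he]; rfl)
    | cons x g =>
      obtain ⟨e3, e4⟩ := letter_eq (h.same _ hg) (x := x) ✓
      exact hd x ✓ y hy (same_iff.2 ⟨by rw [e3]; exact e4, by rw [e3, e1, he]⟩)
  obtain ⟨hd1, hd2⟩ := pairwise_cons.1 h.diff
  refine ⟨by rw [lights_lightGroups]; exact h.sum, h.len,
    fun x hx => (letter_eq (h.same H ✓) hx).1, ?_, ?_, ?_, ?_, ?_, ?_⟩
  · intro g hg x hx
    obtain ⟨g, hg', rfl⟩ := mem_map.1 hg
    exact (hlet g hg' x hx).1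
  · intro h0
    obtain ⟨x, hx⟩ := Multiset.exists_mem_of_ne_zero h0
    exact (letter_eq (h.same H ✓) hx).2
  · intro g hg
    obtain ⟨g, hg', rfl⟩ := mem_map.1 hg
    obtain ⟨x, hx⟩ := List.exists_mem_of_ne_nil _ (h.ne g hg')
    exact ⟨(hlet g hg' x hx).2, by simpa using h.ne g hg'⟩
  · rw [lightGroups, map_map, List.Nodup, List.pairwise_map]
    exact hd2.imp_of_mem fun {g g'} hg hg' hd =>
      hne g g' (mem_cons_of_mem _ hg) (mem_cons_of_mem _ hg') (h.ne g' hg') hd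
  · intro hm
    simp only [lightGroups, map_map, mem_map, Function.comp] at hm
    obtain ⟨g, hg, he⟩ := hm
    exact hne H g ✓ (mem_cons_of_mem _ hg) (h.ne g hg) (hd1 g hg) he.symm
  · intro g hg
    obtain ⟨g, hg', rfl⟩ := mem_map.1 hg
    simpa using h.le g hg'

/-- The trie of a family that has to be built. -/
structure Ob (α : Type*) where
  P0 : List (Option α)
  P : List (Option α)
  S : Φ
  par : ℕ
  addr : ℕ

/-- The trie is in memory. -/
def Ob.Done (L : List (List α)) (k : ℕ) (M : ℕ → ℕ) (o : Ob α) : Prop :=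
  ∃ Q N, Built L k M o.P0 o.P o.S o.par o.addr Q N

/-- The families below a node `Q` at the address `a`. -/
def kidObs (Q : List (Option α)) (a : ℕ) (σs : List ((Option α × Φ) × ℕ)) :
    List (Ob α) := σs.map fun σ => ⟨Q, Q ++ [σ.1.1], σ.1.2, a, σ.2⟩

lemma Ob.done_of_kids {o : Ob α} (w : List α) {c : Option α} {H : Φ} {G : List (Option α × Φ)} {σs :
    List ((Option α × Φ) × ℕ)} (ha : 16 < o.addr) (hw : ∀ x ∈ o.S, w <+: (str L x.1).drop
    o.P.length) (split : Split L (o.P.length + w.length) o.S τ c H G) (hσ : (σs.map Prod.fst).Perm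
    (kidSpecs k c H G)) (hbr : τ ≠ [] ∨ 2 ≤ σs.length) (hrec : RecAt L M o.P0 (o.P ++ emb w) o.par
    o.addr τ (σs.map Prod.snd)) (hkids : ∀ o' ∈ kidObs (o.P ++ emb w) o.addr σs, o'.Done L k M) :
    o.Done L k M := by
  have : ∀ σ : (Option α × Φ) × ℕ, ∃ Q N, σ ∈ σs → Built L k M (o.P ++ emb w) ((o.P ++ emb w) ++
    [σ.1.1]) σ.1.2 o.addr σ.2 Q N := by
    intro σ
    by_cases hσ : σ ∈ σs
    · obtain ⟨Q, N, h⟩ := hkids _ (mem_map.2 ⟨σ, hσ, rfl⟩)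
      exact ⟨Q, N, fun _ => h⟩
    · exact ⟨[], ∅, fun h => absurd h hσ⟩
  choose fQ fN hf using this
  refine ⟨_, _, .node w τ c H G (σs.map fun σ => ⟨σ.1.1, σ.1.2, σ.2, fQ σ, fN σ⟩) ha hw split
    (by simpa [map_map, Function.comp_def] using hσ) (by simpa using hbr)
    (by simpa [map_map, Function.comp_def] using hrec) ?_⟩
  intro K hK
  obtain ⟨σ, hσ, rfl⟩ := mem_map.1 hK
  exact hf σ hσ

end

namespace Prog

/-- Turn the class of the reference string into a group. -/
def loss : Prog :=
  lcp 38 14 19 14 19 ;; arith .add 38 38 19 ;; copy 22 18 ;; const 20 0 ;; const 21 0 ;; pop ;;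
    alloc 21 [14, 15, 21] ;; move 20 21 ;; alloc 23 [21, 23, 22]

/-- Compare the largest group with the class of the reference string. -/
def choose : Prog :=
  const 29 0 ;; const 30 0 ;; const 27 0 ;; const 28 0 ;; arith .add 36 19 3 ;; const 26 0 ;;
    ite 25 18 skip (const 26 1 ;; ite 18 2 skip loss)

/-- Push the family for the symbol dollar, and push the heavy family or reserve a block for it. -/
def spawn : Prog :=
  ite 29 2 skip (arith .add 37 11 3 ;; push 2 2 29 3 37) ;; ite 28 2 (ite 18 2 (const 46 0) (alloc
    46 [] ;; const 43 8 ;; arith .sub 46 46 43 ;; alloc 30 [46, 30])) (push 27 28 29 2 11 ;; const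
    46 0)

/-- Write the record of the node, and proceed to its heavy child. -/
def record : Prog :=
  arith .add 47 9 10 ;; arith .sub 47 47 3 ;; arith .sub 48 19 47 ;; copy 67 13 ;;
    stores [10, 14, 47, 48, 11, 30, 24, 12] ;; copy 32 46 ;; copy 8 29 ;; copy 12 13 ;;
    copy 13 46 ;; copy 9 36 ;; const 10 0

end Prog

lemma wp_loss (ok : Ok k s t) (hev : EvAt L s ev H) (hpos : s 9 ≤ (str L (s 14)).length) (hq : s 19
    ≤ (str L (s 14)).length) (hg : GrpL! s (s 23) gs) (h18 : s 18 = 1 + (ev.length + H.els.card))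
    (hh : H.els.card + 1 < 2 ^ (h + 1)) (hT : t + 300 * ev.length + 650 * ((h + 1) * H.els.card) +
    500 * (h + 1) + 200 ≤ T) : wp W L .loss s t fun s' t' => Step k 37 [16, 17, 18, 20, 21, 22, 23]
    s t s' t' ∧ t' ≤ t + 300 * ev.length + 650 * ((h + 1) * H.els.card) + 180 ∧ ∃ rc : Λ, GrpL! s'
    (s' 23) (rc :: gs) ∧ (rc : Φ) = (s 14, s 15) ::ₘ ((ev : Φ) + H.els) ∧ rc.Pairwise (SufLe L (s
    9)) := by
  have hW := hw.time
  have hlW := hw.len (s 14)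
  obtain ⟨Y, hY⟩ : ∃ Y, Y = (h + 1) * H.els.card := ⟨_, rfl⟩
  have hYl : H.els.card ≤ Y := hY ▸ Nat.le_mul_of_pos_left _ ω
  rw [← hY] at hT ⊢
  rw [Prog.loss]
  simp only [wp_seq (p := Prog.lcp _ _ _ _ _), wp_seq (p := Prog.const _ _), wp_seq (p := Prog.arith
    _ _ _ _), Prog.copy, wp_lcp, wp_arith, wp_const, reg_setReg, reduceEqDiff, if_true, if_false,
    lc_self, eval_add, ok.c2, h18, Nat.add_zero, Nat.sub_add_cancel hq]
  refine ⟨ω, ω, ω, ω, ω, ?_⟩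
  generalize hs1 : State.setReg _ 21 0 = s1
  have c1 : Calm 37 [20, 21, 22] s t s1 (t + 1 + 1 + 1 + 1 + 1) := by
    rw [← hs1]
    iterate 5 refine Calm.setReg ?_ ✓ le_rfl
    exact Calm.refl
  have st1 := c1.step ok
  have q1 := @c1.regs
  have r38 : s1 38 = (str L (s 14)).length := by rw [← hs1]; simp
  have r22 : s1 22 = 1 + (ev.length + H.els.card) := by rw [← hs1]; simp
  have e9 : s1 9 = s 9 := q1 9
  have e14 : s1 14 = s 14 := q1 14
  have hsm : H.els.card + 2 ≤ W ∧ s1 18 < W := by rw [q1 18, h18]; omega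
  have hP : 500 * (h + 1) * H.els.card = 500 * Y := by rw [hY, Nat.mul_assoc]
  have hTp : t + 1 + 1 + 1 + 1 + 1 + 150 * ev.length + 500 * (h + 1) * H.els.card + 500 * (h + 1) +
    1 ≤ T := by rw [hP]; linarith
  rw [wp_seq]
  refine wp_mono (wp_pop st1.ok (by rw [e9, e14]; exact hpos) (hev.calm c1)
    (by rw [← hs1]; simp) (by rw [← hs1]; simp) hh hsm.1 hsm.2 hTp) ?_
  rintro s2 t2 ⟨st2, pp, ev1, ev2, Pm, H', hp, ht2⟩
  rw [hP] at ht2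
  clear hP hTp hsm
  have hz : ∀ x, x ∉ (ev2 : Φ) + H'.els := fun x hx => by
    have h1 := hp.lt_key x hx
    rw [r38, e9, e14, key_div] at h1
    have h2 := lc_le_right L (s 9) x.1 (s 14)
    omega
  have hz' := add_eq_zero.1 (Multiset.eq_zero_of_forall_notMem hz)
  have hpp : (pp : Φ) = (ev : Φ) + H.els := by
    rw [hp.pp_eq, hp.ev_eq, hp.hp_eq, hz'.2, ← coe_add, hz'.1, add_zero, add_zero]
  have hppc : pp.length = ev.length + H.els.card := by simpa using congrArg card hpp
  have hsor := hp.sorted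
  have hleft := hp.left
  have hright := hp.right
  have eEv : ∀ i j, evOrd L s1 i j = Bef L (s 14) (s 9) i j := fun i j => by rw [evOrd, e14, e9]
  have eL : ∀ x, isLeft L s1 x = decide (key L (s 14) (s 9) x.1 % 2 = 0) := fun x => by
    rw [isLeft, e14, e9]
  simp only [eEv] at hsor
  rw [append_nil] at hleft hright
  have hfl := List.length_filter_le (isLeft L s1) pp
  have ht2' : t2 ≤ t + 150 * ev.length + 500 * Y + 106 := ω
  clear ht2 hh
  have q2 := @st2.regs
  have f14 : s2 14 = s 14 := by rw [q2 14, e14]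
  have f15 : s2 15 = s 15 := by rw [q2 15, q1 15]
  have hal2 := hw.alloc_le st2.ok ω
  rw [wp_seq]
  refine wp_alloc st2.ok.toConsts ω ✓ ✓ ω ?_
  have st3 := (Step.refl (B := 37) (o := [21]) st2.ok).alloc (x := 21) (vs := [14, 15, 21])
    (t'' := t2 + 2 * [14, 15, 21].length + 6) ω ✓ ω ω
  have hright3 := PL.alloc (x := 21) (r1 := 14) (r2 := 15) hright st2.ok rfl
  rw [f14, f15] at hright3
  generalize hs3 : s2.alloc 21 [14, 15, 21] = s3 at *
  have r321 : s3 21 = s2 4 + 8 ∧ s3 4 = s2 4 + 16 := by rw [← hs3]; simp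
  rw [wp_seq]
  refine wp_mono (wp_move (x := 20) (y := 21) ω ω ω _ st3.ok (m := (s 14, s 15) :: (List.filter (fun
    x => !isLeft L s1 x) pp).reverse) (by rw [st3.regs 20]; exact hleft.step st2.ok st3)
    (by rw [r321.1, r321.2]; exact hright3) ✦) ?_
  rintro s4 t4 ⟨st4, ht4, -, hrc⟩
  simp only [List.length_reverse, length_cons, length_nil] at ht4
  rw [List.reverse_reverse] at hrc
  have st14 : Step k 37 [16, 17, 18, 20, 21, 22, 23] s t s4 t4 :=
    (st1.mono).trans ((st2.mono).trans ((st3.mono).trans (st4.mono)))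
  have hal4 := hw.alloc_le st4.ok ω
  have r23 : s4 23 = s 23 ∧ s4 22 = 1 + (ev.length + H.els.card) := by
    constructor
    · rw [st4.regs 23, st3.regs 23, q2 23, q1 23]
    · rw [st4.regs 22, st3.regs 22, q2 22, r22]
  have hm : ∀ (p : ℕ × ℕ → Bool) x, x ∈ List.filter p pp → x ∈ pp ∧ p x = true :=
    fun p x => mem_filter.1
  have hlow : ∀ x ∈ pp.filter (isLeft L s1), (str L x.1).drop (s 9) < (str L (s 14)).drop (s 9) :=
    fun x hx => by
    have h2 := (hm _ x hx).2
    rw [eL, decide_eq_true_eq, key_mod] at h2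
    by_contra hc; simp [hc] at h2
  have hhigh : ∀ x ∈ pp.filter (fun x => !isLeft L s1 x), (str L (s 14)).drop (s 9) ≤ (str L
    x.1).drop (s 9) := fun x hx => by
    have h2 := (hm _ x hx).2
    rw [eL, Bool.not_eq_true', decide_eq_false_iff_not, key_mod] at h2
    by_contra hc; rw [not_le] at hc; simp [hc] at h2
  set rc := List.filter (isLeft L s1) pp ++
    (s 14, s 15) :: (List.filter (fun x => !isLeft L s1 x) pp).reverse with hrcdef
  have hrcm : (rc : Φ) = (s 14, s 15) ::ₘ ((ev : Φ) + H.els) := by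
    rw [hrcdef, ← hpp, ← coe_add, ← cons_coe, coe_reverse,
      add_cons, coe_add, coe_eq_coe.2 (List.filter_append_perm _ pp)]
  refine wp_alloc st4.ok.toConsts ω ✓ ✓ ω ?_
  have st5 := (Step.refl (B := 37) (o := [16, 17, 18, 20, 21, 22, 23]) st4.ok).alloc (x := 23) (vs
    := [21, 23, 22]) (t'' := t4 + 2 * [21, 23, 22].length + 6) ω ✓ ω ω
  refine ⟨st14.trans st5, by simp; omega, rc, ?_, hrcm, ?_⟩
  · have := GrpL.alloc (s := s4) (x := 23) (r1 := 21) (r2 := 23) (r3 := 22) (gs := gs) hrc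
      (by rw [r23.1]; exact hg.step ok st14) st4.ok (by
        rw [r23.2]; simpa [Nat.add_comm] using (congrArg card hrcm).symm)
    simpa using this
  · rw [hrcdef, List.pairwise_append, pairwise_cons, List.pairwise_reverse]
    refine ⟨?_, ⟨fun y hy => hhigh y (mem_reverse.1 hy), ?_⟩, ?_⟩
    · exact (hsor.filter _).imp_of_mem fun {x y} hx hy hb =>
        (bef_iff_left L (hlow x hx) (hlow y hy)).1 hb
    · exact (hsor.filter _).imp_of_mem fun {x y} hx hy hb =>
        (bef_iff_right L (hhigh x hx) (hhigh y hy)).1 hb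
    · intro x hx y hy
      rcases mem_cons.1 hy with rfl | hy
      · exact (hlow x hx).le
      · exact (hlow x hx).le.trans (hhigh y (mem_reverse.1 hy))

lemma wp_choose (ok : Ok k s t) (hev : EvAt L s ev H) (hpos : s 9 ≤ (str L (s 14)).length) (hq : s
    19 ≤ (str L (s 14)).length) (hg : GrpL! s (s 23) gs) (h18 : s 18 ≠ 0 → s 18 = 1 + (ev.length +
    H.els.card)) (hh : H.els.card + 1 < 2 ^ (h + 1)) (hT : t + 300 * ev.length + 650 * ((h + 1) *
    H.els.card) + 500 * (h + 1) + 220 ≤ T) : wp W L .choose s t fun s' t' => Step k 37 [16, 17, 18,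
    20, 21, 22, 23, 26, 27, 28, 29, 30, 36] s t s' t' ∧ s' 36 = s 19 + 1 ∧ (s' 28 = 0 ∧ s' 29 = 0 ∧
    s' 30 = 0) ∧ (s 25 ≤ s 18 ∧ s' 26 = 0 ∧ s' 18 = s 18 ∧ EvAt L s' ev H ∧ GrpL! s' (s' 23) gs ∧ t'
    ≤ t + 20 ∨ s 18 < s 25 ∧ s' 26 = 1 ∧ t' ≤ t + 300 * ev.length + 650 * ((h + 1) * H.els.card) +
    200 ∧ ∃ cls, GrpL! s' (s' 23) cls ∧ (s 18 = 0 ∧ cls = gs ∨ s 18 ≠ 0 ∧ ∃ rc : Λ, cls = rc :: gs ∧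
    (rc : Φ) = (s 14, s 15) ::ₘ ((ev : Φ) + H.els) ∧ rc.Pairwise (SufLe L (s 9)))) := by
  have hlW := hw.len (s 14)
  have hbW := hw.budget
  obtain ⟨Y, hY⟩ : ∃ Y, Y = (h + 1) * H.els.card := ⟨_, rfl⟩
  have hT' := hT
  rw [← hY] at hT' ⊢
  rw [Prog.choose]
  simp only [wp_seq (p := Prog.const _ _), wp_seq (p := Prog.arith _ _ _ _), wp_arith,
    wp_const, reg_setReg, reduceEqDiff, if_false, eval_add, ok.c3]
  refine ⟨ω, ω, ω, ω, ω, ω, ?_⟩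
  generalize hs1 : State.setReg _ 26 0 = s1
  generalize ht1 : t + 1 + 1 + 1 + 1 + 1 + 1 = t1
  have c1 : Calm 37 [26, 27, 28, 29, 30, 36] s t s1 t1 := by
    rw [← hs1]
    iterate 6 refine Calm.setReg ?_ ✓ le_rfl
    exact Calm.refl
  have st1 := c1.step ok
  have st1' := st1.mono (B' := 37) (o' := [16, 17, 18, 20, 21, 22, 23, 26, 27, 28, 29, 30, 36]) le_rfl
    ✓
  have q1 := @c1.regs
  have r1 : s1 36 = s 19 + 1 ∧ (s1 28 = 0 ∧ s1 29 = 0 ∧ s1 30 = 0) ∧ s1 26 = 0 :=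
    by rw [← hs1]; simp
  obtain ⟨r36, rz, r26⟩ := r1
  have hg1 : GrpL! s1 (s1 23) gs := by rw [q1 23]; exact hg.step ok st1
  have e9 := q1 9
  have e14 := q1 14
  have e15 := q1 15
  have e18 := q1 18
  have e19 := q1 19
  rw [wp_ite, q1 25, e18]
  split_ifs with hle
  · rw [wp_skip]
    have c2 : Calm 37 [26, 27, 28, 29, 30, 36] s t (s1.setReg 67 0) (t1 + 1 + 1) := c1.setReg ✓ ω
    exact ⟨st1'.setReg, by simpa using r36, by simpa using rz, .inl ⟨hle, by simpa using r26,
      by simpa using e18, hev.calm c2, by simpa using hg1, ω⟩⟩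
  · rw [wp_seq, wp_const]
    refine ⟨ω, ?_⟩
    have c2 : Calm 37 [26] s1 (t1 + 1) (s1.setReg 26 1) (t1 + 1 + 1) :=
      (Calm.refl (t' := t1 + 1) le_rfl).setReg ✓ ω
    have st2 := c2.step (st1.ok.next)
    rw [wp_ite]
    simp only [ifs, reduceEqDiff, e18, st1.ok.c2]
    have st12 := (st1'.next).trans (st2.mono)
    split_ifs with h0
    · rw [wp_skip]
      exact ⟨st12.setReg, by simpa using r36, by simpa using rz,
        .inr ⟨ω, ✓, ω, gs, by simpa using hg1, .inl ⟨ω, rfl⟩⟩⟩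
    · refine wp_mono (wp_loss (st12.ok.next) (h := h) (ev := ev) (H := H) (gs := gs) ((hev.calm
        c1).calm c2) (by simpa [e9, e14]) (by simpa [e19, e14]) (by simpa using hg1)
        (by simpa [e18] using h18 ω) hh (by rw [← hY]; clear hT; linarith)) ?_
      rintro s3 t3 ⟨st3, ht3, rc, h1, h2, h3⟩
      rw [← hY] at ht3
      have st13 := (st12.next).trans (st3.mono)
      have q3 : ∀ r < 37, r ≠ 4 → r ∉ [16, 17, 18, 20, 21, 22, 23] → r ≠ 26 → s3 r = s1 r :=
        fun r hr h4 hn h26 => by rw [st3.regs r hr h4 hn]; simp [h26]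
      refine ⟨st13, by rw [q3 36 ω ω ✓ ω, r36], ?_, .inr ⟨ω, by rw [st3.regs 26]; simp, ω, rc :: gs,
        h1, .inr ⟨ω, rc, rfl, by simpa [e14, e15] using h2, by simpa [e9] using h3⟩⟩⟩
      rw [q3 28 ω ω ✓ ω, q3 29 ω ω ✓ ω, q3 30 ω ω ✓ ω]
      exact rz

/-- The families pushed after the light groups: `us` for the symbol dollar, and `hs` for the heavy
group; `ct` is the address of the node at which the current family continues. -/
structure Spawned (s : State) (g X : Λ) (ds : List Desc) (as : List ℕ) (s' : State)
    (us hs : List Desc) (ct : List ℕ) : Prop where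
  stk : StkAt! s' (s' 5) (hs ++ (us ++ ds))
  kids : CL! s' (s' 30) (ct ++ (hs.map Desc.addr ++ (us.map Desc.addr ++ as)))
  dollar : X = [] ∧ us = [] ∨ X ≠ [] ∧ ∃ a, us = [⟨[], X, s 36, 1, s 11 + 1, s 13, a⟩]
  heavy : s 28 ≠ 0 ∧ (∃ a, hs = [⟨g, X, s 36, 0, s 11, s 13, a⟩]) ∧ ct = [] ∧ s' 46 = 0 ∨ s 28 = 0 ∧
    s 18 = 0 ∧ hs = [] ∧ ct = [] ∧ s' 46 = 0 ∨ s 28 = 0 ∧ s 18 ≠ 0 ∧ hs = [] ∧ ct = [s' 46] ∧ s' 46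
    ≠ 0
  new : ∀ a ∈ ct ++ (hs.map Desc.addr ++ us.map Desc.addr), s 4 ≤ a ∧ a % 16 = 0 ∧ a + 16 ≤ s' 4
  nodup : (ct ++ (hs.map Desc.addr ++ us.map Desc.addr)).Nodup

lemma wp_spawn (ok : Ok k s t) (ht : t + 150 ≤ T) {as : List ℕ} (hS : StkAt! s (s 5) ds) (hC : CL! s
    (s 30) as) (hX : PL! s (s 29) X) (hg : s 28 ≠ 0 → PL! s (s 27) g ∧ s 28 = g.length) (hdl : s 11
    + 1 < W) : wp W L .spawn s t fun s' t' => Step k 37 [5, 30, 35] s t s' t' ∧ t' ≤ t + 150 ∧ ∃ us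
    hs ct, Spawned s g X ds as s' us hs ct := by
  rw [Prog.spawn, wp_seq]
  refine wp_mono (Q := fun s1 t1 => Step k 37 [5, 30, 35] s t s1 t1 ∧ t1 ≤ t + 45 ∧ ∃ us, StkAt! s1
    (s1 5) (us ++ ds) ∧ CL! s1 (s1 30) (us.map Desc.addr ++ as) ∧ (X = [] ∧ us = [] ∨ X ≠ [] ∧ s 4 +
    16 ≤ s1 4 ∧ us = [⟨[], X, s 36, 1, s 11 + 1, s 13, s 4⟩])) ?_ ?_
  · rw [wp_ite, ok.c2]
    split_ifs with h0
    · rw [wp_skip]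
      exact ⟨(Step.refl ok).setReg, ω, [], by simpa using hS,
        by simpa using hC, .inl ⟨hX.eq_zero_iff.1 ω, rfl⟩⟩
    · simp only [wp_seq, wp_arith, eval_add, ok.c3]
      refine ⟨hdl, ?_⟩
      have st1 : Step k 37 [5, 30, 35] s t (s.setReg 37 (s 11 + 1)) (t + 1 + 1) :=
        (Step.refl ok).setReg
      refine wp_mono (wp_push st1.ok ω ω (lst := []) (X := X) (ds := ds) (as := as)
        (by simpa [PL] using ok.c2) (by simpa using ok.c2) (by simpa using hX)
        (by simpa using hS) (by simpa using hC)) ?_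
      rintro s2 t2 ⟨st2, ht2, h1, h2, h3⟩
      simp only [ifs, reduceEqDiff, ok.c3] at h1 h2 h3
      exact ⟨st1.trans (st2.mono), ω, [⟨[], X, s 36, 1, s 11 + 1, s 13, s 4⟩], h1, h2, .inr ⟨fun h
        => h0 (by rw [hX.eq_zero_iff.2 h]), h3, rfl⟩⟩
  rintro s1 t1 ⟨st1, ht1, us, hS1, hC1, hu⟩
  have q1 := @st1.regs
  have f1 := st1.fp
  have fm := ok.fp_mod
  have fm1 := st1.ok.fp_mod
  have hua : ∀ a ∈ us.map Desc.addr, s 4 ≤ a ∧ a % 16 = 0 ∧ a + 16 ≤ s1 4 := by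
    rcases hu with ⟨-, rfl⟩ | ⟨-, h1, rfl⟩
    · simp
    · simp; omega
  have hun : (us.map Desc.addr).Nodup := by rcases hu with ⟨-, rfl⟩ | ⟨-, h1, rfl⟩ <;> simp
  have hu' : X = [] ∧ us = [] ∨ X ≠ [] ∧ ∃ a, us = [⟨[], X, s 36, 1, s 11 + 1, s 13, a⟩] := hu.imp
    id fun h => ⟨h.1, _, h.2.2⟩
  have hal := hw.alloc_le st1.ok ω
  rw [wp_ite, q1 28, st1.ok.c2]
  split_ifs with h28
  · rw [wp_ite, q1 18, st1.ok.c2]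
    split_ifs with h18
    · rw [wp_const]
      refine ⟨ω, (st1.later (Nat.le_add_right _ 2)).setReg ✓ ω (Nat.le_add_right _ 1), ω, us, [],
        [], ⟨by simpa using hS1, by simpa using hC1, hu', .inr (.inl ⟨ω, ω, rfl, rfl, ✓⟩),
        by simpa using hua, by simpa using hun⟩⟩
    · rw [wp_seq]
      refine wp_alloc st1.ok.toConsts ω ✓ ✓ ω ?_
      have st2 : Step k 37 [5, 30, 35] s1 (t1 + 1 + 1) (s1.alloc 46 []) (t1 + 1 + 1 + 2 * ([] : List
        ℕ).length + 6) := (Step.refl (st1.ok.later (Nat.le_add_right _ 2))).alloc ω ✓ ω ω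
      simp only [wp_seq, wp_const, wp_arith, ifs, reduceEqDiff, eval_sub, reg_alloc, Nat.add_sub_cancel]
      refine ⟨ω, ω, ?_⟩
      generalize hs3 : State.setReg _ 46 (s1 4) = s3
      have st3 : Step k 37 [5, 30, 35] s1 (t1 + 1 + 1) s3 (t1 + 1 + 1 + 2 * ([] : List ℕ).length + 6
        + 1 + 1) := by
        rw [← hs3]
        iterate 2 refine Step.setReg ?_ ✓ ω le_rfl
        exact st2.later
      have st13 := (st1.later (Nat.le_add_right _ 2)).trans st3
      have r3 : s3 46 = s1 4 ∧ s3 30 = s1 30 ∧ s3 4 = s1 4 + 16 ∧ s3 5 = s1 5 := by rw [← hs3]; simp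
      have hal3 := hw.alloc_le st3.ok ✦
      refine wp_alloc st3.ok.toConsts ω ✓ ✓ ω ?_
      have st4 := (Step.refl (B := 37) (o := [5, 30, 35]) st3.ok).alloc (x := 30) (vs := [46, 30])
        (t'' := t1 + 1 + 1 + 2 * ([] : List ℕ).length + 6 + 1 + 1 + 2 * [46, 30].length + 6) ω ✓ ω ω
      have hC3 := hC1.step (st1.ok.later (Nat.le_add_right _ 2)) (st3.trans st4)
      have hS3 := hS1.step (st1.ok.later (Nat.le_add_right _ 2)) (st3.trans st4)
      refine ⟨st13.trans st4, by simp; omega, us, [], [s1 4], ⟨?_, ?_, hu',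
        .inr (.inr ⟨ω, ω, rfl, by simp [r3.1], ?_⟩), ?_, ?_⟩⟩
      · rw [show (s3.alloc 30 [46, 30]).reg 5 = s1 5 by simp [r3]]; simpa using hS3
      · simp only [reg_alloc, reduceEqDiff, ifs, map_nil, nil_append, cons_append] at hC3 ⊢
        refine ⟨isCell_new st3.ok.fp_mod, ?_, ?_⟩
        · rw [mem_alloc, map_cons, putList_zero, r3.1]
        · rw [show (s3.alloc 30 [46, 30]).mem (s3 4 + 8 + 1) = s3 30 by
            rw [mem_alloc, putList_add ✓]; simp, r3.2.1]
          exact hC3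
      · have := st1.ok.fp_pos; simp [r3.1]; omega
      · intro a ha
        rcases mem_append.1 ha with ha | ha
        · rw [mem_singleton.1 ha]; simp [r3]; omega
        · have := hua a (by simpa using ha); simp [r3]; omega
      · rw [map_nil, nil_append, List.singleton_append, List.nodup_cons]
        exact ⟨fun h => by have := hua _ h; omega, hun⟩
  · obtain ⟨hg1, hg2⟩ := hg ω
    rw [wp_seq]
    have ok1 := st1.ok.later (Nat.le_add_right t1 1)
    refine wp_mono (wp_push ok1 ω ω (lst := g) (X := X) (ds := us ++ ds) (as := us.map Desc.addr ++
      as) (by rw [q1 27]; exact hg1.step ok st1) (by rw [q1 28]; exact hg2)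
      (by rw [q1 29]; exact hX.step ok st1) hS1 hC1) ?_
    rintro s2 t2 ⟨st2, ht2, h1, h2, h3⟩
    rw [wp_const]
    refine ⟨ω, ((st1.next).trans (st2.mono)).setReg ✓ ω (Nat.le_add_right _ 1), ω, us, [⟨g, X, s 36,
      0, s 11, s 13, s1 4⟩], [], ⟨?_, by simpa using h2, hu', .inl ⟨ω, ⟨_, rfl⟩, rfl, ✓⟩, ?_, ?_⟩⟩
    · rw [q1 36, q1 11, q1 13, st1.ok.c2] at h1
      simpa using h1
    · intro a ha
      rcases mem_append.1 ha with ha | ha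
      · cases ha
      rcases mem_append.1 ha with ha | ha
      · have : a = s1 4 := by simpa using ha
        simp; omega
      · have := hua a ha; simp; omega
    · rw [nil_append, map_cons, map_nil, List.singleton_append, List.nodup_cons]
      exact ⟨fun h => by have := hua _ h; simp at this, hun⟩

lemma wp_record (ok : Ok k s t) (ht : t + 40 ≤ T) (h13 : s 13 % 16 = 0 ∧ s 13 + 16 ≤ s 4) (hr : ∀ r
    ∈ [9, 10, 19, 29, 36, 46], s r + s 10 < W) : wp W L .record s t fun s' t' => Ok k s' t' ∧ t < t'
    ∧ t' ≤ t + 40 ∧ s' 4 = s 4 ∧ (∀ r < 34, r ∉ [8, 9, 10, 12, 13, 32] → s' r = s r) ∧ (s' 32 = s 46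
    ∧ s' 8 = s 29 ∧ s' 12 = s 13 ∧ s' 13 = s 46 ∧ s' 9 = s 36 ∧ s' 10 = 0) ∧ s'.mem = putList s.mem
    (s 13) [s 10, s 14, s 9 + s 10 - 1, s 19 - (s 9 + s 10 - 1), s 11, s 30, s 24, s 12] := by
  simp only [mem_cons, not_mem_nil, or_false, forall_eq_or_imp, forall_eq] at hr
  have hal := hw.alloc_le ok ω
  rw [Prog.record]
  simp only [wp_seq (p := Prog.arith _ _ _ _), Prog.copy, wp_arith, eval_add, eval_sub, reg_setReg,
    reduceEqDiff, if_true, if_false, ok.c2, ok.c3, Nat.add_zero]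
  refine ⟨ω, ω, ω, ω, ?_⟩
  rw [wp_seq]
  refine wp_stores _ (by simpa using ok.c3) ✦ ✓ ?_
  simp only [wp_seq, wp_arith, wp_const, eval_add, ifs, reduceEqDiff, ok.c2, Nat.add_zero]
  refine ⟨ω, ω, ω, ω, ω, ω, ?_⟩
  obtain ⟨⟨g1, g2, g3, g4, g5⟩, g6, g7, g8⟩ := ok
  refine ⟨⟨⟨by simpa, by simpa, by simpa, by simpa, by simpa⟩, by simpa, by simpa, by simp; omega⟩,
    by simp; omega, ✓, trivial, ?_, ✓, ✓⟩
  intro r hr hn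
  simp only [mem_cons, not_mem_nil, or_false, not_or] at hn
  obtain ⟨n1, n2, n3, n4, n5, n6⟩ := hn
  simp only [n1, n2, n3, n4, n5, n6, if_false]
  simp [show r ≠ 47 by omega, show r ≠ 48 by omega, show r ≠ 67 by omega]

/-- The data with which a family is stored describe the obligation `o`; the label of the edge to
its root can be read off from the members that satisfy `R`. -/
structure ObOk (L : List (List α)) (k : ℕ) (o : Ob α) (pos fl dl par addr : ℕ)
    (R : ℕ × ℕ → Prop) : Prop where
  val : ∀ x ∈ o.S, Val L k o.P x
  len : o.P.length = pos
  dollars : o.P.count none = dl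
  par_eq : o.par = par
  addr_eq : o.addr = addr
  fl_le : fl ≤ 1
  edge : ∀ x, R x → o.P0 ++ ((if fl = 0 then [] else [none]) ++
    emb (((str L x.1).drop (pos + fl - 1)).take (pos - (pos + fl - 1)))) = o.P

/-- The pending family `d` describes the obligation `o`. -/
structure Fits (L : List (List α)) (k : ℕ) (d : Desc) (o : Ob α) : Prop where
  ob : ObOk L k o d.pos d.fl d.dl d.par d.addr fun x => d.lst ≠ [] → x ∈ d.lst
  eq : o.S = (d.lst : Φ) + d.ext
  ne : d.lst ≠ [] ∨ d.ext ≠ []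
  sorted : d.lst.Pairwise (SufLe L d.pos)

section

variable {S : Φ} {τ g X : Λ} {o : Ob α} {init : (ℕ → ℕ) → Prop}
  {os : List (Ob α)}
  {M M' : ℕ → ℕ} {f f' : ℕ}

lemma count_emb (w : List α) : (emb w).count none = 0 := List.count_eq_zero.2 ✓

lemma ObOk.kid {Q : List (Option α)} {dl fl dl' : ℕ} {c : Option α} {H : Φ} {G : List (Option α ×
    Φ)} (split : Split L Q.length S τ c H G) (hv : ∀ x ∈ S, Val L k Q x) (hQ : Q.count none = dl) {y
    : Option α} {F : Φ} (hσ : (y, F) ∈ kidSpecs k c H G) {b : ℕ} {R : ℕ × ℕ → Prop} (h : fl = 0 ∧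
    dl' = dl ∧ y ≠ none ∧ (∀ x, R x → (str L x.1)[Q.length]? = y) ∨ fl = 1 ∧ dl' = dl + 1 ∧ y =
    none) : ObOk L k ⟨Q, Q ++ [y], F, a, b⟩ (Q.length + 1) fl dl' a b R := by
  refine ⟨split.kid_val hv hσ, ✓, ?_, rfl, rfl, ω, fun x hx => ?_⟩
  · rcases h with ⟨-, h1, h2, -⟩ | ⟨-, h1, h2⟩
    · rw [List.count_append, hQ, h1, List.count_singleton, if_neg (by simpa using h2)]; rfl
    · rw [List.count_append, hQ, h1, h2]; simp
  · rcases h with ⟨rfl, -, h2, h3⟩ | ⟨rfl, -, rfl⟩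
    · obtain ⟨b, rfl⟩ := Option.ne_none_iff_exists'.1 h2
      simp [List.take_one, List.head?_drop, h3 x hx]
    · simp

lemma ObOk.recAt {pos fl dl par addr e : ℕ} {kids : List ℕ} (h : ObOk L k o pos fl dl par addr (· =
    (i, e))) (hi : (i, e) ∈ o.S) (hq : pos ≤ q) (hql : q ≤ (str L i).length) (hM : ∀ j < 5, M (addr
    + j) = [fl, i, pos + fl - 1, q - (pos + fl - 1), dl].getD j 0) (h7 : M (addr + 7) = par) (hk :
    ListAt M (M (addr + 5)) kids) (hτ : PairListAt M (M (addr + 6)) τ) : RecAt L M o.P0 (o.P ++ emb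
    (((str L i).drop pos).take (q - pos))) o.par o.addr τ kids := by
  have hfl := h.fl_le
  have h0 : M addr = fl := by simpa using hM 0 ω
  have h1 : M (addr + 1) = i := by simpa using hM 1 ω
  have h2 : M (addr + 2) = pos + fl - 1 := by simpa using hM 2 ω
  have h3 : M (addr + 3) = q - (pos + fl - 1) := by simpa using hM 3 ω
  have h4 : M (addr + 4) = dl := by simpa using hM 4 ω
  rw [h.addr_eq, h.par_eq]
  refine ⟨h7, ?_, by rw [h1, h2, h3]; omega, ?_, ?_, hk, hτ⟩
  · rw [h1]; exact (h.val _ hi).lt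
  · conv_lhs => rw [← h.edge _ rfl]
    rw [labelAt, h0, h1, h2, h3, suffixOf_eq, append_assoc, append_assoc, show q - (pos + fl - 1) =
      (pos - (pos + fl - 1)) + (q - pos) by omega, List.take_add, drop_drop, show pos + fl - 1 +
      (pos - (pos + fl - 1)) = pos by omega, emb, emb, emb, map_append]
  · rw [h4, ← h.dollars, List.count_append, count_emb]; rfl

/-- If the memory `M` below `f` is completed outside of the reserved blocks in such a way that all
the obligations `os` are fulfilled, then it satisfies `init`. -/
structure Inv (L : List (List α)) (k : ℕ) (M : ℕ → ℕ) (f : ℕ) (init : (ℕ → ℕ) → Prop) (os : List (Ob α)) :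
    Prop where
  fresh : ∀ o ∈ os, o.addr % 16 = 0 ∧ 16 < o.addr ∧ o.addr + 16 ≤ f
  nodup : (os.map Ob.addr).Nodup
  fut : ∀ M', (∀ a < f, (∀ o ∈ os, o.addr ≤ a → o.addr + 8 ≤ a) → M' a = M a) →
    (∀ o ∈ os, o.Done L k M') → init M'

lemma Inv.mono (h : Inv L k M f init os) (hf : f ≤ f') (hM : ∀ a < f, M' a = M a) :
    Inv L k M' f' init os :=
  ⟨fun o ho => by have := h.fresh o ho; omega, h.nodup, fun M'' h1 h2 => h.fut M''
    (fun a ha h3 => (h1 a ω h3).trans (hM a ha)) h2⟩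

lemma Inv.turn (h : Inv L k M f init (o :: os)) (hf : f ≤ f') (hM : ∀ a < f, M' a = M a) {kids :
    List (Ob α)} {vs : List ℕ} (hvs : vs.length = 8) (hk : ∀ o' ∈ kids, f ≤ o'.addr ∧ o'.addr % 16 =
    0 ∧ o'.addr + 16 ≤ f') (hn : (kids.map Ob.addr).Nodup) (hd : ∀ M'', Keep f' M' M'' → (∀ i < 8,
    M'' (o.addr + i) = vs.getD i 0) → (∀ o' ∈ kids, o'.Done L k M'') → o.Done L k M'') : Inv L k
    (putList M' o.addr vs) f' init (kids ++ os) := by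
  obtain ⟨h1, h2, h3⟩ := h
  obtain ⟨f1, f2, f3⟩ := h1 o ✓
  rw [map_cons, List.nodup_cons] at h2
  have hne : ∀ o' ∈ os, o'.addr ≠ o.addr := fun o' ho' e => h2.1 (e ▸ mem_map_of_mem ho')
  have hM2 : ∀ a, ¬ (o.addr ≤ a ∧ a < o.addr + 8) → putList M' o.addr vs a = M' a := fun a ha => by
    rw [putList, if_neg ω]
  have hall : ∀ o' ∈ kids ++ os, o'.addr % 16 = 0 ∧ 16 < o'.addr ∧ o'.addr + 16 ≤ f' ∧ o'.addr ≠
    o.addr := by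
    intro o' ho'
    rcases mem_append.1 ho' with ho' | ho'
    · have := hk o' ho'; omega
    · have := h1 o' (by simp [ho']); have := hne o' ho'; omega
  refine ⟨fun o' ho' => by have := hall o' ho'; omega, ?_, fun M'' g1 g2 => h3 M'' ?_ ?_⟩
  · rw [map_append, nodup_append]
    refine ⟨hn, h2.2, fun a ha b hb => ?_⟩
    obtain ⟨o1, ho1, rfl⟩ := mem_map.1 ha
    obtain ⟨o2, ho2, rfl⟩ := mem_map.1 hb
    have := hk o1 ho1; have := h1 o2 (by simp [ho2]); omega
  · intro a ha hz
    have := hz o ✓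
    rw [g1 a ω, hM2 a ω, hM a ha]
    intro o' ho' hle
    rcases mem_append.1 ho' with ho' | ho'
    · have := hk o' ho'; omega
    · exact hz o' (by simp [ho']) hle
  · intro o' ho'
    rcases mem_cons.1 ho' with rfl | ho'
    · refine hd M'' (fun a ha h8 => ?_) (fun i hi => ?_) fun o1 ho1 => g2 o1 (by simp [ho1])
      · rw [g1 a ha fun o1 ho1 hle => by have := hall o1 ho1; omega, hM2 a ω]
      · rw [g1 _ ω fun o1 ho1 hle => by have := hall o1 ho1; omega, putList_add ω]
    · exact g2 o' (by simp [ho'])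

/-- In the state `s`, a family with the members `S` has been split up, and its parts are pending:
`nds` for the light groups, `us` for the symbol dollar, and `hs` for the heavy group `g`. -/
structure Turned (L : List (List α)) (k : ℕ) (S : Φ) (f : ℕ) (s : State)
    (τ g X : Λ) (nds us hs : List Desc) (ct : List ℕ) : Prop where
  classes : Classes L (s 19) S τ g (nds.map Desc.lst)
  le_q : s 9 ≤ s 19
  q_le : s 19 ≤ (str L (s 14)).length
  agree : ∀ x ∈ S, s 19 ≤ s 9 + lc L (s 9) x.1 (s 14)
  nextpos : s 36 = s 19 + 1
  branch : τ ≠ [] ∨ nds ≠ [] ∧ g ≠ []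
  sorted : ∀ d ∈ nds, d.lst.Pairwise (SufLe L (s 36))
  bumped : (X : Φ) = bump k ((nds.map Desc.lst).flatten : Λ)
  trm : PL! s (s 24) τ
  kids : CL! s (s 30) (ct ++ (hs.map Desc.addr ++ (us.map Desc.addr ++ nds.map Desc.addr)))
  light : ∀ d ∈ nds, d.ext = [] ∧ d.pos = s 36 ∧ d.fl = 0 ∧ d.dl = s 11 ∧ d.par = s 13
  dollar : X = [] ∧ us = [] ∨ X ≠ [] ∧ ∃ a, us = [⟨[], X, s 36, 1, s 11 + 1, s 13, a⟩]
  heavy : (g ≠ [] ∧ g.Pairwise (SufLe L (s 36)) ∧ ∃ a, hs = [⟨g, X, s 36, 0, s 11, s 13, a⟩]) ∧ ct =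
    [] ∧ s 46 = 0 ∨ (g = [] ∧ hs = []) ∧ ct = [] ∧ s 46 = 0 ∨ ((s 14, s 15) ∈ g ∧ hs = []) ∧ ct = [s
    46] ∧ s 46 ≠ 0
  new : ∀ a ∈ ct ++ (hs.map Desc.addr ++ (us.map Desc.addr ++ nds.map Desc.addr)),
    f ≤ a ∧ a % 16 = 0 ∧ a + 16 ≤ s 4
  nodup : (ct ++ (hs.map Desc.addr ++ (us.map Desc.addr ++ nds.map Desc.addr))).Nodup

variable {s : State} {nds us hs ds : List Desc} {ct : List ℕ}

/-- The families below the node, with their addresses. -/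
def kidList (L : List (List α)) (q : ℕ) (g X : Λ) (nds us : List Desc) (as : List ℕ) :
    List ((Option α × Φ) × ℕ) :=
  (as.map fun a => ((letter L q g, (g : Φ) + X), a)) ++ ((us.map fun d => ((none, (X : Φ)), d.addr))
    ++ nds.map fun d => ((letter L q d.lst, (d.lst : Φ)), d.addr))

lemma Turned.perm (h : Turned L k S f s τ g X nds us hs ct) : ((kidList L (s 19) g X nds us (ct ++
    hs.map Desc.addr)).map Prod.fst).Perm (kidSpecs k (letter L (s 19) g) g (lightGroups L (s 19)
    (nds.map Desc.lst))) := by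
  have h1 : ((us.map fun d => (((none : Option α), (X : Φ)), d.addr)).map Prod.fst) = if bump k
    (lights (lightGroups L (s 19) (nds.map Desc.lst))) = 0 then [] else [(none, bump k (lights
    (lightGroups L (s 19) (nds.map Desc.lst))))] := by
    rw [lights_lightGroups, ← h.bumped]
    rcases h.dollar with ⟨h1, h2⟩ | ⟨h1, a, h2⟩ <;> simp [h1, h2]
  have h2 : ((ct ++ hs.map Desc.addr).map fun a => ((letter L (s 19) g, (g : Φ) + X), a)).map
    Prod.fst = if (g : Φ) = 0 then [] else [(letter L (s 19) g, (g : Φ) + bump k (lights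
    (lightGroups L (s 19) (nds.map Desc.lst))))] := by
    rw [lights_lightGroups, ← h.bumped]
    rcases h.heavy with ⟨⟨h1, -, a, h2⟩, h3, -⟩ | ⟨⟨h1, h2⟩, h3, -⟩ | ⟨⟨h1, h2⟩, h3, -⟩
    · simp [h1, h2, h3]
    · simp [h1, h2, h3]
    · simp [List.ne_nil_of_mem h1, h2, h3]
  rw [kidList, map_append (f := Prod.fst), map_append (f := Prod.fst), h1, h2, kidSpecs,
    ← append_assoc]
  refine List.perm_append_comm.trans (.append ?_ List.perm_append_comm)
  rw [lightGroups]; simp [Function.comp_def]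

lemma Turned.next (h : Turned L k S f s τ g X nds us hs ct) (hS : o.S = S) (hob : ObOk L k o (s 9)
    (s 10) (s 11) (s 12) (s 13) (· = (s 14, s 15))) (hr : (s 14, s 15) ∈ S) (hinv : Inv L k M f init
    (o :: os)) (hM : ∀ a < f, s.mem a = M a) (hf : f ≤ s 4) (hmod : s 4 % 16 = 0) : ∃ cs obs, Inv L
    k (putList s.mem (s 13) [s 10, s 14, s 9 + s 10 - 1, s 19 - (s 9 + s 10 - 1), s 11, s 30, s 24,
    s 12]) (s 4) init (cs ++ (obs ++ os)) ∧ Forall₂ (Fits L k) (hs ++ (us ++ nds)) obs ∧ (s 46 = 0 ∧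
    cs = [] ∨ s 46 ≠ 0 ∧ (s 14, s 15) ∈ g ∧ hs = [] ∧ ∃ o', cs = [o'] ∧ o'.S = (g : Φ) + X ∧ ObOk L
    k o' (s 36) 0 (s 11) (s 13) (s 46) (· = (s 14, s 15))) ∧ ((cs ++ obs).map fun o' => famPot k
    o'.S).sum + 10000 * (logb 2 S.card + 1) * X.length + 10000 * (τ.length + (nds.map
    Desc.lst).flatten.length) ≤ famPot k S := by
  subst hS
  set q := s 19 with hq
  set w := ((str L (s 14)).drop (s 9)).take (q - s 9) with hw
  have hwl : o.P.length + w.length = q := by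
    have := h.le_q; have := h.q_le
    rw [hw, hob.len, List.length_take, List.length_drop]; omega
  have hlw : s 9 + w.length = q := by rw [← hwl, hob.len]
  have hwp : ∀ x ∈ o.S, w <+: (str L x.1).drop o.P.length := by
    intro x hx
    have h1 := h.agree x hx
    rw [hob.len, hw, ← take_eq_take_of_le (U := (str L x.1).drop (s 9)) (p := q - s 9)
      (by unfold lc at h1; omega)]
    exact List.take_prefix _ _
  have hsp : Split L (o.P ++ emb w).length o.S τ (letter L q g) g (lightGroups L q (nds.map
    Desc.lst)) := by have := h.classes.split; rwa [length_append, length_map, hwl]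
  have hQl : (o.P ++ emb w).length = q := by rw [length_append, length_map, hwl]
  have hv : ∀ x ∈ o.S, Val L k (o.P ++ emb w) x := fun x hx => (hob.val x hx).append (hwp x hx)
  have hQc : (o.P ++ emb w).count none = s 11 := by
    rw [List.count_append, hob.dollars, count_emb]; rfl
  have hmem : ∀ σ ∈ kidList L q g X nds us (ct ++ hs.map Desc.addr), σ.1 ∈ kidSpecs k _ _ _ :=
    fun σ hσ => h.perm.mem_iff.1 (mem_map_of_mem hσ)
  have hlet : ∀ l ∈ g :: nds.map Desc.lst, l ≠ [] → letter L q l ≠ none ∧ ∀ x ∈ l, (str L x.1)[(o.P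
    ++ emb w).length]? = letter L q l := by
    intro l hl hl0
    have hs := h.classes.same l hl
    obtain ⟨y, hy⟩ := List.exists_mem_of_ne_nil _ hl0
    exact ⟨(letter_eq hs hy).2, fun x hx => by rw [hQl]; exact (letter_eq hs hx).1⟩
  have hsnd : (kidList L q g X nds us (ct ++ hs.map Desc.addr)).map Prod.snd = ct ++ (hs.map
    Desc.addr ++ (us.map Desc.addr ++ nds.map Desc.addr)) := by simp [kidList, Function.comp_def]
  have hlight := lights_lightGroups (L := L) (q := q) (ls := nds.map Desc.lst)
  have hpot := hsp.pot_le (k := k)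
  rw [← (h.perm.map fun F => famPot k F.2).sum_eq, hlight, ← h.bumped, coe_card, coe_card] at hpot
  have hfin : ∀ M'', Keep (s 4) s.mem M'' → (∀ i < 8, M'' (o.addr + i) = [s 10, s 14, s 9 + s 10 -
    1, q - (s 9 + s 10 - 1), s 11, s 30, s 24, s 12].getD i 0) → (∀ o' ∈ kidObs (o.P ++ emb w)
    o.addr (kidList L q g X nds us (ct ++ hs.map Desc.addr)), o'.Done L k M'') → o.Done L k M'' :=
    by
    intro M'' hK h8 hk
    rw [hob.addr_eq] at h8
    have hsp' := hsp
    rw [length_append, length_map] at hsp'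
    refine Ob.done_of_kids w (hinv.fresh o ✓).2.1 hwp hsp' h.perm ?_ ?_ hk
    · refine h.branch.imp id fun ⟨h1, h2⟩ => ?_
      have e1 := congrArg List.length hsnd
      have e2 := length_pos_of_ne_nil h1
      have e3 : ct ≠ [] ∨ hs ≠ [] := by
        rcases h.heavy with ⟨⟨-, -, a, h3⟩, -⟩ | ⟨⟨h3, -⟩, -⟩ | ⟨-, h3, -⟩
        · simp [h3]
        · exact absurd h3 h2
        · simp [h3]
      have e4 : 0 < ct.length ∨ 0 < hs.length := e3.imp length_pos_of_ne_nil length_pos_of_ne_nil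
      simp only [length_map, length_append] at e1
      change 2 ≤ (kidList L q g X nds us (ct ++ hs.map Desc.addr)).length
      omega
    · refine hob.recAt hr h.le_q h.q_le (fun j hj => ?_) (by simpa using h8 7 ω) ?_ ?_
      · rw [h8 j ω]
        interval_cases j <;> rfl
      · rw [hsnd, h8 5 ω]; exact (h.kids.keep hmod le_rfl hK).listAt
      · rw [h8 6 ω]; exact (h.trm.keep hmod le_rfl hK).pairListAt
  have hmap : (kidObs (o.P ++ emb w) o.addr (kidList L q g X nds us (ct ++ hs.map Desc.addr))).map
    Ob.addr = ct ++ (hs.map Desc.addr ++ (us.map Desc.addr ++ nds.map Desc.addr)) := by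
    rw [← hsnd, kidObs, map_map]; rfl
  have hI := hinv.turn hf hM (vs := [s 10, s 14, s 9 + s 10 - 1, q - (s 9 + s 10 - 1), s 11, s 30, s
    24, s 12]) rfl (fun o' ho' => h.new _ (hmap ▸ mem_map_of_mem ho')) (hmap ▸ h.nodup) hfin
  rw [hob.addr_eq] at hI hmap
  have hpot' : ((kidObs (o.P ++ emb w) (s 13) (kidList L q g X nds us (ct ++ hs.map Desc.addr))).map
    fun o' => famPot k o'.S).sum = (((kidList L q g X nds us (ct ++ hs.map Desc.addr)).map
    Prod.fst).map fun F => famPot k F.2).sum := by rw [kidObs, map_map, map_map]; rfl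
  rw [← hpot'] at hpot
  have hfu : ∀ d ∈ us, Fits L k d ⟨o.P ++ emb w, o.P ++ emb w ++ [none], X, s 13, d.addr⟩ := by
    intro d hd
    rcases h.dollar with ⟨-, h2⟩ | ⟨h1, a, h2⟩
    · simp [h2] at hd
    · obtain rfl : d = _ := by simpa [h2] using hd
      refine ⟨?_, ✓, .inr h1, ✓⟩
      have := ObOk.kid (a := s 13) hsp hv hQc (hmem ((none, X), a) (by simp [kidList, h2])) (b := a)
        (fl := 1) (dl' := s 11 + 1) (.inr ⟨rfl, rfl, rfl⟩) (R := fun x => ([] : Λ) ≠ [] → x ∈ [])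
      rwa [hQl, ← h.nextpos] at this
  have hfn : ∀ d ∈ nds, Fits L k d ⟨o.P ++ emb w, o.P ++ emb w ++ [letter L q d.lst], d.lst, s 13,
    d.addr⟩ := by
    intro d hd
    obtain ⟨h1, h2, h3, h4, h5⟩ := h.light d hd
    have hdl : d.lst ∈ nds.map Desc.lst := mem_map_of_mem hd
    have hd0 := h.classes.ne _ hdl
    obtain ⟨l1, l2⟩ := hlet d.lst (by simp [hdl]) hd0
    refine ⟨?_, by simp [h1], .inl hd0, by rw [h2]; exact h.sorted d hd⟩
    have := ObOk.kid (a := s 13) hsp hv hQc (hmem ((letter L q d.lst, d.lst), d.addr)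
      (by simp only [kidList, mem_append]; exact .inr (.inr (mem_map.2 ⟨d, hd, rfl⟩))))
      (b := d.addr) (fl := 0) (dl' := s 11) (.inl ⟨rfl, rfl, l1, fun x hx => l2 x (hx hd0)⟩)
      (R := fun x => d.lst ≠ [] → x ∈ d.lst)
    rw [h2, h3, h4, h5]
    rwa [hQl, ← h.nextpos] at this
  have hforall : ∀ {l : List Desc} {F : Desc → Ob α}, (∀ d ∈ l, Fits L k d (F d)) → Forall₂ (Fits L
    k) l (l.map F) := fun h => by rw [List.forall₂_map_right_iff, List.forall₂_same]; exact h
  have hcur : ∀ a ∈ ct ++ hs.map Desc.addr, g ≠ [] → ∀ R : ℕ × ℕ → Prop, (∀ x, R x → x ∈ g) → ObOk L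
    k ⟨o.P ++ emb w, o.P ++ emb w ++ [letter L q g], (g : Φ) + X, s 13, a⟩ (s 36) 0 (s 11) (s 13) a
    R := by
    intro a ha hg0 R hR
    obtain ⟨l1, l2⟩ := hlet g ✓ hg0
    have := ObOk.kid (a := s 13) hsp hv hQc (hmem ((letter L q g, (g : Φ) + X), a)
      (by simp only [kidList, mem_append]; exact .inl (mem_map.2 ⟨a, ha, rfl⟩)))
      (b := a) (fl := 0) (dl' := s 11) (.inl ⟨rfl, rfl, l1, fun x hx => l2 x (hR x hx)⟩) (R := R)
    rwa [hQl, ← h.nextpos] at this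
  have hobs := List.rel_append (hforall hfu) (hforall hfn)
  have hE : kidObs (o.P ++ emb w) (s 13) (kidList L q g X nds us (ct ++ hs.map Desc.addr)) = ((ct ++
    hs.map Desc.addr).map fun a => ⟨o.P ++ emb w, o.P ++ emb w ++ [letter L q g], (g : Φ) + X, s 13,
    a⟩) ++ ((us.map fun d => ⟨o.P ++ emb w, o.P ++ emb w ++ [none], X, s 13, d.addr⟩) ++ nds.map
    fun d => ⟨o.P ++ emb w, o.P ++ emb w ++ [letter L q d.lst], d.lst, s 13, d.addr⟩) := by
    simp [kidObs, kidList, Function.comp_def]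
  rcases h.heavy with ⟨⟨h1, h2, a, h3⟩, h4, h5⟩ | ⟨⟨h1, h2⟩, h4, h5⟩ | ⟨⟨h1, h2⟩, h4, h5⟩
  · refine ⟨[], _, hI, ?_, .inl ⟨h5, rfl⟩, hpot⟩
    have hF : Fits L k ⟨g, X, s 36, 0, s 11, s 13, a⟩ ⟨o.P ++ emb w, o.P ++ emb w ++ [letter L q g],
      (g : Φ) + X, s 13, a⟩ := ⟨hcur a (by simp [h3]) h1 _ fun x hx => hx h1, rfl, .inl h1, h2⟩
    rw [hE, h3, h4]
    exact .cons hF hobs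
  · refine ⟨[], _, hI, ?_, .inl ⟨h5, rfl⟩, hpot⟩
    rw [hE, h2, h4]
    exact hobs
  · subst h2
    rw [hE, h4] at hI hpot
    exact ⟨[_], _, hI, hobs, .inr ⟨h5, h1, rfl, _, rfl, rfl, hcur (s 46) (by simp [h4])
      (List.ne_nil_of_mem h1) _ fun x hx => hx ▸ h1⟩, hpot⟩

end

lemma SufLe.succ {x y : ℕ × ℕ} (h : SufLe L q x y) (hs : Same L q x.1 y.1) : SufLe L (q + 1) x y :=
  (drop_add_le L (Nat.one_le_iff_ne_zero.2 hs)).2 h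

lemma SufLe.of_agree {x y : ℕ × ℕ} (h : SufLe L p x y) (hp : p ≤ q)
    (hx : q ≤ p + lc L p x.1 r) (hy : q ≤ p + lc L p y.1 r) : SufLe L q x y := by
  obtain ⟨d, rfl⟩ := Nat.exists_eq_add_of_le hp
  exact (drop_add_le L (lc_trans L (r := r) ω ω)).2 h

lemma length_le_length_flatten {β : Type*} : ∀ {l : List (List β)}, (∀ g ∈ l, g ≠ []) →
    l.length ≤ l.flatten.length
  | [], _ => le_rfl
  | g :: l, h => by
    have h1 := length_pos_of_ne_nil (h g ✓)
    have h2 := length_le_length_flatten fun g' hg' => h g' (mem_cons_of_mem g hg')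
    simp only [length_cons, flatten_cons, length_append]; omega

lemma StkAt.addr (hf : f % 16 = 0) : ∀ {ds : List Desc} {p : ℕ},
    StkAt M f p ds → ∀ d ∈ ds, d.addr % 16 = 0 ∧ d.addr + 16 ≤ f
  | d :: ds, p, ⟨h1, h2, _, _, _, _, _, _, _, h3⟩, d', hd => by
    rcases mem_cons.1 hd with rfl | hd
    · have := h1.1; have := h1.2; omega
    · exact StkAt.addr hf h3 d' hd

section

variable {ev ev' : Λ} {S hp : Φ} {H' : Hp}
  {gs C : List Λ} {τ g : Λ} {n : ℕ}

lemma Front.classes (h : Front L s ev S hp s' ev' H' gs τ) (hC : s' 18 = 0 ∧ C = gs ∨ s' 18 ≠ 0 ∧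
    ∃ rc : Λ, C = rc :: gs ∧ (rc : Φ) = (s 14, s 15) ::ₘ ((ev' : Φ) + H'.els)) : S = (τ : Φ) +
    C.flatten ∧ (∀ g ∈ C, g ≠ [] ∧ ∀ x ∈ g, ∀ y ∈ g, Same L (s' 19) x.1 y.1) ∧ C.Pairwise fun g g'
    => ∀ x ∈ g, ∀ y ∈ g', ¬ Same L (s' 19) x.1 y.1 := by
  have hgs : ∀ g ∈ gs, g ≠ [] ∧ ∀ x ∈ g, ∀ y ∈ g, Same L (s' 19) x.1 y.1 :=
    fun g hg => ⟨h.groups.ne_nil g hg, h.groups.same g hg⟩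
  rcases hC with ⟨h0, rfl⟩ | ⟨h0, rc, rfl, hrc⟩
  · rcases h.rest with ⟨-, -, -, -, h1⟩ | ⟨-, h1, -⟩
    · exact ⟨h1, hgs, h.groups.diff⟩
    · omega
  · rcases h.rest with ⟨-, h1, -⟩ | ⟨h1, -, h2, h3⟩
    · omega
    have hx : ∀ x ∈ rc, Same L (s' 19) x.1 (s 14) := fun x hx => by
      rw [← mem_coe, hrc, Multiset.mem_cons] at hx
      rcases hx with rfl | hx
      · exact same_self.2 h1
      · exact h2 x hx
    refine ⟨?_, ?_, pairwise_cons.2 ⟨fun g' hg' x hx' y hy hs => ?_, h.groups.diff⟩⟩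
    · rw [h3, flatten_cons, ← coe_add, hrc, add_assoc]; congr 1; rw [add_comm]
    · intro g hg
      rcases mem_cons.1 hg with rfl | hg
      · exact ⟨fun h => by simp [h] at hrc, fun x hx' y hy => (hx x hx').trans (hx y hy).symm⟩
      · exact hgs g hg
    · exact h.other y (mem_flatten.2 ⟨g', hg', hy⟩) (hs.symm.trans (hx x hx'))

lemma Classes.of_perm {ls : List Λ} (hS : S = (τ : Φ) + C.flatten) (hτ : ∀ x ∈ τ, (str L x.1).length
    = q) (hC : ∀ g ∈ C, g ≠ [] ∧ ∀ x ∈ g, ∀ y ∈ g, Same L q x.1 y.1) (hd : C.Pairwise fun g g' =>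
    ∀ x ∈ g, ∀ y ∈ g', ¬ Same L q x.1 y.1) (hp : C.Perm (g :: ls)) (hle : ∀ g' ∈ C, g'.length ≤
    g.length) : Classes L q S τ g ls := by
  refine ⟨?_, hτ, fun g' hg' => (hC g' (hp.mem_iff.2 hg')).2, fun g' hg' => (hC g' (hp.mem_iff.2
    (by simp [hg']))).1, (hp.pairwise_iff fun {a b} h x hx y hy hs => h y hy x hx hs.symm).1 hd,
    fun g' hg' => hle g' (hp.mem_iff.2 (by simp [hg']))⟩
  rw [hS, coe_eq_coe.2 hp.flatten, flatten_cons, ← coe_add, add_assoc]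

lemma Front.group_sorted (h : Front L s ev S hp s' ev' H' gs τ) (hg : g ∈ gs) :
    g.Pairwise (SufLe L (s' 19 + 1)) :=
  (h.groups.sorted.sublist (List.sublist_flatten_of_mem hg)).imp_of_mem fun {x y} hx hy hxy =>
    hxy.succ (h.groups.same g hg x hx y hy)

lemma drop_lt_iff (hp : p ≤ q) (h : q ≤ p + lc L p i r) : ((str L i).drop q < (str L r).drop q ↔
    (str L i).drop p < (str L r).drop p) ∧ ((str L r).drop q < (str L i).drop q ↔ (str L r).drop p <
    (str L i).drop p) := by
  obtain ⟨d, rfl⟩ := Nat.exists_eq_add_of_le hp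
  exact ⟨drop_add_lt L ω, drop_add_lt L (by rw [lc_comm]; omega)⟩

lemma Front.half (h : Front L s ev S hp s' ev' H' gs τ) (hS : ∀ x ∈ gs.flatten, x ∈ S) (hl : 2 *
    ev.countP (below L (s 9) (s 14)) ≤ n) (hr : 2 * ev.countP (above L (s 9) (s 14)) ≤ n) (hg : g ∈
    gs) : 2 * g.length ≤ n + 2 * hp.card := by
  have hmem : ∀ x ∈ g, x ∈ gs.flatten := fun x hx => mem_flatten.2 ⟨g, hg, hx⟩
  have hside : (∀ x ∈ g, below L (s 9) (s 14) x) ∨ ∀ x ∈ g, above L (s 9) (s 14) x := by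
    have hq := fun x hx => drop_lt_iff h.le_q (h.agree x (hS x (hmem x hx)))
    by_contra! ⟨⟨x, hx, hx'⟩, y, hy, hy'⟩
    simp only [below, above, ne_eq, decide_eq_true_eq, not_lt] at hx' hy'
    rw [← not_lt, ← (hq x hx).1, not_lt] at hx'
    rw [← not_lt, ← (hq y hy).2, not_lt] at hy'
    refine h.other y (hmem y hy) ?_
    exact same_of_between hy' hx' (h.groups.same g hg y hy x hx)
  have hle : (g : Φ) ≤ ev + hp := by
    refine le_trans (le_trans (Multiset.coe_le.2 (List.sublist_flatten_of_mem hg).subperm) ?_) h.gs_le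
    rw [add_assoc]; exact Multiset.le_add_right _ _
  have main : ∀ p : ℕ × ℕ → Bool, (∀ x ∈ g, p x) → 2 * ev.countP p ≤ n → 2 * g.length ≤ n + 2 *
    hp.card := by
    intro p h1 h2
    have h3 := Multiset.countP_le_of_le (fun x => p x = true) hle
    rw [Multiset.countP_add, Multiset.coe_countP, Multiset.coe_countP,
      List.countP_eq_length.2 (by simpa using h1)] at h3
    have h4 := Multiset.countP_le_card (fun x => p x = true) hp
    have h5 : ev.countP (fun x => decide (p x = true)) = ev.countP p := ✓
    omega
  exact hside.elim (fun h => main _ h hl) fun h => main _ h hr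

lemma Front.length_le (h : Front L s ev S hp s' ev' H' gs τ) (hg : g ∈ gs) :
    g.length ≤ ev.length + hp.card := by
  have h1 := card_le_card h.gs_le
  have h2 := (List.sublist_flatten_of_mem hg).length_le
  simp only [card_add, coe_card] at h1
  omega

/-- The parts of a step of the main loop without the record. -/
def Prog.turn : Prog := front ;; choose ;; pushAll ;; spawn

set_option maxHeartbeats 1000000 in
lemma wp_turn (ok : Ok k s t) {n0 : ℕ} (hF : FamAt L s n0 ev H X) (hlen : ∀ x ∈ members s ev H X, s
    9 ≤ (str L x.1).length) (hS : StkAt! s (s 5) ds) (hh : (members s ev H X).card < 2 ^ (h + 1))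
    (hdl : s 11 + 1 < W) {A : ℕ} (hA : A = 300 * ev.length + 650 * ((h + 1) * (H.els.card +
    X.length)) + 750 * ((h + 1) * X.length)) (hT : t + A + 500 * (h + 1) + 130 * (members s ev H
    X).card + 1000 ≤ T) : wp W L .turn s t fun s' t' => Step k 37 [5, 8, 16, 17, 18, 19, 20, 21, 22,
    23, 24, 25, 26, 27, 28, 29, 30, 35, 36] s t s' t' ∧ ∃ ev' H' τ g X' nds us hs ct, Turned L k
    (members s ev H X) (s 4) s' τ g X' nds us hs ct ∧ StkAt! s' (s' 5) (hs ++ (us ++ (nds ++ ds))) ∧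
    PL! s' (s' 29) X' ∧ H'.els.card ≤ H.els.card + X.length ∧ ev'.Sublist ev ∧ (s' 46 ≠ 0 → EvAt L
    s' ev' H' ∧ s' 18 = 1 + (ev'.length + H'.els.card) ∧ (g : Φ) = (s' 14, s' 15) ::ₘ ((ev' : Φ) +
    H'.els) ∧ t' + 300 * ev'.length + 650 * ((h + 1) * H'.els.card) ≤ t + A + 700 + 100 * nds.length
    + 30 * (nds.map Desc.lst).flatten.length) ∧ (s' 46 = 0 → 2 * g.length ≤ n0 + 2 * (H.els.card +
    X.length) ∧ g.length ≤ ev.length + (H.els.card + X.length) ∧ t' ≤ t + A + 900 + 100 * nds.length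
    + 30 * ((nds.map Desc.lst).flatten.length + g.length)) := by
  have hcm : (members s ev H X).card = 1 + (ev.length + H.els.card + X.length) := by
    simp [members]; omega
  rw [Prog.turn, wp_seq]
  have hWT := hw.time
  refine wp_mono (wp_front ok hF hlen (h := h) ω (by subst hA; linarith)) ?_
  rintro s1 t1 ⟨st1, ev', H', gs, τ, fr, ht1⟩
  generalize hSd : members s ev H X = S at *
  have hle := fr.hp_le
  have hle1 : H'.els.card ≤ H.els.card + X.length := by simpa using card_le_card hle
  obtain ⟨Y, hY⟩ : ∃ Y, Y = (h + 1) * H'.els.card := ⟨_, rfl⟩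
  have ht1' : t1 + 300 * ev'.length + 650 * Y ≤ t + A + 300 := by rw [hY, hA]; linarith
  obtain ⟨Z, hZ⟩ : ∃ Z, Z = 500 * (h + 1) := ⟨_, rfl⟩
  rw [← hZ] at hT
  clear hA ht1
  have q1 := @st1.regs
  have e9 := q1 9
  have e14 := q1 14
  have e15 := q1 15
  rw [wp_seq]
  refine wp_mono (wp_choose st1.ok (h := h) fr.evAt (by rw [e9, e14]; exact fr.le_q.trans fr.q_le)
    (by rw [e14]; exact fr.q_le) fr.grp (fun h0 =>
    by rcases fr.rest with ⟨-, h1, -⟩ | ⟨-, h1, -⟩ <;> omega) ω (by rw [← hY, ← hZ]; omega)) ?_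
  rintro s2 t2 ⟨st2, r36, ⟨r28, r29, r30⟩, hch⟩
  rw [← hY, e14, e15, e9] at hch
  have q2 := @st2.regs
  have hR : ∃ rc : Λ, (rc : Φ) = (s 14, s 15) ::ₘ ((ev' : Φ) + H'.els) := ⟨(s 14, s 15) :: (ev' ++
    H'.els.toList), by rw [← cons_coe, ← coe_add, Multiset.coe_toList]⟩
  have hgsS : ∀ x ∈ gs.flatten, x ∈ S := fun x hx => by
    rcases fr.rest with ⟨-, -, -, -, h1⟩ | ⟨-, -, -, h1⟩ <;> rw [h1] <;> simp only [mem_add, mem_coe] <;> tauto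
  have hRS : (s 14, s 15) ∈ S := by rw [← hSd]; simp [members]
  have hgsort : ∀ l ∈ gs, l.Pairwise (SufLe L (s1 19 + 1)) := fun l => fr.group_sorted
  obtain ⟨C, hC, hC0, hCs, hCS, hCgs, ht2⟩ : ∃ C, GrpL! s2 (s2 23) C ∧ (∀ g ∈ C, g ≠ []) ∧ (∀ l ∈ C,
    l.Pairwise (SufLe L (s1 19 + 1))) ∧ C.flatten.length ≤ S.card ∧ (s2 26 = 0 ∧ C = gs ∨ s2 26 = 1
    ∧ s1 18 < s1 25 ∧ (s1 18 = 0 ∧ C = gs ∨ s1 18 ≠ 0 ∧ ∃ rc : Λ, C = rc :: gs ∧ (rc : Φ) = (s 14, s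
    15) ::ₘ ((ev' : Φ) + H'.els))) ∧ t2 ≤ t + A + 500 := by
    have hgsc : gs.flatten.length ≤ S.card := by
      rcases fr.rest with ⟨-, -, -, -, h1⟩ | ⟨-, -, -, h1⟩ <;> rw [h1] <;> simp <;> omega
    rcases hch with ⟨h1, h2, h3, h4, h5, h6⟩ | ⟨h1, h2, h3, C, h4, h5⟩
    · exact ⟨gs, h5, fr.groups.ne_nil, hgsort, hgsc, .inl ⟨h2, rfl⟩, ω⟩
    · have h6 : s1 18 = 0 ∧ C = gs ∨ s1 18 ≠ 0 ∧ ∃ rc : Λ, C = rc :: gs ∧ (rc : Φ) = (s 14, s 15)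
        ::ₘ ((ev' : Φ) + H'.els) := h5.imp id fun ⟨h, rc, h', h'', _⟩ => ⟨h, rc, h', h''⟩
      obtain ⟨g1, g2, g3⟩ := fr.classes h6
      refine ⟨C, h4, fun g hg => (g2 g hg).1, fun l hl => ?_, by rw [g1]; simp, .inr ⟨h2, h1, h6⟩, ω⟩
      rcases h5 with ⟨-, rfl⟩ | ⟨-, rc, rfl, -, h7⟩
      · exact hgsort l hl
      rcases mem_cons.1 hl with rfl | hl
      · have h8 : ∀ x ∈ l, x ∈ S := fun x hx => by rw [g1]; simp [hx]
        exact h7.imp_of_mem fun {x y} hx hy hxy => (hxy.of_agree fr.le_q (fr.agree x (h8 x hx))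
          (fr.agree y (h8 y hy))).succ ((g2 l ✓).2 x hx y hy)
      · exact hgsort l hl
  have hCl := length_le_length_flatten hC0
  have hX2 : PL! s2 (s2 29) [] := r29
  have hK2 : CL! s2 (s2 30) [] := r30
  have st12 := st1.base.trans st2.base
  have hS2 : StkAt! s2 (s2 5) ds := by
    rw [q2 5, q1 5]
    exact hS.step ok st12
  rw [wp_seq]
  refine wp_mono (wp_pushAll C st2.ok hC hX2 hS2 hK2 (fun g hg => ?_) ω) ?_
  · have := (List.sublist_flatten_of_mem hg).length_le
    omega
  rintro s3 t3 ⟨st3, ht3, nds, X', pa⟩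
  have q3 := @st3.regs
  have e25 : s2 25 = s1 25 := q2 25
  obtain ⟨g0, hg0⟩ : ∃ g0, (s2 26 = 0 ∧ C.Perm (nds.map Desc.lst) ∧ s3 28 = 0 ∧ g0 = []) ∨ (s2 26 ≠
    0 ∧ C.Perm (g0 :: nds.map Desc.lst) ∧ s1 25 ≤ g0.length ∧ PL! s3 (s3 27) g0 ∧ s3 28 = g0.length)
    := by
    rcases pa.alt with ⟨h1, h2, h3, h4⟩ | ⟨h1, g, h2, h3, h4, h5⟩
    · refine ⟨[], .inl ⟨?_, h1, ω, rfl⟩⟩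
      by_contra h0
      rcases hCgs with ⟨h5, -⟩ | ⟨-, h5, h6⟩
      · exact h0 h5
      rcases fr.best_eq with h7 | ⟨g, hg, h7⟩
      · omega
      have := h4.resolve_left h0 g (by
        rcases h6 with ⟨-, rfl⟩ | ⟨-, rc, rfl, -⟩
        · exact hg
        · simp [hg])
      omega
    · exact ⟨g, .inr ⟨h1, h2, ω, h4, h5⟩⟩
  have e11 : s3 11 = s 11 := by rw [q3 11, q2 11, q1 11]
  refine wp_mono (wp_spawn st3.ok ω (g := g0) pa.stk pa.kids pa.bumped (fun h0 => by
    rcases hg0 with ⟨-, -, h1, -⟩ | ⟨-, -, -, h1, h2⟩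
    · exact absurd h1 h0
    · exact ⟨h1, h2⟩) ω) ?_
  rintro s4 t4 ⟨st4, ht4, us, hs, ct, sp⟩
  have q4 := @st4.regs
  have q24 : ∀ r < 37, r ≠ 4 → r ∉ [5, 23, 26, 27, 28, 29, 30, 35] → s4 r = s2 r :=
    fun r hr h4 h => by rw [q4 r hr h4 (by simp at h ⊢; omega), q3 r hr h4 h]
  have q14 : ∀ r < 37, r ≠ 4 → r ∉ [5, 16, 17, 18, 20, 21, 22, 23, 26, 27, 28, 29, 30, 35, 36] → s4
    r = s1 r := fun r hr h4 h => by
    rw [q24 r hr h4 (by simp at h ⊢; omega), q2 r hr h4 (by simp at h ⊢; omega)]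
  have q04 : ∀ r < 35, r ≠ 4 → r ∉ [5, 8, 16, 17, 18, 19, 20, 21, 22, 23, 24, 25, 26, 27, 28, 29,
    30] → s4 r = s r := fun r hr h4 h => by
    rw [q14 r ω h4 (by simp at h ⊢; omega), q1 r hr h4 (by simp at h ⊢; omega)]
  have f36 : s4 36 = s1 19 + 1 := by rw [q24 36 ω ω ✓, r36]
  have f19 : s4 19 = s1 19 := q14 19 ω ω ✓
  have f9 : s4 9 = s 9 := q04 9 ω ω ✓
  have f14 : s4 14 = s 14 := q04 14 ω ω ✓
  have f15 : s4 15 = s 15 := q04 15 ω ω ✓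
  have g36 : s3 36 = s4 36 := (q4 36).symm
  have g11 : s3 11 = s4 11 := (q4 11).symm
  have g13 : s3 13 = s4 13 := (q4 13).symm
  have g18 : s3 18 = s2 18 := q3 18
  have st34 := st3.base.trans st4.base
  have st24 := st2.base.trans st34
  have hlsC : ∀ l ∈ nds.map Desc.lst, l ∈ C := fun l hl => by
    rcases hg0 with ⟨-, h1, -⟩ | ⟨-, h1, -⟩ <;> exact h1.mem_iff.2 (by simp [hl])
  have hfl : C.flatten.length = (nds.map Desc.lst).flatten.length + g0.length ∧ C.length ≤
    nds.length + 1 := by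
    rcases hg0 with ⟨-, h1, -, rfl⟩ | ⟨-, h1, -⟩
    · exact ⟨by rw [h1.flatten.length_eq]; rfl, by rw [h1.length_eq]; simp⟩
    · exact ⟨by rw [h1.flatten.length_eq]; simp; omega, by rw [h1.length_eq]; simp⟩
  have hnd := pa.stk.addr st3.ok.fp_mod
  have hnew : ∀ a ∈ nds.map Desc.addr, s 4 ≤ a ∧ a % 16 = 0 ∧ a + 16 ≤ s3 4 := by
    intro a ha
    obtain ⟨d, hd, rfl⟩ := mem_map.1 ha
    have h1 := (pa.desc d hd).2.2.2.2.2
    have h2 := hnd d (by simp [hd])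
    have := st12.fp
    exact ⟨ω, h2⟩
  have mk : ∀ g, Classes L (s4 19) S τ g (nds.map Desc.lst) → (τ ≠ [] ∨ nds ≠ [] ∧ g ≠ []) → (∀ d ∈
    nds, d.lst.Pairwise (SufLe L (s4 36))) → ((g ≠ [] ∧ g.Pairwise (SufLe L (s4 36)) ∧ ∃ a, hs =
    [⟨g, X', s4 36, 0, s4 11, s4 13, a⟩]) ∧ ct = [] ∧ s4 46 = 0 ∨ (g = [] ∧ hs = []) ∧ ct = [] ∧ s4
    46 = 0 ∨ ((s4 14, s4 15) ∈ g ∧ hs = []) ∧ ct = [s4 46] ∧ s4 46 ≠ 0) → Turned L k S (s 4) s4 τ g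
    X' nds us hs ct := by
    intro g h1 h2 h3 h4
    refine ⟨h1, by rw [f9, f19]; exact fr.le_q, by rw [f14, f19]; exact fr.q_le,
      by rw [f9, f14, f19]; exact fr.agree, by rw [f36, f19], h2, h3,
      by rw [pa.eq, coe_nil, add_zero], ?_, by simpa using sp.kids, ?_, ?_, h4, ?_, ?_⟩
    · rw [q14 24 ω ω ✓]; exact fr.trm.step st1.ok st24
    · intro d hd
      rw [← g36, ← g11, ← g13, q3 36, q3 11, q3 13]
      obtain ⟨a1, a2, a3, a4, a5, -⟩ := pa.desc d hd
      exact ⟨a1, a2, a3, a4, a5⟩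
    · rw [← g36, ← g11, ← g13]; exact sp.dollar
    · intro a ha
      have := (st12.trans st3.base).fp
      have := st4.fp
      rw [← append_assoc, ← append_assoc, mem_append, append_assoc] at ha
      rcases ha with ha | ha
      · have := sp.new a ha; omega
      · have := hnew a ha; omega
    · rw [← append_assoc, ← append_assoc, append_assoc ct, nodup_append]
      exact ⟨sp.nodup, pa.nodup, fun a ha b hb => by have := sp.new a ha; have := hnew b hb; omega⟩
  have hnds : ∀ d ∈ nds, d.lst.Pairwise (SufLe L (s4 36)) := fun d hd => by
    rw [f36]; exact hCs _ (hlsC _ (mem_map_of_mem hd))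
  have hstep : Step k 37 [5, 8, 16, 17, 18, 19, 20, 21, 22, 23, 24, 25, 26, 27, 28, 29, 30, 35, 36]
    s t s4 t4 := by
    have := st12.trans st34
    refine ⟨fun r hr h4 hn => ?_, this.ok, this.mem, this.fp, this.time⟩
    simp only [mem_cons, not_mem_nil, or_false, not_or] at hn
    exact q04 r ω h4 ✦
  refine ⟨hstep, ev', H', τ, ?_⟩
  have hX4 := (pa.bumped.step st3.ok st4)
  rw [← q4 29] at hX4
  rcases hCgs with ⟨h26, rfl⟩ | ⟨h26, hlt, hcls⟩
  · obtain ⟨h1, h2, rfl⟩ : C.Perm (nds.map Desc.lst) ∧ s3 28 = 0 ∧ g0 = [] := by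
      rcases hg0 with ⟨-, h⟩ | ⟨h, -⟩
      · exact h
      · exact absurd h26 h
    obtain ⟨b1, b2, b3, -⟩ : s1 25 ≤ s1 18 ∧ s2 18 = s1 18 ∧ EvAt L s2 ev' H' ∧ t2 ≤ t1 + 20 := by
      rcases hch with ⟨h1, h2, h3, h4, -, h6⟩ | ⟨-, h, -⟩
      · exact ⟨h1, h3, h4, h6⟩
      · omega
    have hlen := h1.length_eq
    rw [length_map] at hlen
    rw [length_nil, Nat.add_zero] at hfl
    by_cases h18 : s1 18 = 0
    · have hC0 : C = [] := List.eq_nil_iff_forall_not_mem.2 fun l hl =>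
        hC0 l hl (length_eq_zero_iff.1 (by have := fr.best_le l hl; omega))
      subst hC0
      have hn0 : nds = [] := length_eq_zero_iff.1 (by simpa using hlen.symm)
      obtain ⟨rfl, rfl, h46⟩ : hs = [] ∧ ct = [] ∧ s4 46 = 0 := by
        rcases sp.heavy with ⟨h, -⟩ | ⟨-, -, h⟩ | ⟨-, h, -⟩
        · exact absurd h2 h
        · exact h
        · omega
      have hτ : S = τ := by
        rcases fr.rest with ⟨-, -, -, -, h⟩ | ⟨-, h, -⟩
        · simpa using h
        · omega
      refine ⟨[], X', nds, us, [], [], mk [] ?_ ?_ hnds (.inr (.inl ⟨⟨rfl, rfl⟩, rfl, h46⟩)),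
        sp.stk, hX4, hle1, fr.sub, fun h => absurd h46 h, fun _ => ⟨✓, ✓, ω⟩⟩
      · rw [hn0, f19]
        exact ⟨by simpa using hτ, fr.trm_len, ✓, ✓, ✓, ✓⟩
      · exact fr.ne.imp id fun h => absurd rfl h
    · obtain ⟨rc, hrc⟩ := hR
      obtain ⟨g1, g2, g3⟩ := fr.classes (C := rc :: C) (.inr ⟨h18, rc, rfl, hrc⟩)
      obtain ⟨rfl, rfl, h46⟩ : hs = [] ∧ ct = [s4 46] ∧ s4 46 ≠ 0 := by
        rcases sp.heavy with ⟨h, -⟩ | ⟨-, h, -⟩ | ⟨-, -, h⟩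
        · exact absurd h2 h
        · omega
        · exact h
      have hev18 : s1 18 = 1 + (ev'.length + H'.els.card) := by
        rcases fr.rest with ⟨-, h, -⟩ | ⟨-, h, -⟩
        · exact absurd h h18
        · exact h
      have hrcl : rc.length = s1 18 := by
        have := congrArg card hrc
        simp only [coe_card, card_cons, card_add] at this; omega
      have hmem : (s4 14, s4 15) ∈ rc := by rw [f14, f15, ← mem_coe, hrc]; simp
      refine ⟨rc, X', nds, us, [], _, mk rc ?_ ?_ hnds (.inr (.inr ⟨⟨hmem, rfl⟩, rfl, h46⟩)),
        sp.stk, hX4, hle1, fr.sub, fun _ => ⟨(b3.step st2.ok st3 ω ✓).step st3.ok st4 ω ✓, ?_,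
        by rw [f14, f15]; exact hrc, ?_⟩, fun h => absurd h h46⟩
      · rw [f19]
        refine .of_perm g1 fr.trm_len g2 g3 (h1.cons rc) fun g hg => ?_
        rcases mem_cons.1 hg with rfl | hg
        · exact le_rfl
        · have := fr.best_le g hg; omega
      · refine fr.ne.imp id fun h => ⟨?_, List.ne_nil_of_mem hmem⟩
        rintro rfl
        exact h (length_eq_zero_iff.1 hlen)
      · rw [q4 18, g18, b2, hev18]
      · rw [← hY]; omega
  · obtain ⟨h1, h2, h3⟩ : C.Perm (g0 :: nds.map Desc.lst) ∧ s1 25 ≤ g0.length ∧ s3 28 = g0.length :=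
      by
      rcases hg0 with ⟨h, -⟩ | ⟨-, h1, h2, -, h3⟩
      · omega
      · exact ⟨h1, h2, h3⟩
    have hg0C : g0 ∈ C := h1.mem_iff.2 ✓
    have hg00 := hC0 g0 hg0C
    obtain ⟨g1, g2, g3⟩ := fr.classes hcls
    have hsmall : ∀ rc : Λ, (rc : Φ) = (s 14, s 15) ::ₘ ((ev' : Φ) + H'.els) → s1 18 ≠ 0 → rc.length
      < s1 25 := fun rc hrc h18 => by
      have := congrArg card hrc
      simp only [coe_card, card_cons, card_add] at this
      rcases fr.rest with ⟨-, h, -⟩ | ⟨-, h, -⟩ <;> omega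
    have hg0gs : g0 ∈ gs ∧ ∀ g ∈ C, g.length ≤ g0.length := by
      rcases hcls with ⟨-, rfl⟩ | ⟨h18, rc, rfl, hrc⟩
      · exact ⟨hg0C, fun g hg => (fr.best_le g hg).trans h2⟩
      · have := hsmall rc hrc h18
        refine ⟨(mem_cons.1 hg0C).resolve_left fun h => by subst h; omega, fun g hg => ?_⟩
        rcases mem_cons.1 hg with rfl | hg
        · omega
        · exact (fr.best_le g hg).trans h2
    obtain ⟨⟨a, rfl⟩, rfl, h46⟩ : (∃ a, hs = [⟨g0, X', s3 36, 0, s3 11, s3 13, a⟩]) ∧ ct = [] ∧ s4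
      46 = 0 := by
      have := length_pos_of_ne_nil hg00
      rcases sp.heavy with ⟨-, h⟩ | ⟨h, -⟩ | ⟨h, -⟩
      · exact h
      · omega
      · omega
    have hhp := fr.half hgsS hF.left hF.right hg0gs.1
    have hll := fr.length_le hg0gs.1
    rw [card_add, coe_card] at hhp hll
    refine ⟨g0, X', nds, us, _, [], mk g0 ?_ ?_ hnds (.inl ⟨⟨hg00, by rw [f36]; exact hCs _ hg0C, a,
      by rw [g36, g11, g13]⟩, rfl, h46⟩), sp.stk, hX4, hle1, fr.sub, fun h => absurd h46 h,
      fun _ => ⟨hhp, hll, ω⟩⟩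
    · rw [f19]; exact .of_perm g1 fr.trm_len g2 g3 h1 hg0gs.2
    · rcases hcls with ⟨h18, rfl⟩ | ⟨h18, rc, rfl, hrc⟩
      · left
        rintro rfl
        have hm : (s 14, s 15) ∈ C.flatten := by rw [g1] at hRS; simpa using hRS
        obtain ⟨g, hg, hm'⟩ := mem_flatten.1 hm
        exact fr.other _ hm ((g2 g hg).2 _ hm' _ hm')
      · right
        refine ⟨?_, hg00⟩
        rintro rfl
        have := h1.length_eq
        have := List.length_pos_of_mem hg0gs.1
        simp only [length_cons, map_nil, length_nil] at *
        omega

end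

/-- The logarithm of a size, plus one. -/
noncomputable def lg (n : ℕ) : ℝ := logb 2 n + 1

lemma one_le_lg (n : ℕ) : 1 ≤ lg n := by have := logb_nonneg n; unfold lg; linarith

lemma lg_mono {m : ℕ} (h : m ≤ n) : lg m ≤ lg n := by
  rcases Nat.eq_zero_or_pos m with rfl | h0
  · simpa [lg] using logb_nonneg n
  · have := logb_mono h0 h; unfold lg; linarith

/-- The time reserved for a pending family, in addition to that for its members. -/
noncomputable def Desc.slack (d : Desc) : ℝ :=
  1400 * d.lst.length + 3200 * (lg (d.lst.length + d.ext.length) * d.ext.length) + 2000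

/-- The time reserved for the family that is being processed, in addition to that for its
members. -/
noncomputable def slack (n0 : ℕ) (ev : Λ) (H : Hp) (X : Λ) (S : Φ) :
    ℝ :=
  700 * n0 + 500 * ev.length + lg S.card * (2400 * H.els.card + 3200 * X.length)

/-- The time reserved for a list of obligations and for the pending families. -/
noncomputable def reserve (k : ℕ) (ds : List Desc) (os : List (Ob α)) : ℝ :=
  (os.map fun o => famPot k o.S).sum + (ds.map Desc.slack).sum

/-- Pending families only. -/
structure Idle (L : List (List α)) (k : ℕ) (init : (ℕ → ℕ) → Prop) (s : State) (ds : List Desc)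
    (os : List (Ob α)) : Prop where
  stk : StkAt! s (s 5) ds
  fits : Forall₂ (Fits L k) ds os
  inv : Inv L k s.mem (s 4) init os

/-- A family that is being processed, and pending families. -/
structure Busy (L : List (List α)) (k : ℕ) (init : (ℕ → ℕ) → Prop) (s : State) (n0 : ℕ)
    (ev : Λ) (H : Hp) (X : Λ) (o : Ob α) (ds : List Desc)
    (os : List (Ob α)) : Prop where
  fam : FamAt L s n0 ev H X
  stk : StkAt! s (s 5) ds
  fits : Forall₂ (Fits L k) ds os
  cur : ObOk L k o (s 9) (s 10) (s 11) (s 12) (s 13) (· = (s 14, s 15))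
  eq : o.S = members s ev H X
  inv : Inv L k s.mem (s 4) init (o :: os)

lemma famPot_nonneg (S : Φ) : 0 ≤ famPot k S := by
  have h1 := le_sumPot (k := k) (logb_nonneg S.card) S
  have h2 := logb_nonneg S.card
  unfold famPot
  have : (0 : ℝ) ≤ 20000 * (logb 2 S.card + 1) * S.card := by positivity
  linarith

lemma Desc.slack_nonneg (d : Desc) : 0 ≤ d.slack := by
  have := one_le_lg (d.lst.length + d.ext.length)
  unfold Desc.slack; positivity

lemma reserve_nonneg (ds : List Desc) (os : List (Ob α)) : 0 ≤ reserve k ds os := by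
  refine add_nonneg (List.sum_nonneg fun x hx => ?_) (List.sum_nonneg fun x hx => ?_)
  · obtain ⟨o, -, rfl⟩ := mem_map.1 hx; exact famPot_nonneg _
  · obtain ⟨d, -, rfl⟩ := mem_map.1 hx; exact d.slack_nonneg

lemma slack_nonneg (n0 : ℕ) (ev : Λ) (H : Hp) (X : Λ) (S : Φ) : 0 ≤ slack n0 ev H X S := by
  have := one_le_lg S.card
  unfold slack; positivity

lemma ObOk.dl_le {o : Ob α} {pos fl dl par addr : ℕ} {R : ℕ × ℕ → Prop}
    (h : ObOk L k o pos fl dl par addr R) {x : ℕ × ℕ} (hx : x ∈ o.S) :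
    dl ≤ (str L x.1).length ∧ pos ≤ (str L x.1).length := by
  have h1 := (h.val x hx).len
  have h2 := List.count_le_length (l := o.P) (a := none)
  have := h.dollars; have := h.len; omega

section

variable {S : Φ} {τ g X : Λ} {f : ℕ} {nds us hs ds : List Desc}
  {ct : List ℕ} {n0 : ℕ} {ev : Λ} {H : Hp} {o : Ob α} {init : (ℕ → ℕ) → Prop}
  {os : List (Ob α)}

lemma Turned.sizes (h : Turned L k S f s τ g X nds us hs ct) : S.card = τ.length + g.length +
    (nds.map Desc.lst).flatten.length ∧ X.length ≤ (nds.map Desc.lst).flatten.length ∧ nds.length ≤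
    (nds.map Desc.lst).flatten.length ∧ 0 < τ.length + (nds.map Desc.lst).flatten.length := by
  have h1 := congrArg card h.classes.sum
  have h2 := congrArg card h.bumped
  have h3 := card_bump_le (k := k) ((nds.map Desc.lst).flatten : Φ)
  have h4 := length_le_length_flatten h.classes.ne
  simp only [card_add, coe_card] at h1 h2 h3
  rw [length_map] at h4
  refine ⟨h1, ω, h4, ?_⟩
  rcases h.branch with h5 | ⟨h5, -⟩ <;> have := length_pos_of_ne_nil h5 <;> omega

lemma Turned.slack_le (h : Turned L k S f s τ g X nds us hs ct) : ((us ++ nds).map Desc.slack).sum ≤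
    5200 * (lg S.card * X.length) + 3400 * (nds.map Desc.lst).flatten.length ∧ (hs.map
    Desc.slack).sum ≤ 1400 * g.length + 3200 * (lg S.card * X.length) + 2000 := by
  obtain ⟨c1, c2, -⟩ := h.sizes
  have hX := one_le_lg S.card
  have hN : ∀ l : List Desc, (∀ d ∈ l, d.ext = [] ∧ d.lst ≠ []) → (l.map Desc.slack).sum ≤ 3400 *
    (l.map Desc.lst).flatten.length := by
    intro l hl
    induction l with
    | nil => simp
    | cons d l ih =>
      have h1 := ih fun d hd => hl d (mem_cons_of_mem _ hd)
      obtain ⟨h2, h3⟩ := hl d ✓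
      have h4 : (1 : ℝ) ≤ d.lst.length := by exact_mod_cast length_pos_of_ne_nil h3
      simp only [map_cons, sum_cons, flatten_cons, length_append, Nat.cast_add]
      rw [Desc.slack, h2]
      simp only [length_nil, Nat.cast_zero]
      linarith
  have h1 := hN nds fun d hd => ⟨(h.light d hd).1, h.classes.ne _ (mem_map_of_mem hd)⟩
  rw [map_append, sum_append]
  constructor
  · have h2 : (us.map Desc.slack).sum ≤ 5200 * (lg S.card * X.length) := by
      rcases h.dollar with ⟨h2, h3⟩ | ⟨h2, a, h3⟩
      · rw [h3]; simp; positivity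
      · have h4 : (1 : ℝ) ≤ X.length := by exact_mod_cast length_pos_of_ne_nil h2
        have h5 := lg_mono (show X.length ≤ S.card by omega)
        have h6 := mul_le_mul_of_nonneg_right h5 (by linarith : (0 : ℝ) ≤ X.length)
        have h7 := mul_le_mul hX h4 zero_le_one (by linarith)
        rw [h3]
        simp [Desc.slack]
        linarith
    linarith
  · rcases h.heavy with ⟨⟨-, -, a, h3⟩, -⟩ | ⟨⟨-, h3⟩, -⟩ | ⟨⟨-, h3⟩, -⟩
    · have h5 := lg_mono (show g.length + X.length ≤ S.card by omega)
      have h6 := mul_le_mul_of_nonneg_right h5 (cast_nonneg X.length)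
      rw [h3]
      simp [Desc.slack]
      linarith
    all_goals rw [h3]; simp; positivity

/-- The state of the inner loop. -/
def Inner (L : List (List α)) (k : ℕ) (init : (ℕ → ℕ) → Prop) (a : ℕ) (B : ℝ) (s : State) (t : ℕ) : Prop :=
  Ok k s t ∧ s 31 = a ∧ ∃ ds os, s 32 = 0 ∧ Idle L k init s ds os ∧ t + reserve k ds os + 5 ≤ B ∨ s
    32 ≠ 0 ∧ ∃ n0 ev H X o, Busy L k init s n0 ev H X o ds os ∧ t + (famPot k o.S + slack n0 ev H X
    o.S + reserve k ds os) + 5 ≤ B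

/-- The body of the inner loop. -/
def Prog.step : Prog := turn ;; record

lemma keep_record {vs : List ℕ} (ha : a % 16 = 0) (hv : vs.length = 8) :
    Keep f M (putList M a vs) := fun b _ hb => by rw [putList, if_neg ω]

lemma FamAt.next {ev' X' : Λ} {H' : Hp} (hl : 2 * ev.countP (below L p r) ≤ n0) (hr : 2 * ev.countP
    (above L p r) ≤ n0) (hsub : ev'.Sublist ev) (he : EvAt L s ev' H') (hX : PL! s (s 29) X') (h14 :
    s 14 = r) (h9 : s 9 = p) (hp : p ≤ s' 9) (hlc : ∀ x ∈ (ev' : Φ) + H'.els, s' 9 ≤ p + lc L p x.1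
    r) (h18 : s' 18 = 1 + (ev'.length + H'.els.card)) (hM : Keep (s 4) s.mem s'.mem) (hmod : s 4 %
    16 = 0) (h4 : s' 4 = s 4) (h8 : s' 8 = s 29) (h16 : s' 16 = s 16 ∧ s' 17 = s 17 ∧ s' 14 = s 14)
    : FamAt L s' n0 ev' H' X' := by
  subst h14 h9
  obtain ⟨e1, e2, e3⟩ := h16
  have hord : ∀ x ∈ (ev' : Φ) + H'.els, ∀ y ∈ (ev' : Φ) + H'.els, evOrd L s x.1 y.1 → evOrd L s' x.1
    y.1 := fun x hx y hy h => by rw [evOrd, e3]; exact (Bef.shift L hp (hlc x hx) (hlc y hy)).2 h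
  have hcount := fun x (hx : x ∈ ev') => drop_lt_iff hp (hlc x (by simp [hx]))
  refine ⟨⟨?_, ?_, ?_, ?_⟩, ?_, h18, ?_, ?_⟩
  · rw [e1, h4]; exact he.evp.keep hmod le_rfl hM
  · rw [e2, h4]; exact he.hpp.keep hmod le_rfl hM
  · exact he.sorted.imp_of_mem fun {x y} hx hy => hord x (by simp [hx]) y (by simp [hy])
  · exact he.good.imp fun x hx y hy => hord x (mem_add.2 (.inr hx)) y (mem_add.2 (.inr hy))
  · rw [h8, h4]; exact hX.keep hmod le_rfl hM
  · rw [e3, List.countP_congr (q := below L (s 9) (s 14)) fun x hx => by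
      simpa [below] using (hcount x hx).1]
    have := hsub.countP_le (p := below L (s 9) (s 14)); omega
  · rw [e3, List.countP_congr (q := above L (s 9) (s 14)) fun x hx => by
      simpa [above] using (hcount x hx).2]
    have := hsub.countP_le (p := above L (s 9) (s 14)); omega

lemma wp_step {B : ℝ} (hB : B ≤ T) (hI : Inner L k init a B s t) (h32 : s 32 ≠ 0) : wp W L .step s
    (t + 1) fun s' t' => Inner L k init a B s' t' ∧ t < t' := by
  obtain ⟨ok, h31, ds, os, ⟨h, -⟩ | ⟨-, n0, ev, H, X, o, ⟨hF, hS, hfit, hob, hoS, hinv⟩, hpot⟩⟩ := hI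
  · exact absurd h h32
  have hrS : (s 14, s 15) ∈ o.S := by rw [hoS]; simp [members]
  have hcm : o.S.card = 1 + (ev.length + H.els.card + X.length) := by
    rw [hoS]; simp [members]; omega
  set x := lg o.S.card with hx
  have hx1 : 1 ≤ x := one_le_lg o.S.card
  set h := Nat.log 2 o.S.card with hh
  have hhx : ((h + 1 : ℕ) : ℝ) ≤ x := by
    have := Real.natLog_le_logb o.S.card 2
    rw [hx, lg]; push_cast; simpa using this
  have hhS : o.S.card < 2 ^ (h + 1) := Nat.lt_pow_succ_log_self (by norm_num) _
  obtain ⟨A, hA⟩ : ∃ A, A = 300 * ev.length + 650 * ((h + 1) * (H.els.card + X.length)) +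
    750 * ((h + 1) * X.length) := ⟨_, rfl⟩
  have hAr : (A : ℝ) ≤ 300 * ev.length + x * (650 * H.els.card + 1400 * X.length) := by
    have h1 := mul_le_mul_of_nonneg_right hhx (cast_nonneg (α := ℝ) (H.els.card + X.length))
    have h2 := mul_le_mul_of_nonneg_right hhx (cast_nonneg (α := ℝ) X.length)
    rw [hA]; push_cast at h1 h2 ⊢; linarith
  have hres := reserve_nonneg (k := k) ds os
  have hfam : 20000 * (x * o.S.card) ≤ famPot k o.S := by
    have := le_sumPot (k := k) (logb_nonneg o.S.card) o.S
    rw [famPot, hx, lg]; linarith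
  have hT : t + 1 + A + 500 * (h + 1) + 300 * o.S.card + 3000 ≤ T := by
    have h1 : (1 : ℝ) ≤ o.S.card := by exact_mod_cast (by omega : 1 ≤ o.S.card)
    have h2 := mul_le_mul_of_nonneg_right hx1 (by linarith : (0 : ℝ) ≤ o.S.card)
    have h3 := mul_le_mul_of_nonneg_left h1 (by linarith : (0 : ℝ) ≤ x)
    have h4 : 0 ≤ x * (1750 * H.els.card + 1800 * X.length) := by positivity
    have : (t : ℝ) + 1 + A + 500 * (h + 1 : ℕ) + 300 * o.S.card + 3000 ≤ T := by
      unfold slack at hpot; linarith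
    exact_mod_cast this
  have hlW := hw.len (s 14)
  have hTW := hw.time
  have hlenS : ∀ y ∈ members s ev H X, s 9 ≤ (str L y.1).length := fun y hy =>
    (hob.dl_le (hoS ▸ hy)).2
  have hdl := (hob.dl_le hrS).1
  rw [Prog.step, wp_seq]
  refine wp_mono (wp_turn (ok.later (Nat.le_add_right t 1)) hF hlenS hS (by rw [← hoS]; exact hhS)
    (by simp only at hdl; omega) hA (by rw [← hoS]; omega)) ?_
  rintro s4 t4 ⟨st4, ev', H', τ, g, X', nds, us, hs, ct, tn, hS4, hX4, hle, hsub, hcon, hend⟩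
  rw [← hoS] at tn
  obtain ⟨c1, c2, c3, c4⟩ := tn.sizes
  obtain ⟨o1, o2⟩ := tn.slack_le
  have hevl := hsub.length_le
  have q : ∀ r ∈ [9, 10, 11, 12, 13, 14, 15, 31], s4 r = s r := fun r hr =>
    st4.regs r (by simp at hr; omega) (by simp at hr; omega) (by simp at hr ⊢; omega)
  have hob4 := hob
  rw [← q 9 ✓, ← q 10 ✓, ← q 11 ✓, ← q 12 ✓, ← q 13 ✓, ← q 14 ✓, ← q 15 ✓] at hob4
  have hrS4 := hrS
  rw [← q 14 ✓, ← q 15 ✓] at hrS4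
  have hfr := hinv.fresh o ✓
  rw [hob4.addr_eq] at hfr
  have hfp := st4.fp
  have hmod := st4.ok.fp_mod
  have htm := st4.time
  have ht4 : t4 + 40 ≤ T := by
    by_cases h46 : s4 46 = 0
    · have := (hend h46).2.2; omega
    · have := (hcon h46).2.2.2; omega
  have hal := hw.alloc_le st4.ok ω
  obtain ⟨cs, obs, hinv', hfits, hcs, hpot'⟩ := tn.next rfl hob4 hrS4 hinv st4.mem hfp hmod
  refine wp_mono (wp_record st4.ok ht4 ⟨hfr.1, ω⟩ ?_) ?_
  · have h1 := tn.le_q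
    have h2 := tn.q_le
    have h3 := tn.nextpos
    have h4 := hX4.lt ω
    have h5 := hob4.fl_le
    have h6 : s4 46 < s4 4 := by
      rcases tn.heavy with ⟨-, -, h⟩ | ⟨-, -, h⟩ | ⟨-, h, -⟩
      · omega
      · omega
      · have := tn.new (s4 46) (by simp [h]); omega
    rw [q 14 ✓] at h2
    simp only [mem_cons, not_mem_nil, or_false, forall_eq_or_imp, forall_eq]
    clear hpot hAr hT hA
    omega
  rintro s5 t5 ⟨ok5, hlt5, ht5, e4, e5, ⟨e32, e8, e12, e13, e9, e10⟩, em⟩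
  have hK : Keep (s4 4) s4.mem s5.mem := by rw [em]; exact keep_record hfr.1 rfl
  have hstk5 : StkAt! s5 (s5 5) (hs ++ (us ++ (nds ++ ds))) := by
    rw [e5 5 ω ✓, e4]; exact hS4.keep hmod le_rfl hK
  have hfit5 : Forall₂ (Fits L k) (hs ++ (us ++ (nds ++ ds))) (obs ++ os) := by
    have := List.rel_append hfits hfit
    simpa only [append_assoc] using this
  rw [← em, ← e4] at hinv'
  have n1 : (0 : ℝ) ≤ x * X'.length := by positivity
  have n2 : (1 : ℝ) ≤ τ.length + (nds.map Desc.lst).flatten.length := by exact_mod_cast c4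
  have n3 : (nds.length : ℝ) ≤ (nds.map Desc.lst).flatten.length := by exact_mod_cast c3
  have n4 : (0 : ℝ) ≤ τ.length := by positivity
  have n6 : (0 : ℝ) ≤ nds.length := by positivity
  have n5 : (t5 : ℝ) ≤ t4 + 40 := by exact_mod_cast ht5
  rw [← hx] at o1 o2
  rw [show logb 2 o.S.card + 1 = x from rfl] at hpot'
  simp only [map_append, sum_append] at o1 hpot'
  refine ⟨⟨ok5, by rw [e5 31 ω ✓, q 31 ✓, h31], hs ++ (us ++ (nds ++ ds)), obs ++ os, ?_⟩, ω⟩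
  have hres5 : reserve k (hs ++ (us ++ (nds ++ ds))) (obs ++ os) = (obs.map fun o => famPot k
    o.S).sum + (hs.map Desc.slack).sum + ((us.map Desc.slack).sum + (nds.map Desc.slack).sum) +
    reserve k ds os := by simp only [reserve, map_append, sum_append]; ring
  rw [hres5]
  rcases hcs with ⟨h46, rfl⟩ | ⟨h46, hrg, rfl, o', rfl, hoS', hob'⟩
  · refine .inl ⟨by rw [e32, h46], ⟨hstk5, hfit5, hinv'⟩, ?_⟩
    obtain ⟨h1, h2, h3⟩ := hend h46
    have h1' : 2 * (g.length : ℝ) ≤ n0 + 2 * (H.els.card + X.length) := by exact_mod_cast h1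
    have h2' : (g.length : ℝ) ≤ ev.length + (H.els.card + X.length) := by exact_mod_cast h2
    have h3' : (t4 : ℝ) ≤ t + 1 + A + 900 + 100 * nds.length +
      30 * ((nds.map Desc.lst).flatten.length + g.length) := by exact_mod_cast h3
    have h4 := mul_le_mul_of_nonneg_right hx1 (cast_nonneg (α := ℝ) H.els.card)
    have h5 := mul_le_mul_of_nonneg_right hx1 (cast_nonneg (α := ℝ) X.length)
    have h6 : (0 : ℝ) ≤ ev.length ∧ (0 : ℝ) ≤ H.els.card ∧ (0 : ℝ) ≤ X.length := by
      refine ⟨?_, ?_, ?_⟩ <;> positivity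
    obtain ⟨h6, h7, h8⟩ := h6
    simp only [map_nil, sum_nil] at hpot'
    unfold slack at hpot
    rw [← hx] at hpot
    clear_value x
    clear hend hcon hT hA
    linarith
  · refine .inr ⟨by rw [e32]; exact h46, n0, ev', H', X', o', ?_, ?_⟩
    · obtain ⟨b1, b2, b3, -⟩ := hcon h46
      have f14 : s5 14 = s4 14 := e5 14 ω ✓
      have f15 : s5 15 = s4 15 := e5 15 ω ✓
      refine ⟨.next (r := s 14) (p := s 9) hF.left hF.right hsub b1 hX4 (q 14 ✓) (q 9 ✓) ?_ ?_ ?_ hK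
        hmod e4 e8 ⟨e5 16 ω ✓, e5 17 ω ✓, f14⟩, hstk5, hfit5, ?_, ?_, hinv'⟩
      · have := tn.le_q; rw [e9, tn.nextpos, ← q 9 ✓]; omega
      · intro y hy
        have hyg : y ∈ g := by rw [← mem_coe, b3]; exact Multiset.mem_cons_of_mem hy
        have h1 : Same L (s4 19) y.1 (s4 14) := tn.classes.same g ✓ y hyg _ hrg
        have h2 := tn.agree y (by rw [tn.classes.sum]; simp [hyg])
        have h3 := tn.le_q
        obtain ⟨d, hd⟩ := Nat.exists_eq_add_of_le h3
        rw [Same, hd, lc_add L _ _ _ d ω] at h1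
        rw [e9, tn.nextpos, ← q 9 ✓, ← q 14 ✓, hd]
        clear hpot hAr hT hA hcon hend hhS
        omega
      · rw [e5 18 ω ✓, b2]
      · rw [e9, e10, e5 11 ω ✓, e12, e13, f14, f15]; exact hob'
      · rw [hoS', members, f14, f15, b3, cons_add]
    · obtain ⟨-, -, -, h3⟩ := hcon h46
      have hle' : (H'.els.card : ℝ) ≤ H.els.card + X.length := by exact_mod_cast hle
      have hev' : (ev'.length : ℝ) ≤ ev.length := by exact_mod_cast hevl
      have hx' : lg o'.S.card ≤ x := lg_mono (by rw [hoS']; simp; omega)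
      have h4 := mul_le_mul_of_nonneg_right hx'
        (by positivity : (0 : ℝ) ≤ 2400 * H'.els.card + 3200 * X'.length)
      have h5 := mul_le_mul_of_nonneg_right hhx
        (by linarith : (0 : ℝ) ≤ H.els.card + X.length - H'.els.card)
      have h6 := mul_le_mul_of_nonneg_right hhx (cast_nonneg (α := ℝ) X.length)
      have h7 := mul_le_mul_of_nonneg_left
        (by linarith : (0 : ℝ) ≤ H.els.card + X.length - H'.els.card) (by linarith : (0 : ℝ) ≤ x)
      have h8 : 0 ≤ x * X.length := by positivity
      have h3' : (t4 : ℝ) + 300 * ev'.length + 650 * ((h + 1 : ℕ) * H'.els.card) ≤ t + 1 + (300 *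
        ev.length + 650 * ((h + 1 : ℕ) * (H.els.card + X.length)) + 750 * ((h + 1 : ℕ) * X.length))
        + 700 + 100 * nds.length + 30 * (nds.map Desc.lst).flatten.length :=
        by rw [hA] at h3; exact_mod_cast h3
      simp only [map_cons, map_nil, sum_cons, sum_nil] at hpot'
      simp only [map_nil, sum_nil]
      unfold slack at hpot ⊢
      rw [← hx] at hpot
      clear hend hcon hT hA h3
      generalize ((h + 1 : ℕ) : ℝ) = y at *
      clear_value x
      linarith

end

lemma wp_loop_inv {p : Prog} {I : State → ℕ → Prop} (hT : ∀ s t, I s t → t ≤ T) (h : ∀ s t, I s t →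
    s x ≠ 0 → wp W L p s (t + 1) fun s' t' => I s' t' ∧ t < t') : ∀ (n : ℕ) {s : State} {t : ℕ}, T ≤
    t + n → I s t → wp W L (.loop x p) s t fun s' t' => s' x = 0 ∧ ∃ t0, t' = t0 + 1 ∧ I s' t0 := by
  intro n
  induction n with
  | zero =>
    intro s t hn hI
    rw [wp_loop]
    split_ifs with h0
    · exact ⟨h0, t, rfl, hI⟩
    · refine wp_mono (h s t hI h0) fun s' t' ⟨h1, h2⟩ => ?_
      have := hT s' t' h1; omega
  | succ n ih =>
    intro s t hn hI
    rw [wp_loop]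
    split_ifs with h0
    · exact ⟨h0, t, rfl, hI⟩
    · exact wp_mono (h s t hI h0) fun s' t' ⟨h1, h2⟩ => ih ω h1

/-- The state of the outer loop. -/
def Outer (L : List (List α)) (k : ℕ) (init : (ℕ → ℕ) → Prop) (a : ℕ) (B : ℝ) (s : State) (t : ℕ) :
    Prop :=
  Ok k s t ∧ s 31 = a ∧ ∃ ds os, Idle L k init s ds os ∧ t + reserve k ds os + 5 ≤ B

/-- The body of the outer loop. -/
def Prog.family : Prog := setup ;; loop 32 step

lemma wp_family {B : ℝ} (hB : B ≤ T) (hO : Outer L k init a B s t) (h5 : s 5 ≠ 0) : wp W L .family s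
    (t + 1) fun s' t' => Outer L k init a B s' t' ∧ t < t' := by
  obtain ⟨ok, h31, ds, os, ⟨hS, hfit, hinv⟩, hpot⟩ := hO
  cases hfit with
  | nil => exact absurd hS h5
  | @cons d o ds os hd hds =>
  obtain ⟨y, hy⟩ : ∃ y, y ∈ o.S := by
    rw [hd.eq]
    rcases hd.ne with h | h <;> obtain ⟨y, hy⟩ := List.exists_mem_of_ne_nil _ h <;>
      exact ⟨y, by simp [hy]⟩
  have hcard : o.S.card = d.lst.length + d.ext.length := by rw [hd.eq]; simp
  have hres : reserve k (d :: ds) (o :: os) = famPot k o.S + d.slack + reserve k ds os := by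
    simp only [reserve, map_cons, sum_cons]; ring
  have h1 := famPot_nonneg (k := k) o.S
  have h2 := reserve_nonneg (k := k) ds os
  have h3 := one_le_lg (d.lst.length + d.ext.length)
  rw [hres, Desc.slack] at hpot
  have h4 : 0 ≤ lg (d.lst.length + d.ext.length) * d.ext.length := by positivity
  have hT : t + 1 + 200 * d.lst.length + 400 ≤ T := by
    have : (t : ℝ) + 1 + 200 * d.lst.length + 400 ≤ T := by linarith
    exact_mod_cast this
  have hlW := hw.len y.1
  have hdl := (hd.ob.dl_le hy).1
  rw [Prog.family, wp_seq]
  refine wp_mono (wp_setup (ok.later (Nat.le_add_right t 1)) hS hd.ne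
    (fun x hx => (hd.ob.dl_le (hd.eq ▸ hx)).2) hd.sorted ω hT) ?_
  rintro s1 t1 ⟨q1, ok1, hM, hfp, hlt, ht1, r32, r9, r10, r11, r12, r13, hS1, n0, ev, X, hF, hmem, hn0,
    hev, hX, hR⟩
  have hob : ObOk L k o (s1 9) (s1 10) (s1 11) (s1 12) (s1 13) (· = (s1 14, s1 15)) := by
    rw [r9, r10, r11, r12, r13]
    exact { hd.ob with edge := fun x hx => hd.ob.edge x fun h => hx ▸ hR h }
  have hI : Inner L k init a (B - 2) s1 t1 := by
    refine ⟨ok1, by rw [q1 31 ω ω, h31], ds, os, .inr ⟨ω, n0, ev, .nil, X, o,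
      ⟨hF, hS1, hds, hob, by rw [hmem, hd.eq], hinv.mono hfp hM⟩, ?_⟩⟩
    have g1 : (t1 : ℝ) ≤ t + 1 + 200 * d.lst.length + 400 := by exact_mod_cast ht1
    have g2 : (n0 : ℝ) ≤ d.lst.length + 1 := by exact_mod_cast hn0
    have g3 : (ev.length : ℝ) ≤ d.lst.length := by exact_mod_cast hev
    have g4 := mul_le_mul_of_nonneg_left (show (X.length : ℝ) ≤ d.ext.length by exact_mod_cast hX)
      (by linarith : 0 ≤ lg (d.lst.length + d.ext.length))
    rw [slack, hcard, Hp.els]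
    simp only [Multiset.card_zero, Nat.cast_zero]
    linarith
  have hTI : ∀ s t, Inner L k init a (B - 2) s t → t ≤ T := by
    rintro s t ⟨-, -, ds, os, ⟨-, -, h⟩ | ⟨-, n0, ev, H, X, o, -, h⟩⟩
    · have := reserve_nonneg (k := k) ds os
      have : (t : ℝ) ≤ T := by linarith
      exact_mod_cast this
    · have := reserve_nonneg (k := k) ds os
      have := famPot_nonneg (k := k) o.S
      have := slack_nonneg n0 ev H X o.S
      have : (t : ℝ) ≤ T := by linarith
      exact_mod_cast this
  refine wp_mono (wp_loop_inv (I := fun s t' => Inner L k init a (B - 2) s t' ∧ t < t') (fun s t h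
    => hTI s t h.1) (fun s t h h' => wp_mono (wp_step (by linarith) h.1 h') fun s t h'' => ⟨⟨h''.1,
    h.2.trans h''.2⟩, h''.2⟩) T (Nat.le_add_left _ _) ⟨hI, ω⟩) ?_
  rintro s2 t2 ⟨h0, t0, rfl, ⟨ok2, h31', ds', os', ⟨-, hI2, h⟩ | ⟨h, -⟩⟩, hlt'⟩
  · refine ⟨⟨ok2.later, h31', ds', os', hI2, ?_⟩, ω⟩
    push_cast; linarith
  · exact absurd h0 h

/-- Make a list of all strings. -/
def Prog.listAll : Prog :=
  loop 44 (arith .sub 44 44 3 ;; alloc 8 [44, 2, 8])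

lemma wp_listAll : ∀ (n : ℕ) {X : Λ} {s : State} {t : ℕ}, Ok k s t → s 44 = n → PL! s (s 8) X → t +
    20 * n + 1 ≤ T → n < W → wp W L .listAll s t fun s' t' => Step k 43 [8] s t s' t' ∧ t' ≤ t + 20
    * n + 1 ∧ ∃ X' : Λ, PL! s' (s' 8) X' ∧ (X' : Φ) = initFam n + X := by
  intro n
  induction n with
  | zero =>
    intro X s t ok h44 hX hT _
    rw [Prog.listAll, wp_loop, if_pos h44]
    exact ⟨(Step.refl ok).later, ω, X, hX, by simp [initFam]⟩
  | succ n ih =>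
    intro X s t ok h44 hX hT hn
    rw [Prog.listAll, wp_loop, if_neg ω, wp_seq, wp_arith]
    simp only [eval_sub, h44, ok.c3, Nat.add_sub_cancel]
    have st1 : Step k 43 [8] s t (s.setReg 44 n) (t + 1 + 1) := (Step.refl ok).setReg
    have hal := hw.alloc_le st1.ok ω
    refine ⟨ω, wp_alloc st1.ok.toConsts ω ✓ ✓ ω ?_⟩
    have st2 := (Step.refl (B := 43) (o := [8]) st1.ok).alloc (x := 8) (vs := [44, 2, 8])
      (t'' := t + 1 + 1 + 2 * [44, 2, 8].length + 6) ω ✓ ω ω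
    have hX1 := (hX.step ok st1).alloc st1.ok (x := 8) (r1 := 44) (r2 := 2) (r3 := 8) ✓
    refine wp_mono (ih (X := (n, 0) :: X) st2.ok ✓ ?_ ✦ ω) ?_
    · simpa [ok.c2] using hX1
    · rintro s3 t3 ⟨st3, ht3, X', h1, h2⟩
      refine ⟨(st1.trans st2).trans st3, by simp at ht3; omega, X', h1, ?_⟩
      rw [h2, initFam, initFam, Multiset.range_succ, Multiset.map_cons, ← cons_coe,
        add_cons, cons_add]

/-- The trie of all strings is at the address `a`, and there is a root above it. -/
def Whole (L : List (List α)) (k a : ℕ) (M : ℕ → ℕ) : Prop :=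
  (Ob.mk [] [] (initFam L.length) 16 a).Done L k M ∧ RecAt L M [] [] 0 16 [] [a]

/-- Make a root, and push the family of all strings. -/
def Prog.start : Prog :=
  const 3 1 ;; const 33 2 ;; const 34 16 ;; const 4 32 ;; copy 44 0 ;; listAll ;; const 13 16 ;;
    push 2 2 8 2 2 ;; copy 67 13 ;; stores [2, 2, 2, 2, 2, 30, 2, 2] ;; const 43 8 ;;
    arith .sub 31 5 43

/-- The time for a list of all strings. -/
noncomputable def total (L : List (List α)) (k : ℕ) : ℝ :=
  25 * L.length + famPot k (initFam L.length) + 3200 * (lg L.length * L.length) + 2200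

lemma card_initFam (n : ℕ) : (initFam n).card = n := by simp [initFam]

lemma wp_start (hL : L ≠ []) (hT : total L k ≤ T) : wp W L .start (initState L.length k) 0 fun s' t'
    => ∃ a, a + 3 < W ∧ Outer L k (Whole L k a) a (total L k) s' t' := by
  have hm := length_pos_of_ne_nil hL
  have hp := famPot_nonneg (k := k) (initFam L.length)
  have hlg := mul_nonneg (zero_le_one.trans (one_le_lg L.length)) (cast_nonneg (α := ℝ) L.length)
  have hTn : 25 * L.length + 2200 ≤ T := by
    have : 25 * (L.length : ℝ) + 2200 ≤ T := by unfold total at hT; linarith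
    exact_mod_cast this
  have hWT := hw.time
  simp only [Prog.start, wp_seq (p := Prog.const _ _), wp_seq (p := Prog.arith _ _ _ _), wp_const,
    Prog.copy, wp_arith, eval_add, reg_setReg, reduceEqDiff, if_false]
  refine ⟨ω, ω, ω, ω, by simp [initState]; omega, ?_⟩
  generalize hs1 : State.setReg _ 44 _ = s1
  have r1 : ∀ r, s1 r = if r = 44 then L.length else if r = 4 then 32 else if r = 34 then 16 else if
    r = 33 then 2 else if r = 3 then 1 else if r = 0 then L.length else if r = 1 then k else 0 := by
    intro r; rw [← hs1]; simp [initState]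
  clear hs1
  have ok1 : Ok k s1 5 := ⟨⟨by simp [r1], by simp [r1], by simp [r1], by simp [r1], by simp [r1]⟩,
    by simp [r1], by simp [r1], by simp [r1]⟩
  rw [wp_seq]
  refine wp_mono (wp_listAll L.length (X := []) (t := 5) ok1 (by simp [r1]) (by simp [r1, PL])
    ω ω) ?_
  rintro s2 t2 ⟨st2, ht2, X, hX, hXs⟩
  have q2 : ∀ r < 43, r ≠ 4 → r ≠ 8 → s2 r = s1 r := fun r h h4 h8 =>
    st2.regs r h h4 (by simpa using h8)
  rw [wp_seq, wp_const]
  refine ⟨ω, ?_⟩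
  have st3 : Step k 43 [13] s2 t2 (s2.setReg 13 16) (t2 + 1) := (Step.refl st2.ok).setReg
  have hfm := st2.ok.fp_mod
  have hfp := st2.ok.fp_pos
  have hX3 := hX.step st2.ok st3
  generalize hs3 : s2.setReg 13 16 = s3 at *
  have q3 : ∀ r < 43, r ≠ 4 → r ≠ 8 → r ≠ 13 → s3 r = s1 r := fun r h h4 h8 h13 => by
    rw [← hs3, reg_setReg, if_neg h13, q2 r h h4 h8]
  have e4 : s3 4 = s2 4 := by rw [← hs3]; simp
  have e8 : s3 8 = s2 8 := by rw [← hs3]; simp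
  have e13 : s3 13 = 16 := by rw [← hs3]; simp
  have c2 := st3.ok.c2
  have e36 : s3 36 = 0 := by rw [q3 36 ω ω ω ω]; simp [r1]
  rw [wp_seq]
  refine wp_mono (wp_push st3.ok ω ω (lst := []) (X := X) (ds := []) (as := []) (by rw [c2]; rfl) c2
    (by rw [e8]; exact hX3) (by rw [q3 5 ω ω ω ω]; simp [r1, StkAt])
    (by rw [q3 30 ω ω ω ω]; simp [r1, CL])) ?_
  rintro s4 t4 ⟨st4, ht4, hS4, hC4, hf4⟩
  rw [c2, e36, e13, e4] at hS4
  rw [e4] at hC4 hf4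
  have c3 := st4.ok.c3
  have c24 := st4.ok.c2
  have e134 : s4 13 = 16 := by rw [st4.regs 13, e13]
  simp only [wp_seq, wp_arith, eval_add, c24, e134]
  refine ⟨ω, wp_stores _ (by simpa using c3) ✦ ✓ ?_⟩
  simp only [wp_const, eval_sub, ifs, reduceEqDiff]
  have h5 : s4 5 = s2 4 + 8 := hS4.2.1
  have hal := hw.alloc_le st4.ok ω
  rw [h5, Nat.add_sub_cancel]
  refine ⟨ω, ω, ?_⟩
  obtain ⟨a, ha⟩ : ∃ a, s2 4 = a := ⟨_, rfl⟩
  rw [ha] at hS4 hC4 hf4 h5 hfm hfp ⊢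
  refine ⟨a, ω, ?_⟩
  simp only [map_cons, map_nil, ifs, reduceEqDiff, c24]
  generalize hs5 : State.setReg _ 31 a = s5
  have r5 : ∀ r < 43, s5 r = if r = 31 then a else s4 r := by
    intro r hr; rw [← hs5]
    simp [show r ≠ 43 by omega, show r ≠ 67 by omega]
  have m5 : s5.mem = putList s4.mem 16 [0, 0, 0, 0, 0, s4 30, 0, 0] := by rw [← hs5]; simp
  clear hs5
  have f5 : s5 4 = s4 4 := r5 4 ω
  have hK : Keep (s4 4) s4.mem s5.mem := by rw [m5]; exact keep_record rfl rfl
  obtain ⟨⟨g1, g2, g3, g4, g5⟩, g6, g7, g8⟩ := st4.ok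
  have gm := g6
  refine ⟨⟨⟨by simpa [r5], by simpa [r5], by simpa [r5], by simpa [r5], by simpa [r5]⟩,
    by rwa [f5], by rwa [f5], by rw [f5]; omega⟩, r5 31 ω,
    [⟨[], X, 0, 0, 0, 16, a⟩], [⟨[], [], initFam L.length, 16, a⟩], ⟨?_, ?_, ?_⟩, ?_⟩
  · rw [r5 5 ω, f5]; exact hS4.keep gm le_rfl hK
  · have hXS : (X : Φ) = initFam L.length := by simpa using hXs
    refine .cons ⟨⟨fun x hx => ?_, rfl, rfl, rfl, rfl, ✓, ✓⟩, by simp [hXS], .inr ?_, ✓⟩ .nil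
    · obtain ⟨h1, h2⟩ := mem_initFam.1 hx
      exact ⟨h1, ω, ✓, by simp [h2, dH]⟩
    · have := congrArg card hXS
      rw [card_initFam, coe_card] at this
      exact List.ne_nil_of_length_pos (by simp [this, hm])
  · refine ⟨by simp [f5]; omega, ✓, fun M' h1 h2 => ⟨h2 _ ✓, ?_⟩⟩
    rw [f5] at h1
    simp only [mem_singleton, forall_eq] at h1
    have hr : ∀ i < 8, M' (16 + i) = [0, 0, 0, 0, 0, s4 30, 0, 0].getD i 0 := fun i hi => by
      rw [h1 _ ω ω, m5, putList_add (by simpa using hi)]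
    have hC5 := (hC4.keep gm le_rfl hK).keep (M' := M') gm le_rfl fun b hb hb' => h1 b hb ω
    have v0 := hr 0 ω
    have v1 := hr 1 ω
    have v2 := hr 2 ω
    have v3 := hr 3 ω
    simp only [Nat.reduceAdd, Nat.add_zero, List.getD_cons_succ, List.getD_cons_zero] at v0 v1 v2 v3
    exact ⟨hr 7 ω, by simp [v1, hm], by simp [v2, v3], by simp [labelAt, v0, v3],
      hr 4 ω, by rw [hr 5 ω]; exact hC5.listAt, hr 6 ω⟩
  · have hl : X.length = L.length := by
      have := congrArg card hXs
      simpa [card_initFam] using this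
    have e1 : ∀ n : ℕ, n ≤ t2 + 62 → (n : ℝ) ≤ 20 * L.length + 68 := fun n hn => by
      exact_mod_cast (by omega : n ≤ 20 * L.length + 68)
    have e2 := e1 (t4 + 1 + 2 * [2, 2, 2, 2, 2, 30, 2, 2].length + 1 + 1 + 1) ✦
    simp only [reserve, total, Desc.slack, map_cons, map_nil, sum_cons, sum_nil,
      length_nil, Nat.zero_add, hl, Nat.cast_zero]
    linarith

/-- The algorithm. -/
def Prog.main : Prog :=
  start ;; loop 5 family ;; get 41 31 3 ;; ite 41 2 (copy 0 31) (const 0 16)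

lemma wp_main (hL : L ≠ []) (hT : total L k ≤ T) : wp W L .main (initState L.length k) 0 fun s' t'
    => t' ≤ T + 10 ∧ ∃ a Q N, Built L k s'.mem [] [] (initFam L.length) 16 a Q N ∧ ((Q = [] ∧ s' 0 =
    a) ∨ (Q ≠ [] ∧ s' 0 = 16 ∧ RecAt L s'.mem [] [] 0 16 [] [a])) := by
  rw [Prog.main, wp_seq]
  refine wp_mono (wp_start hL hT) ?_
  rintro s1 t1 ⟨a, ha, hO⟩
  rw [wp_seq]
  have hTO : ∀ s t, Outer L k (Whole L k a) a (total L k) s t → t ≤ T := by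
    rintro s t ⟨-, -, ds, os, -, h⟩
    have := reserve_nonneg (k := k) ds os
    have : (t : ℝ) ≤ T := by linarith
    exact_mod_cast this
  refine wp_mono (wp_loop_inv hTO (fun s t h h' => wp_family hT h h') T (Nat.le_add_left _ _) hO) ?_
  rintro s2 t2 ⟨h0, t0, rfl, hO2⟩
  have ht0 := hTO _ _ hO2
  obtain ⟨ok, h31, ds, os, ⟨hS, hfit, hinv⟩, -⟩ := hO2
  have hos : os = [] := by
    cases hfit with
    | nil => rfl
    | cons hd hds => rw [h0] at hS; exact absurd hS.1.ne_zero ✓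
  subst hos
  obtain ⟨⟨Q, N, hB⟩, hR⟩ := hinv.fut s2.mem (fun _ _ _ => rfl) ✓
  simp only at hB
  have hW := hw.time
  have hcase : s2.mem (a + 3) = 0 ↔ Q = [] := by
    cases hB with
    | node w τ c H G kids ha hw' split hk hbr hrec hkids =>
      have h1 := hrec.label
      have h2 := hrec.label_le
      simp only [nil_append] at h1 ⊢
      rw [labelAt, suffixOf_eq] at h1
      constructor
      · intro h
        rw [h] at h1
        split_ifs at h1 with h3
        · simpa using h1
        · cases w <;> simp [emb] at h1
      · intro h
        rw [h] at h1
        have := congrArg List.length h1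
        simp at this
        omega
  simp only [wp_seq, Prog.get, wp_const, wp_arith, wp_load, wp_ite, Prog.copy, eval_add, ifs, reduceEqDiff, ok.c2, h31, Nat.add_zero]
  refine ⟨ω, ω, ?_⟩
  split_ifs with h
  · refine ⟨ω, ω, a, Q, N, hB, .inl ⟨hcase.1 ω, rfl⟩⟩
  · exact ⟨ω, ω, a, Q, N, hB, .inr ⟨fun h' => h (hcase.2 h').le, trivial, hR⟩⟩

lemma total_le (hL : L ≠ []) : 1 ≤ timeBound L.length k ∧ k ≤ timeBound L.length k ∧ total L k ≤
    45425 * timeBound L.length k := by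
  obtain ⟨x, hx⟩ : ∃ x, logb 2 L.length = x := ⟨_, rfl⟩
  obtain ⟨b, hb⟩ : ∃ b, bin (k + 1) x = b := ⟨_, rfl⟩
  have hm : (1 : ℝ) ≤ L.length := by exact_mod_cast length_pos_of_ne_nil hL
  have hx0 : 0 ≤ x := hx ▸ logb_nonneg _
  have hE : timeBound L.length k = 2 ^ k * L.length * b := by
    rw [timeBound, hx, ← hb, bin]; push_cast; rw [add_assoc]
  have hb1 : x + 1 ≤ b := by
    have := sub_le_bin_sub k le_rfl hx0
    have := one_le_bin (k + 1) le_rfl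
    linarith
  have hk1 : (1 : ℝ) ≤ 2 ^ k := one_le_pow₀ (by norm_num)
  have hmE : L.length * (x + 1) ≤ 2 ^ k * L.length * b := by
    have := mul_le_mul hk1 (mul_le_mul_of_nonneg_left hb1 (zero_le_one.trans hm)) (by positivity)
      (by positivity)
    linarith
  have hmx : (L.length : ℝ) ≤ L.length * (x + 1) := by nlinarith
  have hkE : (2 : ℝ) ^ k ≤ 2 ^ k * L.length * b := by
    have := mul_le_mul_of_nonneg_left (one_le_mul_of_one_le_of_one_le hm (by linarith : 1 ≤ b))
      (zero_le_one.trans hk1)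
    linarith
  have hk2 : (k : ℝ) < 2 ^ k := by exact_mod_cast Nat.lt_two_pow_self
  rw [hE]
  refine ⟨by linarith, by linarith, ?_⟩
  have hfam : famPot k (initFam L.length) ≤ 40000 * (2 ^ k * L.length * b) := by
    have : famPot k (initFam L.length) = L.length * pot k x 0 := by
      rw [famPot, card_initFam, hx, sumPot, initFam, Multiset.map_map]
      simp
    rw [this, pot, Nat.sub_zero, hb]
    nlinarith
  rw [total, lg, hx]
  linarith

theorem exists_solution {α : Type*} [LinearOrder α] (𝓕 : Finset (List α)) (k : ℕ) (L : List (List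
    α)) (hL : L.Nodup) (hLF : L.toFinset = 𝓕) (hne : L ≠ []) : ∃ N : List α → Finset (List (Option
    α)), IsComplete 𝓕 k N ∧ (∀ F ∈ 𝓕, ∀ F' ∈ N F, F'.length = F.length) ∧ (∀ F ∈ 𝓕, ∀ d ≤ k,
    ((nearSet N d F).card : ℝ) ≤ 2 ^ d * Ring.choose (logb 2 𝓕.card + d) d) ∧ ∀ W : ℕ, 10 ^ 6 *
    (timeBound 𝓕.card k + 𝓕.sup List.length) ≤ W → ∃ (s : State) (t : ℕ), Exec W L .main (initState
    𝓕.card k) s t ∧ (t : ℝ) ≤ 10 ^ 6 * timeBound 𝓕.card k ∧ HoldsTrie 𝓕 L N s.mem (s 0) := by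
  have hcard : 𝓕.card = L.length := by rw [← hLF, List.toFinset_card_of_nodup hL]
  rw [hcard]
  obtain ⟨h1, hk, hT⟩ := total_le (k := k) hne
  generalize timeBound L.length k = E at h1 hk hT ⊢
  have hT' := Nat.ceil_lt_add_one (a := 45425 * E) (by linarith)
  have hT2 := hT.trans (Nat.le_ceil (45425 * E))
  generalize ⌈45425 * E⌉₊ = T at hT' hT2
  have hstr : ∀ i, (str L i).length ≤ 𝓕.sup List.length := fun i => by
    rw [str]
    by_cases hi : i < L.length
    · rw [List.getD_eq_getElem _ _ hi]
      exact Finset.le_sup (f := List.length) (hLF ▸ List.mem_toFinset.2 (List.getElem_mem hi))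
    · rw [List.getD_eq_default _ _ ω]; simp
  have hw : Wide ⌈10 ^ 6 * (E + 𝓕.sup List.length)⌉₊ L k T := by
    have hle : ∀ n : ℕ, (n : ℝ) ≤ 10 ^ 6 * (E + 𝓕.sup List.length) → n ≤ ⌈10 ^ 6 * (E + 𝓕.sup
      List.length)⌉₊ := fun n hn => by exact_mod_cast hn.trans (Nat.le_ceil _)
    refine ⟨hle _ ?_, fun i => hle _ ?_, hle _ ?_⟩
    · push_cast; linarith
    · have : ((str L i).length : ℝ) ≤ (𝓕.sup List.length : ℕ) := by exact_mod_cast hstr i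
      push_cast; linarith
    · push_cast; linarith
  obtain ⟨s, t, hE, ht, a, Q, N, hB, hroot⟩ := wp_main (hw := hw) hne hT2
  obtain ⟨N', g1, g2, g3, g4⟩ := hB.solution hL hLF hroot
  refine ⟨N', g1, g2, hcard ▸ g3, fun W hW => ⟨s, t, hE.mono (Nat.ceil_le.2 hW), ?_, g4⟩⟩
  have : (t : ℝ) ≤ T + 10 := by exact_mod_cast (Nat.zero_add t ▸ ht)
  linarith

end KMismatch

theorem mainTheorem3 : ∃ (prog : KMismatch.Prog) (C : ℝ), 0 < C ∧ ∀ (α : Type*) [LinearOrder α] (𝓕 :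
    Finset (List α)) (k : ℕ) (L : List (List α)), L.Nodup → L.toFinset = 𝓕 → ∃ N : List α → Finset
    (List (Option α)), KMismatch.IsComplete 𝓕 k N ∧ (∀ F ∈ 𝓕, ∀ F' ∈ N F, F'.length = F.length) ∧ (∀
    F ∈ 𝓕, ∀ d ≤ k, ((KMismatch.nearSet N d F).card : ℝ) ≤ 2 ^ d * Ring.choose (Real.logb 2 𝓕.card +
    d) d) ∧ (𝓕.Nonempty → ∀ W : ℕ, C * (KMismatch.timeBound 𝓕.card k + 𝓕.sup List.length) ≤ W → ∃ (s
    : KMismatch.State) (t : ℕ), KMismatch.Exec W L prog (KMismatch.initState 𝓕.card k) s t ∧ (t : ℝ)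
    ≤ C * KMismatch.timeBound 𝓕.card k ∧ KMismatch.HoldsTrie 𝓕 L N s.mem (s.reg 0)) := by
  refine ⟨.main, 10 ^ 6, by norm_num, fun α _ 𝓕 k L hL hLF => ?_⟩
  rcases eq_or_ne L [] with rfl | hne
  · obtain rfl : 𝓕 = ∅ := by rw [← hLF]; rfl
    exact ⟨fun _ => ∅, fun U hU => absurd hU (by simp), by simp, by simp, fun h => absurd h (by simp)⟩
  · obtain ⟨N, h1, h2, h3, h4⟩ := KMismatch.exists_solution 𝓕 k L hL hLF hne
    exact ⟨N, h1, h2, h3, fun _ => h4⟩
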